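/- **Setting.** Fix $\alpha>0$, a viscosity $\nu>0$, real $p>3$ and $1\le q\le\infty$. For vector fields on $\mathbb R^3$ put $(\nabla f)_{ij}=\partial_i f_j$ (weak derivatives), $(\operatorname{div}S)_i=\sum_k\partial_kS_{ki}$, $\operatorname{Def}f=\nabla f+(\nabla f)^T$, $\operatorname{Rot}f=\nabla f-(\nabla f)^T$ and $$\tau^\alpha(f,g)=\tfrac{\alpha^2}{2}(1-\alpha^2\Delta)^{-1}\big[\operatorname{Def}f\cdot\operatorname{Rot}g+\operatorname{Def}g\cdot\operatorname{Rot}f\big].$$ $B^s_{p,q}$ denotes the inhomogeneous Besov space of vector fields on $\mathbb R^3$, normed through a fixed Littlewood–Paley decomposition. $BC([0,T):B^s_{p,q})$ is the space of bounded continuous functions from $[0,T)$ to $B^s_{p,q}$, and $\dot C^T_{b;s,p,q}$ is the space of continuous $f:(0,T)\to B^s_{p,q}$ with $\sup_{0<t<T}t^b\|f(t)\|_{B^s_{p,q}}<\infty$ and $t^b\|f(t)\|_{B^s_{p,q}}\to0$ as $t\to0^+$. Equations are understood in the sense of distributions in $x$, that is, tested against divergence-free fields, for every positive time in the interval of existence.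 Let $v$ be a global solution of the LANS equation $$\partial_t v+\operatorname{div}(v\otimes v)+\operatorname{div}\tau^\alpha(v,v)=-(1-\alpha^2\Delta)^{-1}\nabla\pi+\nu\Delta v,\qquad \operatorname{div}v=0,$$ with $v\in BC([0,T):B^{3/p}_{p,q})\cap\dot C^T_{(r-3/p)/2;\,r,p,q}$ for all $T>0$ and all $r>3/p$. Let $0<a<T^*<\infty$ and let $u$ be a solution on $[0,T^*)$ of the mLANS equation $$\partial_t u-\nu\Delta u+\operatorname{div}(u\otimes u+u\otimes v+v\otimes u)+\operatorname{div}\big(\tau^\alpha(u,u)+2\tau^\alpha(u,v)\big)=-(1-\alpha^2\Delta)^{-1}\nabla\pi,\qquad \operatorname{div}u=0,$$ with, for some $s\in(3/2,5/2)$, $u\in BC([0,T):B^{3/2}_{2,q})\cap\dot C^T_{(s-3/2)/2;\,s,2,q}$ for every $0<T<T^*$. **Lemma.** If $u(t)\in\dot H^{3,2}(\mathbb R^3)$ for every $t\in[a,T^*)$, then $$\sup_{t\in[a,T^*)}\|u(t)\|_{\dot H^{2,2}}<\infty .$$ -/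

import Mathlib

open MeasureTheory Filter Topology Set
open scoped ENNReal NNReal ContDiff SchwartzMap FourierTransform Laplacian

noncomputable section

namespace MLANS

/-- Three-dimensional Euclidean space. -/
abbrev E3 : Type := EuclideanSpace ℝ (Fin 3)

/-- Real `3 × 3` matrices. -/
abbrev Mat3 : Type := Matrix (Fin 3) (Fin 3) ℝ

/-- The `k`-th standard basis vector. -/
def basisVec (k : Fin 3) : E3 := EuclideanSpace.single k (1 : ℝ)

/-! ### Littlewood-Paley decomposition and Besov spaces -/

/-- `χ` is (the Fourier transform of) a Littlewood-Paley generator: a smooth radial nonnegative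
function, supported in the annulus `1/2 < |ξ| < 2`, whose dyadic dilates sum to one away from the
origin. -/
structure IsLPProfile (χ : E3 → ℝ) : Prop where
  smooth : ContDiff ℝ ∞ χ
  nonneg : ∀ ξ, 0 ≤ χ ξ
  radial : ∀ ξ η : E3, ‖ξ‖ = ‖η‖ → χ ξ = χ η
  support_subset : Function.support χ ⊆ {ξ : E3 | 1 / 2 < ‖ξ‖ ∧ ‖ξ‖ < 2}
  hasSum_one : ∀ ξ : E3, ξ ≠ 0 → HasSum (fun j : ℤ => χ (((2 : ℝ) ^ (-j)) • ξ)) 1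

/-- The convolution kernel with a given real, even Fourier symbol (the inverse Fourier transform of
such a symbol is real-valued). -/
def kernelOf (m : E3 → ℝ) (x : E3) : ℝ := (𝓕⁻ (fun ξ : E3 => (m ξ : ℂ)) x).re

/-- Convolution of a real kernel with a vector field. -/
def conv (k : E3 → ℝ) (f : E3 → E3) (x : E3) : E3 := ∫ y, k (x - y) • f y

/-- The dyadic block `ψ_j ∗ f`, where `ψ_j` has Fourier transform `χ (2^{-j} ξ)`. -/
def dyadicBlock (χ : E3 → ℝ) (j : ℕ) (f : E3 → E3) : E3 → E3 :=
  conv (kernelOf fun ξ => χ (((2 : ℝ) ^ (-(j : ℤ))) • ξ)) f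

/-- The low-frequency part `Ψ ∗ f`, where `Ψ` has Fourier transform
`1 - ∑_{k ≥ 0} χ (2^{-k} ξ)`. -/
def lowFreq (χ : E3 → ℝ) (f : E3 → E3) : E3 → E3 :=
  conv (kernelOf fun ξ => 1 - ∑' k : ℕ, χ (((2 : ℝ) ^ (-(k : ℤ))) • ξ)) f

/-- The inhomogeneous Besov norm
`‖Ψ ∗ f‖_{L^p} + ‖(2^{js} ‖ψ_j ∗ f‖_{L^p})_{j ≥ 0}‖_{ℓ^q}`, with values in `[0, ∞]`. -/
def besovNorm (χ : E3 → ℝ) (s : ℝ) (p q : ℝ≥0∞) (f : E3 → E3) : ℝ≥0∞ :=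
  eLpNorm (lowFreq χ f) p volume +
    eLpNorm (fun j : ℕ =>
      ENNReal.ofReal ((2 : ℝ) ^ ((j : ℝ) * s)) * eLpNorm (dyadicBlock χ j f) p volume)
      q Measure.count

/-- Membership in `B^s_{p,q}(ℝ³; ℝ³)` for `s > 0`; for such `s` the space consists of
`L^p` functions. -/
def MemBesov (χ : E3 → ℝ) (s : ℝ) (p q : ℝ≥0∞) (f : E3 → E3) : Prop :=
  MemLp f p volume ∧ besovNorm χ s p q f < ⊤

/-- `u` maps the set of times `I` continuously into `B^s_{p,q}`. -/
def ContBesov (χ : E3 → ℝ) (I : Set ℝ) (s : ℝ) (p q : ℝ≥0∞) (u : ℝ → E3 → E3) : Prop :=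
  (∀ t ∈ I, MemBesov χ s p q (u t)) ∧
    ∀ t ∈ I, Tendsto (fun r => besovNorm χ s p q (u r - u t)) (𝓝[I] t) (𝓝 0)

/-- `u ∈ BC([0,T) : B^s_{p,q})`: continuous and bounded. -/
def BCBesov (χ : E3 → ℝ) (T s : ℝ) (p q : ℝ≥0∞) (u : ℝ → E3 → E3) : Prop :=
  ContBesov χ (Ico 0 T) s p q u ∧
    ∃ M : ℝ≥0, ∀ t ∈ Ico 0 T, besovNorm χ s p q (u t) ≤ M

/-- `u ∈ Ċ^T_{a;s,p,q}`: continuous from `(0,T)` to `B^s_{p,q}`, with `t^a ‖u(t)‖` bounded on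
`(0,T)` and tending to zero as `t → 0⁺`. -/
def DotCBesov (χ : E3 → ℝ) (T a s : ℝ) (p q : ℝ≥0∞) (u : ℝ → E3 → E3) : Prop :=
  ContBesov χ (Ioo 0 T) s p q u ∧
    (∃ M : ℝ≥0, ∀ t ∈ Ioo 0 T, ENNReal.ofReal (t ^ a) * besovNorm χ s p q (u t) ≤ M) ∧
    Tendsto (fun t : ℝ => ENNReal.ofReal (t ^ a) * besovNorm χ s p q (u t)) (𝓝[>] 0) (𝓝 0)

/-! ### Homogeneous Sobolev norms -/

/-- A real vector field regarded as a complex one. -/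
def complexify (f : E3 → E3) (x : E3) : EuclideanSpace ℂ (Fin 3) :=
  WithLp.toLp 2 fun i => ((f x i : ℝ) : ℂ)

open Classical in
/-- The homogeneous Sobolev norm `‖f‖_{Ḣ^{s,2}} = ‖(-Δ)^{s/2} f‖_{L²}` of a square integrable
field, through its Fourier transform (`-Δ` has the symbol `(2π|ξ|)²`). It takes values in
`[0, ∞]`, and is set to `∞` off `L²`. -/
def homSobolevNorm (s : ℝ) (f : E3 → E3) : ℝ≥0∞ :=
  if h : MemLp (complexify f) 2 volume then
    (∫⁻ ξ, ENNReal.ofReal ((2 * Real.pi * ‖ξ‖) ^ (2 * s)) *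
      ‖(𝓕 (h.toLp (complexify f)) : Lp (EuclideanSpace ℂ (Fin 3)) 2 (volume : Measure E3)) ξ‖ₑ ^ 2)
        ^ (1 / 2 : ℝ)
  else ⊤

/-! ### Weak derivatives -/

/-- `D` is the weak gradient of `f`, with the convention `D x i j = ∂_i f_j`. -/
def HasWeakGrad (f : E3 → E3) (D : E3 → Mat3) : Prop :=
  LocallyIntegrable f volume ∧
    ∀ i j : Fin 3, LocallyIntegrable (fun x => D x i j) volume ∧
      ∀ φ : E3 → ℝ, ContDiff ℝ ∞ φ → HasCompactSupport φ →
        ∫ x, f x j * fderiv ℝ φ x (basisVec i) = - ∫ x, D x i j * φ x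

open Classical in
/-- The weak gradient `(∇f)_{ij} = ∂_i f_j` (unique up to null sets; zero if there is none). -/
def weakGrad (f : E3 → E3) : E3 → Mat3 :=
  if h : ∃ D : E3 → Mat3, HasWeakGrad f D then h.choose else 0

/-- `div f = 0` in the sense of distributions. -/
def WeakDivFree (f : E3 → E3) : Prop :=
  ∀ φ : E3 → ℝ, ContDiff ℝ ∞ φ → HasCompactSupport φ →
    ∫ x, ∑ i, f x i * fderiv ℝ φ x (basisVec i) = 0

/-! ### The Reynolds stress -/

/-- `Def f = ∇f + (∇f)ᵀ`. -/
def defTensor (f : E3 → E3) (x : E3) : Mat3 := weakGrad f x + (weakGrad f x).transpose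

/-- `Rot f = ∇f - (∇f)ᵀ`. -/
def rotTensor (f : E3 → E3) (x : E3) : Mat3 := weakGrad f x - (weakGrad f x).transpose

/-- The kernel of `(1 - α² Δ)⁻¹` on `ℝ³`, namely `e^{-|x|/α} / (4 π α² |x|)`. -/
def helmholtzKernel (α : ℝ) (x : E3) : ℝ :=
  Real.exp (-‖x‖ / α) / (4 * Real.pi * α ^ 2 * ‖x‖)

/-- The symmetric bilinear Reynolds stress
`τ^α(f,g) = (α²/2) (1 - α² Δ)⁻¹ [Def f · Rot g + Def g · Rot f]`. With `Def` and `Rot` normalized as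
above, for divergence-free `f` the field `(1 - α² Δ) (div (f ⊗ f) + div τ^α(f,f))` equals
`(f · ∇) m + ∑_j m_j ∇f_j`, `m = (1 - α² Δ) f`, up to a gradient. -/
def tau (α : ℝ) (f g : E3 → E3) (x : E3) : Mat3 := fun i j =>
  α ^ 2 / 2 * ∫ y, helmholtzKernel α (x - y) *
    (defTensor f y * rotTensor g y + defTensor g y * rotTensor f y) i j

/-- The tensor product `f ⊗ g`. -/
def tensor (f g : E3 → E3) (x : E3) : Mat3 := fun i j => f x i * g x j

/-! ### The equations -/

/-- `u` satisfies `∂_t u - ν Δu + div S(t) = -∇π` for some (unspecified) scalar distribution `π`,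
at the times `t ∈ I`, in the sense of tempered distributions in space: the equation is tested
against divergence-free Schwartz fields, which eliminates the gradient. Here
`(div S)_i = ∑_k ∂_k S_{ki}`. -/
def WeakFlow (ν : ℝ) (I : Set ℝ) (u : ℝ → E3 → E3) (S : ℝ → E3 → Mat3) : Prop :=
  ∀ φ : 𝓢(E3, E3), (∀ x, ∑ i, (fderiv ℝ φ x (basisVec i)) i = 0) →
    ∀ t ∈ I, HasDerivAt (fun r => ∫ x, ∑ i, u r x i * φ x i)
      (ν * (∫ x, ∑ i, u t x i * (Δ (φ : E3 → E3) x) i) +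
        ∫ x, ∑ k, ∑ i, S t x k i * (fderiv ℝ φ x (basisVec k)) i) t

/-- `v` is a global solution of the LANS equation
`∂_t v + div (v ⊗ v + τ^α(v,v)) = -(1 - α² Δ)⁻¹ ∇π + ν Δv`, `div v = 0`, in the class
`BC([0,T) : B^{3/p}_{p,q}) ∩ Ċ^T_{(r-3/p)/2;r,p,q}` for every `T > 0` and every `r > 3/p`. -/
structure IsGlobalLANSSolution (χ : E3 → ℝ) (α ν p : ℝ) (q : ℝ≥0∞) (v : ℝ → E3 → E3) :
    Prop where
  divFree : ∀ t, 0 ≤ t → WeakDivFree (v t)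
  bc : ∀ T : ℝ, 0 < T → BCBesov χ T (3 / p) (ENNReal.ofReal p) q v
  dotC : ∀ T : ℝ, 0 < T → ∀ r : ℝ, 3 / p < r →
    DotCBesov χ T ((r - 3 / p) / 2) r (ENNReal.ofReal p) q v
  equation : WeakFlow ν (Ioi 0) v fun t x => tensor (v t) (v t) x + tau α (v t) (v t) x

/-- `u` is a solution on `[0,T')` of the mLANS equation
`∂_t u - ν Δu + div (u ⊗ u + u ⊗ v + v ⊗ u) + div (τ^α(u,u) + 2 τ^α(u,v))
  = -(1 - α² Δ)⁻¹ ∇π`, `div u = 0`, in the class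
`BC([0,T) : B^{3/2}_{2,q}) ∩ Ċ^T_{(s-3/2)/2;s,2,q}` for every `0 < T < T'`. -/
structure IsMLANSSolution (χ : E3 → ℝ) (α ν s : ℝ) (q : ℝ≥0∞) (T' : ℝ) (v u : ℝ → E3 → E3) :
    Prop where
  divFree : ∀ t ∈ Ico 0 T', WeakDivFree (u t)
  bc : ∀ T ∈ Ioo 0 T', BCBesov χ T (3 / 2) 2 q u
  dotC : ∀ T ∈ Ioo 0 T', DotCBesov χ T ((s - 3 / 2) / 2) s 2 q u
  equation : WeakFlow ν (Ioo 0 T') u fun t x =>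
    tensor (u t) (u t) x + tensor (u t) (v t) x + tensor (v t) (u t) x +
      (tau α (u t) (u t) x + (2 : ℝ) • tau α (u t) (v t) x)

end MLANS

end

noncomputable section

namespace MLANS

/-! ### The Fourier transform of square integrable scalar functions -/

/-! The proof is an energy method at two levels, with all energies computed on the Fourier side.

At the first level the equation is paired with `(1 - α²Δ)u`. The Helmholtz filter inside the
Reynolds stress is self-adjoint and cancels against this operator (`integral_hconv_mul`). After
integration by parts `u ⊗ u` contributes `-α² X`, where `X` is a cubic integral in `∇u`, and the
stress contributes `α² X` minus `α²` times `∫ tr (∇u)³`. The last integral vanishes for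
divergence-free fields (`DivFree.integral_tr_cube`), so the self-interaction does no work
(`DivFree.pairing_self`). What remains is linear in `v`. Times `t ≥ a > 0` stay away from the
initial singularity, so the smoothing class bounds `v` in `W^{2,∞}` uniformly on `[a, T')`
(`exists_W2Bound`). The cross terms are then at most a multiple of `‖u‖² + α²‖∇u‖²` plus a small
multiple of `‖Δu‖²` (`pairing_bound`), which viscosity absorbs. Gronwall on the finite interval
bounds this energy up to `T'` and also gives `∫ ‖Δu‖² dt < ∞` (`FlowData.exists_enr_bound`).

At the second level let `y` be the squared `Ḣ²` norm. Pairing with the weight `|ξ|⁴` and absorbing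
the third-order term into viscosity leaves `y' ≤ C ‖S‖²` with the stress `S` measured in `Ḣ²`. The
filter gains two derivatives, so `‖S‖²` is bounded by `‖û‖²_{L¹} y` plus a multiple of the squared
`H²` norm (`exists_nm_two_stress_le`). Since `‖û‖²_{L¹}` is itself bounded by the squared `H²` norm,
`(1 + y)' ≤ C (1 + y)(1 + y)`. One of the two factors is integrable in time by the first level, so a
linear Gronwall argument (`exists_bound_of_le_add_lintegral`) bounds `y`.

The difficulty is rigour. The `H³` norm is finite at each time, but without any uniform bound, and
the equation holds only weakly. Energies are therefore formed with smooth weights supported in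
annuli of frequencies. For these the weak equation is an equation in `L²` with bounded right-hand
side, and the squared norm is differentiable (`hasDerivWithinAt_norm_sq`, `hasDerivWithinAt_engy`);
the pressure disappears because it is parallel to `ξ` while `û` is orthogonal to it. The truncation
is removed by dominated convergence. The majorant contains the `Ḣ²` norm, whose local integrability
in time has to be known beforehand. It follows from a bound of the stress in `Ḣ¹` that uses only the
`H^{s'}` regularity of the solution class, `3/2 < s' ≤ 2` (`exists_nm_one_stress_le`,
`FlowData.integrableOn_enr_two`). -/

open Classical in
/-- The `L²` Fourier transform, as an operation on functions (zero off `L²`). -/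
def ft (f : E3 → ℂ) : E3 → ℂ :=
  if h : MemLp f 2 volume then ((𝓕 (h.toLp f) : Lp ℂ 2 (volume : Measure E3)) : E3 → ℂ) else 0

theorem ft_of_memLp {f : E3 → ℂ} (h : MemLp f 2 volume) :
    ft f = ((𝓕 (h.toLp f) : Lp ℂ 2 (volume : Measure E3)) : E3 → ℂ) := by
  simp [ft, h]

theorem memLp_ft (f : E3 → ℂ) : MemLp (ft f) 2 volume := by
  by_cases h : MemLp f 2 volume
  · rw [ft_of_memLp h]; exact Lp.memLp _
  · simp [ft, h]

theorem ft_congr {f g : E3 → ℂ} (h : f =ᵐ[volume] g) : ft f = ft g := by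
  by_cases hf : MemLp f 2 volume
  · have hg : MemLp g 2 volume := hf.ae_eq h
    rw [ft_of_memLp hf, ft_of_memLp hg, (MemLp.toLp_eq_toLp_iff hf hg).2 h]
  · have hg : ¬ MemLp g 2 volume := fun hg => hf (hg.ae_eq h.symm)
    simp [ft, hf, hg]

theorem eLpNorm_ft {f : E3 → ℂ} (h : MemLp f 2 volume) :
    eLpNorm (ft f) 2 volume = eLpNorm f 2 volume := by
  rw [ft_of_memLp h, ← Lp.enorm_def, ← eLpNorm_congr_ae h.coeFn_toLp, ← Lp.enorm_def]
  have := Lp.norm_fourier_eq (h.toLp f)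
  rw [← ofReal_norm, ← ofReal_norm, this]

/-- A smooth compactly supported real function, as a complex Schwartz function. -/
theorem exists_schwartz_ofReal {ψ : E3 → ℝ} (h1 : ContDiff ℝ ∞ ψ) (h2 : HasCompactSupport ψ) :
    ∃ φ : 𝓢(E3, ℂ), ∀ x, φ x = (ψ x : ℂ) := by
  have h3 : HasCompactSupport (fun x => (ψ x : ℂ)) := h2.comp_left (g := Complex.ofReal) rfl
  have h4 : ContDiff ℝ ∞ (fun x => (ψ x : ℂ)) := Complex.ofRealCLM.contDiff.comp h1
  exact ⟨h3.toSchwartzMap h4, fun x => rfl⟩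

/-- Two locally integrable functions which agree as tempered distributions agree almost
everywhere. -/
theorem ae_eq_of_forall_schwartz {f g : E3 → ℂ} (hf : LocallyIntegrable f volume)
    (hg : LocallyIntegrable g volume)
    (h : ∀ φ : 𝓢(E3, ℂ), ∫ x, f x * φ x = ∫ x, g x * φ x) : f =ᵐ[volume] g := by
  refine ae_eq_of_integral_contDiff_smul_eq hf hg fun ψ h1 h2 => ?_
  obtain ⟨φ, hφ⟩ := exists_schwartz_ofReal h1 h2
  have h6 := h φ
  simp only [hφ] at h6
  simp only [Complex.real_smul]
  simpa only [mul_comm] using h6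

theorem _root_.MeasureTheory.MemLp.locInt2 {F : Type*} [NormedAddCommGroup F] {f : E3 → F}
    (h : MemLp f 2 volume) : LocallyIntegrable f volume :=
  h.locallyIntegrable (by norm_num)

theorem integrable_mul_of_memLp {f g : E3 → ℂ} (hf : MemLp f 2 volume) (hg : MemLp g 2 volume) :
    Integrable (fun x => f x * g x) volume :=
  hf.integrable_mul hg

theorem memLp_schwartz {F : Type*} [NormedAddCommGroup F] [NormedSpace ℝ F] (φ : 𝓢(E3, F))
    (p : ℝ≥0∞) : MemLp φ p volume := φ.memLp p volume

/-- The `L²` transform agrees with the transform of tempered distributions. -/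
theorem integral_ft_mul {f : E3 → ℂ} (hf : MemLp f 2 volume) (φ : 𝓢(E3, ℂ)) :
    ∫ x, ft f x * φ x = ∫ x, f x * 𝓕 φ x := by
  have h := DFunLike.congr_fun (Lp.fourier_toTemperedDistribution_eq (hf.toLp f)) φ
  rw [TemperedDistribution.fourier_apply, Lp.toTemperedDistribution_apply,
    Lp.toTemperedDistribution_apply] at h
  rw [ft_of_memLp hf]
  simp only [smul_eq_mul] at h
  calc _ = _ := integral_congr_ae (Eventually.of_forall fun x => mul_comm _ _)
    _ = _ := h.symm
    _ = _ := integral_congr_ae ?_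
  filter_upwards [hf.coeFn_toLp] with x hx
  rw [hx, mul_comm]

/-- The recognition principle behind the transform formulas below: a candidate is checked only
against Schwartz functions. -/
theorem ae_eq_ft_of_forall {f h : E3 → ℂ} (hf : MemLp f 2 volume)
    (hh : LocallyIntegrable h volume)
    (H : ∀ φ : 𝓢(E3, ℂ), ∫ x, h x * φ x = ∫ x, f x * 𝓕 φ x) : h =ᵐ[volume] ft f :=
  ae_eq_of_forall_schwartz hh (memLp_ft f).locInt2 fun φ => by
    rw [H, integral_ft_mul hf]

theorem ft_add {f g : E3 → ℂ} (hf : MemLp f 2 volume) (hg : MemLp g 2 volume) :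
    ft (fun x => f x + g x) =ᵐ[volume] fun x => ft f x + ft g x := by
  have h : (hf.add hg).toLp (fun x => f x + g x) = hf.toLp f + hg.toLp g := rfl
  have h' : MemLp (fun x => f x + g x) 2 volume := hf.add hg
  rw [ft_of_memLp hf, ft_of_memLp hg, ft_of_memLp h', h, FourierTransform.fourier_add]
  exact Lp.coeFn_add _ _

theorem ft_const_mul {f : E3 → ℂ} (hf : MemLp f 2 volume) (c : ℂ) :
    ft (fun x => c * f x) =ᵐ[volume] fun x => c * ft f x := by
  have h : (hf.const_mul c).toLp (fun x => c * f x) = c • hf.toLp f := rfl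
  rw [ft_of_memLp hf, ft_of_memLp (hf.const_mul c), h, FourierTransform.fourier_smul]
  exact Lp.coeFn_smul _ _

theorem ft_sub {f g : E3 → ℂ} (hf : MemLp f 2 volume) (hg : MemLp g 2 volume) :
    ft (fun x => f x - g x) =ᵐ[volume] fun x => ft f x - ft g x := by
  have h1 := ft_add hf (hg.const_mul (-1))
  have h2 := ft_const_mul hg (-1)
  have h3 : (fun x => f x - g x) = fun x => f x + -1 * g x := by ext x; ring
  rw [h3]
  filter_upwards [h1, h2] with x hx1 hx2
  rw [hx1, hx2]; ring

theorem ft_sum {ι : Type*} (s : Finset ι) {f : ι → E3 → ℂ} (hf : ∀ i ∈ s, MemLp (f i) 2 volume) :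
    ft (fun x => ∑ i ∈ s, f i x) =ᵐ[volume] fun x => ∑ i ∈ s, ft (f i) x := by
  classical
  induction s using Finset.induction_on with
  | empty =>
    have := ft_const_mul (f := 0) (MemLp.zero (p := 2)) 0
    simpa using this
  | insert i s hi ih =>
    have h1 := ih fun j hj => hf j (Finset.mem_insert_of_mem hj)
    have h2 := ft_add (hf i (Finset.mem_insert_self i s))
      (memLp_finsetSum s fun j hj => hf j (Finset.mem_insert_of_mem hj))
    simp only [Finset.sum_insert hi]
    filter_upwards [h1, h2] with x hx1 hx2
    rw [hx2, ← hx1]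

theorem ft_surjective {G : E3 → ℂ} (hG : MemLp G 2 volume) :
    ∃ g : E3 → ℂ, MemLp g 2 volume ∧ ft g =ᵐ[volume] G := by
  refine ⟨(𝓕⁻ (hG.toLp G) : Lp ℂ 2 (volume : Measure E3)), Lp.memLp _, ?_⟩
  rw [ft_of_memLp (Lp.memLp _), Lp.toLp_coeFn, FourierTransform.fourier_fourierInv_eq]
  exact hG.coeFn_toLp

theorem ae_eq_of_ft {f g : E3 → ℂ} (hf : MemLp f 2 volume) (hg : MemLp g 2 volume)
    (h : ft f =ᵐ[volume] ft g) : f =ᵐ[volume] g := by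
  have hfg : MemLp (fun x => f x - g x) 2 volume := hf.sub hg
  have h0 : eLpNorm (fun x => f x - g x) 2 volume = 0 := by
    rw [← eLpNorm_ft hfg, eLpNorm_congr_ae (ft_sub hf hg),
      eLpNorm_congr_ae (g := fun _ => (0 : ℂ)) ?_]
    · simp
    · filter_upwards [h] with x hx
      rw [hx, sub_self]
  rw [eLpNorm_eq_zero_iff hfg.aestronglyMeasurable (by norm_num)] at h0
  filter_upwards [h0] with x hx
  simpa [sub_eq_zero] using hx

theorem parseval {f g : E3 → ℂ} (hf : MemLp f 2 volume) (hg : MemLp g 2 volume) :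
    ∫ x, f x * (starRingEnd ℂ) (g x) = ∫ ξ, ft f ξ * (starRingEnd ℂ) (ft g ξ) := by
  have h := Lp.inner_fourier_eq (hg.toLp g) (hf.toLp f)
  rw [L2.inner_def, L2.inner_def] at h
  rw [ft_of_memLp hf, ft_of_memLp hg]
  simp only [RCLike.inner_apply] at h
  rw [h]
  refine integral_congr_ae ?_
  filter_upwards [hf.coeFn_toLp, hg.coeFn_toLp] with x h1 h2
  rw [h1, h2]

/-- Both sides are continuous in `g` for the bilinear `L²` pairing, so Schwartz `g` suffice, and
there the identity is `integral_ft_mul`. -/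
theorem integral_ft_mul_ft {f g : E3 → ℂ} (hf : MemLp f 2 volume) (hg : MemLp g 2 volume) :
    ∫ x, ft f x * g x = ∫ x, f x * ft g x := by
  let B := (ContinuousLinearMap.mul ℂ ℂ).lpPairing (volume : Measure E3) 2 2
  have key : ∀ F G : Lp ℂ 2 (volume : Measure E3), B (𝓕 F) G = B F (𝓕 G) := by
    intro F G
    refine DenseRange.induction_on (p := fun G => B (𝓕 F) G = B F (𝓕 G))
      (SchwartzMap.denseRange_toLpCLM (E := E3) (F := ℂ) (μ := volume) (p := 2) ENNReal.ofNat_ne_top)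
      G ?_ ?_
    · exact isClosed_eq (B (𝓕 F)).continuous
        ((B F).continuous.comp (FourierTransform.fourierCLM ℂ (Lp ℂ 2 (volume : Measure E3))).continuous)
    · intro φ
      have h := integral_ft_mul (Lp.memLp F) φ
      rw [ft_of_memLp (Lp.memLp F), Lp.toLp_coeFn] at h
      simp only [B, ContinuousLinearMap.lpPairing_eq_integral, SchwartzMap.toLpCLM_apply,
        SchwartzMap.toLp_fourier_eq, ContinuousLinearMap.mul_apply']
      calc _ = ∫ x, (𝓕 F : Lp ℂ 2 (volume : Measure E3)) x * φ x := integral_congr_ae ?_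
        _ = _ := h
        _ = _ := integral_congr_ae ?_
      · filter_upwards [φ.coeFn_toLp 2 volume] with x hx
        rw [hx]
      · filter_upwards [(𝓕 φ).coeFn_toLp 2 volume] with x hx
        rw [hx]
  have h := key (hf.toLp f) (hg.toLp g)
  simp only [B, ContinuousLinearMap.lpPairing_eq_integral, ContinuousLinearMap.mul_apply'] at h
  rw [ft_of_memLp hf, ft_of_memLp hg]
  calc _ = _ := integral_congr_ae ?_
    _ = _ := h
    _ = _ := integral_congr_ae ?_
  · filter_upwards [hg.coeFn_toLp] with x hx
    rw [hx]
  · filter_upwards [hf.coeFn_toLp] with x hx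
    rw [hx]

theorem integral_fourier_mul_of_integrable {f g : E3 → ℂ} (hf : Integrable f volume)
    (hg : Integrable g volume) : ∫ x, 𝓕 f x * g x = ∫ x, f x * 𝓕 g x := by
  simpa using! VectorFourier.integral_bilin_fourierIntegral_eq_flip (ContinuousLinearMap.mul ℂ ℂ)
    (L := innerₗ E3) Real.continuous_fourierChar continuous_inner hf hg

theorem continuous_fourier_of_integrable {f : E3 → ℂ} (hf : Integrable f volume) :
    Continuous (𝓕 f) :=
  VectorFourier.fourierIntegral_continuous Real.continuous_fourierChar
    (L := innerₗ E3) continuous_inner hf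

theorem norm_fourier_le (f : E3 → ℂ) (ξ : E3) : ‖𝓕 f ξ‖ ≤ ∫ x, ‖f x‖ :=
  VectorFourier.norm_fourierIntegral_le_integral_norm _ _ _ _ _

theorem ft_eq_fourier {f : E3 → ℂ} (hf : MemLp f 2 volume) (h1 : Integrable f volume) :
    ft f =ᵐ[volume] 𝓕 f := by
  refine (ae_eq_ft_of_forall hf (continuous_fourier_of_integrable h1).locallyIntegrable
    fun φ => ?_).symm
  rw [SchwartzMap.fourier_coe]
  exact integral_fourier_mul_of_integrable h1 φ.integrable

/-! ### Young's inequality and convolutions -/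

/-- Cauchy–Schwarz for the measure with density `a`, obtained by splitting `a` into two square
roots. Applied to a translated kernel it yields Young's inequality. -/
theorem sq_lintegral_mul_le {a b : E3 → ℝ≥0∞} (ha : AEMeasurable a volume)
    (hb : AEMeasurable b volume) :
    (∫⁻ x, a x * b x) ^ 2 ≤ (∫⁻ x, a x) * ∫⁻ x, a x * b x ^ 2 := by
  have h := ENNReal.lintegral_mul_le_Lp_mul_Lq (volume : Measure E3) Real.HolderConjugate.two_two
    (f := fun x => a x ^ (1 / 2 : ℝ)) (g := fun x => a x ^ (1 / 2 : ℝ) * b x)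
    (ha.pow_const _) ((ha.pow_const _).mul hb)
  have e1 : ∀ x, a x ^ (1 / 2 : ℝ) * (a x ^ (1 / 2 : ℝ) * b x) = a x * b x := fun x => by
    rw [← mul_assoc, ← ENNReal.rpow_add_of_nonneg _ _ (by norm_num) (by norm_num)]
    norm_num
  have e2 : ∀ x, (a x ^ (1 / 2 : ℝ)) ^ (2 : ℝ) = a x := fun x => by
    rw [← ENNReal.rpow_mul]; norm_num
  have e3 : ∀ x, (a x ^ (1 / 2 : ℝ) * b x) ^ (2 : ℝ) = a x * b x ^ 2 := fun x => by
    rw [ENNReal.mul_rpow_of_nonneg _ _ (by norm_num), e2]; norm_num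
  simp only [Pi.mul_apply, e1, e2, e3] at h
  calc (∫⁻ x, a x * b x) ^ 2
      ≤ ((∫⁻ x, a x) ^ (1 / 2 : ℝ) * (∫⁻ x, a x * b x ^ 2) ^ (1 / 2 : ℝ)) ^ 2 := by gcongr
    _ = _ := by
      rw [mul_pow, ← ENNReal.rpow_natCast, ← ENNReal.rpow_natCast, ← ENNReal.rpow_mul,
        ← ENNReal.rpow_mul]
      norm_num

theorem lintegral_mul_sq_le {a b : E3 → ℝ≥0∞} (ha : AEMeasurable a volume)
    (hb : AEMeasurable b volume) :
    (∫⁻ x, a x * b x) ^ 2 ≤ (∫⁻ x, a x ^ 2) * ∫⁻ x, b x ^ 2 := by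
  have h := ENNReal.lintegral_mul_le_Lp_mul_Lq (volume : Measure E3) Real.HolderConjugate.two_two
    ha hb
  simp only [Pi.mul_apply] at h
  calc (∫⁻ x, a x * b x) ^ 2
      ≤ ((∫⁻ x, a x ^ (2 : ℝ)) ^ (1 / 2 : ℝ) * (∫⁻ x, b x ^ (2 : ℝ)) ^ (1 / 2 : ℝ)) ^ 2 := by gcongr
    _ = _ := by
      rw [mul_pow, ← ENNReal.rpow_natCast, ← ENNReal.rpow_natCast, ← ENNReal.rpow_mul,
        ← ENNReal.rpow_mul]
      norm_num

theorem aemeasurable_sub_mul {a b : E3 → ℝ≥0∞} (ha : AEMeasurable a volume)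
    (hb : AEMeasurable b volume) :
    AEMeasurable (fun z : E3 × E3 => a (z.1 - z.2) * b z.2) (volume.prod volume) :=
  (ha.comp_quasiMeasurePreserving (quasiMeasurePreserving_sub volume volume)).mul
    (hb.comp_quasiMeasurePreserving Measure.quasiMeasurePreserving_snd)

/-- Young's inequality `L¹ * L² ⊆ L²` for nonnegative functions. -/
theorem lintegral_conv_sq_le {a b : E3 → ℝ≥0∞} (ha : AEMeasurable a volume)
    (hb : AEMeasurable b volume) :
    ∫⁻ x, (∫⁻ y, a (x - y) * b y) ^ 2 ≤ (∫⁻ x, a x) ^ 2 * ∫⁻ x, b x ^ 2 := by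
  have hs : ∀ x : E3, ∫⁻ y, a (x - y) = ∫⁻ y, a y := fun x => lintegral_sub_left_eq_self a x
  have hm : ∀ x : E3, AEMeasurable (fun y => a (x - y)) volume := fun x =>
    ha.comp_quasiMeasurePreserving (quasiMeasurePreserving_sub_left_of_right_invariant volume x)
  calc ∫⁻ x, (∫⁻ y, a (x - y) * b y) ^ 2
      ≤ ∫⁻ x, (∫⁻ y, a y) * ∫⁻ y, a (x - y) * b y ^ 2 := by
        refine lintegral_mono fun x => ?_
        rw [← hs x]
        exact sq_lintegral_mul_le (hm x) hb
    _ = (∫⁻ y, a y) * ∫⁻ x, ∫⁻ y, a (x - y) * b y ^ 2 := by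
        rw [lintegral_const_mul'']
        exact (aemeasurable_sub_mul ha (hb.pow_const 2)).lintegral_prod_right'
    _ = (∫⁻ y, a y) * ∫⁻ y, ∫⁻ x, a (x - y) * b y ^ 2 := by
        rw [lintegral_lintegral_swap]
        exact aemeasurable_sub_mul ha (hb.pow_const 2)
    _ = (∫⁻ y, a y) * ∫⁻ y, (∫⁻ x, a x) * b y ^ 2 := by
        congr 1
        refine lintegral_congr fun y => ?_
        rw [lintegral_mul_const'', lintegral_sub_right_eq_self a y]
        exact ha.comp_quasiMeasurePreserving (measurePreserving_sub_right volume y).quasiMeasurePreserving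
    _ = _ := by
        rw [lintegral_const_mul'' _ (hb.pow_const 2)]
        ring

theorem eLpNorm_two_sq {F : Type*} [NormedAddCommGroup F] (f : E3 → F) :
    eLpNorm f 2 volume ^ 2 = ∫⁻ x, ‖f x‖ₑ ^ 2 := by
  rw [eLpNorm_eq_lintegral_rpow_enorm_toReal (by norm_num) (by norm_num), ← ENNReal.rpow_natCast,
    ← ENNReal.rpow_mul]
  norm_num

theorem memLp_two_iff {F : Type*} [NormedAddCommGroup F] {f : E3 → F}
    (hf : AEStronglyMeasurable f volume) :
    MemLp f 2 volume ↔ ∫⁻ x, ‖f x‖ₑ ^ 2 < ⊤ := by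
  rw [← eLpNorm_two_sq, MemLp]
  simp [hf, ENNReal.pow_lt_top_iff]

theorem aestronglyMeasurable_sub_mul {k f : E3 → ℂ} (hk : AEStronglyMeasurable k volume)
    (hf : AEStronglyMeasurable f volume) :
    AEStronglyMeasurable (fun z : E3 × E3 => k (z.1 - z.2) * f z.2) (volume.prod volume) :=
  (hk.comp_quasiMeasurePreserving (quasiMeasurePreserving_sub volume volume)).mul
    (hf.comp_quasiMeasurePreserving Measure.quasiMeasurePreserving_snd)

theorem aestronglyMeasurable_conv {k f : E3 → ℂ} (hk : AEStronglyMeasurable k volume)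
    (hf : AEStronglyMeasurable f volume) :
    AEStronglyMeasurable (fun x => ∫ y, k (x - y) * f y) volume :=
  (aestronglyMeasurable_sub_mul hk hf).integral_prod_right'

theorem memLp_conv {k f : E3 → ℂ} (hk : Integrable k volume) (hf : MemLp f 2 volume) :
    MemLp (fun x => ∫ y, k (x - y) * f y) 2 volume := by
  rw [memLp_two_iff (aestronglyMeasurable_conv hk.1 hf.1)]
  calc _ ≤ ∫⁻ x, (∫⁻ y, ‖k (x - y)‖ₑ * ‖f y‖ₑ) ^ 2 := by
        gcongr with x
        refine (enorm_integral_le_lintegral_enorm _).trans_eq ?_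
        simp
    _ ≤ (∫⁻ x, ‖k x‖ₑ) ^ 2 * ∫⁻ x, ‖f x‖ₑ ^ 2 := lintegral_conv_sq_le hk.1.enorm hf.1.enorm
    _ < ⊤ := ENNReal.mul_lt_top (ENNReal.pow_lt_top hk.2) ((memLp_two_iff hf.1).1 hf)

/-- Fubini for a trilinear form `∫∫ k(x-y) f(y) g(x)` with `k ∈ L¹`, `f, g ∈ L²`. -/
theorem integrable_conv_trilinear {k f g : E3 → ℂ} (hk : Integrable k volume)
    (hf : MemLp f 2 volume) (hg : MemLp g 2 volume) :
    Integrable (fun z : E3 × E3 => k (z.1 - z.2) * f z.2 * g z.1) (volume.prod volume) := by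
  have hm : AEStronglyMeasurable (fun z : E3 × E3 => k (z.1 - z.2) * f z.2 * g z.1)
      (volume.prod volume) :=
    (aestronglyMeasurable_sub_mul hk.1 hf.1).mul
      (hg.1.comp_quasiMeasurePreserving Measure.quasiMeasurePreserving_fst)
  refine ⟨hm, ?_⟩
  rw [HasFiniteIntegral, lintegral_prod _ hm.enorm]
  have hc := (aemeasurable_sub_mul hk.1.enorm hf.1.enorm).lintegral_prod_right'
  have h1 : ∀ x, ∫⁻ y, ‖k (x - y) * f y * g x‖ₑ = (∫⁻ y, ‖k (x - y)‖ₑ * ‖f y‖ₑ) * ‖g x‖ₑ := by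
    intro x
    simp only [enorm_mul]
    rw [lintegral_mul_const' _ _ enorm_ne_top]
  simp only [h1]
  refine (ENNReal.pow_lt_top_iff.1 ((lintegral_mul_sq_le hc hg.1.enorm).trans_lt ?_)).resolve_right
    two_ne_zero
  refine ENNReal.mul_lt_top ((lintegral_conv_sq_le hk.1.enorm hf.1.enorm).trans_lt ?_)
    ((memLp_two_iff hg.1).1 hg)
  exact ENNReal.mul_lt_top (ENNReal.pow_lt_top hk.2) ((memLp_two_iff hf.1).1 hf)

theorem memLp_mul_bdd {m f : E3 → ℂ} (hm : AEStronglyMeasurable m volume) {C : ℝ}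
    (hC : ∀ x, ‖m x‖ ≤ C) (hf : MemLp f 2 volume) : MemLp (fun x => m x * f x) 2 volume := by
  refine (hf.const_mul (C : ℂ)).of_le (hm.mul hf.1) (Eventually.of_forall fun x => ?_)
  rw [norm_mul, norm_mul]
  refine mul_le_mul_of_nonneg_right ((hC x).trans ?_) (norm_nonneg _)
  simpa using le_abs_self C

/-- The Fourier transform of the convolution of an integrable with a square integrable function. -/
theorem ft_conv {k f : E3 → ℂ} (hk : Integrable k volume) (hf : MemLp f 2 volume) :
    ft (fun x => ∫ y, k (x - y) * f y) =ᵐ[volume] fun ξ => 𝓕 k ξ * ft f ξ := by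
  have hkc := continuous_fourier_of_integrable hk
  refine (ae_eq_ft_of_forall (memLp_conv hk hf) (memLp_mul_bdd hkc.aestronglyMeasurable
    (norm_fourier_le k) (memLp_ft f)).locInt2 fun φ => ?_).symm
  have hp : MemLp (fun ξ => 𝓕 k ξ * φ ξ) 2 volume :=
    memLp_mul_bdd hkc.aestronglyMeasurable (norm_fourier_le k) (memLp_schwartz φ 2)
  have hp1 : Integrable (fun ξ => 𝓕 k ξ * φ ξ) volume :=
    φ.integrable.bdd_mul hkc.aestronglyMeasurable (Eventually.of_forall (norm_fourier_le k))
  -- Since `k` is merely integrable, `𝓕 k * φ` need not be Schwartz. Its transform is computed by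
  -- moving the transform from `k` onto a modulated `φ`, whose transform is a translate of `𝓕 φ`.
  have hF : ∀ y, 𝓕 (fun ξ => 𝓕 k ξ * φ ξ) y = ∫ x, k (x - y) * 𝓕 φ x := by
    intro y
    have h1 : 𝓕 (fun ξ => 𝓕 k ξ * φ ξ) y
        = ∫ ξ, 𝓕 k ξ * (Real.fourierChar (-inner ℝ ξ y) • φ ξ) := by
      rw [Real.fourier_eq]
      refine integral_congr_ae (Eventually.of_forall fun ξ => ?_)
      simp only [Circle.smul_def, smul_eq_mul]; ring
    have h2 : Integrable (fun ξ => Real.fourierChar (-inner ℝ ξ y) • φ ξ) volume :=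
      (Real.fourierIntegral_convergent_iff y).2 φ.integrable
    rw [h1, integral_fourier_mul_of_integrable hk h2, ← integral_sub_right_eq_self _ y]
    refine integral_congr_ae (Eventually.of_forall fun x => ?_)
    simp only
    congr 1
    rw [Real.fourier_eq, SchwartzMap.fourier_coe, Real.fourier_eq]
    refine integral_congr_ae (Eventually.of_forall fun ξ => ?_)
    simp only [Circle.smul_def, smul_eq_mul]
    rw [← mul_assoc, ← Circle.coe_mul, ← AddChar.map_add_eq_mul]
    congr 3
    rw [inner_sub_right]; ring
  calc ∫ ξ, 𝓕 k ξ * ft f ξ * φ ξ = ∫ ξ, ft f ξ * (𝓕 k ξ * φ ξ) := by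
        congr 1; ext ξ; ring
    _ = ∫ y, f y * ft (fun ξ => 𝓕 k ξ * φ ξ) y := integral_ft_mul_ft hf hp
    _ = ∫ y, f y * ∫ x, k (x - y) * 𝓕 φ x := by
        refine integral_congr_ae ?_
        filter_upwards [ft_eq_fourier hp hp1] with y hy
        rw [hy, hF]
    _ = ∫ y, ∫ x, k (x - y) * f y * 𝓕 φ x := by
        refine integral_congr_ae (Eventually.of_forall fun y => ?_)
        simp only
        rw [← integral_const_mul]
        congr 1; ext x; ring
    _ = ∫ x, ∫ y, k (x - y) * f y * 𝓕 φ x :=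
        integral_integral_swap (f := fun y x => k (x - y) * f y * 𝓕 φ x)
          (integrable_conv_trilinear hk hf (memLp_schwartz (𝓕 φ) 2)).swap
    _ = _ := by
        refine integral_congr_ae (Eventually.of_forall fun x => ?_)
        simp only
        rw [integral_mul_const]

end MLANS

end

/-! ### Reflections, the iterated transform, and transforms of products. -/

noncomputable section

namespace MLANS

theorem memLp_comp_neg {F : Type*} [NormedAddCommGroup F] {f : E3 → F} {p : ℝ≥0∞}
    (hf : MemLp f p volume) : MemLp (fun x => f (-x)) p volume :=
  hf.comp_measurePreserving (Measure.measurePreserving_neg volume)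

theorem ae_comp_neg {P : E3 → Prop} (h : ∀ᵐ x, P x) : ∀ᵐ x : E3, P (-x) :=
  (Measure.measurePreserving_neg (volume : Measure E3)).quasiMeasurePreserving.ae h

/-- Reflection of Schwartz functions. -/
def schwartzNeg (φ : 𝓢(E3, ℂ)) : 𝓢(E3, ℂ) :=
  SchwartzMap.compCLMOfContinuousLinearEquiv ℂ (ContinuousLinearEquiv.neg ℝ) φ

theorem schwartzNeg_apply (φ : 𝓢(E3, ℂ)) (x : E3) : schwartzNeg φ x = φ (-x) := rfl

theorem fourier_schwartzNeg (φ : 𝓢(E3, ℂ)) (x : E3) :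
    𝓕 (schwartzNeg φ) x = 𝓕 φ (-x) := by
  rw [SchwartzMap.fourier_coe, SchwartzMap.fourier_coe]
  exact Real.fourier_comp_linearIsometry (LinearIsometryEquiv.neg ℝ) φ x

theorem fourier_fourier_schwartz (φ : 𝓢(E3, ℂ)) (x : E3) : 𝓕 (𝓕 φ) x = φ (-x) := by
  have h : 𝓕⁻ (𝓕 φ) (-x) = φ (-x) := by rw [FourierTransform.fourierInv_fourier_eq]
  rw [SchwartzMap.fourierInv_coe, Real.fourierInv_eq_fourier_neg, neg_neg] at h
  exact h

theorem ft_comp_neg {f : E3 → ℂ} (hf : MemLp f 2 volume) :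
    ft (fun x => f (-x)) =ᵐ[volume] fun ξ => ft f (-ξ) := by
  refine (ae_eq_ft_of_forall (memLp_comp_neg hf) (memLp_comp_neg (memLp_ft f)).locInt2
    fun φ => ?_).symm
  calc ∫ x, ft f (-x) * φ x = ∫ x, ft f x * schwartzNeg φ x := by
        rw [← integral_neg_eq_self]; simp [schwartzNeg_apply]
    _ = ∫ x, f x * 𝓕 (schwartzNeg φ) x := integral_ft_mul hf _
    _ = ∫ x, f (-x) * 𝓕 φ x := by
        rw [← integral_neg_eq_self]; simp [fourier_schwartzNeg]

theorem ft_ft {f : E3 → ℂ} (hf : MemLp f 2 volume) :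
    ft (ft f) =ᵐ[volume] fun x => f (-x) := by
  refine (ae_eq_ft_of_forall (memLp_ft f) (memLp_comp_neg hf).locInt2 fun φ => ?_).symm
  rw [integral_ft_mul hf, ← integral_neg_eq_self]
  simp [fourier_fourier_schwartz]

/-- Fourier inversion: the transform of `ft f` is the reflection of `f`, and the transform of an
integrable function is bounded by its `L¹` norm. -/
theorem ae_norm_le_of_integrable_ft {f : E3 → ℂ} (hf : MemLp f 2 volume)
    (h : Integrable (ft f) volume) : ∀ᵐ x, ‖f x‖ ≤ ∫ ξ, ‖ft f ξ‖ := by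
  have h1 := ft_eq_fourier (memLp_ft f) h
  have h2 : ∀ᵐ x, ‖f (-x)‖ ≤ ∫ ξ, ‖ft f ξ‖ := by
    filter_upwards [h1, ft_ft hf] with x hx hx'
    rw [← hx', hx]
    exact norm_fourier_le _ _
  simpa using ae_comp_neg h2

theorem lintegral_conv_le {F G : E3 → ℂ} (hF : MemLp F 2 volume) (hG : MemLp G 2 volume) (ξ : E3) :
    ∫⁻ η, ‖G (ξ - η)‖ₑ * ‖F η‖ₑ ≤ eLpNorm F 2 volume * eLpNorm G 2 volume := by
  have hm : AEMeasurable (fun y => ‖G (ξ - y)‖ₑ) volume :=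
    hG.1.enorm.comp_quasiMeasurePreserving
      (quasiMeasurePreserving_sub_left_of_right_invariant volume ξ)
  rw [← ENNReal.pow_le_pow_left_iff two_ne_zero]
  calc _ ≤ (∫⁻ η, ‖G (ξ - η)‖ₑ ^ 2) * ∫⁻ η, ‖F η‖ₑ ^ 2 := lintegral_mul_sq_le hm hF.1.enorm
    _ = _ := by
        rw [lintegral_sub_left_eq_self (fun y => ‖G y‖ₑ ^ 2) ξ, mul_pow, eLpNorm_two_sq,
          eLpNorm_two_sq, mul_comm]

theorem enorm_conv_le {F G : E3 → ℂ} (hF : MemLp F 2 volume) (hG : MemLp G 2 volume) (ξ : E3) :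
    ‖∫ η, G (ξ - η) * F η‖ₑ ≤ eLpNorm F 2 volume * eLpNorm G 2 volume :=
  ((enorm_integral_le_lintegral_enorm _).trans_eq (by simp)).trans (lintegral_conv_le hF hG ξ)

theorem locallyIntegrable_of_bdd {F : Type*} [NormedAddCommGroup F] {f : E3 → F}
    (hf : AEStronglyMeasurable f volume) {C : ℝ}
    (hC : ∀ᵐ x, ‖f x‖ ≤ C) : LocallyIntegrable f volume :=
  (memLp_top_of_bound hf C hC).locallyIntegrable le_top

/-- The Fourier transform of a product is the convolution of the Fourier transforms. -/
theorem ft_mul {f g : E3 → ℂ} (hf : MemLp f 2 volume) (hg : MemLp g 2 volume)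
    (hfg : MemLp (fun x => f x * g x) 2 volume) :
    ft (fun x => f x * g x) =ᵐ[volume] fun ξ => ∫ η, ft g (ξ - η) * ft f η := by
  have hF := memLp_ft f
  have hG := memLp_ft g
  have hlt : eLpNorm (ft f) 2 volume * eLpNorm (ft g) 2 volume < ⊤ := ENNReal.mul_lt_top hF.2 hG.2
  refine (ae_eq_ft_of_forall hfg (locallyIntegrable_of_bdd (aestronglyMeasurable_conv hG.1 hF.1)
    (C := (eLpNorm (ft f) 2 volume * eLpNorm (ft g) 2 volume).toReal)
    (Eventually.of_forall fun ξ => ?_)) fun φ => ?_).symm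
  · have := ENNReal.toReal_mono hlt.ne (enorm_conv_le hF hG ξ)
    rwa [toReal_enorm] at this
  have hGn := memLp_comp_neg hG
  -- The transform of the reflected `ft g` is `g` itself, as the two reflections cancel.
  have e1 : ft (fun η => ∫ y, φ (η - y) * ft g (-y)) =ᵐ[volume] fun x => 𝓕 φ x * g x := by
    filter_upwards [ft_conv φ.integrable hGn, ft_comp_neg hG, ae_comp_neg (ft_ft hg)] with x h1 h2 h3
    rw [h1, h2, h3, neg_neg]; rfl
  have hI := integrable_conv_trilinear φ.integrable hGn hF
  calc ∫ ξ, (∫ η, ft g (ξ - η) * ft f η) * φ ξ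
      = ∫ ξ, ∫ η, φ ξ * ft g (ξ - η) * ft f η := by
        refine integral_congr_ae (Eventually.of_forall fun ξ => ?_)
        simp only
        rw [← integral_mul_const]
        congr 1; ext η; ring
    _ = ∫ η, ∫ ξ, φ ξ * ft g (ξ - η) * ft f η := by
        refine integral_integral_swap (f := fun ξ η => φ ξ * ft g (ξ - η) * ft f η) ?_
        have hm : AEStronglyMeasurable (fun z : E3 × E3 => φ z.1 * ft g (z.1 - z.2) * ft f z.2)
            (volume.prod volume) :=
          ((φ.integrable.1.comp_quasiMeasurePreserving
            Measure.quasiMeasurePreserving_fst).mul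
            (hG.1.comp_quasiMeasurePreserving (quasiMeasurePreserving_sub volume volume))).mul
            (hF.1.comp_quasiMeasurePreserving Measure.quasiMeasurePreserving_snd)
        refine ⟨hm, ?_⟩
        rw [HasFiniteIntegral, Function.uncurry_def, lintegral_prod _ hm.enorm]
        calc _ ≤ ∫⁻ ξ, ‖φ ξ‖ₑ * (eLpNorm (ft f) 2 volume * eLpNorm (ft g) 2 volume) := by
              refine lintegral_mono fun ξ => ?_
              simp only [enorm_mul, mul_assoc]
              rw [lintegral_const_mul' _ _ enorm_ne_top]
              gcongr
              exact lintegral_conv_le hF hG ξ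
          _ < ⊤ := by
              rw [lintegral_mul_const' _ _ hlt.ne]
              exact ENNReal.mul_lt_top φ.integrable.2 hlt
    _ = ∫ η, ft f η * ∫ y, φ (η - y) * ft g (-y) := by
        refine integral_congr_ae (Eventually.of_forall fun η => ?_)
        simp only
        rw [← integral_const_mul, ← integral_sub_left_eq_self _ volume η]
        refine integral_congr_ae (Eventually.of_forall fun y => ?_)
        simp only
        rw [show η - y - η = -y by abel]; ring
    _ = ∫ x, f x * ft (fun η => ∫ y, φ (η - y) * ft g (-y)) x :=
        integral_ft_mul_ft hf (memLp_conv φ.integrable hGn)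
    _ = _ := by
        refine integral_congr_ae ?_
        filter_upwards [e1] with x hx
        rw [hx]; ring

theorem enorm_ft_mul_le {f g : E3 → ℂ} (hf : MemLp f 2 volume) (hg : MemLp g 2 volume)
    (hfg : MemLp (fun x => f x * g x) 2 volume) :
    ∀ᵐ ξ, ‖ft (fun x => f x * g x) ξ‖ₑ ≤ ∫⁻ η, ‖ft g (ξ - η)‖ₑ * ‖ft f η‖ₑ := by
  filter_upwards [ft_mul hf hg hfg] with ξ h
  rw [h]
  exact (enorm_integral_le_lintegral_enorm _).trans_eq (by simp)

end MLANS

end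

noncomputable section

namespace MLANS

open LineDeriv

/-! ### Weak derivatives of real functions, tested against Schwartz functions -/

/-- An integrable weight. -/
def wt (x : E3) : ℝ := (1 + ‖x‖) ^ (-(4 : ℝ))

theorem wt_pos (x : E3) : 0 < wt x := by unfold wt; positivity

theorem wt_le_one (x : E3) : wt x ≤ 1 :=
  Real.rpow_le_one_of_one_le_of_nonpos (by linarith [norm_nonneg x]) (by norm_num)

theorem continuous_wt : Continuous wt := by
  unfold wt
  refine Continuous.rpow_const (by fun_prop) fun x => Or.inl ?_
  positivity

theorem integrable_wt : Integrable wt volume :=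
  integrable_one_add_norm (E := E3) (by norm_num)

theorem memLp_wt {p : ℝ≥0∞} (hp : 1 ≤ p) : MemLp wt p volume := by
  by_cases hpt : p = ⊤
  · rw [hpt]
    refine memLp_top_of_bound continuous_wt.aestronglyMeasurable 1 (Eventually.of_forall fun x => ?_)
    rw [Real.norm_of_nonneg (wt_pos x).le]; exact wt_le_one x
  have hp0 : p ≠ 0 := (zero_lt_one.trans_le hp).ne'
  rw [← integrable_norm_rpow_iff continuous_wt.aestronglyMeasurable hp0 hpt]
  refine integrable_wt.mono' (by
    refine Continuous.aestronglyMeasurable ?_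
    exact continuous_wt.norm.rpow_const fun x => Or.inr (by positivity))
    (Eventually.of_forall fun x => ?_)
  rw [Real.norm_of_nonneg (by positivity), Real.norm_of_nonneg (wt_pos x).le]
  have : 1 ≤ p.toReal := by
    rw [← ENNReal.toReal_one]; exact ENNReal.toReal_mono hpt hp
  exact (Real.rpow_le_rpow_of_exponent_ge (wt_pos x) (wt_le_one x) this).trans_eq (Real.rpow_one _)

/-- Integrability against the weight `wt`. -/
def TI (f : E3 → ℝ) : Prop := Integrable (fun x => f x * wt x) volume

theorem TI.aestronglyMeasurable {f : E3 → ℝ} (h : TI f) : AEStronglyMeasurable f volume := by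
  have h1 : AEStronglyMeasurable (fun x => (f x * wt x) * (wt x)⁻¹) volume :=
    h.1.mul (continuous_wt.inv₀ fun x => (wt_pos x).ne').aestronglyMeasurable
  convert h1 using 2 with x
  have := (wt_pos x).ne'
  field_simp

theorem TI.integrable_mul {f : E3 → ℝ} (h : TI f) {g : E3 → ℝ} (hg : AEStronglyMeasurable g volume)
    {C : ℝ} (hC : ∀ x, |g x| ≤ C * wt x) : Integrable (fun x => f x * g x) volume := by
  refine (h.norm.const_mul C).mono' (h.aestronglyMeasurable.mul hg) (Eventually.of_forall fun x => ?_)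
  rw [norm_mul, norm_mul, Real.norm_of_nonneg (wt_pos x).le, Real.norm_eq_abs (g x)]
  calc _ ≤ ‖f x‖ * (C * wt x) := by gcongr; exact hC x
    _ = _ := by ring

theorem TI.add {f g : E3 → ℝ} (hf : TI f) (hg : TI g) : TI fun x => f x + g x := by
  have h : Integrable (fun x => f x * wt x + g x * wt x) volume := Integrable.add hf hg
  simpa only [TI, add_mul] using h

theorem TI.const_mul {f : E3 → ℝ} (hf : TI f) (c : ℝ) : TI fun x => c * f x := by
  have h : Integrable (fun x => c * (f x * wt x)) volume := Integrable.const_mul hf c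
  simpa only [TI, mul_assoc] using h

theorem TI.locallyIntegrable {f : E3 → ℝ} (h : TI f) : LocallyIntegrable f volume := by
  have h1 : LocallyIntegrable (fun x => (wt x)⁻¹ * (f x * wt x)) volume := by
    have := (Integrable.locallyIntegrable (f := fun x => f x * wt x) h).locallyIntegrableOn univ
    rw [← locallyIntegrableOn_univ]
    exact this.continuousOn_mul
      (continuous_wt.inv₀ fun x => (wt_pos x).ne').continuousOn isOpen_univ.isLocallyClosed
  convert h1 using 2 with x
  have := (wt_pos x).ne'
  field_simp

/-- Hölder against the weight, which lies in every `L^p` with `p ≥ 1`. One class thus covers the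
square integrable `u`, the field `v` in `L^p`, and bounded derivatives. -/
theorem _root_.MeasureTheory.MemLp.ti {f : E3 → ℝ} {p : ℝ≥0∞} (hf : MemLp f p volume) (hp : 1 ≤ p) :
    TI f := by
  have : ENNReal.HolderTriple p (ENNReal.conjExponent p) 1 :=
    (ENNReal.HolderConjugate.conjExponent hp)
  have h1 : 1 ≤ ENNReal.conjExponent p := by
    rw [ENNReal.conjExponent]; exact le_self_add
  have h := (memLp_wt h1).mul' hf (r := 1)
  rw [memLp_one_iff_integrable] at h
  exact h

theorem schwartz_le_wt {F : Type*} [NormedAddCommGroup F] [NormedSpace ℝ F] (φ : 𝓢(E3, F)) :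
    ∃ C : ℝ, 0 ≤ C ∧ ∀ x, ‖φ x‖ ≤ C * wt x := by
  refine ⟨2 ^ 4 * ((Finset.Iic (4, 0)).sup fun m => SchwartzMap.seminorm ℝ m.1 m.2) φ, by positivity,
    fun x => ?_⟩
  have h := SchwartzMap.one_add_le_sup_seminorm_apply (𝕜 := ℝ) (m := (4, 0)) (k := 4) (n := 0)
    le_rfl le_rfl φ x
  rw [norm_iteratedFDeriv_zero] at h
  unfold wt
  rw [Real.rpow_neg (by positivity), ← div_eq_mul_inv, le_div_iff₀ (by positivity)]
  have e : (1 + ‖x‖) ^ (4 : ℝ) = (1 + ‖x‖) ^ 4 := by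
    rw [← Real.rpow_natCast]; norm_num
  rw [e, mul_comm]
  exact h

theorem TI.integrable_mul_schwartz {f : E3 → ℝ} (h : TI f) (φ : 𝓢(E3, ℝ)) :
    Integrable (fun x => f x * φ x) volume := by
  obtain ⟨C, -, hC⟩ := schwartz_le_wt φ
  exact h.integrable_mul φ.continuous.aestronglyMeasurable hC

/-- `g` is the weak derivative `∂_k f`. -/
def WD (k : Fin 3) (f g : E3 → ℝ) : Prop :=
  TI f ∧ TI g ∧ ∀ φ : 𝓢(E3, ℝ), ∫ x, f x * (∂_{basisVec k} φ) x = -∫ x, g x * φ x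

theorem exists_schwartz_of_contDiff {ψ : E3 → ℝ} (h1 : ContDiff ℝ ∞ ψ) (h2 : HasCompactSupport ψ) :
    ∃ φ : 𝓢(E3, ℝ), ∀ x, φ x = ψ x :=
  ⟨h2.toSchwartzMap h1, fun _ => rfl⟩

theorem WD.unique {k : Fin 3} {f f' g g' : E3 → ℝ} (hf : f =ᵐ[volume] f') (h : WD k f g)
    (h' : WD k f' g') : g =ᵐ[volume] g' := by
  refine ae_eq_of_integral_contDiff_smul_eq h.2.1.locallyIntegrable h'.2.1.locallyIntegrable
    fun ψ h1 h2 => ?_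
  obtain ⟨φ, hφ⟩ := exists_schwartz_of_contDiff h1 h2
  have e1 := h.2.2 φ
  have e2 := h'.2.2 φ
  have e3 : ∫ x, f x * (∂_{basisVec k} φ) x = ∫ x, f' x * (∂_{basisVec k} φ) x :=
    integral_congr_ae (by filter_upwards [hf] with x hx; rw [hx])
  simp only [hφ] at e1 e2
  simp only [smul_eq_mul, mul_comm (ψ _)]
  linarith

theorem WD.add {k : Fin 3} {f g f' g' : E3 → ℝ} (h : WD k f f') (h' : WD k g g') :
    WD k (fun x => f x + g x) (fun x => f' x + g' x) := by
  refine ⟨h.1.add h'.1, h.2.1.add h'.2.1, fun φ => ?_⟩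
  simp only [add_mul]
  rw [integral_add (h.1.integrable_mul_schwartz _) (h'.1.integrable_mul_schwartz _),
    integral_add (h.2.1.integrable_mul_schwartz _) (h'.2.1.integrable_mul_schwartz _), h.2.2, h'.2.2]
  ring

theorem WD.const_mul {k : Fin 3} {f f' : E3 → ℝ} (h : WD k f f') (c : ℝ) :
    WD k (fun x => c * f x) (fun x => c * f' x) := by
  refine ⟨h.1.const_mul c, h.2.1.const_mul c, fun φ => ?_⟩
  simp only [mul_assoc]
  rw [integral_const_mul, integral_const_mul, h.2.2]
  ring

theorem WD.sub {k : Fin 3} {f g f' g' : E3 → ℝ} (h : WD k f f') (h' : WD k g g') :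
    WD k (fun x => f x - g x) (fun x => f' x - g' x) := by
  have := h.add (h'.const_mul (-1))
  convert this using 2 <;> ring

/-! ### The weak gradient of the statement -/

theorem HasWeakGrad.unique {f : E3 → E3} {D D' : E3 → Mat3} (h : HasWeakGrad f D)
    (h' : HasWeakGrad f D') : D =ᵐ[volume] D' := by
  have key : ∀ i j, (fun x => D x i j) =ᵐ[volume] fun x => D' x i j := by
    intro i j
    refine ae_eq_of_integral_contDiff_smul_eq (h.2 i j).1 (h'.2 i j).1 fun ψ h1 h2 => ?_
    have e1 := (h.2 i j).2 ψ h1 h2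
    have e2 := (h'.2 i j).2 ψ h1 h2
    simp only [smul_eq_mul, mul_comm (ψ _)]
    linarith
  have : ∀ᵐ x, ∀ i j, D x i j = D' x i j := by
    rw [ae_all_iff]; intro i; rw [ae_all_iff]; exact key i
  filter_upwards [this] with x hx
  ext i j; exact hx i j

/-- Weak gradients are unique almost everywhere, so the arbitrary choice in `weakGrad` agrees with
any derivatives that are actually constructed. -/
theorem weakGrad_ae_eq {f : E3 → E3} {D : Fin 3 → Fin 3 → E3 → ℝ}
    (hD : ∀ i j, WD i (fun x => f x j) (D i j)) :
    ∀ᵐ x, ∀ i j, weakGrad f x i j = D i j x := by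
  have h : HasWeakGrad f (fun x => Matrix.of fun i j => D i j x) := by
    refine ⟨?_, fun i j => ⟨(hD i j).2.1.locallyIntegrable, fun φ h1 h2 => ?_⟩⟩
    · intro x
      have hj : ∀ j, IntegrableAtFilter (fun x => f x j) (𝓝 x) volume := fun j =>
        (hD 0 j).1.locallyIntegrable x
      choose s hs hsi using hj
      refine ⟨⋂ j, s j, (iInter_mem).2 hs, ?_⟩
      have hint : ∀ j, IntegrableOn (fun x => f x j) (⋂ j, s j) volume := fun j =>
        (hsi j).mono_set (iInter_subset _ j)
      have h2 : IntegrableOn (fun x => ∑ j, f x j • basisVec j) (⋂ j, s j) volume :=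
        integrable_finsetSum _ fun j _ => (hint j).smul_const _
      convert h2 using 2 with x
      ext i
      simp [basisVec, Pi.single_apply]
    · obtain ⟨ψ, hψ⟩ := exists_schwartz_of_contDiff h1 h2
      have e := (hD i j).2.2 ψ
      have hφ : φ = ψ := funext fun x => (hψ x).symm
      rw [hφ]
      simpa only [SchwartzMap.lineDerivOp_apply_eq_fderiv, Matrix.of_apply] using e
  have h2 : ∃ D, HasWeakGrad f D := ⟨_, h⟩
  have h3 : HasWeakGrad f (weakGrad f) := by
    rw [weakGrad, dif_pos h2]; exact h2.choose_spec
  filter_upwards [h3.unique h] with x hx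
  intro i j; rw [hx]; rfl

/-! ### Square integrable weak derivatives and the Fourier transform -/

/-- The `L²` Fourier transform of a real function. -/
def rft (f : E3 → ℝ) : E3 → ℂ := ft fun x => (f x : ℂ)

theorem memLp_rft (f : E3 → ℝ) : MemLp (rft f) 2 volume := memLp_ft _

theorem rft_congr {f g : E3 → ℝ} (h : f =ᵐ[volume] g) : rft f = rft g :=
  ft_congr (by filter_upwards [h] with x hx; rw [hx])

theorem eLpNorm_rft {f : E3 → ℝ} (h : MemLp f 2 volume) :
    eLpNorm (rft f) 2 volume = eLpNorm f 2 volume := by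
  rw [rft, eLpNorm_ft (f := fun x => (f x : ℂ)) h.ofReal]
  exact eLpNorm_congr_norm_ae (Eventually.of_forall fun x => by simp)

theorem rft_add {f g : E3 → ℝ} (hf : MemLp f 2 volume) (hg : MemLp g 2 volume) :
    rft (fun x => f x + g x) =ᵐ[volume] fun x => rft f x + rft g x := by
  have := ft_add (f := fun x => (f x : ℂ)) (g := fun x => (g x : ℂ)) hf.ofReal hg.ofReal
  simpa [rft] using this

theorem rft_sub {f g : E3 → ℝ} (hf : MemLp f 2 volume) (hg : MemLp g 2 volume) :
    rft (fun x => f x - g x) =ᵐ[volume] fun x => rft f x - rft g x := by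
  have := ft_sub (f := fun x => (f x : ℂ)) (g := fun x => (g x : ℂ)) hf.ofReal hg.ofReal
  simpa [rft] using this

theorem rft_const_mul {f : E3 → ℝ} (hf : MemLp f 2 volume) (c : ℝ) :
    rft (fun x => c * f x) =ᵐ[volume] fun x => c * rft f x := by
  have := ft_const_mul (f := fun x => (f x : ℂ)) hf.ofReal (c : ℂ)
  simpa [rft] using this

theorem rft_sum {ι : Type*} (s : Finset ι) {f : ι → E3 → ℝ} (hf : ∀ i ∈ s, MemLp (f i) 2 volume) :
    rft (fun x => ∑ i ∈ s, f i x) =ᵐ[volume] fun x => ∑ i ∈ s, rft (f i) x := by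
  have := ft_sum s (f := fun i x => (f i x : ℂ)) fun i hi => (hf i hi).ofReal
  simpa [rft] using this

theorem rparseval {f g : E3 → ℝ} (hf : MemLp f 2 volume) (hg : MemLp g 2 volume) :
    ((∫ x, f x * g x : ℝ) : ℂ) = ∫ ξ, rft f ξ * (starRingEnd ℂ) (rft g ξ) := by
  have := parseval (f := fun x => (f x : ℂ)) (g := fun x => (g x : ℂ)) hf.ofReal hg.ofReal
  rw [rft, rft, ← this, ← integral_complex_ofReal]
  simp

theorem rft_mul {f g : E3 → ℝ} (hf : MemLp f 2 volume) (hg : MemLp g 2 volume)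
    (hfg : MemLp (fun x => f x * g x) 2 volume) :
    ∀ᵐ ξ, ‖rft (fun x => f x * g x) ξ‖ₑ ≤ ∫⁻ η, ‖rft g (ξ - η)‖ₑ * ‖rft f η‖ₑ := by
  have h := enorm_ft_mul_le (f := fun x => (f x : ℂ)) (g := fun x => (g x : ℂ)) hf.ofReal hg.ofReal
    (by simpa using hfg.ofReal (K := ℂ))
  simpa [rft] using h

theorem abs_le_of_integrable_rft {f : E3 → ℝ} (hf : MemLp f 2 volume)
    (h : Integrable (rft f) volume) : ∀ᵐ x, |f x| ≤ ∫ ξ, ‖rft f ξ‖ := by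
  have := ae_norm_le_of_integrable_ft (f := fun x => (f x : ℂ)) hf.ofReal h
  simpa [rft] using this

theorem inner_basisVec (ξ : E3) (k : Fin 3) : inner ℝ ξ (basisVec k) = ξ k := by
  simp [basisVec, EuclideanSpace.inner_single_right]

theorem hasTemperateGrowth_coord (k : Fin 3) :
    Function.HasTemperateGrowth (fun ξ : E3 => ((ξ k : ℝ) : ℂ)) := by
  have : (fun ξ : E3 => ((ξ k : ℝ) : ℂ)) = Complex.ofRealCLM ∘L EuclideanSpace.proj k := rfl
  rw [this]
  exact ContinuousLinearMap.hasTemperateGrowth _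

/-- Multiplication of a Schwartz function by a coordinate. -/
def coordMul (k : Fin 3) (φ : 𝓢(E3, ℂ)) : 𝓢(E3, ℂ) :=
  SchwartzMap.smulLeftCLM ℂ (fun ξ : E3 => ((ξ k : ℝ) : ℂ)) φ

theorem coordMul_apply (k : Fin 3) (φ : 𝓢(E3, ℂ)) (ξ : E3) : coordMul k φ ξ = (ξ k : ℂ) * φ ξ := by
  rw [coordMul, SchwartzMap.smulLeftCLM_apply_apply (hasTemperateGrowth_coord k), smul_eq_mul]

theorem lineDeriv_fourier (k : Fin 3) (ψ : 𝓢(E3, ℂ)) :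
    ∂_{basisVec k} (𝓕 ψ) = (-(2 * Real.pi * Complex.I)) • 𝓕 (coordMul k ψ) := by
  rw [SchwartzMap.lineDerivOp_fourier_eq, FourierTransform.fourier_smul]
  congr 2
  ext ξ
  rw [coordMul_apply, SchwartzMap.smulLeftCLM_apply_apply (by fun_prop), inner_basisVec]
  simp

end MLANS

end

/-! ### Weak derivatives through the Fourier transform: existence, integration by parts, Leibniz
rule. -/

noncomputable section

namespace MLANS

open LineDeriv

/-- Real Schwartz functions as complex ones. -/
def schwartzOfReal (φ : 𝓢(E3, ℝ)) : 𝓢(E3, ℂ) := SchwartzMap.postcompCLM Complex.ofRealCLM φ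

theorem schwartzOfReal_apply (φ : 𝓢(E3, ℝ)) (x : E3) : schwartzOfReal φ x = (φ x : ℂ) := rfl

/-- The real part of a Schwartz function. -/
def schwartzRe (φ : 𝓢(E3, ℂ)) : 𝓢(E3, ℝ) := SchwartzMap.postcompCLM Complex.reCLM φ

/-- The imaginary part of a Schwartz function. -/
def schwartzIm (φ : 𝓢(E3, ℂ)) : 𝓢(E3, ℝ) := SchwartzMap.postcompCLM Complex.imCLM φ

theorem schwartzRe_apply (φ : 𝓢(E3, ℂ)) (x : E3) : schwartzRe φ x = (φ x).re := rfl

theorem schwartzIm_apply (φ : 𝓢(E3, ℂ)) (x : E3) : schwartzIm φ x = (φ x).im := rfl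

theorem lineDeriv_schwartzOfReal (k : Fin 3) (φ : 𝓢(E3, ℝ)) (x : E3) :
    (∂_{basisVec k} (schwartzOfReal φ)) x = ((∂_{basisVec k} φ) x : ℂ) := by
  rw [SchwartzMap.lineDerivOp_apply_eq_fderiv, SchwartzMap.lineDerivOp_apply_eq_fderiv]
  have h := (Complex.ofRealCLM.hasFDerivAt.comp x (φ.hasFDerivAt x)).fderiv
  have e : (schwartzOfReal φ : E3 → ℂ) = Complex.ofRealCLM ∘ φ := rfl
  rw [e, h]; rfl

theorem lineDeriv_schwartzRe (k : Fin 3) (φ : 𝓢(E3, ℂ)) (x : E3) :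
    (∂_{basisVec k} (schwartzRe φ)) x = ((∂_{basisVec k} φ) x).re := by
  rw [SchwartzMap.lineDerivOp_apply_eq_fderiv, SchwartzMap.lineDerivOp_apply_eq_fderiv]
  have h := (Complex.reCLM.hasFDerivAt.comp x (φ.hasFDerivAt x)).fderiv
  have e : (schwartzRe φ : E3 → ℝ) = Complex.reCLM ∘ φ := rfl
  rw [e, h]; rfl

theorem lineDeriv_schwartzIm (k : Fin 3) (φ : 𝓢(E3, ℂ)) (x : E3) :
    (∂_{basisVec k} (schwartzIm φ)) x = ((∂_{basisVec k} φ) x).im := by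
  rw [SchwartzMap.lineDerivOp_apply_eq_fderiv, SchwartzMap.lineDerivOp_apply_eq_fderiv]
  have h := (Complex.imCLM.hasFDerivAt.comp x (φ.hasFDerivAt x)).fderiv
  have e : (schwartzIm φ : E3 → ℝ) = Complex.imCLM ∘ φ := rfl
  rw [e, h]; rfl

theorem TI.integrable_mul_schwartzC {f : E3 → ℝ} (h : TI f) (φ : 𝓢(E3, ℂ)) :
    Integrable (fun x => (f x : ℂ) * φ x) volume := by
  have h1 := (h.integrable_mul_schwartz (schwartzRe φ)).ofReal (𝕜 := ℂ)
  have h2 := ((h.integrable_mul_schwartz (schwartzIm φ)).ofReal (𝕜 := ℂ)).const_mul Complex.I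
  refine (h1.add h2).congr (Eventually.of_forall fun x => ?_)
  simp only [Pi.add_apply, schwartzRe_apply, schwartzIm_apply, RCLike.ofReal_mul]
  conv_rhs => rw [← Complex.re_add_im (φ x)]
  simp only [Complex.coe_algebraMap]
  change (f x : ℂ) * ((φ x).re : ℂ) + Complex.I * ((f x : ℂ) * ((φ x).im : ℂ)) = _
  ring

theorem integral_mul_schwartzC {f : E3 → ℝ} (h : TI f) (φ : 𝓢(E3, ℂ)) :
    ∫ x, (f x : ℂ) * φ x =
      ((∫ x, f x * schwartzRe φ x : ℝ) : ℂ) + ((∫ x, f x * schwartzIm φ x : ℝ) : ℂ) * Complex.I := by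
  have hi := h.integrable_mul_schwartzC φ
  apply Complex.ext
  · have h1 : ∀ x, ((f x : ℂ) * φ x).re = f x * schwartzRe φ x := fun x => by simp [schwartzRe_apply]
    have := integral_re hi
    simp only [RCLike.re_eq_complex_re, h1] at this
    simp [this]
  · have h1 : ∀ x, ((f x : ℂ) * φ x).im = f x * schwartzIm φ x := fun x => by simp [schwartzIm_apply]
    have := integral_im hi
    simp only [RCLike.im_eq_complex_im, h1] at this
    simp [this]

theorem WD.integral_complex {k : Fin 3} {f g : E3 → ℝ} (h : WD k f g) (φ : 𝓢(E3, ℂ)) :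
    ∫ x, (f x : ℂ) * (∂_{basisVec k} φ) x = -∫ x, (g x : ℂ) * φ x := by
  rw [integral_mul_schwartzC h.1, integral_mul_schwartzC h.2.1]
  have e1 : ∫ x, f x * schwartzRe (∂_{basisVec k} φ) x = -∫ x, g x * schwartzRe φ x := by
    rw [← h.2.2]; congr 1; ext x; rw [lineDeriv_schwartzRe, schwartzRe_apply]
  have e2 : ∫ x, f x * schwartzIm (∂_{basisVec k} φ) x = -∫ x, g x * schwartzIm φ x := by
    rw [← h.2.2]; congr 1; ext x; rw [lineDeriv_schwartzIm, schwartzIm_apply]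
  rw [e1, e2]; push_cast; ring

theorem continuous_coordC (k : Fin 3) : Continuous fun ξ : E3 => ((ξ k : ℝ) : ℂ) := by fun_prop

theorem locallyIntegrable_continuous_mul {m F : E3 → ℂ} (hm : Continuous m)
    (hF : LocallyIntegrable F volume) : LocallyIntegrable (fun ξ => m ξ * F ξ) volume := by
  have := hF.locallyIntegrableOn univ
  rw [← locallyIntegrableOn_univ]
  exact this.continuousOn_mul hm.continuousOn isOpen_univ.isLocallyClosed

/-- The symbol `2πi ξ_k` of `∂_k`. -/
def dsym (k : Fin 3) (ξ : E3) : ℂ := 2 * Real.pi * Complex.I * (ξ k : ℂ)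

theorem continuous_dsym (k : Fin 3) : Continuous (dsym k) := by unfold dsym; fun_prop

theorem WD.rft_eq {k : Fin 3} {f g : E3 → ℝ} (h : WD k f g) (hf : MemLp f 2 volume)
    (hg : MemLp g 2 volume) : rft g =ᵐ[volume] fun ξ => dsym k ξ * rft f ξ := by
  refine ae_eq_of_forall_schwartz (memLp_rft g).locInt2
    (locallyIntegrable_continuous_mul (continuous_dsym k) (memLp_rft f).locInt2) fun ψ => ?_
  have h1 := h.integral_complex (𝓕 ψ)
  rw [lineDeriv_fourier] at h1
  have h2 := integral_ft_mul (f := fun x => (g x : ℂ)) hg.ofReal ψ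
  have h3 := integral_ft_mul (f := fun x => (f x : ℂ)) hf.ofReal (coordMul k ψ)
  have h4 : ∫ x, (f x : ℂ) * ((-(2 * Real.pi * Complex.I)) • 𝓕 (coordMul k ψ)) x
      = -(2 * Real.pi * Complex.I) * ∫ x, (f x : ℂ) * 𝓕 (coordMul k ψ) x := by
    rw [← integral_const_mul]
    congr 1; ext x
    rw [smul_apply, smul_eq_mul]; ring
  rw [rft, rft, h2]
  rw [h4, ← h3] at h1
  have h5 : ∫ ξ, dsym k ξ * ft (fun x => (f x : ℂ)) ξ * ψ ξ
      = (2 * Real.pi * Complex.I) * ∫ ξ, ft (fun x => (f x : ℂ)) ξ * coordMul k ψ ξ := by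
    rw [← integral_const_mul]
    refine integral_congr_ae (Eventually.of_forall fun ξ => ?_)
    simp only
    rw [coordMul_apply, dsym]; ring
  rw [h5]
  linear_combination h1

/-- The inverse transform of the symbol times the transform of `f` is a derivative, a priori
complex-valued. As `f` and the test functions are real, its real part already satisfies the
identity, and no symmetry of the transform has to be examined. -/
theorem exists_WD_of_memLp {k : Fin 3} {f : E3 → ℝ} (hf : MemLp f 2 volume)
    (h : MemLp (fun ξ => dsym k ξ * rft f ξ) 2 volume) :
    ∃ g : E3 → ℝ, MemLp g 2 volume ∧ WD k f g := by
  obtain ⟨G, hG, hGe⟩ := ft_surjective h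
  have hre : MemLp (fun x => (G x).re) 2 volume := hG.re
  refine ⟨fun x => (G x).re, hre, hf.ti (by norm_num), hre.ti (by norm_num), fun φ => ?_⟩
  set ψ : 𝓢(E3, ℂ) := 𝓕⁻ (schwartzOfReal φ) with hψ
  have hF : 𝓕 ψ = schwartzOfReal φ := by rw [hψ, FourierTransform.fourier_fourierInv_eq]
  have h1 : ∫ x, (f x : ℂ) * (∂_{basisVec k} (schwartzOfReal φ)) x = -∫ x, G x * schwartzOfReal φ x := by
    rw [← hF, ← integral_ft_mul hG, lineDeriv_fourier]
    have h4 : ∫ x, (f x : ℂ) * ((-(2 * Real.pi * Complex.I)) • 𝓕 (coordMul k ψ)) x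
        = -(2 * Real.pi * Complex.I) * ∫ x, (f x : ℂ) * 𝓕 (coordMul k ψ) x := by
      rw [← integral_const_mul]
      congr 1; ext x
      rw [smul_apply, smul_eq_mul]; ring
    rw [h4, ← integral_ft_mul (f := fun x => (f x : ℂ)) hf.ofReal, ← integral_const_mul,
      ← integral_neg]
    refine integral_congr_ae ?_
    filter_upwards [hGe] with ξ hξ
    rw [hξ, coordMul_apply, dsym, rft]; ring
  have h2 : ((∫ x, f x * (∂_{basisVec k} φ) x : ℝ) : ℂ) = -∫ x, G x * (φ x : ℂ) := by
    rw [← integral_complex_ofReal]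
    simp only [lineDeriv_schwartzOfReal, schwartzOfReal_apply] at h1
    rw [← h1]; simp
  have hint : Integrable (fun x => G x * (φ x : ℂ)) volume :=
    integrable_mul_of_memLp (g := fun x => (φ x : ℂ)) hG (memLp_schwartz φ 2).ofReal
  have h3 := congrArg Complex.re h2
  rw [Complex.ofReal_re, Complex.neg_re] at h3
  rw [h3]
  congr 1
  have := integral_re hint
  simp only [RCLike.re_eq_complex_re] at this
  rw [← this]
  congr 1; ext x; simp

/-- Parseval: the symbol of `∂_k` is purely imaginary, hence changes sign when moved across the
conjugation. -/
theorem WD.integral_mul_eq {k : Fin 3} {f f' g g' : E3 → ℝ} (h : WD k f f') (h' : WD k g g')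
    (hf : MemLp f 2 volume) (hf' : MemLp f' 2 volume) (hg : MemLp g 2 volume)
    (hg' : MemLp g' 2 volume) : ∫ x, f x * g' x = -∫ x, f' x * g x := by
  have h1 := rparseval hf hg'
  have h2 := rparseval hf' hg
  have e : ∫ ξ, rft f ξ * (starRingEnd ℂ) (rft g' ξ) = -∫ ξ, rft f' ξ * (starRingEnd ℂ) (rft g ξ) := by
    rw [← integral_neg]
    refine integral_congr_ae ?_
    filter_upwards [h.rft_eq hf hf', h'.rft_eq hg hg'] with ξ e1 e2
    rw [e1, e2, map_mul]
    have : (starRingEnd ℂ) (dsym k ξ) = -dsym k ξ := by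
      simp only [dsym, map_mul, Complex.conj_I, Complex.conj_ofReal, map_ofNat]
      ring
    rw [this]; ring
  rw [← h1, ← h2] at e
  exact_mod_cast e

/-- The product of two real Schwartz functions. -/
def schwartzMul (φ ψ : 𝓢(E3, ℝ)) : 𝓢(E3, ℝ) := SchwartzMap.pairing (ContinuousLinearMap.mul ℝ ℝ) φ ψ

theorem schwartzMul_apply (φ ψ : 𝓢(E3, ℝ)) (x : E3) : schwartzMul φ ψ x = φ x * ψ x := by
  rw [schwartzMul, SchwartzMap.pairing_apply_apply]; rfl

theorem lineDeriv_schwartzMul (k : Fin 3) (φ ψ : 𝓢(E3, ℝ)) (x : E3) :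
    (∂_{basisVec k} (schwartzMul φ ψ)) x =
      φ x * (∂_{basisVec k} ψ) x + (∂_{basisVec k} φ) x * ψ x := by
  simp only [SchwartzMap.lineDerivOp_apply_eq_fderiv]
  have e : (schwartzMul φ ψ : E3 → ℝ) = fun x => φ x * ψ x := funext (schwartzMul_apply φ ψ)
  rw [e, fderiv_fun_mul φ.differentiableAt ψ.differentiableAt]
  simp [mul_comm]

theorem WD.mul_schwartz {k : Fin 3} {f f' : E3 → ℝ} (h : WD k f f') (φ : 𝓢(E3, ℝ)) :
    WD k (fun x => f x * φ x) (fun x => f' x * φ x + f x * (∂_{basisVec k} φ) x) := by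
  have i1 : TI fun x => f x * φ x :=
    (memLp_one_iff_integrable.2 (h.1.integrable_mul_schwartz φ)).ti le_rfl
  have i2 : TI fun x => f' x * φ x :=
    (memLp_one_iff_integrable.2 (h.2.1.integrable_mul_schwartz φ)).ti le_rfl
  have i3 : TI fun x => f x * (∂_{basisVec k} φ) x :=
    (memLp_one_iff_integrable.2 (h.1.integrable_mul_schwartz _)).ti le_rfl
  refine ⟨i1, i2.add i3, fun ψ => ?_⟩
  have e := h.2.2 (schwartzMul φ ψ)
  simp only [lineDeriv_schwartzMul, schwartzMul_apply, mul_add, ← mul_assoc] at e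
  rw [integral_add (i1.integrable_mul_schwartz _) (i3.integrable_mul_schwartz _)] at e
  simp only [add_mul]
  rw [integral_add (i2.integrable_mul_schwartz _) (i3.integrable_mul_schwartz _)]
  linarith

theorem memLp_top_mul {f g : E3 → ℝ} (hf : MemLp f ⊤ volume) (hg : MemLp g 2 volume) :
    MemLp (fun x => f x * g x) 2 volume := hg.mul' hf

/-- Leibniz rule for the product of `f ∈ W^{1,∞}` and `g ∈ H¹`. -/
theorem WD.mul {k : Fin 3} {f f' g g' : E3 → ℝ} (h : WD k f f') (h' : WD k g g')
    (hf : MemLp f ⊤ volume) (hf' : MemLp f' ⊤ volume) (hg : MemLp g 2 volume)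
    (hg' : MemLp g' 2 volume) :
    WD k (fun x => f x * g x) (fun x => f' x * g x + f x * g' x) := by
  have i1 := (memLp_top_mul hf hg).ti (by norm_num)
  have i2 := (memLp_top_mul hf' hg).ti (by norm_num)
  have i3 := (memLp_top_mul hf hg').ti (by norm_num)
  refine ⟨i1, i2.add i3, fun φ => ?_⟩
  have m1 := memLp_top_mul hf (memLp_schwartz φ 2)
  have m2 := memLp_top_mul hf' (memLp_schwartz φ 2)
  have m3 := memLp_top_mul hf (memLp_schwartz (∂_{basisVec k} φ) 2)
  -- The test function is merged with `f`: the product `f φ` is in `H¹`, so integration by parts for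
  -- square integrable functions applies to `g` and `f φ`.
  have e := h'.integral_mul_eq (h.mul_schwartz φ) hg hg' m1 (m2.add m3)
  simp only [mul_add] at e
  have e0 : ∫ x, g x * (f' x * φ x) + g x * (f x * (∂_{basisVec k} φ) x)
      = (∫ x, g x * (f' x * φ x)) + ∫ x, g x * (f x * (∂_{basisVec k} φ) x) :=
    integral_add (hg.integrable_mul m2) (hg.integrable_mul m3)
  rw [e0] at e
  have e5 := integral_add (i2.integrable_mul_schwartz φ) (i3.integrable_mul_schwartz φ)
  simp only [← add_mul] at e5
  rw [e5]
  have a1 : ∫ x, f x * g x * (∂_{basisVec k} φ) x = ∫ x, g x * (f x * (∂_{basisVec k} φ) x) := by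
    congr 1; ext x; ring
  have a2 : ∫ x, f' x * g x * φ x = ∫ x, g x * (f' x * φ x) := by congr 1; ext x; ring
  have a3 : ∫ x, f x * g' x * φ x = ∫ x, g' x * (f x * φ x) := by congr 1; ext x; ring
  rw [a1, a2, a3]
  linarith

end MLANS

end

noncomputable section

namespace MLANS

/-! ### The Fourier transform of the Helmholtz kernel -/

/-- A primitive of the Gaussian. -/
def gaussPrim (y : ℝ) : ℝ := ∫ x in (0 : ℝ)..y, Real.exp (-x ^ 2)

theorem hasDerivAt_gaussPrim (y : ℝ) : HasDerivAt gaussPrim (Real.exp (-y ^ 2)) y := by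
  have hc : Continuous fun x : ℝ => Real.exp (-x ^ 2) := by fun_prop
  exact intervalIntegral.integral_hasDerivAt_right (hc.intervalIntegrable _ _)
    (hc.stronglyMeasurableAtFilter _ _) hc.continuousAt

theorem gaussPrim_neg (y : ℝ) : gaussPrim (-y) = -gaussPrim y := by
  have h := intervalIntegral.integral_comp_neg (f := fun x : ℝ => Real.exp (-x ^ 2)) (a := 0) (b := y)
  simp only [even_two, Even.neg_pow, neg_zero] at h
  rw [gaussPrim, gaussPrim, h, intervalIntegral.integral_symm]

theorem tendsto_gaussPrim_atTop : Tendsto gaussPrim atTop (𝓝 (√Real.pi / 2)) := by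
  have h : IntegrableOn (fun x : ℝ => Real.exp (-x ^ 2)) (Ioi 0) := by
    have := (integrable_exp_neg_mul_sq (b := 1) one_pos).integrableOn (s := Ioi 0)
    simpa using this
  have h1 := intervalIntegral_tendsto_integral_Ioi 0 h tendsto_id
  have h2 := integral_gaussian_Ioi 1
  simp only [neg_mul, one_mul, div_one] at h2
  rw [h2] at h1
  exact h1

theorem tendsto_gaussPrim_atBot : Tendsto gaussPrim atBot (𝓝 (-(√Real.pi / 2))) := by
  have h := (tendsto_gaussPrim_atTop.comp tendsto_neg_atBot_atTop).neg
  refine h.congr fun y => ?_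
  rw [Function.comp_apply, gaussPrim_neg, neg_neg]

/-- A primitive of `s^{-3/2} exp (-s - b²/s)` on `(0, ∞)`. -/
def besselPrim (b s : ℝ) : ℝ :=
  -(1 / b) * (Real.exp (-(2 * b)) * gaussPrim (b * s ^ (-(1 / 2) : ℝ) - s ^ (1 / 2 : ℝ)) +
    Real.exp (2 * b) * gaussPrim (b * s ^ (-(1 / 2) : ℝ) + s ^ (1 / 2 : ℝ)))

/-- Completing the square, `s + b²/s = (b s^{-1/2} ∓ s^{1/2})² ± 2b`, so both Gaussians become `exp
(-s - b²/s)`. In the sum of the inner derivatives the `s^{-1/2}` terms cancel and `-b s^{-3/2}`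
remains. -/
theorem hasDerivAt_besselPrim {b s : ℝ} (hb : 0 < b) (hs : 0 < s) :
    HasDerivAt (besselPrim b) (s ^ (-(3 / 2) : ℝ) * Real.exp (-s - b ^ 2 / s)) s := by
  have h1 : HasDerivAt (fun s : ℝ => s ^ (-(1 / 2) : ℝ)) (-(1 / 2) * s ^ (-(3 / 2) : ℝ)) s := by
    have := Real.hasDerivAt_rpow_const (p := -(1 / 2)) (Or.inl hs.ne')
    convert this using 2; norm_num
  have h2 : HasDerivAt (fun s : ℝ => s ^ (1 / 2 : ℝ)) (1 / 2 * s ^ (-(1 / 2) : ℝ)) s := by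
    have := Real.hasDerivAt_rpow_const (p := 1 / 2) (Or.inl hs.ne')
    convert this using 2; norm_num
  have h3 := (hasDerivAt_gaussPrim (b * s ^ (-(1 / 2) : ℝ) - s ^ (1 / 2 : ℝ))).comp s
    ((h1.const_mul b).sub h2)
  have h4 := (hasDerivAt_gaussPrim (b * s ^ (-(1 / 2) : ℝ) + s ^ (1 / 2 : ℝ))).comp s
    ((h1.const_mul b).add h2)
  have h5 := ((h3.const_mul (Real.exp (-(2 * b)))).add
    (h4.const_mul (Real.exp (2 * b)))).const_mul (-(1 / b))
  have ea : s ^ (-(1 / 2) : ℝ) * s ^ (1 / 2 : ℝ) = 1 := by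
    rw [← Real.rpow_add hs]; norm_num
  have eb : (s ^ (-(1 / 2) : ℝ)) ^ 2 = 1 / s := by
    rw [← Real.rpow_natCast, ← Real.rpow_mul hs.le]; norm_num
    exact Real.rpow_neg_one s
  have ec : (s ^ (1 / 2 : ℝ)) ^ 2 = s := by
    rw [← Real.rpow_natCast, ← Real.rpow_mul hs.le]; norm_num
  have e1 : Real.exp (-(2 * b)) * Real.exp (-(b * s ^ (-(1 / 2) : ℝ) - s ^ (1 / 2 : ℝ)) ^ 2)
      = Real.exp (-s - b ^ 2 / s) := by
    rw [← Real.exp_add]; congr 1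
    linear_combination 2 * b * ea - b ^ 2 * eb - ec
  have e2 : Real.exp (2 * b) * Real.exp (-(b * s ^ (-(1 / 2) : ℝ) + s ^ (1 / 2 : ℝ)) ^ 2)
      = Real.exp (-s - b ^ 2 / s) := by
    rw [← Real.exp_add]; congr 1
    linear_combination -2 * b * ea - b ^ 2 * eb - ec
  refine h5.congr_deriv ?_
  have hbb : 1 / b * b = 1 := by field_simp
  linear_combination (-(1 / b) * (b * (-(1 / 2) * s ^ (-(3 / 2) : ℝ)) - 1 / 2 * s ^ (-(1 / 2) : ℝ))) * e1
    + (-(1 / b) * (b * (-(1 / 2) * s ^ (-(3 / 2) : ℝ)) + 1 / 2 * s ^ (-(1 / 2) : ℝ))) * e2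
    + Real.exp (-s - b ^ 2 / s) * s ^ (-(3 / 2) : ℝ) * hbb

theorem tendsto_besselPrim_zero {b : ℝ} (hb : 0 < b) :
    Tendsto (besselPrim b) (𝓝[>] 0) (𝓝 (-(1 / b) * (Real.exp (-(2 * b)) * (√Real.pi / 2) +
      Real.exp (2 * b) * (√Real.pi / 2)))) := by
  have h1 : Tendsto (fun s : ℝ => b * s ^ (-(1 / 2) : ℝ)) (𝓝[>] 0) atTop :=
    (tendsto_rpow_neg_nhdsGT_zero (by norm_num)).const_mul_atTop hb
  have h2 : Tendsto (fun s : ℝ => s ^ (1 / 2 : ℝ)) (𝓝[>] 0) (𝓝 0) := by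
    have : ContinuousAt (fun s : ℝ => s ^ (1 / 2 : ℝ)) 0 :=
      Real.continuousAt_rpow_const _ _ (Or.inr (by norm_num))
    have h := this.tendsto.mono_left (nhdsWithin_le_nhds (s := Ioi 0))
    simpa using h
  have h3 := tendsto_gaussPrim_atTop.comp (h1.atTop_add h2.neg)
  have h4 := tendsto_gaussPrim_atTop.comp (h1.atTop_add h2)
  exact ((h3.const_mul _).add (h4.const_mul _)).const_mul _

theorem tendsto_besselPrim_atTop {b : ℝ} :
    Tendsto (besselPrim b) atTop (𝓝 (-(1 / b) * (Real.exp (-(2 * b)) * (-(√Real.pi / 2)) +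
      Real.exp (2 * b) * (√Real.pi / 2)))) := by
  have h1 : Tendsto (fun s : ℝ => b * s ^ (-(1 / 2) : ℝ)) atTop (𝓝 0) := by
    have := (tendsto_rpow_neg_atTop (y := 1 / 2) (by norm_num)).const_mul b
    simpa using this
  have h2 : Tendsto (fun s : ℝ => s ^ (1 / 2 : ℝ)) atTop atTop := tendsto_rpow_atTop (by norm_num)
  have h3 := tendsto_gaussPrim_atBot.comp (h1.add_atBot (tendsto_neg_atTop_atBot.comp h2))
  have h4 := tendsto_gaussPrim_atTop.comp (h1.add_atTop h2)
  exact ((h3.const_mul _).add (h4.const_mul _)).const_mul _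

theorem integrableOn_bessel_and_integral {b : ℝ} (hb : 0 < b) :
    ∫ s in Ioi (0 : ℝ), s ^ (-(3 / 2) : ℝ) * Real.exp (-s - b ^ 2 / s) =
      √Real.pi * Real.exp (-(2 * b)) / b := by
  classical
  set m := -(1 / b) * (Real.exp (-(2 * b)) * (√Real.pi / 2) + Real.exp (2 * b) * (√Real.pi / 2))
  -- The formula for the primitive is meaningless at zero, so its value there is replaced by the
  -- limit from the right. Between zero and infinity only the term with `exp (-(2 * b))` changes,
  -- from `√π / 2` to `-√π / 2`.
  have hu : ∀ s ∈ Ioi (0 : ℝ), HasDerivAt (Function.update (besselPrim b) 0 m)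
      (s ^ (-(3 / 2) : ℝ) * Real.exp (-s - b ^ 2 / s)) s := by
    intro s hs
    refine (hasDerivAt_besselPrim hb hs).congr_of_eventuallyEq ?_
    filter_upwards [eventually_ne_nhds (ne_of_gt hs)] with x hx
    rw [Function.update_of_ne hx]
  have hc : ContinuousWithinAt (Function.update (besselPrim b) 0 m) (Ici 0) 0 := by
    rw [continuousWithinAt_update_same]
    have : Ici (0 : ℝ) \ {0} = Ioi 0 := by ext x; simp [lt_iff_le_and_ne, eq_comm]
    rw [this]
    exact tendsto_besselPrim_zero hb
  have ht : Tendsto (Function.update (besselPrim b) 0 m) atTop (𝓝 (-(1 / b) *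
      (Real.exp (-(2 * b)) * (-(√Real.pi / 2)) + Real.exp (2 * b) * (√Real.pi / 2)))) := by
    refine tendsto_besselPrim_atTop.congr' ?_
    filter_upwards [eventually_ne_atTop 0] with x hx
    rw [Function.update_of_ne hx]
  rw [integral_Ioi_of_hasDerivAt_of_nonneg hc hu (fun s hs => ?_) ht]
  · simp only [Function.update_self, m]
    field_simp
    ring
  · have : 0 < s := hs
    positivity

/-- The heat-kernel density in the subordination formula for the Helmholtz kernel. -/
def subord (α : ℝ) (s : ℝ) (x : E3) : ℝ :=
  Real.exp (-s) * (4 * Real.pi * α ^ 2 * s) ^ (-(3 / 2) : ℝ) *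
    Real.exp (-(1 / (4 * α ^ 2 * s)) * ‖x‖ ^ 2)

/-- The resolvent is the Laplace transform of the heat semigroup, `(1 - α²Δ)⁻¹ = ∫ e^{-s} e^{sα²Δ}
ds`. For the kernels this is the Bessel integral with `b = |x| / (2α)`, which needs `x ≠ 0`. -/
theorem integral_subord_time {α : ℝ} (hα : 0 < α) {x : E3} (hx : x ≠ 0) :
    ∫ s in Ioi (0 : ℝ), subord α s x = helmholtzKernel α x := by
  have hr : 0 < ‖x‖ := norm_pos_iff.2 hx
  have hb : 0 < ‖x‖ / (2 * α) := by positivity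
  have h := integrableOn_bessel_and_integral hb
  have e : ∀ s ∈ Ioi (0 : ℝ), subord α s x = (4 * Real.pi * α ^ 2) ^ (-(3 / 2) : ℝ) *
      (s ^ (-(3 / 2) : ℝ) * Real.exp (-s - (‖x‖ / (2 * α)) ^ 2 / s)) := by
    intro s hs
    have hs' : 0 < s := hs
    rw [subord, Real.mul_rpow (by positivity) hs'.le]
    have : Real.exp (-s - (‖x‖ / (2 * α)) ^ 2 / s)
        = Real.exp (-s) * Real.exp (-(1 / (4 * α ^ 2 * s)) * ‖x‖ ^ 2) := by
      rw [← Real.exp_add]; congr 1; field_simp; ring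
    rw [this]; ring
  rw [setIntegral_congr_fun measurableSet_Ioi e, integral_const_mul, h, helmholtzKernel]
  have e1 : (4 * Real.pi * α ^ 2) ^ (-(3 / 2) : ℝ) = 1 / (8 * Real.pi * √Real.pi * α ^ 3) := by
    have hp : 0 < 4 * Real.pi * α ^ 2 := by positivity
    have hsq : (4 * Real.pi * α ^ 2) ^ (1 / 2 : ℝ) = 2 * √Real.pi * α := by
      rw [← Real.sqrt_eq_rpow]
      rw [show 4 * Real.pi * α ^ 2 = Real.pi * (2 * α) ^ 2 by ring, Real.sqrt_mul Real.pi_pos.le,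
        Real.sqrt_sq (by positivity)]
      ring
    rw [Real.rpow_neg hp.le, show (3 / 2 : ℝ) = 1 + 1 / 2 by norm_num, Real.rpow_add hp, hsq,
      Real.rpow_one, one_div]
    congr 1; ring
  have e2 : -(2 * (‖x‖ / (2 * α))) = -‖x‖ / α := by field_simp
  rw [e1, e2]
  have := Real.sqrt_pos.2 Real.pi_pos
  field_simp
  ring

theorem integral_subord_space {α s : ℝ} (hα : 0 < α) (hs : 0 < s) :
    ∫ x, subord α s x = Real.exp (-s) := by
  have hb : 0 < 1 / (4 * α ^ 2 * s) := by positivity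
  unfold subord
  rw [integral_const_mul, GaussianFourier.integral_rexp_neg_mul_sq_norm hb]
  have : Real.pi / (1 / (4 * α ^ 2 * s)) = 4 * Real.pi * α ^ 2 * s := by field_simp
  rw [this, mul_assoc, ← Real.rpow_add (by positivity)]
  norm_num

theorem subord_nonneg {α s : ℝ} (hs : 0 < s) (x : E3) : 0 ≤ subord α s x := by
  unfold subord; positivity

theorem integrable_subord_space {α s : ℝ} (hα : 0 < α) (hs : 0 < s) :
    Integrable (subord α s) volume := by
  -- A function that is not integrable has integral zero by convention, while this integral is `exp
  -- (-s)`.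
  by_contra h
  have := integral_subord_space hα hs
  rw [integral_undef h] at this
  exact absurd this (Real.exp_pos _).ne

theorem measurable_subord (α : ℝ) : Measurable fun z : ℝ × E3 => subord α z.1 z.2 := by
  unfold subord
  fun_prop

theorem integrable_subord {α : ℝ} (hα : 0 < α) :
    Integrable (fun z : ℝ × E3 => subord α z.1 z.2)
      ((volume.restrict (Ioi (0 : ℝ))).prod volume) := by
  rw [integrable_prod_iff (measurable_subord α).aestronglyMeasurable]
  refine ⟨?_, ?_⟩
  · filter_upwards [ae_restrict_mem measurableSet_Ioi] with s hs
    exact integrable_subord_space hα hs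
  · have h : IntegrableOn (fun s : ℝ => Real.exp (-s)) (Ioi 0) := integrableOn_exp_neg_Ioi 0
    refine h.congr ?_
    filter_upwards [ae_restrict_mem measurableSet_Ioi] with s hs
    rw [← integral_subord_space hα hs]
    congr 1; ext x
    rw [Real.norm_of_nonneg (subord_nonneg hs x)]

theorem helmholtz_ae {α : ℝ} (hα : 0 < α) :
    (fun x => ∫ s in Ioi (0 : ℝ), subord α s x) =ᵐ[volume] helmholtzKernel α := by
  have : ∀ᵐ x : E3, x ≠ 0 := by simp [ae_iff]
  filter_upwards [this] with x hx
  exact integral_subord_time hα hx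

theorem integrable_helmholtz {α : ℝ} (hα : 0 < α) : Integrable (helmholtzKernel α) volume :=
  ((integrable_subord hα).integral_prod_right (f := fun z : ℝ × E3 => subord α z.1 z.2)).congr
    (helmholtz_ae hα)

/-- The symbol of `(1 - α² Δ)⁻¹`. -/
def hsym (α : ℝ) (ξ : E3) : ℝ := 1 / (1 + (2 * Real.pi * α * ‖ξ‖) ^ 2)

theorem fourier_subord {α s : ℝ} (hα : 0 < α) (hs : 0 < s) (ξ : E3) :
    𝓕 (fun x => (subord α s x : ℂ)) ξ = Real.exp (-(1 + (2 * Real.pi * α * ‖ξ‖) ^ 2) * s) := by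
  have hb : 0 < 1 / (4 * α ^ 2 * s) := by positivity
  have hb' : 0 < ((1 / (4 * α ^ 2 * s) : ℝ) : ℂ).re := by rw [Complex.ofReal_re]; exact hb
  have h := fourier_gaussian_innerProductSpace (V := E3) hb' ξ
  have e : (fun x : E3 => (subord α s x : ℂ)) =
      fun x => ((Real.exp (-s) * (4 * Real.pi * α ^ 2 * s) ^ (-(3 / 2) : ℝ) : ℝ) : ℂ) •
        Complex.exp (-((1 / (4 * α ^ 2 * s) : ℝ) : ℂ) * (‖x‖ : ℂ) ^ 2) := by
    ext x; rw [subord]; push_cast; rw [smul_eq_mul]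
  have e2 : 𝓕 (fun x : E3 => ((Real.exp (-s) * (4 * Real.pi * α ^ 2 * s) ^ (-(3 / 2) : ℝ) : ℝ) : ℂ) •
        Complex.exp (-((1 / (4 * α ^ 2 * s) : ℝ) : ℂ) * (‖x‖ : ℂ) ^ 2)) ξ =
      ((Real.exp (-s) * (4 * Real.pi * α ^ 2 * s) ^ (-(3 / 2) : ℝ) : ℝ) : ℂ) •
        𝓕 (fun x : E3 => Complex.exp (-((1 / (4 * α ^ 2 * s) : ℝ) : ℂ) * (‖x‖ : ℂ) ^ 2)) ξ := by
    rw [Real.fourier_eq, Real.fourier_eq, ← integral_smul]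
    congr 1; ext x
    rw [smul_comm]
  rw [e, e2, h]
  have e3 : ((Real.pi : ℂ) / ((1 / (4 * α ^ 2 * s) : ℝ) : ℂ)) ^ (Module.finrank ℝ E3 / 2 : ℂ)
      = (((4 * Real.pi * α ^ 2 * s) ^ (3 / 2 : ℝ) : ℝ) : ℂ) := by
    rw [Complex.ofReal_cpow (by positivity)]
    congr 1
    · push_cast; field_simp
    · simp
  have e4 : Complex.exp (-(Real.pi : ℂ) ^ 2 * (‖ξ‖ : ℂ) ^ 2 / ((1 / (4 * α ^ 2 * s) : ℝ) : ℂ))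
      = (Real.exp (-((2 * Real.pi * α * ‖ξ‖) ^ 2) * s) : ℂ) := by
    push_cast; congr 1
    have : (s : ℂ) ≠ 0 := by exact_mod_cast hs.ne'
    have : (α : ℂ) ≠ 0 := by exact_mod_cast hα.ne'
    field_simp
    ring
  rw [e3, e4, smul_eq_mul, ← Complex.ofReal_mul, ← Complex.ofReal_mul]
  congr 1
  have e5 : (4 * Real.pi * α ^ 2 * s) ^ (-(3 / 2) : ℝ) * (4 * Real.pi * α ^ 2 * s) ^ (3 / 2 : ℝ) = 1 := by
    rw [← Real.rpow_add (by positivity)]; norm_num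
  have e6 : Real.exp (-(1 + (2 * Real.pi * α * ‖ξ‖) ^ 2) * s)
      = Real.exp (-s) * Real.exp (-((2 * Real.pi * α * ‖ξ‖) ^ 2) * s) := by
    rw [← Real.exp_add]; congr 1; ring
  rw [e6]
  linear_combination Real.exp (-s) * Real.exp (-((2 * Real.pi * α * ‖ξ‖) ^ 2) * s) * e5

/-- Fubini exchanges the space transform with the subordination integral. The Gaussian transforms
leave an elementary exponential integral in `s`. -/
theorem fourier_helmholtz {α : ℝ} (hα : 0 < α) (ξ : E3) :
    𝓕 (fun x => (helmholtzKernel α x : ℂ)) ξ = hsym α ξ := by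
  have h0 : 𝓕 (fun x => (helmholtzKernel α x : ℂ)) ξ
      = ∫ x, ∫ s in Ioi (0 : ℝ), Real.fourierChar (-inner ℝ x ξ) • (subord α s x : ℂ) := by
    rw [Real.fourier_eq]
    refine integral_congr_ae ?_
    filter_upwards [helmholtz_ae hα] with x hx
    simp only [Circle.smul_def]
    rw [integral_smul, ← hx, integral_complex_ofReal]
  have hint : Integrable (fun z : ℝ × E3 => Real.fourierChar (-inner ℝ z.2 ξ) • (subord α z.1 z.2 : ℂ))
      ((volume.restrict (Ioi (0 : ℝ))).prod volume) := by
    refine (integrable_subord hα).norm.mono' ?_ (Eventually.of_forall fun z => ?_)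
    · refine AEStronglyMeasurable.fun_smul ?_ ((integrable_subord hα).ofReal (𝕜 := ℂ)).1
      refine (Continuous.aestronglyMeasurable ?_)
      exact Real.continuous_fourierChar.comp (by fun_prop)
    · simp [Circle.norm_smul]
  rw [h0, integral_integral_swap (f := fun x s => Real.fourierChar (-inner ℝ x ξ) • (subord α s x : ℂ))
    hint.swap]
  have h1 : ∀ s ∈ Ioi (0 : ℝ), ∫ x, Real.fourierChar (-inner ℝ x ξ) • (subord α s x : ℂ)
      = ((Real.exp (-(1 + (2 * Real.pi * α * ‖ξ‖) ^ 2) * s) : ℝ) : ℂ) := fun s hs => by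
    rw [← fourier_subord hα hs, Real.fourier_eq]
  rw [setIntegral_congr_fun measurableSet_Ioi h1, integral_complex_ofReal,
    integral_exp_mul_Ioi (by nlinarith [sq_nonneg (2 * Real.pi * α * ‖ξ‖)])]
  congr 1
  have : 0 < 1 + (2 * Real.pi * α * ‖ξ‖) ^ 2 := by positivity
  rw [hsym]; field_simp
  simp

theorem rft_helmholtz_conv {α : ℝ} (hα : 0 < α) {M : E3 → ℝ} (hM : MemLp M 2 volume) :
    MemLp (fun x => ∫ y, helmholtzKernel α (x - y) * M y) 2 volume ∧
      rft (fun x => ∫ y, helmholtzKernel α (x - y) * M y) =ᵐ[volume]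
        fun ξ => hsym α ξ * rft M ξ := by
  have hk : Integrable (fun x => (helmholtzKernel α x : ℂ)) volume := (integrable_helmholtz hα).ofReal
  have e : ∀ x, ((∫ y, helmholtzKernel α (x - y) * M y : ℝ) : ℂ)
      = ∫ y, (helmholtzKernel α (x - y) : ℂ) * (M y : ℂ) := fun x => by
    rw [← integral_complex_ofReal]; simp
  have h1 := memLp_conv hk (f := fun x => (M x : ℂ)) hM.ofReal
  have h2 := ft_conv hk (f := fun x => (M x : ℂ)) hM.ofReal
  simp only [← e] at h1 h2
  refine ⟨?_, ?_⟩
  · simpa using h1.re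
  · rw [rft]
    filter_upwards [h2] with ξ h
    rw [h, fourier_helmholtz hα]; rfl

end MLANS

end

noncomputable section

namespace MLANS

open LineDeriv

/-! ### Convolution kernels with smooth compactly supported even symbols -/

/-- Smooth, even, compactly supported symbols. -/
structure IsSym (m : E3 → ℝ) : Prop where
  smooth : ContDiff ℝ ∞ m
  cpt : HasCompactSupport m
  even : ∀ ξ, m (-ξ) = m ξ

/-- The symbol as a Schwartz function. -/
def symS {m : E3 → ℝ} (h : IsSym m) : 𝓢(E3, ℂ) :=
  schwartzOfReal (h.cpt.toSchwartzMap h.smooth)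

theorem symS_apply {m : E3 → ℝ} (h : IsSym m) (ξ : E3) : symS h ξ = (m ξ : ℂ) := rfl

/-- The kernel with a given symbol, as a Schwartz function. -/
def kerS {m : E3 → ℝ} (h : IsSym m) : 𝓢(E3, ℝ) := schwartzRe (𝓕⁻ (symS h))

theorem fourierInv_symS_neg {m : E3 → ℝ} (h : IsSym m) (x : E3) :
    𝓕⁻ (symS h) (-x) = 𝓕⁻ (symS h) x := by
  have h1 : (fun y => symS h (-y)) = symS h := by
    ext y; rw [symS_apply, symS_apply, h.even]
  rw [SchwartzMap.fourierInv_coe, Real.fourierInv_eq_fourier_neg, neg_neg,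
    Real.fourierInv_eq_fourier_comp_neg, h1]

theorem conj_fourierInv_symS {m : E3 → ℝ} (h : IsSym m) (x : E3) :
    (starRingEnd ℂ) (𝓕⁻ (symS h) x) = 𝓕⁻ (symS h) x := by
  have e : ∀ y, 𝓕⁻ (symS h) y
      = ∫ v, Complex.exp ((2 * Real.pi * inner ℝ v y : ℝ) * Complex.I) • symS h v := fun y => by
    rw [SchwartzMap.fourierInv_coe, Real.fourierInv_eq']
  refine Eq.trans ?_ (fourierInv_symS_neg h x)
  rw [e (-x), e x, ← integral_conj]
  refine integral_congr_ae (Eventually.of_forall fun y => ?_)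
  simp only [symS_apply, smul_eq_mul, map_mul, Complex.conj_ofReal, inner_neg_right]
  rw [← Complex.exp_conj]
  congr 2
  simp only [map_mul, Complex.conj_I, Complex.conj_ofReal]
  push_cast; ring

/-- The real part taken in `kernelOf` loses nothing, because a real even symbol has a real inverse
transform. -/
theorem kerS_ofReal {m : E3 → ℝ} (h : IsSym m) (x : E3) : (kerS h x : ℂ) = 𝓕⁻ (symS h) x := by
  rw [kerS, schwartzRe_apply]
  exact Complex.conj_eq_iff_re.1 (conj_fourierInv_symS h x)

theorem schwartzOfReal_kerS {m : E3 → ℝ} (h : IsSym m) : schwartzOfReal (kerS h) = 𝓕⁻ (symS h) := by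
  ext x; rw [schwartzOfReal_apply, kerS_ofReal]

theorem kernelOf_eq {m : E3 → ℝ} (h : IsSym m) (x : E3) : kernelOf m x = kerS h x := by
  rw [kerS, schwartzRe_apply, SchwartzMap.fourierInv_coe]; rfl

theorem kerS_neg {m : E3 → ℝ} (h : IsSym m) (x : E3) : kerS h (-x) = kerS h x := by
  rw [kerS, schwartzRe_apply, schwartzRe_apply, fourierInv_symS_neg]

theorem fourier_kerS {m : E3 → ℝ} (h : IsSym m) : 𝓕 (schwartzOfReal (kerS h)) = symS h := by
  rw [schwartzOfReal_kerS, FourierTransform.fourier_fourierInv_eq]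

theorem integral_kerS {m : E3 → ℝ} (h : IsSym m) : ∫ x, kerS h x = m 0 := by
  have h1 : 𝓕 (schwartzOfReal (kerS h)) 0 = (m 0 : ℂ) := by rw [fourier_kerS, symS_apply]
  rw [SchwartzMap.fourier_coe, Real.fourier_eq] at h1
  simp only [inner_zero_right, neg_zero, AddChar.map_zero_eq_one, one_smul, schwartzOfReal_apply,
    integral_complex_ofReal] at h1
  exact_mod_cast h1

/-- Dilated symbols. -/
theorem IsSym.dilate {m : E3 → ℝ} (h : IsSym m) {c : ℝ} (hc : c ≠ 0) : IsSym fun ξ => m (c • ξ) where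
  smooth := h.smooth.comp (contDiff_const_smul c)
  cpt := h.cpt.comp_homeomorph (Homeomorph.smulOfNeZero c hc)
  even ξ := by rw [smul_neg, h.even]

theorem kerS_dilate {m : E3 → ℝ} (h : IsSym m) {c : ℝ} (hc : 0 < c) (x : E3) :
    kerS (h.dilate (inv_pos.2 hc).ne') x = c ^ 3 * kerS h (c • x) := by
  have key : 𝓕⁻ (symS (h.dilate (inv_pos.2 hc).ne')) x = (c ^ 3 : ℝ) • 𝓕⁻ (symS h) (c • x) := by
    rw [SchwartzMap.fourierInv_coe, SchwartzMap.fourierInv_coe, Real.fourierInv_eq',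
      Real.fourierInv_eq']
    have := Measure.integral_comp_inv_smul_of_nonneg (volume : Measure E3)
      (fun v : E3 => Complex.exp ((2 * Real.pi * inner ℝ v (c • x) : ℝ) * Complex.I) • symS h v) hc.le
    have e : Module.finrank ℝ E3 = 3 := by simp
    rw [e] at this
    rw [← this]
    refine integral_congr_ae (Eventually.of_forall fun v => ?_)
    simp only [symS_apply, inner_smul_left, inner_smul_right]
    have : (starRingEnd ℝ) c⁻¹ * (c * inner ℝ v x) = inner ℝ v x := by
      simp; field_simp
    rw [show c * ((starRingEnd ℝ) c⁻¹ * inner ℝ v x) = inner ℝ v x by simp; field_simp]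
  have := congrArg Complex.re key
  rw [Complex.smul_re, smul_eq_mul] at this
  exact this

/-! ### Convolution of Schwartz kernels -/

/-- The convolution of two real Schwartz functions. -/
def sconvS (κ φ : 𝓢(E3, ℝ)) : 𝓢(E3, ℝ) :=
  schwartzRe (SchwartzMap.convolution (ContinuousLinearMap.mul ℂ ℂ) (schwartzOfReal κ)
    (schwartzOfReal φ))

theorem convolution_ofReal (κ φ : 𝓢(E3, ℝ)) (x : E3) :
    SchwartzMap.convolution (ContinuousLinearMap.mul ℂ ℂ) (schwartzOfReal κ) (schwartzOfReal φ) x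
      = ((∫ y, κ (x - y) * φ y : ℝ) : ℂ) := by
  rw [SchwartzMap.convolution_apply, convolution_eq_swap, ← integral_complex_ofReal]
  simp [schwartzOfReal_apply]

theorem sconvS_apply (κ φ : 𝓢(E3, ℝ)) (x : E3) : sconvS κ φ x = ∫ y, κ (x - y) * φ y := by
  rw [sconvS, schwartzRe_apply, convolution_ofReal, Complex.ofReal_re]

theorem fourier_sconvS (κ φ : 𝓢(E3, ℝ)) (ξ : E3) :
    𝓕 (schwartzOfReal (sconvS κ φ)) ξ = 𝓕 (schwartzOfReal κ) ξ * 𝓕 (schwartzOfReal φ) ξ := by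
  have : schwartzOfReal (sconvS κ φ) = SchwartzMap.convolution (ContinuousLinearMap.mul ℂ ℂ)
      (schwartzOfReal κ) (schwartzOfReal φ) := by
    ext x; rw [schwartzOfReal_apply, sconvS_apply, convolution_ofReal]
  rw [this, SchwartzMap.fourier_convolution, SchwartzMap.pairing_apply_apply]; rfl

theorem schwartz_ext_fourier {φ ψ : 𝓢(E3, ℝ)}
    (h : ∀ ξ, 𝓕 (schwartzOfReal φ) ξ = 𝓕 (schwartzOfReal ψ) ξ) : φ = ψ := by
  have h1 : 𝓕 (schwartzOfReal φ) = 𝓕 (schwartzOfReal ψ) := SchwartzMap.ext h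
  have h2 := congrArg (fun z : 𝓢(E3, ℂ) => 𝓕⁻ z) h1
  simp only [FourierTransform.fourierInv_fourier_eq] at h2
  ext x
  have := DFunLike.congr_fun h2 x
  simpa [schwartzOfReal_apply] using this

/-- Peetre's inequality, from `1 + |x - z| ≤ (1 + |x|)(1 + |z|)`. The weight passes through a
convolution at the price of a polynomial factor, which a Schwartz kernel absorbs. -/
theorem wt_le_mul (x z : E3) : wt x ≤ (1 + ‖z‖) ^ 4 * wt (x - z) := by
  unfold wt
  have e : ∀ y : E3, (1 + ‖y‖) ^ (-(4 : ℝ)) = ((1 + ‖y‖) ^ 4)⁻¹ := fun y => by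
    rw [Real.rpow_neg (by positivity)]
    congr 1
    rw [← Real.rpow_natCast]; norm_num
  rw [e, e, ← div_eq_mul_inv, inv_eq_one_div, div_le_div_iff₀ (by positivity) (by positivity), one_mul,
    ← mul_pow]
  gcongr
  have := norm_sub_le x z
  nlinarith [norm_nonneg x, norm_nonneg z]

theorem integrable_schwartz_mul_pow (κ : 𝓢(E3, ℝ)) :
    Integrable (fun z => ‖κ z‖ * (1 + ‖z‖) ^ 4) volume := by
  have h : ∀ k : ℕ, Integrable (fun z => ‖z‖ ^ k * ‖κ z‖) volume := fun k =>
    κ.integrable_pow_mul volume k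
  have := ((h 0).add (((h 1).const_mul 4).add (((h 2).const_mul 6).add (((h 3).const_mul 4).add (h 4)))))
  refine this.congr (Eventually.of_forall fun z => ?_)
  simp only [Pi.add_apply]; ring

/-- Peetre's inequality moves the decay of `g` from one variable to the other, where it pairs with
`f`. This is what licenses Fubini for convolutions of functions that are only integrable against the
weight. -/
theorem integrable_kernel_prod (κ : 𝓢(E3, ℝ)) {f g : E3 → ℝ} (hf : TI f)
    (hg : AEStronglyMeasurable g volume) {C : ℝ} (hC : ∀ x, |g x| ≤ C * wt x) :
    Integrable (fun z : E3 × E3 => κ (z.1 - z.2) * f z.2 * g z.1) (volume.prod volume) := by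
  have h0 : Integrable (fun z : E3 × E3 => (‖κ (z.1 - z.2)‖ * (1 + ‖z.1 - z.2‖) ^ 4) *
      (f z.2 * wt z.2)) (volume.prod volume) := by
    have h := (Integrable.convolution_integrand (ContinuousLinearMap.mul ℝ ℝ)
      (show Integrable (fun x => f x * wt x) volume from hf) (integrable_schwartz_mul_pow κ))
    refine h.congr (Eventually.of_forall fun z => ?_)
    simp [mul_comm]
  have hm : AEStronglyMeasurable (fun z : E3 × E3 => κ (z.1 - z.2) * f z.2 * g z.1)
      (volume.prod volume) :=
    ((κ.continuous.comp (continuous_fst.sub continuous_snd)).aestronglyMeasurable.mul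
      (hf.aestronglyMeasurable.comp_quasiMeasurePreserving Measure.quasiMeasurePreserving_snd)).mul
      (hg.comp_quasiMeasurePreserving Measure.quasiMeasurePreserving_fst)
  refine (h0.norm.const_mul |C|).mono' hm (Eventually.of_forall fun z => ?_)
  simp only [norm_mul, norm_norm, Real.norm_of_nonneg (wt_pos _).le,
    Real.norm_of_nonneg (show 0 ≤ (1 + ‖z.1 - z.2‖) ^ 4 by positivity)]
  have h1 : ‖g z.1‖ ≤ |C| * ((1 + ‖z.1 - z.2‖) ^ 4 * wt z.2) := by
    calc ‖g z.1‖ ≤ C * wt z.1 := hC _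
      _ ≤ |C| * wt z.1 := by gcongr; exact (wt_pos _).le; exact le_abs_self C
      _ ≤ |C| * ((1 + ‖z.1 - z.2‖) ^ 4 * wt (z.1 - (z.1 - z.2))) := by
          gcongr; exact wt_le_mul _ _
      _ = _ := by rw [sub_sub_cancel]
  calc ‖κ (z.1 - z.2)‖ * ‖f z.2‖ * ‖g z.1‖
      ≤ ‖κ (z.1 - z.2)‖ * ‖f z.2‖ * (|C| * ((1 + ‖z.1 - z.2‖) ^ 4 * wt z.2)) := by gcongr
    _ = _ := by ring

/-- Convolution of a kernel with a scalar function. -/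
def rconv (κ : E3 → ℝ) (f : E3 → ℝ) (x : E3) : ℝ := ∫ y, κ (x - y) * f y

theorem TI.rconv {f : E3 → ℝ} (hf : TI f) (κ : 𝓢(E3, ℝ)) : TI (rconv κ f) := by
  have h := (integrable_kernel_prod κ hf continuous_wt.aestronglyMeasurable (C := 1)
    fun x => by rw [abs_of_pos (wt_pos x), one_mul]).integral_prod_left
  refine h.congr (Eventually.of_forall fun x => ?_)
  simp only [MLANS.rconv]
  rw [integral_mul_const]

theorem integral_rconv_mul (κ : 𝓢(E3, ℝ)) {f g : E3 → ℝ} (hf : TI f)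
    (hg : AEStronglyMeasurable g volume) {C : ℝ} (hC : ∀ x, |g x| ≤ C * wt x) :
    ∫ x, rconv κ f x * g x = ∫ y, f y * ∫ x, κ (x - y) * g x := by
  calc _ = ∫ x, ∫ y, κ (x - y) * f y * g x := by
        simp only [rconv, integral_mul_const]
    _ = ∫ y, ∫ x, κ (x - y) * f y * g x :=
        integral_integral_swap (f := fun x y => κ (x - y) * f y * g x)
          (integrable_kernel_prod κ hf hg hC)
    _ = _ := by
        congr 1; ext y
        rw [← integral_const_mul]
        congr 1; ext x; ring

/-- The adjoint of convolution with `κ`. -/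
def adjC (κ φ : 𝓢(E3, ℝ)) (y : E3) : ℝ := ∫ x, κ (x - y) * φ x

theorem integral_rconv_schwartz (κ : 𝓢(E3, ℝ)) {f : E3 → ℝ} (hf : TI f) (φ : 𝓢(E3, ℝ)) :
    ∫ x, rconv κ f x * φ x = ∫ y, f y * adjC κ φ y := by
  obtain ⟨C, -, hC⟩ := schwartz_le_wt φ
  exact integral_rconv_mul κ hf φ.continuous.aestronglyMeasurable hC

theorem adjC_of_even {κ : 𝓢(E3, ℝ)} (h : ∀ x, κ (-x) = κ x) (φ : 𝓢(E3, ℝ)) (y : E3) :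
    adjC κ φ y = sconvS κ φ y := by
  rw [adjC, sconvS_apply]
  congr 1; ext x
  rw [← h, neg_sub]

theorem adjC_lineDeriv (k : Fin 3) (κ φ : 𝓢(E3, ℝ)) (y : E3) :
    adjC (∂_{basisVec k} κ) φ y = -adjC κ (∂_{basisVec k} φ) y := by
  have h := SchwartzMap.integral_mul_lineDerivOp_right_eq_neg_left (μ := volume)
    (SchwartzMap.compSubConstCLM ℝ y κ) φ (basisVec k)
  have e : ∀ x, (∂_{basisVec k} (SchwartzMap.compSubConstCLM ℝ y κ)) x = (∂_{basisVec k} κ) (x - y) := by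
    intro x
    rw [SchwartzMap.lineDerivOp_apply_eq_fderiv, SchwartzMap.lineDerivOp_apply_eq_fderiv]
    have : (SchwartzMap.compSubConstCLM ℝ y κ : E3 → ℝ) = fun x => κ (x - y) := by
      ext x; rw [SchwartzMap.compSubConstCLM_apply]
    rw [this, fderiv_comp_sub]
  simp only [e, SchwartzMap.compSubConstCLM_apply] at h
  rw [adjC, adjC, h, neg_neg]

theorem integral_mul_le_of_holder {f g : E3 → ℝ} {p r : ℝ≥0∞} [ENNReal.HolderTriple r p 1]
    (hg : MemLp g r volume) (hf : MemLp f p volume) :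
    Integrable (fun y => g y * f y) volume ∧
    ∫ y, ‖g y * f y‖ ≤ (eLpNorm g r volume).toReal * (eLpNorm f p volume).toReal := by
  have hi : Integrable (fun y => g y * f y) volume :=
    memLp_one_iff_integrable.1 (MemLp.mul' (r := 1) hf hg)
  have h2 : eLpNorm (g • f) 1 volume ≤ eLpNorm g r volume * eLpNorm f p volume :=
    eLpNorm_smul_le_mul_eLpNorm hf.1 hg.1
  refine ⟨hi, ?_⟩
  rw [integral_norm_eq_lintegral_enorm hi.1, ← eLpNorm_one_eq_lintegral_enorm, ← ENNReal.toReal_mul]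
  exact ENNReal.toReal_mono (ENNReal.mul_ne_top hg.2.ne hf.2.ne) h2

theorem measurePreserving_const_sub (x : E3) :
    MeasurePreserving (fun y : E3 => x - y) volume volume :=
  Measure.measurePreserving_sub_left volume x

theorem integral_wt_mul_le {p r : ℝ≥0∞} [ENNReal.HolderTriple r p 1] (hr : 1 ≤ r) {f : E3 → ℝ}
    (hf : MemLp f p volume) (x : E3) :
    Integrable (fun y => wt (x - y) * f y) volume ∧
    ∫ y, ‖wt (x - y) * f y‖ ≤ (eLpNorm wt r volume).toReal * (eLpNorm f p volume).toReal := by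
  have hw : MemLp (wt ∘ fun y => x - y) r volume :=
    (memLp_wt hr).comp_measurePreserving (measurePreserving_const_sub x)
  have hwe : eLpNorm (wt ∘ fun y => x - y) r volume = eLpNorm wt r volume :=
    eLpNorm_comp_measurePreserving continuous_wt.aestronglyMeasurable (measurePreserving_const_sub x)
  rw [← hwe]
  exact integral_mul_le_of_holder hw hf

/-- Hölder between the translated weight and `f`; translation invariance makes the bound uniform in
`x`. It serves as a crude Bernstein inequality. -/
theorem abs_rconv_le {κ f : E3 → ℝ} {C : ℝ} (hκ : ∀ x, |κ x| ≤ C * wt x) {p : ℝ≥0∞} (hp : 1 ≤ p)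
    (hf : MemLp f p volume) (x : E3) :
    |rconv κ f x| ≤ C * ((eLpNorm wt (ENNReal.conjExponent p) volume).toReal
      * (eLpNorm f p volume).toReal) := by
  have hC : 0 ≤ C := by
    have := (abs_nonneg _).trans (hκ 0)
    exact nonneg_of_mul_nonneg_left this (wt_pos 0)
  have ht : ENNReal.HolderTriple (ENNReal.conjExponent p) p 1 :=
    (ENNReal.HolderConjugate.conjExponent hp).symm
  have h1 : 1 ≤ ENNReal.conjExponent p := by rw [ENNReal.conjExponent]; exact le_self_add
  obtain ⟨hi, h3⟩ := integral_wt_mul_le h1 hf x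
  calc |rconv κ f x| ≤ ∫ y, C * ‖wt (x - y) * f y‖ := by
        refine norm_integral_le_of_norm_le (f := fun y => κ (x - y) * f y) (hi.norm.const_mul C) (Eventually.of_forall fun y => ?_)
        rw [norm_mul, norm_mul, Real.norm_of_nonneg (wt_pos _).le, ← mul_assoc]
        gcongr
        exact hκ _
    _ = C * ∫ y, ‖wt (x - y) * f y‖ := integral_const_mul _ _
    _ ≤ _ := by gcongr

end MLANS

end

noncomputable section

namespace MLANS

open LineDeriv

/-! ### The Littlewood–Paley symbols -/

namespace IsLPProfile

variable {χ : E3 → ℝ}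

theorem eq_zero_of_norm_le (hχ : IsLPProfile χ) {ξ : E3} (h : ‖ξ‖ ≤ 1 / 2) : χ ξ = 0 := by
  by_contra h1
  exact absurd (hχ.support_subset h1).1 (not_lt.2 h)

theorem eq_zero_of_le_norm (hχ : IsLPProfile χ) {ξ : E3} (h : 2 ≤ ‖ξ‖) : χ ξ = 0 := by
  by_contra h1
  exact absurd (hχ.support_subset h1).2 (not_lt.2 h)

theorem isSym (hχ : IsLPProfile χ) : IsSym χ where
  smooth := hχ.smooth
  cpt := HasCompactSupport.intro (isCompact_closedBall (0 : E3) 2) fun ξ hξ => by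
    refine hχ.eq_zero_of_le_norm ?_
    rw [Metric.mem_closedBall, dist_zero_right, not_le] at hξ
    exact hξ.le
  even ξ := hχ.radial _ _ (norm_neg ξ)

end IsLPProfile

theorem two_zpow_neg (j : ℕ) : (2 : ℝ) ^ (-(j : ℤ)) = ((2 : ℝ) ^ j)⁻¹ := by
  rw [zpow_neg, zpow_natCast]

theorem norm_two_zpow_smul (j : ℕ) (ξ : E3) : ‖(2 : ℝ) ^ (-(j : ℤ)) • ξ‖ = ‖ξ‖ / 2 ^ j := by
  rw [two_zpow_neg, norm_smul, norm_inv, norm_pow, Real.norm_ofNat, inv_mul_eq_div]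

/-- The low-frequency symbol. -/
def loSym (χ : E3 → ℝ) (ξ : E3) : ℝ := 1 - ∑' k : ℕ, χ (((2 : ℝ) ^ (-(k : ℤ))) • ξ)

namespace IsLPProfile

variable {χ : E3 → ℝ}

theorem block_eq_zero (hχ : IsLPProfile χ) {N k : ℕ} (hk : N ≤ k) {ξ : E3} (h : ‖ξ‖ ≤ 2 ^ N / 2) :
    χ (((2 : ℝ) ^ (-(k : ℤ))) • ξ) = 0 := by
  refine hχ.eq_zero_of_norm_le ?_
  rw [norm_two_zpow_smul, div_le_iff₀ (by positivity)]
  have : (2 : ℝ) ^ N ≤ 2 ^ k := pow_le_pow_right₀ (by norm_num) hk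
  linarith

theorem loSym_eq (hχ : IsLPProfile χ) {N : ℕ} {ξ : E3} (h : ‖ξ‖ ≤ 2 ^ N / 2) :
    loSym χ ξ = 1 - ∑ k ∈ Finset.range N, χ (((2 : ℝ) ^ (-(k : ℤ))) • ξ) := by
  rw [loSym, tsum_eq_sum]
  intro k hk
  exact hχ.block_eq_zero (not_lt.1 (by simpa using hk)) h

theorem exists_norm_lt (ξ : E3) : ∃ N : ℕ, ‖ξ‖ < 2 ^ N / 2 := by
  obtain ⟨N, hN⟩ := pow_unbounded_of_one_lt (2 * ‖ξ‖) (by norm_num : (1 : ℝ) < 2)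
  exact ⟨N, by linarith⟩

theorem loSym_eq_one (hχ : IsLPProfile χ) {ξ : E3} (h : ‖ξ‖ ≤ 1 / 2) : loSym χ ξ = 1 := by
  rw [hχ.loSym_eq (N := 0) (by simpa using h)]; simp

/-- When `|ξ| ≥ 1` the blocks of negative index vanish, since their argument has norm at least two.
The sum over nonnegative indices is then the full partition of unity. -/
theorem loSym_eq_zero (hχ : IsLPProfile χ) {ξ : E3} (h : 1 ≤ ‖ξ‖) : loSym χ ξ = 0 := by
  have h0 : ξ ≠ 0 := by
    rintro rfl; rw [norm_zero] at h; linarith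
  have h1 := hχ.hasSum_one ξ h0
  have h2 : HasSum (fun k : ℕ => χ (((2 : ℝ) ^ (-(k : ℤ))) • ξ)) 1 := by
    refine (Function.Injective.hasSum_iff (f := fun j : ℤ => χ (((2 : ℝ) ^ (-j)) • ξ))
      (g := ((↑) : ℕ → ℤ)) Nat.cast_injective ?_).2 h1
    intro j hj
    have hj0 : j < 0 := by
      by_contra hh
      exact hj ⟨j.toNat, Int.toNat_of_nonneg (not_lt.1 hh)⟩
    refine hχ.eq_zero_of_le_norm ?_
    rw [norm_smul, norm_zpow, Real.norm_ofNat]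
    have : (2 : ℝ) ^ (1 : ℤ) ≤ 2 ^ (-j) := zpow_le_zpow_right₀ (by norm_num) (by omega)
    rw [zpow_one] at this
    nlinarith
  rw [loSym, h2.tsum_eq, sub_self]

/-- Dilation by two sends each block to the next one, so only the block of index zero is gained.
Iteration gives `loSym_dilate`: the low-frequency part plus `N` blocks is again a dilated
low-frequency cutoff. -/
theorem loSym_half (hχ : IsLPProfile χ) (ξ : E3) :
    loSym χ (((2 : ℝ) ^ (-((1 : ℕ) : ℤ))) • ξ) = loSym χ ξ + χ ξ := by
  obtain ⟨N, hN⟩ := exists_norm_lt ξ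
  have h1 : ‖ξ‖ ≤ 2 ^ (N + 1) / 2 := by
    rw [pow_succ]; have : (0 : ℝ) < 2 ^ N := by positivity
    linarith
  have h2 : ‖((2 : ℝ) ^ (-((1 : ℕ) : ℤ))) • ξ‖ ≤ 2 ^ N / 2 := by
    rw [norm_two_zpow_smul]; linarith [norm_nonneg ξ]
  rw [hχ.loSym_eq h1, hχ.loSym_eq h2, Finset.sum_range_succ']
  have e : ∀ k : ℕ, χ ((2 : ℝ) ^ (-(k : ℤ)) • (2 : ℝ) ^ (-((1 : ℕ) : ℤ)) • ξ)
      = χ ((2 : ℝ) ^ (-((k + 1 : ℕ) : ℤ)) • ξ) := fun k => by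
    rw [smul_smul, ← zpow_add₀ (by norm_num)]
    congr 3; push_cast; ring
  simp only [e]
  simp only [Nat.cast_zero, neg_zero, zpow_zero, one_smul]
  ring

theorem loSym_dilate (hχ : IsLPProfile χ) (N : ℕ) (ξ : E3) :
    loSym χ (((2 : ℝ) ^ (-(N : ℤ))) • ξ)
      = loSym χ ξ + ∑ k ∈ Finset.range N, χ (((2 : ℝ) ^ (-(k : ℤ))) • ξ) := by
  induction N with
  | zero => simp
  | succ N ih =>
    have := hχ.loSym_half (((2 : ℝ) ^ (-(N : ℤ))) • ξ)
    rw [smul_smul, ← zpow_add₀ (by norm_num)] at this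
    rw [Finset.sum_range_succ, ← add_assoc, ← ih, ← this]
    congr 3; push_cast; ring

/-- Near every point the defining series has only finitely many nonzero terms, which gives
smoothness without any convergence argument. -/
theorem isSym_loSym (hχ : IsLPProfile χ) : IsSym (loSym χ) where
  smooth := by
    rw [contDiff_iff_contDiffAt]
    intro ξ
    obtain ⟨N, hN⟩ := exists_norm_lt ξ
    have h : loSym χ =ᶠ[𝓝 ξ] fun ξ => 1 - ∑ k ∈ Finset.range N, χ (((2 : ℝ) ^ (-(k : ℤ))) • ξ) := by
      have : {η : E3 | ‖η‖ < 2 ^ N / 2} ∈ 𝓝 ξ := (isOpen_lt continuous_norm continuous_const).mem_nhds hN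
      filter_upwards [this] with η hη
      exact hχ.loSym_eq (le_of_lt hη)
    refine ContDiffAt.congr_of_eventuallyEq (ContDiff.contDiffAt ?_) h
    exact contDiff_const.sub (ContDiff.sum fun k _ => hχ.smooth.comp (contDiff_const_smul _))
  cpt := HasCompactSupport.intro (isCompact_closedBall (0 : E3) 1) fun ξ hξ => by
    refine hχ.loSym_eq_zero ?_
    rw [Metric.mem_closedBall, dist_zero_right, not_le] at hξ
    exact hξ.le
  even ξ := by
    simp only [loSym, smul_neg]
    congr 2; ext k
    exact hχ.radial _ _ (norm_neg _)

end IsLPProfile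

theorem IsSym.dilate_two {m : E3 → ℝ} (h : IsSym m) (j : ℕ) :
    IsSym fun ξ => m (((2 : ℝ) ^ (-(j : ℤ))) • ξ) :=
  h.dilate (by positivity)

theorem kerS_congr {m m' : E3 → ℝ} (h : IsSym m) (h' : IsSym m') (e : m = m') (x : E3) :
    kerS h x = kerS h' x := by subst e; rfl

theorem kerS_dilate_two {m : E3 → ℝ} (h : IsSym m) (j : ℕ) (x : E3) :
    kerS (h.dilate_two j) x = ((2 : ℝ) ^ j) ^ 3 * kerS h ((2 : ℝ) ^ j • x) := by
  rw [← kerS_dilate h (by positivity) x]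
  refine kerS_congr _ _ ?_ x
  ext ξ; rw [two_zpow_neg]

/-! ### Components of the dyadic blocks -/

theorem abs_coord_le (x : E3) (i : Fin 3) : |x i| ≤ ‖x‖ := PiLp.norm_apply_le x i

theorem memLp_coord {f : E3 → E3} {p : ℝ≥0∞} (hf : MemLp f p volume) (i : Fin 3) :
    MemLp (fun x => f x i) p volume :=
  hf.mono ((EuclideanSpace.proj (𝕜 := ℝ) i).continuous.comp_aestronglyMeasurable hf.1)
    (Eventually.of_forall fun _ => abs_coord_le _ _)

theorem conv_apply {m : E3 → ℝ} (h : IsSym m) {f : E3 → E3} {p : ℝ≥0∞} (hp : 1 ≤ p)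
    (hf : MemLp f p volume) (x : E3) (i : Fin 3) :
    conv (kernelOf m) f x i = rconv (kerS h) (fun y => f y i) x := by
  obtain ⟨C, -, hC⟩ := schwartz_le_wt (kerS h)
  have ht : ENNReal.HolderTriple (ENNReal.conjExponent p) p 1 :=
    (ENNReal.HolderConjugate.conjExponent hp).symm
  have h1 : 1 ≤ ENNReal.conjExponent p := by rw [ENNReal.conjExponent]; exact le_self_add
  have hi : Integrable (fun y => kerS h (x - y) • f y) volume := by
    refine ((integral_wt_mul_le h1 hf.norm x).1.const_mul C).mono'
      (((kerS h).continuous.comp (continuous_const.sub continuous_id)).aestronglyMeasurable.smul hf.1)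
      (Eventually.of_forall fun y => ?_)
    rw [norm_smul, ← mul_assoc]
    gcongr
    exact hC _
  have h2 := (EuclideanSpace.proj (𝕜 := ℝ) i).integral_comp_comm hi
  have e : conv (kernelOf m) f x = ∫ y, kerS h (x - y) • f y := by
    simp only [conv, kernelOf_eq h]
  rw [e]
  exact h2.symm

theorem eLpNorm_rconv_le {m : E3 → ℝ} (h : IsSym m) {f : E3 → E3} {p : ℝ≥0∞} (hp : 1 ≤ p)
    (hf : MemLp f p volume) (i : Fin 3) :
    eLpNorm (rconv (kerS h) fun y => f y i) p volume ≤ eLpNorm (conv (kernelOf m) f) p volume := by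
  refine eLpNorm_mono fun x => ?_
  rw [← conv_apply h hp hf]
  exact abs_coord_le _ _

/-- Comparison with the indicator of a single index. Of the summability of the blocks only this is
kept, that is, the weakest case `q = ∞`. -/
theorem le_eLpNorm_count {q : ℝ≥0∞} (hq : 1 ≤ q) (g : ℕ → ℝ≥0∞) (j : ℕ) :
    g j ≤ eLpNorm g q Measure.count := by
  have h1 : eLpNorm (({j} : Set ℕ).indicator fun _ => g j) q Measure.count ≤ eLpNorm g q Measure.count := by
    refine eLpNorm_mono_enorm fun k => ?_
    by_cases hk : k ∈ ({j} : Set ℕ)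
    · rw [indicator_of_mem hk, mem_singleton_iff.1 hk]
    · rw [indicator_of_notMem hk]; simp
  rwa [eLpNorm_indicator_const' (measurableSet_singleton j) (by simp) (zero_lt_one.trans_le hq).ne',
    Measure.count_singleton, ENNReal.one_rpow, mul_one, enorm_eq_self] at h1

theorem eLpNorm_lowFreq_le (χ : E3 → ℝ) (s : ℝ) (p q : ℝ≥0∞) (f : E3 → E3) :
    eLpNorm (conv (kernelOf (loSym χ)) f) p volume ≤ besovNorm χ s p q f := le_self_add

theorem eLpNorm_block_le (χ : E3 → ℝ) (s : ℝ) (p : ℝ≥0∞) {q : ℝ≥0∞} (hq : 1 ≤ q) (f : E3 → E3) (j : ℕ) :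
    ENNReal.ofReal ((2 : ℝ) ^ ((j : ℝ) * s)) *
      eLpNorm (conv (kernelOf fun ξ => χ (((2 : ℝ) ^ (-(j : ℤ))) • ξ)) f) p volume
      ≤ besovNorm χ s p q f :=
  (le_eLpNorm_count hq (fun j : ℕ => ENNReal.ofReal ((2 : ℝ) ^ ((j : ℝ) * s)) *
    eLpNorm (dyadicBlock χ j f) p volume) j).trans le_add_self

end MLANS

end

noncomputable section

namespace MLANS

open LineDeriv

/-! ### Bounded weak derivatives from Besov regularity -/

/-- A family of kernels given by dyadic dilation of a fixed kernel. -/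
def DyadicScaled (κ : ℕ → 𝓢(E3, ℝ)) (K : 𝓢(E3, ℝ)) (m : ℕ) : Prop :=
  ∀ N x, κ N x = ((2 : ℝ) ^ N) ^ m * K ((2 : ℝ) ^ N • x)

theorem DyadicScaled.lineDeriv {κ : ℕ → 𝓢(E3, ℝ)} {K : 𝓢(E3, ℝ)} {m : ℕ} (h : DyadicScaled κ K m)
    (k : Fin 3) : DyadicScaled (fun N => ∂_{basisVec k} (κ N)) (∂_{basisVec k} K) (m + 1) := by
  intro N x
  rw [SchwartzMap.lineDerivOp_apply_eq_fderiv, SchwartzMap.lineDerivOp_apply_eq_fderiv]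
  have e : (κ N : E3 → ℝ) = fun x => ((2 : ℝ) ^ N) ^ m * K ((2 : ℝ) ^ N • x) := funext (h N)
  have hd : DifferentiableAt ℝ (fun x => K ((2 : ℝ) ^ N • x)) x :=
    DifferentiableAt.fun_comp' x K.differentiableAt (by fun_prop)
  rw [e, fderiv_const_mul hd, fderiv_comp_smul]
  simp only [smul_apply, smul_eq_mul]
  ring

theorem wt_smul_le {c : ℝ} (hc : 1 ≤ c) (x : E3) : wt (c • x) ≤ wt x := by
  unfold wt
  refine Real.rpow_le_rpow_of_nonpos (by positivity) ?_ (by norm_num)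
  rw [norm_smul, Real.norm_of_nonneg (by linarith)]
  nlinarith [norm_nonneg x]

/-- Normalization in three dimensions costs `2^{3N}` and each derivative one more power, so two
derivatives give exponent five; the decay only improves under dilation. The bound ignores the
shrinking support, and Besov regularity six is taken to pay for that. -/
theorem DyadicScaled.bound {κ : ℕ → 𝓢(E3, ℝ)} {K : 𝓢(E3, ℝ)} {m : ℕ} (h : DyadicScaled κ K m)
    (hm : m ≤ 5) : ∃ C : ℝ, 0 ≤ C ∧ ∀ N x, |κ N x| ≤ C * ((2 : ℝ) ^ N) ^ 5 * wt x := by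
  obtain ⟨C, hC0, hC⟩ := schwartz_le_wt K
  refine ⟨C, hC0, fun N x => ?_⟩
  have h1 : (1 : ℝ) ≤ 2 ^ N := one_le_pow₀ (by norm_num)
  rw [h N x, abs_mul, abs_of_nonneg (by positivity)]
  calc ((2 : ℝ) ^ N) ^ m * |K ((2 : ℝ) ^ N • x)| ≤ ((2 : ℝ) ^ N) ^ 5 * (C * wt ((2 : ℝ) ^ N • x)) := by
        gcongr
        exact hC _
    _ ≤ ((2 : ℝ) ^ N) ^ 5 * (C * wt x) := by gcongr; exact wt_smul_le h1 x
    _ = _ := by ring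

theorem integral_sconvS_eq (κ ψ : 𝓢(E3, ℝ)) (x : E3) : sconvS κ ψ x = ∫ z, κ z * ψ (x - z) := by
  rw [sconvS_apply, ← integral_sub_left_eq_self (fun y => κ (x - y) * ψ y) volume x]
  simp only [sub_sub_cancel]

theorem sconvS_dilate {m : E3 → ℝ} (h : IsSym m) (N : ℕ) (ψ : 𝓢(E3, ℝ)) (x : E3) :
    sconvS (kerS (h.dilate_two N)) ψ x = ∫ z, kerS h z * ψ (x - ((2 : ℝ) ^ N)⁻¹ • z) := by
  rw [integral_sconvS_eq]
  have := Measure.integral_comp_smul_of_nonneg (volume : Measure E3)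
    (fun z : E3 => kerS h z * ψ (x - ((2 : ℝ) ^ N)⁻¹ • z)) ((2 : ℝ) ^ N) (hR := by positivity)
  have e : Module.finrank ℝ E3 = 3 := by simp
  rw [e, smul_eq_mul, inv_mul_eq_div, eq_div_iff (by positivity)] at this
  rw [← this, mul_comm, ← integral_const_mul]
  refine integral_congr_ae (Eventually.of_forall fun z => ?_)
  simp only [kerS_dilate_two h, smul_smul]
  rw [inv_mul_cancel₀ (by positivity), one_smul]
  ring

theorem wt_sub_le (x z : E3) : wt (x - z) ≤ (1 + ‖z‖) ^ 4 * wt x := by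
  have := wt_le_mul (x - z) (-z)
  rwa [norm_neg, sub_neg_eq_add, sub_add_cancel] at this

theorem approx_bound {m : E3 → ℝ} (h : IsSym m) {ψ : 𝓢(E3, ℝ)} {C : ℝ} (hC0 : 0 ≤ C)
    (hC : ∀ x, |ψ x| ≤ C * wt x) (N : ℕ) (x z : E3) :
    |kerS h z * ψ (x - ((2 : ℝ) ^ N)⁻¹ • z)| ≤ C * wt x * (‖kerS h z‖ * (1 + ‖z‖) ^ 4) := by
  have h1 : ‖((2 : ℝ) ^ N)⁻¹ • z‖ ≤ ‖z‖ := by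
    rw [norm_smul, norm_inv, norm_pow, Real.norm_ofNat]
    exact mul_le_of_le_one_left (norm_nonneg _) (inv_le_one_of_one_le₀ (one_le_pow₀ (by norm_num)))
  rw [abs_mul, ← Real.norm_eq_abs (kerS h z)]
  calc _ ≤ ‖kerS h z‖ * (C * ((1 + ‖z‖) ^ 4 * wt x)) := by
        gcongr
        refine (hC _).trans ?_
        gcongr
        refine (wt_sub_le _ _).trans ?_
        gcongr
        exact (wt_pos x).le
    _ = _ := by ring

/-- A symbol equal to one at the origin has a kernel of integral one, so its dilates are an
approximate identity. The weighted bound `approx_bound` supplies the majorant in both limits. -/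
theorem tendsto_integral_approx {m : E3 → ℝ} (h : IsSym m) (h1 : m 0 = 1) {F : E3 → ℝ} (hF : TI F)
    (ψ : 𝓢(E3, ℝ)) :
    Tendsto (fun N : ℕ => ∫ x, F x * sconvS (kerS (h.dilate_two N)) ψ x) atTop
      (𝓝 (∫ x, F x * ψ x)) := by
  obtain ⟨C, hC0, hC⟩ := schwartz_le_wt ψ
  have hi := integrable_schwartz_mul_pow (kerS h)
  set K := ∫ z, ‖kerS h z‖ * (1 + ‖z‖) ^ 4
  have hm : ∀ (N : ℕ) (x : E3), AEStronglyMeasurable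
      (fun z => kerS h z * ψ (x - ((2 : ℝ) ^ N)⁻¹ • z)) volume := fun N x =>
    ((kerS h).continuous.mul (ψ.continuous.comp (by fun_prop))).aestronglyMeasurable
  refine tendsto_integral_of_dominated_convergence (fun x => C * K * ‖F x * wt x‖)
    (fun N => hF.aestronglyMeasurable.mul (SchwartzMap.continuous _).aestronglyMeasurable)
    ((show Integrable (fun x => F x * wt x) volume from hF).norm.const_mul (C * K)) (fun N => Eventually.of_forall fun x => ?_)
    (Eventually.of_forall fun x => ?_)
  · rw [sconvS_dilate h, norm_mul, norm_mul, Real.norm_of_nonneg (wt_pos x).le]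
    have : ‖∫ z, kerS h z * ψ (x - ((2 : ℝ) ^ N)⁻¹ • z)‖ ≤ C * wt x * K := by
      rw [← integral_const_mul]
      exact norm_integral_le_of_norm_le (hi.const_mul _)
        (Eventually.of_forall fun z => approx_bound h hC0 hC N x z)
    calc _ ≤ ‖F x‖ * (C * wt x * K) := by gcongr
      _ = _ := by ring
  · refine Tendsto.const_mul _ ?_
    simp only [sconvS_dilate h]
    have e : ψ x = ∫ z, kerS h z * ψ x := by
      rw [integral_mul_const, integral_kerS, h1, one_mul]
    rw [e]
    refine tendsto_integral_of_dominated_convergence (fun z => C * wt x * (‖kerS h z‖ * (1 + ‖z‖) ^ 4))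
      (fun N => hm N x) (hi.const_mul _) (fun N => Eventually.of_forall fun z => approx_bound h hC0 hC N x z)
      (Eventually.of_forall fun z => ?_)
    refine Tendsto.const_mul _ ?_
    have h2 : Tendsto (fun N : ℕ => x - ((2 : ℝ) ^ N)⁻¹ • z) atTop (𝓝 x) := by
      have h3 : Tendsto (fun N : ℕ => ((2 : ℝ) ^ N)⁻¹) atTop (𝓝 0) :=
        tendsto_inv_atTop_zero.comp (tendsto_pow_atTop_atTop_of_one_lt (by norm_num))
      have := (h3.smul_const z).const_sub x
      simpa using this
    exact (ψ.continuous.tendsto x).comp h2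

theorem sconvS_sum_eq {χ : E3 → ℝ} (hχ : IsLPProfile χ) (N : ℕ) (ψ : 𝓢(E3, ℝ)) (x : E3) :
    sconvS (kerS hχ.isSym_loSym) ψ x + ∑ j ∈ Finset.range N, sconvS (kerS (hχ.isSym.dilate_two j)) ψ x
      = sconvS (kerS (hχ.isSym_loSym.dilate_two N)) ψ x := by
  have key : sconvS (kerS hχ.isSym_loSym) ψ
      + ∑ j ∈ Finset.range N, sconvS (kerS (hχ.isSym.dilate_two j)) ψ
      = sconvS (kerS (hχ.isSym_loSym.dilate_two N)) ψ := by
    refine schwartz_ext_fourier fun ξ => ?_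
    have e1 : ∀ a b : 𝓢(E3, ℝ), schwartzOfReal (a + b) = schwartzOfReal a + schwartzOfReal b :=
      fun a b => by ext x; simp [schwartzOfReal_apply]
    have e2 : ∀ (n : ℕ) (a : ℕ → 𝓢(E3, ℝ)), 𝓕 (schwartzOfReal (∑ j ∈ Finset.range n, a j)) ξ
        = ∑ j ∈ Finset.range n, 𝓕 (schwartzOfReal (a j)) ξ := by
      intro n a
      induction n with
      | zero =>
        have : schwartzOfReal (0 : 𝓢(E3, ℝ)) = 0 := by ext x; simp [schwartzOfReal_apply]
        simp [this, FourierTransform.fourier_zero]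
      | succ n ih =>
        rw [Finset.sum_range_succ, Finset.sum_range_succ, e1, FourierTransform.fourier_add,
          add_apply, ih]
    rw [e1, FourierTransform.fourier_add, add_apply, e2]
    simp only [fourier_sconvS, fourier_kerS, symS_apply]
    rw [hχ.loSym_dilate, ← Finset.sum_mul, ← add_mul]
    push_cast; ring
  have := DFunLike.congr_fun key x
  rw [← this, add_apply, sum_apply]

/-- When `m'` is one on the support of `m`, convolution with the kernel of `m'` can be inserted for
free. The derivatives are later put on that fattened kernel. -/
theorem sconvS_repro {m m' : E3 → ℝ} (h : IsSym m) (h' : IsSym m') (e : ∀ ξ, m ξ * m' ξ = m ξ)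
    (ψ : 𝓢(E3, ℝ)) : sconvS (kerS h) (sconvS (kerS h') ψ) = sconvS (kerS h) ψ := by
  refine schwartz_ext_fourier fun ξ => ?_
  simp only [fourier_sconvS, fourier_kerS, symS_apply]
  rw [← mul_assoc, ← Complex.ofReal_mul, e]

theorem loSym_repro {χ : E3 → ℝ} (hχ : IsLPProfile χ) (ξ : E3) :
    loSym χ ξ * loSym χ (((2 : ℝ) ^ (-((1 : ℕ) : ℤ))) • ξ) = loSym χ ξ := by
  rcases le_or_gt 1 ‖ξ‖ with h | h
  · rw [hχ.loSym_eq_zero h, zero_mul]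
  · rw [hχ.loSym_eq_one (ξ := ((2 : ℝ) ^ (-((1 : ℕ) : ℤ))) • ξ), mul_one]
    rw [norm_two_zpow_smul]; linarith

/-- The block lives in `|ξ| < 2^{j+1}`, and the low-frequency symbol at scale `N` is one for `|ξ| ≤
2^{N-1}`; hence the shift by two. -/
theorem block_repro {χ : E3 → ℝ} (hχ : IsLPProfile χ) (j : ℕ) (ξ : E3) :
    χ (((2 : ℝ) ^ (-(j : ℤ))) • ξ) * loSym χ (((2 : ℝ) ^ (-((j + 2 : ℕ) : ℤ))) • ξ)
      = χ (((2 : ℝ) ^ (-(j : ℤ))) • ξ) := by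
  rcases le_or_gt 2 ‖((2 : ℝ) ^ (-(j : ℤ))) • ξ‖ with h | h
  · rw [hχ.eq_zero_of_le_norm h, zero_mul]
  · rw [hχ.loSym_eq_one (ξ := ((2 : ℝ) ^ (-((j + 2 : ℕ) : ℤ))) • ξ), mul_one]
    rw [norm_two_zpow_smul, div_lt_iff₀ (by positivity)] at h
    rw [norm_two_zpow_smul, div_le_iff₀ (by positivity), pow_add]
    linarith

/-- The bounds on the dyadic blocks of a scalar function that come from Besov regularity `6`. -/
structure BlockData {χ : E3 → ℝ} (hχ : IsLPProfile χ) (p : ℝ≥0∞) (F : E3 → ℝ) (B : ℝ) : Prop where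
  nonneg : 0 ≤ B
  memLp : MemLp F p volume
  low : eLpNorm (rconv (kerS hχ.isSym_loSym) F) p volume ≤ ENNReal.ofReal B
  block : ∀ j : ℕ, eLpNorm (rconv (kerS (hχ.isSym.dilate_two j)) F) p volume
    ≤ ENNReal.ofReal ((((2 : ℝ) ^ j) ^ 6)⁻¹ * B)

theorem memLp_rconv_of_le {p : ℝ≥0∞} (hp : 1 ≤ p) {F : E3 → ℝ} (hF : MemLp F p volume) (κ : 𝓢(E3, ℝ))
    {b : ℝ} (h : eLpNorm (rconv κ F) p volume ≤ ENNReal.ofReal b) (hb : 0 ≤ b) :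
    MemLp (rconv κ F) p volume ∧ (eLpNorm (rconv κ F) p volume).toReal ≤ b :=
  ⟨⟨((hF.ti hp).rconv κ).aestronglyMeasurable, h.trans_lt ENNReal.ofReal_lt_top⟩,
    ENNReal.toReal_le_of_le_ofReal hb h⟩

theorem integral_rconv_rconv {p : ℝ≥0∞} (hp : 1 ≤ p) {F : E3 → ℝ} (hF : MemLp F p volume)
    {D D' : 𝓢(E3, ℝ) → 𝓢(E3, ℝ)} (hD : ∀ κ φ y, adjC (D κ) φ y = adjC κ (D' φ) y)
    {m m' : E3 → ℝ} (h : IsSym m) (h' : IsSym m') (e : ∀ ξ, m ξ * m' ξ = m ξ) (φ : 𝓢(E3, ℝ)) :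
    ∫ x, rconv (D (kerS h')) (rconv (kerS h) F) x * φ x = ∫ x, F x * sconvS (kerS h) (D' φ) x := by
  have hT := hF.ti hp
  rw [integral_rconv_schwartz _ (hT.rconv _)]
  have e1 : ∀ y, adjC (D (kerS h')) φ y = sconvS (kerS h') (D' φ) y := fun y => by
    rw [hD, adjC_of_even (kerS_neg h')]
  simp only [e1]
  rw [integral_rconv_schwartz _ hT]
  refine integral_congr_ae (Eventually.of_forall fun y => ?_)
  simp only [adjC_of_even (kerS_neg h), sconvS_repro h h' e]

/-- Bernstein's inequality summed over the blocks. Each block is reproduced by a fattened kernel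
carrying `D`, which costs `2^{5j}` against the gain `2^{-6j}`, so the series converges uniformly.
Testing the partial sums against `φ` and passing to the limit identifies the sum with `D F`. The map
`D'` is the transpose of `D`, so a single statement serves for `F` and for its first and second
derivatives. -/
theorem exists_bounded_rep {χ : E3 → ℝ} (hχ : IsLPProfile χ) {p : ℝ≥0∞} (hp : 1 ≤ p)
    {D D' : 𝓢(E3, ℝ) → 𝓢(E3, ℝ)} (hD : ∀ κ φ y, adjC (D κ) φ y = adjC κ (D' φ) y)
    {K : 𝓢(E3, ℝ)} {m : ℕ} (hm : m ≤ 5)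
    (hK : DyadicScaled (fun N => D (kerS (hχ.isSym_loSym.dilate_two N))) K m) :
    ∃ C : ℝ, 0 ≤ C ∧ ∀ F B, BlockData hχ p F B → ∃ g : E3 → ℝ, AEStronglyMeasurable g volume ∧
      (∀ x, |g x| ≤ C * B) ∧ ∀ φ : 𝓢(E3, ℝ), ∫ x, g x * φ x = ∫ x, F x * D' φ x := by
  obtain ⟨C, hC0, hC⟩ := hK.bound hm
  set W := (eLpNorm wt (ENNReal.conjExponent p) volume).toReal
  have hW : 0 ≤ W := ENNReal.toReal_nonneg
  set κ : ℕ → 𝓢(E3, ℝ) := fun N => D (kerS (hχ.isSym_loSym.dilate_two N)) with hκ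
  -- The factor `32` is `2^5` from the low-frequency kernel at scale one, `1024` is `2^{10}` from
  -- the shift to scale `j + 2`, and the last `2` sums the geometric series.
  refine ⟨C * 32 * W + C * 1024 * W * 2, by positivity, fun F B hF => ?_⟩
  have hB := hF.nonneg
  obtain ⟨hl1, hl2⟩ := memLp_rconv_of_le hp hF.memLp _ hF.low hB
  have hb := fun j => memLp_rconv_of_le hp hF.memLp _ (hF.block j) (by positivity)
  set gl : E3 → ℝ := rconv (κ 1) (rconv (kerS hχ.isSym_loSym) F) with hgl
  set gb : ℕ → E3 → ℝ := fun j => rconv (κ (j + 2)) (rconv (kerS (hχ.isSym.dilate_two j)) F) with hgb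
  have hlb : ∀ x, |gl x| ≤ C * 32 * W * B := fun x => by
    refine (abs_rconv_le (hC 1) hp hl1 x).trans ?_
    calc _ ≤ C * ((2 : ℝ) ^ 1) ^ 5 * (W * B) := by gcongr
      _ = _ := by ring
  have hbb : ∀ j x, |gb j x| ≤ C * 1024 * W * B * (1 / 2) ^ j := fun j x => by
    refine (abs_rconv_le (hC (j + 2)) hp (hb j).1 x).trans ?_
    calc _ ≤ C * ((2 : ℝ) ^ (j + 2)) ^ 5 * (W * ((((2 : ℝ) ^ j) ^ 6)⁻¹ * B)) := by
          gcongr; exact (hb j).2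
      _ = _ := by
          rw [pow_add, one_div, inv_pow]
          field_simp
          norm_num; ring
  have hlm : AEStronglyMeasurable gl volume := ((hl1.ti hp).rconv _).aestronglyMeasurable
  have hbm : ∀ j, AEStronglyMeasurable (gb j) volume := fun j =>
    (((hb j).1.ti hp).rconv _).aestronglyMeasurable
  have hgeo : Summable fun j : ℕ => C * 1024 * W * B * (1 / 2 : ℝ) ^ j :=
    summable_geometric_two.mul_left _
  have hsum : ∀ x, Summable fun j => gb j x := fun x =>
    Summable.of_norm_bounded hgeo fun j => hbb j x
  have htend : ∀ x, Tendsto (fun N => gl x + ∑ j ∈ Finset.range N, gb j x) atTop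
      (𝓝 (gl x + ∑' j, gb j x)) := fun x => (hsum x).hasSum.tendsto_sum_nat.const_add _
  have hpm : ∀ N, AEStronglyMeasurable (fun x => gl x + ∑ j ∈ Finset.range N, gb j x) volume :=
    fun N => hlm.add (Finset.aestronglyMeasurable_fun_sum _ fun j _ => hbm j)
  have hpb : ∀ N x, |gl x + ∑ j ∈ Finset.range N, gb j x| ≤ (C * 32 * W + C * 1024 * W * 2) * B := by
    intro N x
    have h1 : |∑ j ∈ Finset.range N, gb j x| ≤ C * 1024 * W * B * 2 := by
      refine (Finset.abs_sum_le_sum_abs _ _).trans ((Finset.sum_le_sum fun j _ => hbb j x).trans ?_)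
      refine (hgeo.sum_le_tsum _ fun j _ => by positivity).trans ?_
      rw [tsum_mul_left, tsum_geometric_two]
    calc _ ≤ |gl x| + |∑ j ∈ Finset.range N, gb j x| := abs_add_le _ _
      _ ≤ C * 32 * W * B + C * 1024 * W * B * 2 := add_le_add (hlb x) h1
      _ = _ := by ring
  refine ⟨fun x => gl x + ∑' j, gb j x, aestronglyMeasurable_of_tendsto_ae atTop hpm
    (Eventually.of_forall htend), fun x => le_of_tendsto (htend x).abs
      (Eventually.of_forall fun N => hpb N x), fun φ => ?_⟩
  have l1 : Tendsto (fun N => ∫ x, (gl x + ∑ j ∈ Finset.range N, gb j x) * φ x) atTop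
      (𝓝 (∫ x, (gl x + ∑' j, gb j x) * φ x)) := by
    refine tendsto_integral_of_dominated_convergence
      (fun x => (C * 32 * W + C * 1024 * W * 2) * B * ‖φ x‖)
      (fun N => (hpm N).mul φ.continuous.aestronglyMeasurable) (φ.integrable.norm.const_mul _)
      (fun N => Eventually.of_forall fun x => ?_)
      (Eventually.of_forall fun x => (htend x).mul_const _)
    rw [norm_mul]
    gcongr
    exact hpb N x
  have l2 := tendsto_integral_approx hχ.isSym_loSym (hχ.loSym_eq_one (by simp)) (hF.memLp.ti hp) (D' φ)
  refine tendsto_nhds_unique l1 (l2.congr fun N => ?_)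
  have hT := hF.memLp.ti hp
  have i1 : Integrable (fun x => gl x * φ x) volume := ((hl1.ti hp).rconv _).integrable_mul_schwartz φ
  have i2 : ∀ j, Integrable (fun x => gb j x * φ x) volume := fun j =>
    (((hb j).1.ti hp).rconv _).integrable_mul_schwartz φ
  calc ∫ x, F x * sconvS (kerS (hχ.isSym_loSym.dilate_two N)) (D' φ) x
      = ∫ x, (F x * sconvS (kerS hχ.isSym_loSym) (D' φ) x
        + ∑ j ∈ Finset.range N, F x * sconvS (kerS (hχ.isSym.dilate_two j)) (D' φ) x) := by
        refine integral_congr_ae (Eventually.of_forall fun x => ?_)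
        simp only
        rw [← sconvS_sum_eq hχ N (D' φ) x, mul_add, Finset.mul_sum]
    _ = (∫ x, gl x * φ x) + ∑ j ∈ Finset.range N, ∫ x, gb j x * φ x := by
        rw [integral_add (hT.integrable_mul_schwartz _)
          (integrable_finsetSum _ fun j _ => hT.integrable_mul_schwartz _),
          integral_finsetSum _ fun j _ => hT.integrable_mul_schwartz _]
        congr 1
        · exact (integral_rconv_rconv hp hF.memLp hD _ _ (loSym_repro hχ) φ).symm
        · refine Finset.sum_congr rfl fun j _ => ?_
          exact (integral_rconv_rconv hp hF.memLp hD _ _ (block_repro hχ j) φ).symm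
    _ = ∫ x, (gl x + ∑ j ∈ Finset.range N, gb j x) * φ x := by
        rw [← integral_finsetSum _ fun j _ => i2 j, ← integral_add i1
          (integrable_finsetSum _ fun j _ => i2 j)]
        refine integral_congr_ae (Eventually.of_forall fun x => ?_)
        simp only
        rw [add_mul, Finset.sum_mul]

/-- Bounded weak derivatives up to order two, with a common bound. -/
def W2Bound (F : E3 → ℝ) (b : ℝ) : Prop :=
  ∃ (g : Fin 3 → E3 → ℝ) (h : Fin 3 → Fin 3 → E3 → ℝ),
    (∀ᵐ x, |F x| ≤ b) ∧ (∀ j, WD j F (g j)) ∧ (∀ j x, |g j x| ≤ b) ∧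
    (∀ j k, WD k (g j) (h j k)) ∧ ∀ j k x, |h j k x| ≤ b

theorem TI.of_bound {g : E3 → ℝ} (hg : AEStronglyMeasurable g volume) {b : ℝ} (hb : ∀ x, |g x| ≤ b) :
    TI g :=
  (integrable_wt.const_mul b).mono' (hg.mul continuous_wt.aestronglyMeasurable)
    (Eventually.of_forall fun x => by
      rw [norm_mul, Real.norm_of_nonneg (wt_pos x).le]
      exact mul_le_mul_of_nonneg_right (hb x) (wt_pos x).le)

theorem exists_W2Bound {χ : E3 → ℝ} (hχ : IsLPProfile χ) {p : ℝ≥0∞} (hp : 1 ≤ p) :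
    ∃ C : ℝ, 0 ≤ C ∧ ∀ F B, BlockData hχ p F B → W2Bound F (C * B) := by
  have s0 : DyadicScaled (fun N => kerS (hχ.isSym_loSym.dilate_two N)) (kerS hχ.isSym_loSym) 3 :=
    fun N x => kerS_dilate_two hχ.isSym_loSym N x
  obtain ⟨C0, hC0, H0⟩ := exists_bounded_rep hχ hp (D := id) (D' := id) (fun _ _ _ => rfl)
    (by norm_num) s0
  have a1 : ∀ (j : Fin 3) (κ φ : 𝓢(E3, ℝ)) (y : E3),
      adjC (∂_{basisVec j} κ) φ y = adjC κ (-∂_{basisVec j} φ) y := fun j κ φ y => by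
    rw [adjC_lineDeriv, adjC, adjC, ← integral_neg]
    congr 1; ext x; rw [neg_apply, mul_neg]
  choose C1 hC1 H1 using fun j : Fin 3 => exists_bounded_rep hχ hp
    (D := fun κ => ∂_{basisVec j} κ) (D' := fun φ => -∂_{basisVec j} φ) (a1 j)
    (by norm_num) (s0.lineDeriv j)
  choose C2 hC2 H2 using fun j k : Fin 3 => exists_bounded_rep hχ hp
    (D := fun κ => ∂_{basisVec k} (∂_{basisVec j} κ))
    (D' := fun φ => -∂_{basisVec j} (-∂_{basisVec k} φ))
    (fun κ φ y => by rw [a1, a1])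
    (by norm_num) ((s0.lineDeriv j).lineDeriv k)
  set C := C0 + ∑ j, C1 j + ∑ j, ∑ k, C2 j k with hC
  have c0 : C0 ≤ C := by
    have h1 : 0 ≤ ∑ j, C1 j := Finset.sum_nonneg fun j _ => hC1 j
    have h2 : 0 ≤ ∑ j, ∑ k, C2 j k := Finset.sum_nonneg fun j _ => Finset.sum_nonneg fun k _ => hC2 j k
    linarith
  have c1 : ∀ j, C1 j ≤ C := fun j => by
    have h1 : C1 j ≤ ∑ j, C1 j := Finset.single_le_sum (fun j _ => hC1 j) (Finset.mem_univ j)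
    have h2 : 0 ≤ ∑ j, ∑ k, C2 j k := Finset.sum_nonneg fun j _ => Finset.sum_nonneg fun k _ => hC2 j k
    linarith
  have c2 : ∀ j k, C2 j k ≤ C := fun j k => by
    have h1 : 0 ≤ ∑ j, C1 j := Finset.sum_nonneg fun j _ => hC1 j
    have h2 : C2 j k ≤ ∑ k, C2 j k := Finset.single_le_sum (fun k _ => hC2 j k) (Finset.mem_univ k)
    have h3 : ∑ k, C2 j k ≤ ∑ j, ∑ k, C2 j k :=
      Finset.single_le_sum (f := fun j => ∑ k, C2 j k)
        (fun j _ => Finset.sum_nonneg fun k _ => hC2 j k) (Finset.mem_univ j)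
    linarith
  refine ⟨C, hC0.trans c0, fun F B hF => ?_⟩
  have hB := hF.nonneg
  have hT := hF.memLp.ti hp
  obtain ⟨g0, m0, b0, i0⟩ := H0 F B hF
  choose g m1 b1 i1 using fun j => H1 j F B hF
  choose h m2 b2 i2 using fun j k => H2 j k F B hF
  have t1 := fun j => TI.of_bound (m1 j) (b1 j)
  have t2 := fun j k => TI.of_bound (m2 j k) (b2 j k)
  -- With `D` the identity the representative is `F` itself almost everywhere, which is how the sup
  -- bound transfers to `F`.
  have e0 : F =ᵐ[volume] g0 := by
    refine ae_eq_of_integral_contDiff_smul_eq hT.locallyIntegrable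
      (TI.of_bound m0 b0).locallyIntegrable fun ψ h1 h2 => ?_
    obtain ⟨φ, hφ⟩ := exists_schwartz_of_contDiff h1 h2
    have := i0 φ
    simp only [hφ, id] at this
    simp only [smul_eq_mul, mul_comm (ψ _)]
    exact this.symm
  refine ⟨g, h, ?_, fun j => ⟨hT, t1 j, fun φ => ?_⟩, fun j x => (b1 j x).trans (by gcongr; exact c1 j),
    fun j k => ⟨t1 j, t2 j k, fun φ => ?_⟩, fun j k x => (b2 j k x).trans (by gcongr; exact c2 j k)⟩
  · filter_upwards [e0] with x hx
    rw [hx]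
    exact (b0 x).trans (by gcongr)
  · rw [i1]
    simp only [neg_apply, mul_neg, integral_neg, neg_neg]
  · have := i1 j (-∂_{basisVec k} φ)
    rw [i2, ← this]
    simp only [neg_apply, mul_neg, integral_neg, neg_neg]

/-- Besov regularity `6` gives the bounds on the blocks of each component. -/
theorem MemBesov.blockData {χ : E3 → ℝ} (hχ : IsLPProfile χ) {p q : ℝ≥0∞} (hp : 1 ≤ p) (hq : 1 ≤ q)
    {f : E3 → E3} (hf : MemBesov χ 6 p q f) (i : Fin 3) :
    BlockData hχ p (fun x => f x i) (besovNorm χ 6 p q f).toReal where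
  nonneg := ENNReal.toReal_nonneg
  memLp := memLp_coord hf.1 i
  low := by
    rw [ENNReal.ofReal_toReal hf.2.ne]
    exact (eLpNorm_rconv_le _ hp hf.1 i).trans (eLpNorm_lowFreq_le χ 6 p q f)
  block j := by
    refine (eLpNorm_rconv_le (hχ.isSym.dilate_two j) hp hf.1 i).trans ?_
    have h := eLpNorm_block_le χ 6 p hq f j
    have e : (2 : ℝ) ^ ((j : ℝ) * 6) = ((2 : ℝ) ^ j) ^ 6 := by
      rw [Real.rpow_mul (by norm_num), Real.rpow_natCast]
      exact_mod_cast Real.rpow_natCast ((2 : ℝ) ^ j) 6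
    rw [e] at h
    rw [ENNReal.ofReal_mul (by positivity), ENNReal.ofReal_toReal hf.2.ne,
      ENNReal.ofReal_inv_of_pos (by positivity), mul_comm (_⁻¹), ← div_eq_mul_inv,
      ENNReal.le_div_iff_mul_le (Or.inl (by simp)) (Or.inl ENNReal.ofReal_ne_top), mul_comm]
    exact h

end MLANS

end

noncomputable section

namespace MLANS

open LineDeriv

/-! ### Square integrable Besov fields -/

theorem rft_rconv {m : E3 → ℝ} (h : IsSym m) {F : E3 → ℝ} (hF : MemLp F 2 volume) :
    rft (rconv (kerS h) F) =ᵐ[volume] fun ξ => (m ξ : ℂ) * rft F ξ := by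
  have hk : Integrable (schwartzOfReal (kerS h)) volume := SchwartzMap.integrable _
  have h1 := ft_conv (k := schwartzOfReal (kerS h)) (f := fun x => (F x : ℂ)) hk hF.ofReal
  have e : (fun x => ((rconv (kerS h) F x : ℝ) : ℂ))
      = fun x => ∫ y, schwartzOfReal (kerS h) (x - y) * (F y : ℂ) := by
    ext x
    rw [rconv, ← integral_complex_ofReal]
    simp only [schwartzOfReal_apply, Complex.ofReal_mul]
  rw [rft, e]
  filter_upwards [h1] with ξ hξ
  rw [hξ, ← SchwartzMap.fourier_coe, fourier_kerS, symS_apply, rft]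

/-- The bounds on the dyadic blocks of a square integrable scalar function that come from Besov
regularity `s`. -/
structure BlockData2 {χ : E3 → ℝ} (hχ : IsLPProfile χ) (s : ℝ) (F : E3 → ℝ) (B : ℝ) : Prop where
  nonneg : 0 ≤ B
  memLp : MemLp F 2 volume
  low : eLpNorm (rconv (kerS hχ.isSym_loSym) F) 2 volume ≤ ENNReal.ofReal B
  block : ∀ j : ℕ, eLpNorm (rconv (kerS (hχ.isSym.dilate_two j)) F) 2 volume
    ≤ ENNReal.ofReal ((((2 : ℝ) ^ s) ^ j)⁻¹ * B)

theorem two_rpow_mul_nat (s : ℝ) (j : ℕ) : (2 : ℝ) ^ ((j : ℝ) * s) = ((2 : ℝ) ^ s) ^ j := by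
  rw [mul_comm, Real.rpow_mul (by norm_num), Real.rpow_natCast]

theorem MemBesov.blockData2 {χ : E3 → ℝ} (hχ : IsLPProfile χ) {s : ℝ} {q : ℝ≥0∞} (hq : 1 ≤ q)
    {f : E3 → E3} (hf : MemBesov χ s 2 q f) (i : Fin 3) :
    BlockData2 hχ s (fun x => f x i) (besovNorm χ s 2 q f).toReal where
  nonneg := ENNReal.toReal_nonneg
  memLp := memLp_coord hf.1 i
  low := by
    rw [ENNReal.ofReal_toReal hf.2.ne]
    exact (eLpNorm_rconv_le _ (by norm_num) hf.1 i).trans (eLpNorm_lowFreq_le χ s 2 q f)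
  block j := by
    refine (eLpNorm_rconv_le (hχ.isSym.dilate_two j) (by norm_num) hf.1 i).trans ?_
    have h := eLpNorm_block_le χ s 2 hq f j
    rw [two_rpow_mul_nat] at h
    rw [ENNReal.ofReal_mul (by positivity), ENNReal.ofReal_toReal hf.2.ne,
      ENNReal.ofReal_inv_of_pos (by positivity), mul_comm (_⁻¹), ← div_eq_mul_inv,
      ENNReal.le_div_iff_mul_le (Or.inl (by simp; positivity)) (Or.inl ENNReal.ofReal_ne_top), mul_comm]
    exact h

/-- Weighted Cauchy–Schwarz. It replaces almost orthogonality of the blocks; the loss `r^{-j}` is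
affordable because the target regularity is strictly smaller. -/
theorem sq_sum_le_geometric {r : ℝ} (h0 : 0 < r) (h1 : r < 1) (a : ℕ → ℝ) (N : ℕ) :
    (∑ j ∈ Finset.range N, a j) ^ 2 ≤ (1 - r)⁻¹ * ∑ j ∈ Finset.range N, (r ^ j)⁻¹ * a j ^ 2 := by
  have h := Finset.sum_sq_le_sum_mul_sum_of_sq_le_mul (Finset.range N) (r := a) (f := fun j => r ^ j)
    (g := fun j => (r ^ j)⁻¹ * a j ^ 2) (fun _ _ => by positivity) (fun _ _ => by positivity)
    (fun j _ => le_of_eq (by field_simp))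
  refine h.trans ?_
  gcongr
  · rw [← tsum_geometric_of_lt_one h0.le h1]
    exact (summable_geometric_of_lt_one h0.le h1).sum_le_tsum _ fun _ _ => by positivity

/-- At a fixed frequency one is a finite sum of symbols; square it with `sq_sum_le_geometric`. On
the support of block `j` one has `1 + |ξ| ≤ 3 · 2^j`, and on that of the low-frequency symbol `1 +
|ξ| ≤ 2`. -/
theorem weight_le {χ : E3 → ℝ} (hχ : IsLPProfile χ) {s' r : ℝ} (hs : 0 ≤ s') (h0 : 0 < r) (h1 : r < 1)
    (ξ : E3) : ∃ N : ℕ, (1 + ‖ξ‖) ^ (2 * s') ≤ 2 * 2 ^ (2 * s') * loSym χ ξ ^ 2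
      + ∑ j ∈ Finset.range N, 2 * (1 - r)⁻¹ * 3 ^ (2 * s') * ((2 : ℝ) ^ (2 * s') * r⁻¹) ^ j *
          χ (((2 : ℝ) ^ (-(j : ℤ))) • ξ) ^ 2 := by
  obtain ⟨N, hN⟩ := IsLPProfile.exists_norm_lt ξ
  refine ⟨N, ?_⟩
  set c : ℕ → ℝ := fun j => χ (((2 : ℝ) ^ (-(j : ℤ))) • ξ) with hc
  have hsum : loSym χ ξ + ∑ j ∈ Finset.range N, c j = 1 := by
    rw [← hχ.loSym_dilate, hχ.loSym_eq_one]
    rw [norm_two_zpow_smul, div_le_iff₀ (by positivity)]; linarith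
  have hr : 0 < 1 - r := by linarith
  have h2 : (1 : ℝ) ≤ 2 * loSym χ ξ ^ 2
      + 2 * ((1 - r)⁻¹ * ∑ j ∈ Finset.range N, (r ^ j)⁻¹ * c j ^ 2) := by
    have := sq_sum_le_geometric h0 h1 c N
    nlinarith [sq_nonneg (loSym χ ξ - ∑ j ∈ Finset.range N, c j)]
  have w0 : 0 ≤ (1 + ‖ξ‖) ^ (2 * s') := by positivity
  have e1 : (1 + ‖ξ‖) ^ (2 * s') * loSym χ ξ ^ 2 ≤ 2 ^ (2 * s') * loSym χ ξ ^ 2 := by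
    rcases le_or_gt 1 ‖ξ‖ with h | h
    · rw [hχ.loSym_eq_zero h]; simp
    · gcongr; linarith
  have e2 : ∀ j, (1 + ‖ξ‖) ^ (2 * s') * c j ^ 2 ≤ 3 ^ (2 * s') * ((2 : ℝ) ^ (2 * s')) ^ j * c j ^ 2 := by
    intro j
    rcases le_or_gt 2 ‖((2 : ℝ) ^ (-(j : ℤ))) • ξ‖ with h | h
    · rw [hc]; simp only; rw [hχ.eq_zero_of_le_norm h]; simp
    · rw [norm_two_zpow_smul, div_lt_iff₀ (by positivity)] at h
      have e : (3 : ℝ) ^ (2 * s') * ((2 : ℝ) ^ (2 * s')) ^ j = (3 * 2 ^ j) ^ (2 * s') := by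
        rw [Real.mul_rpow (by norm_num) (by positivity), ← two_rpow_mul_nat,
          Real.rpow_mul (by norm_num : (0 : ℝ) ≤ 2), Real.rpow_natCast]
      rw [e]
      gcongr
      have : (1 : ℝ) ≤ 2 ^ j := one_le_pow₀ (by norm_num)
      linarith
  calc (1 + ‖ξ‖) ^ (2 * s') = (1 + ‖ξ‖) ^ (2 * s') * 1 := (mul_one _).symm
    _ ≤ (1 + ‖ξ‖) ^ (2 * s') * (2 * loSym χ ξ ^ 2
      + 2 * ((1 - r)⁻¹ * ∑ j ∈ Finset.range N, (r ^ j)⁻¹ * c j ^ 2)) := by gcongr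
    _ = 2 * ((1 + ‖ξ‖) ^ (2 * s') * loSym χ ξ ^ 2)
      + ∑ j ∈ Finset.range N, 2 * (1 - r)⁻¹ * (r ^ j)⁻¹ * ((1 + ‖ξ‖) ^ (2 * s') * c j ^ 2) := by
        simp only [Finset.mul_sum, mul_add]
        congr 1
        · ring
        · exact Finset.sum_congr rfl fun j _ => by ring
    _ ≤ 2 * (2 ^ (2 * s') * loSym χ ξ ^ 2) + ∑ j ∈ Finset.range N, 2 * (1 - r)⁻¹ * (r ^ j)⁻¹ *
          (3 ^ (2 * s') * ((2 : ℝ) ^ (2 * s')) ^ j * c j ^ 2) := by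
        gcongr 2 * ?_ + ∑ j ∈ _, _ * ?_ with j
        exact e2 j
    _ = _ := by
        congr 1
        · ring
        · exact Finset.sum_congr rfl fun j _ => by rw [mul_pow, inv_pow]; ring

theorem lintegral_sym_mul_rft {m : E3 → ℝ} (h : IsSym m) {F : E3 → ℝ} (hF : MemLp F 2 volume) {b : ℝ}
    (hb : 0 ≤ b) (hle : eLpNorm (rconv (kerS h) F) 2 volume ≤ ENNReal.ofReal b) :
    ∫⁻ ξ, ENNReal.ofReal (m ξ ^ 2) * ‖rft F ξ‖ₑ ^ 2 ≤ ENNReal.ofReal (b ^ 2) := by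
  have h1 := (memLp_rconv_of_le (by norm_num) hF (kerS h) hle hb).1
  calc _ = ∫⁻ ξ, ‖rft (rconv (kerS h) F) ξ‖ₑ ^ 2 := by
        refine lintegral_congr_ae ?_
        filter_upwards [rft_rconv h hF] with ξ hξ
        rw [hξ, enorm_mul, mul_pow, ← ofReal_norm (m ξ : ℂ), ← ENNReal.ofReal_pow (norm_nonneg _),
          Complex.norm_real, Real.norm_eq_abs, sq_abs]
    _ = eLpNorm (rconv (kerS h) F) 2 volume ^ 2 := by rw [← eLpNorm_two_sq, eLpNorm_rft h1]
    _ ≤ ENNReal.ofReal b ^ 2 := by gcongr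
    _ = _ := (ENNReal.ofReal_pow hb 2).symm

/-- The embedding of `B^s_{2,∞}` into `H^{s'}`: the pointwise weight bound is integrated block by
block and the blocks sum geometrically. -/
theorem exists_sobolev_bound {χ : E3 → ℝ} (hχ : IsLPProfile χ) {s' s : ℝ} (hs0 : 0 ≤ s') (hs : s' < s) :
    ∃ C : ℝ, 0 ≤ C ∧ ∀ F B, BlockData2 hχ s F B →
      ∫⁻ ξ, ENNReal.ofReal ((1 + ‖ξ‖) ^ (2 * s')) * ‖rft F ξ‖ₑ ^ 2 ≤ ENNReal.ofReal (C * B ^ 2) := by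
  -- The available decay per block is `2^{-2(s-s')} = r²`. One factor `r` pays for the weighted
  -- Cauchy–Schwarz inequality, the other makes the series geometric.
  set r : ℝ := 2 ^ (-(s - s')) with hr
  have h0 : 0 < r := by positivity
  have h1 : r < 1 := Real.rpow_lt_one_of_one_lt_of_neg (by norm_num) (by linarith)
  have hr1 : 0 < 1 - r := by linarith
  set K : ℝ := 2 * (1 - r)⁻¹ * 3 ^ (2 * s') with hK
  have hK0 : 0 ≤ K := by positivity
  set A : ℝ := (2 : ℝ) ^ (2 * s') * r⁻¹ with hA
  have hA0 : 0 < A := by positivity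
  have hAr : A * ((2 : ℝ) ^ s)⁻¹ ^ 2 = r := by
    rw [hA, hr, ← Real.rpow_neg (by norm_num), ← Real.rpow_neg (by norm_num), ← Real.rpow_natCast,
      ← Real.rpow_mul (by norm_num), ← Real.rpow_add (by norm_num), ← Real.rpow_add (by norm_num)]
    congr 1; push_cast; ring
  refine ⟨2 * 2 ^ (2 * s') + K * (1 - r)⁻¹, by positivity, fun F B hF => ?_⟩
  have hB := hF.nonneg
  have hmeas : AEMeasurable (fun ξ => ‖rft F ξ‖ₑ ^ 2) volume := (memLp_rft F).1.enorm.pow_const 2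
  have mlo : Measurable fun ξ => ENNReal.ofReal (loSym χ ξ ^ 2) :=
    (hχ.isSym_loSym.smooth.continuous.pow 2).measurable.ennreal_ofReal
  have mbl : ∀ j : ℕ, Measurable fun ξ => ENNReal.ofReal (χ (((2 : ℝ) ^ (-(j : ℤ))) • ξ) ^ 2) := fun j =>
    ((hχ.isSym.dilate_two j).smooth.continuous.pow 2).measurable.ennreal_ofReal
  have hpt : ∀ ξ, ENNReal.ofReal ((1 + ‖ξ‖) ^ (2 * s')) * ‖rft F ξ‖ₑ ^ 2 ≤
      ENNReal.ofReal (2 * 2 ^ (2 * s')) * (ENNReal.ofReal (loSym χ ξ ^ 2) * ‖rft F ξ‖ₑ ^ 2)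
      + ∑' j : ℕ, ENNReal.ofReal (K * A ^ j) *
        (ENNReal.ofReal (χ (((2 : ℝ) ^ (-(j : ℤ))) • ξ) ^ 2) * ‖rft F ξ‖ₑ ^ 2) := by
    intro ξ
    obtain ⟨N, hN⟩ := weight_le hχ hs0 h0 h1 ξ
    calc _ ≤ ENNReal.ofReal (2 * 2 ^ (2 * s') * loSym χ ξ ^ 2
      + ∑ j ∈ Finset.range N, K * A ^ j * χ (((2 : ℝ) ^ (-(j : ℤ))) • ξ) ^ 2) * ‖rft F ξ‖ₑ ^ 2 := by
          gcongr
      _ = ENNReal.ofReal (2 * 2 ^ (2 * s')) * (ENNReal.ofReal (loSym χ ξ ^ 2) * ‖rft F ξ‖ₑ ^ 2)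
      + ∑ j ∈ Finset.range N, ENNReal.ofReal (K * A ^ j) *
        (ENNReal.ofReal (χ (((2 : ℝ) ^ (-(j : ℤ))) • ξ) ^ 2) * ‖rft F ξ‖ₑ ^ 2) := by
          rw [ENNReal.ofReal_add (by positivity) (Finset.sum_nonneg fun j _ => by positivity),
            ENNReal.ofReal_sum_of_nonneg fun j _ => by positivity, add_mul, Finset.sum_mul,
            ENNReal.ofReal_mul (by positivity), mul_assoc]
          congr 1
          exact Finset.sum_congr rfl fun j _ => by
            rw [ENNReal.ofReal_mul (by positivity), mul_assoc]
      _ ≤ _ := by gcongr; exact ENNReal.sum_le_tsum _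
  calc _ ≤ ∫⁻ ξ, (ENNReal.ofReal (2 * 2 ^ (2 * s')) * (ENNReal.ofReal (loSym χ ξ ^ 2) * ‖rft F ξ‖ₑ ^ 2)
      + ∑' j : ℕ, ENNReal.ofReal (K * A ^ j) *
        (ENNReal.ofReal (χ (((2 : ℝ) ^ (-(j : ℤ))) • ξ) ^ 2) * ‖rft F ξ‖ₑ ^ 2)) := lintegral_mono hpt
    _ = ENNReal.ofReal (2 * 2 ^ (2 * s')) * (∫⁻ ξ, ENNReal.ofReal (loSym χ ξ ^ 2) * ‖rft F ξ‖ₑ ^ 2)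
      + ∑' j : ℕ, ENNReal.ofReal (K * A ^ j) *
        ∫⁻ ξ, ENNReal.ofReal (χ (((2 : ℝ) ^ (-(j : ℤ))) • ξ) ^ 2) * ‖rft F ξ‖ₑ ^ 2 := by
        have m1 : AEMeasurable (fun ξ => ENNReal.ofReal (loSym χ ξ ^ 2) * ‖rft F ξ‖ₑ ^ 2) volume :=
          mlo.aemeasurable.mul hmeas
        have m2 : ∀ j : ℕ, AEMeasurable (fun ξ => ENNReal.ofReal (χ (((2 : ℝ) ^ (-(j : ℤ))) • ξ) ^ 2) *
          ‖rft F ξ‖ₑ ^ 2) volume := fun j => (mbl j).aemeasurable.mul hmeas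
        rw [lintegral_add_left' (m1.const_mul _), lintegral_const_mul'' _ m1,
          lintegral_tsum fun j => (m2 j).const_mul _]
        congr 2; ext j
        rw [lintegral_const_mul'' _ (m2 j)]
    _ ≤ ENNReal.ofReal (2 * 2 ^ (2 * s')) * ENNReal.ofReal (B ^ 2)
      + ∑' j : ℕ, ENNReal.ofReal (K * A ^ j) * ENNReal.ofReal (((((2 : ℝ) ^ s) ^ j)⁻¹ * B) ^ 2) := by
        gcongr with j
        · exact lintegral_sym_mul_rft _ hF.memLp hB hF.low
        · exact lintegral_sym_mul_rft (hχ.isSym.dilate_two j) hF.memLp (by positivity) (hF.block j)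
    _ = ENNReal.ofReal (2 * 2 ^ (2 * s') * B ^ 2) + ∑' j : ℕ, ENNReal.ofReal (K * B ^ 2 * r ^ j) := by
        rw [← ENNReal.ofReal_mul (by positivity)]
        congr 2; ext j
        rw [← ENNReal.ofReal_mul (by positivity)]
        congr 1
        rw [← hAr, mul_pow A, ← inv_pow]
        ring
    _ = ENNReal.ofReal (2 * 2 ^ (2 * s') * B ^ 2) + ENNReal.ofReal (K * B ^ 2 * (1 - r)⁻¹) := by
        rw [← ENNReal.ofReal_tsum_of_nonneg (fun j => by positivity)
          ((summable_geometric_of_lt_one h0.le h1).mul_left _), tsum_mul_left,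
          tsum_geometric_of_lt_one h0.le h1]
    _ = _ := by
        rw [← ENNReal.ofReal_add (by positivity) (by positivity)]
        congr 1; ring

/-- Cauchy–Schwarz with `(1 + |ξ|)^{-s'}`, which is square integrable on `ℝ³` exactly when `s' >
3/2`. -/
theorem exists_l1_bound {s' : ℝ} (hs : 3 / 2 < s') : ∃ C : ℝ, 0 ≤ C ∧ ∀ (G : E3 → ℂ) (B : ℝ), 0 ≤ B →
    AEStronglyMeasurable G volume →
    ∫⁻ ξ, ENNReal.ofReal ((1 + ‖ξ‖) ^ (2 * s')) * ‖G ξ‖ₑ ^ 2 ≤ ENNReal.ofReal (B ^ 2) →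
    ∫⁻ ξ, ‖G ξ‖ₑ ≤ ENNReal.ofReal (C * B) := by
  have hi : Integrable (fun ξ : E3 => (1 + ‖ξ‖) ^ (-(2 * s'))) volume :=
    integrable_one_add_norm (by simp; linarith)
  refine ⟨Real.sqrt (∫ ξ : E3, (1 + ‖ξ‖) ^ (-(2 * s'))), Real.sqrt_nonneg _, fun G B hB hG h => ?_⟩
  have hI : 0 ≤ ∫ ξ : E3, (1 + ‖ξ‖) ^ (-(2 * s')) := integral_nonneg fun ξ => by positivity
  rw [← ENNReal.pow_le_pow_left_iff two_ne_zero, ← ENNReal.ofReal_pow (by positivity), mul_pow,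
    Real.sq_sqrt hI, ENNReal.ofReal_mul hI]
  have m1 : Measurable fun ξ : E3 => ENNReal.ofReal ((1 + ‖ξ‖) ^ (-s')) := by fun_prop
  have m2 : Measurable fun ξ : E3 => ENNReal.ofReal ((1 + ‖ξ‖) ^ s') := by fun_prop
  have e : ∀ (ξ : E3) (t : ℝ), ENNReal.ofReal ((1 + ‖ξ‖) ^ t) ^ 2 = ENNReal.ofReal ((1 + ‖ξ‖) ^ (2 * t)) :=
    fun ξ t => by
      rw [← ENNReal.ofReal_pow (by positivity), mul_comm 2 t, Real.rpow_mul (by positivity)]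
      norm_num
  calc (∫⁻ ξ, ‖G ξ‖ₑ) ^ 2
      = (∫⁻ ξ, ENNReal.ofReal ((1 + ‖ξ‖) ^ (-s')) * (ENNReal.ofReal ((1 + ‖ξ‖) ^ s') * ‖G ξ‖ₑ)) ^ 2 := by
        congr 2; ext ξ
        rw [← mul_assoc, ← ENNReal.ofReal_mul (by positivity), ← Real.rpow_add (by positivity)]
        simp
    _ ≤ (∫⁻ ξ, ENNReal.ofReal ((1 + ‖ξ‖) ^ (-s')) ^ 2) *
        ∫⁻ ξ, (ENNReal.ofReal ((1 + ‖ξ‖) ^ s') * ‖G ξ‖ₑ) ^ 2 :=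
        lintegral_mul_sq_le m1.aemeasurable (m2.aemeasurable.mul hG.enorm)
    _ ≤ _ := by
        refine mul_le_mul' (le_of_eq ?_) ?_
        · simp only [e]
          rw [ofReal_integral_eq_lintegral_ofReal hi (Eventually.of_forall fun ξ => by positivity)]
          simp
        · simpa only [mul_pow, e] using h

end MLANS

end

noncomputable section

namespace MLANS

open LineDeriv

/-! ### Sobolev functions of integer order -/

/-- `f ∈ Hⁿ`. -/
def HPow (n : ℕ) (f : E3 → ℝ) : Prop :=
  MemLp f 2 volume ∧ MemLp (fun ξ => ((‖ξ‖ : ℝ) : ℂ) ^ n * rft f ξ) 2 volume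

theorem continuous_norm_pow (n : ℕ) : Continuous fun ξ : E3 => ((‖ξ‖ : ℝ) : ℂ) ^ n := by fun_prop

theorem pow_le_one_add_pow {x : ℝ} (hx : 0 ≤ x) {m n : ℕ} (h : m ≤ n) : x ^ m ≤ 1 + x ^ n := by
  rcases le_total x 1 with h1 | h1
  · exact (pow_le_one₀ hx h1).trans (by linarith [pow_nonneg hx n])
  · exact (pow_le_pow_right₀ h1 h).trans (by linarith)

theorem HPow.mono {m n : ℕ} {f : E3 → ℝ} (h : HPow n f) (hmn : m ≤ n) : HPow m f := by
  refine ⟨h.1, ((memLp_rft f).norm.add h.2.norm).mono'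
    ((continuous_norm_pow m).aestronglyMeasurable.mul (memLp_rft f).1) (Eventually.of_forall fun ξ => ?_)⟩
  simp only [norm_mul, norm_pow, Complex.norm_real, norm_norm, Pi.add_apply]
  have := pow_le_one_add_pow (norm_nonneg ξ) hmn
  nlinarith [norm_nonneg (rft f ξ)]

theorem HPow.congr_rft {n : ℕ} {f : E3 → ℝ} {G : E3 → ℂ} (hf : MemLp f 2 volume)
    (h : rft f =ᵐ[volume] G) (hG : MemLp (fun ξ => ((‖ξ‖ : ℝ) : ℂ) ^ n * G ξ) 2 volume) : HPow n f :=
  ⟨hf, hG.ae_eq (by filter_upwards [h] with ξ hξ; rw [hξ])⟩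

theorem HPow.add {n : ℕ} {f g : E3 → ℝ} (hf : HPow n f) (hg : HPow n g) :
    HPow n fun x => f x + g x := by
  have h : MemLp (fun ξ => ((‖ξ‖ : ℝ) : ℂ) ^ n * (rft f ξ + rft g ξ)) 2 volume := by
    simp only [mul_add]
    exact hf.2.add hg.2
  exact HPow.congr_rft (hf.1.add hg.1) (rft_add hf.1 hg.1) h

theorem HPow.const_mul {n : ℕ} {f : E3 → ℝ} (hf : HPow n f) (c : ℝ) : HPow n fun x => c * f x := by
  have h : MemLp (fun ξ => ((‖ξ‖ : ℝ) : ℂ) ^ n * (c * rft f ξ)) 2 volume := by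
    have := hf.2.const_mul (c : ℂ)
    refine this.ae_eq (Eventually.of_forall fun ξ => ?_)
    simp only; ring
  exact HPow.congr_rft (hf.1.const_mul c) (rft_const_mul hf.1 c) h

theorem HPow.sub {n : ℕ} {f g : E3 → ℝ} (hf : HPow n f) (hg : HPow n g) :
    HPow n fun x => f x - g x := by
  have := hf.add (hg.const_mul (-1))
  convert this using 2; ring

theorem HPow.sum {n : ℕ} {ι : Type*} (s : Finset ι) {f : ι → E3 → ℝ} (hf : ∀ i ∈ s, HPow n (f i)) :
    HPow n fun x => ∑ i ∈ s, f i x := by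
  classical
  induction s using Finset.induction_on with
  | empty =>
    have h0 : HPow n fun _ => (0 : ℝ) := by
      refine HPow.congr_rft (MemLp.zero (p := 2)) (G := fun _ => 0) ?_ (by simp)
      have := rft_const_mul (f := fun _ => (0 : ℝ)) (MemLp.zero (p := 2)) 0
      simpa using this
    simpa using h0
  | insert i s hi ih =>
    simp only [Finset.sum_insert hi]
    exact (hf i (by simp)).add (ih fun j hj => hf j (by simp [hj]))

theorem norm_dsym_le (k : Fin 3) (ξ : E3) : ‖dsym k ξ‖ ≤ 2 * Real.pi * ‖ξ‖ := by
  rw [dsym]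
  simp only [norm_mul, Complex.norm_ofNat, Complex.norm_real, Complex.norm_I, mul_one, Real.norm_eq_abs,
    abs_of_pos Real.pi_pos]
  gcongr
  exact abs_coord_le ξ k

theorem memLp_dsym_mul {n : ℕ} {f : E3 → ℝ} (h : HPow (n + 1) f) (k : Fin 3) :
    MemLp (fun ξ => ((‖ξ‖ : ℝ) : ℂ) ^ n * (dsym k ξ * rft f ξ)) 2 volume := by
  refine (h.2.norm.const_mul (2 * Real.pi)).mono' ((continuous_norm_pow n).aestronglyMeasurable.mul
    ((continuous_dsym k).aestronglyMeasurable.mul (memLp_rft f).1)) (Eventually.of_forall fun ξ => ?_)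
  simp only [norm_mul, norm_pow, Complex.norm_real, norm_norm]
  calc _ ≤ ‖ξ‖ ^ n * (2 * Real.pi * ‖ξ‖ * ‖rft f ξ‖) := by gcongr; exact norm_dsym_le k ξ
    _ = _ := by ring

open Classical in
/-- The square integrable weak partial derivative (zero if there is none). -/
def pd (k : Fin 3) (f : E3 → ℝ) : E3 → ℝ :=
  if h : ∃ g : E3 → ℝ, MemLp g 2 volume ∧ WD k f g then h.choose else 0

theorem HPow.pd_spec {f : E3 → ℝ} (h : HPow 1 f) (k : Fin 3) :
    MemLp (pd k f) 2 volume ∧ WD k f (pd k f) := by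
  have h1 := memLp_dsym_mul (n := 0) h k
  simp only [pow_zero, one_mul] at h1
  have h2 := exists_WD_of_memLp h.1 h1
  rw [pd, dif_pos h2]
  exact h2.choose_spec

theorem HPow.memLp_pd {f : E3 → ℝ} (h : HPow 1 f) (k : Fin 3) : MemLp (pd k f) 2 volume :=
  (h.pd_spec k).1

theorem HPow.wd {f : E3 → ℝ} (h : HPow 1 f) (k : Fin 3) : WD k f (pd k f) := (h.pd_spec k).2

theorem HPow.rft_pd {f : E3 → ℝ} (h : HPow 1 f) (k : Fin 3) :
    rft (pd k f) =ᵐ[volume] fun ξ => dsym k ξ * rft f ξ :=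
  (h.wd k).rft_eq h.1 (h.memLp_pd k)

theorem HPow.pd {n : ℕ} {f : E3 → ℝ} (h : HPow (n + 1) f) (k : Fin 3) : HPow n (pd k f) := by
  have h1 : HPow 1 f := h.mono (by omega)
  exact HPow.congr_rft (h1.memLp_pd k) (h1.rft_pd k) (memLp_dsym_mul h k)

theorem lintegral_rft_lt_top {f : E3 → ℝ} (h : HPow 2 f) : ∫⁻ ξ, ‖rft f ξ‖ₑ < ⊤ := by
  obtain ⟨C, -, hC⟩ := exists_l1_bound (s' := 2) (by norm_num)
  have hm : MemLp (fun ξ => 2 * ‖rft f ξ‖ + 2 * ‖((‖ξ‖ : ℝ) : ℂ) ^ 2 * rft f ξ‖) 2 volume :=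
    ((memLp_rft f).norm.const_mul 2).add (h.2.norm.const_mul 2)
  have hlt := (memLp_two_iff hm.1).1 hm
  refine (hC (rft f) (Real.sqrt (∫⁻ ξ, ‖2 * ‖rft f ξ‖ + 2 * ‖((‖ξ‖ : ℝ) : ℂ) ^ 2 * rft f ξ‖‖ₑ ^ 2).toReal)
    (Real.sqrt_nonneg _) (memLp_rft f).1 ?_).trans_lt ENNReal.ofReal_lt_top
  rw [Real.sq_sqrt ENNReal.toReal_nonneg, ENNReal.ofReal_toReal hlt.ne]
  refine lintegral_mono fun ξ => ?_
  rw [← ofReal_norm (rft f ξ), ← ofReal_norm (2 * ‖rft f ξ‖ + _), ← ENNReal.ofReal_pow (norm_nonneg _),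
    ← ENNReal.ofReal_pow (norm_nonneg _), ← ENNReal.ofReal_mul (by positivity)]
  refine ENNReal.ofReal_le_ofReal ?_
  rw [Real.norm_of_nonneg (by positivity), norm_mul, norm_pow, Complex.norm_real, norm_norm,
    show (2 : ℝ) * 2 = (4 : ℕ) by norm_num, Real.rpow_natCast]
  have e : (1 + ‖ξ‖) ^ 4 * ‖rft f ξ‖ ^ 2 = ((1 + ‖ξ‖) ^ 2 * ‖rft f ξ‖) ^ 2 := by ring
  rw [e]
  gcongr
  nlinarith [mul_nonneg (sq_nonneg (1 - ‖ξ‖)) (norm_nonneg (rft f ξ)), norm_nonneg (rft f ξ)]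

theorem HPow.integrable_rft {f : E3 → ℝ} (h : HPow 2 f) : Integrable (rft f) volume :=
  ⟨(memLp_rft f).1, lintegral_rft_lt_top h⟩

theorem HPow.memLp_top {f : E3 → ℝ} (h : HPow 2 f) : MemLp f ⊤ volume :=
  memLp_top_of_bound h.1.1 _ (abs_le_of_integrable_rft h.1 h.integrable_rft)

theorem WD.ae_eq_pd {k : Fin 3} {f g : E3 → ℝ} (hf : HPow 1 f) (h : WD k f g) : g =ᵐ[volume] pd k f :=
  h.unique (ae_eq_refl f) (hf.wd k)

/-- Second derivatives commute. -/
theorem HPow.pd_pd_comm {f : E3 → ℝ} (h : HPow 2 f) (j k : Fin 3) :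
    MLANS.pd j (MLANS.pd k f) =ᵐ[volume] MLANS.pd k (MLANS.pd j f) := by
  have hj := (h.pd j).mono le_rfl
  have hk := (h.pd k).mono le_rfl
  have h1 := h.mono one_le_two
  have key : rft (MLANS.pd j (MLANS.pd k f)) =ᵐ[volume] rft (MLANS.pd k (MLANS.pd j f)) := by
    filter_upwards [hk.rft_pd j, hj.rft_pd k, h1.rft_pd j, h1.rft_pd k] with ξ e1 e2 e3 e4
    rw [e1, e2, e3, e4]; ring
  have := ae_eq_of_ft (f := fun x => (MLANS.pd j (MLANS.pd k f) x : ℂ))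
    (g := fun x => (MLANS.pd k (MLANS.pd j f) x : ℂ)) (hk.memLp_pd j).ofReal (hj.memLp_pd k).ofReal key
  filter_upwards [this] with x hx
  exact_mod_cast hx

end MLANS

end

noncomputable section

namespace MLANS

open LineDeriv

/-! ### Cancellations in the energy identity -/

theorem integrable_mul_mul {f g h : E3 → ℝ} (hf : MemLp f ⊤ volume) (hg : MemLp g 2 volume)
    (hh : MemLp h 2 volume) : Integrable (fun x => f x * g x * h x) volume :=
  (memLp_top_mul hf hg).integrable_mul hh

theorem sum_ae_eq_zero {ι : Type*} (s : Finset ι) {f : ι → E3 → ℝ} (hf : ∀ i ∈ s, MemLp (f i) 2 volume)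
    (h : ∀ᵐ ξ, ∑ i ∈ s, rft (f i) ξ = 0) : ∀ᵐ x, ∑ i ∈ s, f i x = 0 := by
  have hm : MemLp (fun x => ∑ i ∈ s, f i x) 2 volume := memLp_finsetSum s hf
  have h1 : rft (fun x => ∑ i ∈ s, f i x) =ᵐ[volume] fun _ => 0 := by
    filter_upwards [rft_sum s hf, h] with ξ e1 e2
    rw [e1, e2]
  have h2 : eLpNorm (fun x => ∑ i ∈ s, f i x) 2 volume = 0 := by
    rw [← eLpNorm_rft hm, eLpNorm_congr_ae h1]; simp
  have h3 := (eLpNorm_eq_zero_iff hm.1 two_ne_zero).1 h2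
  exact h3

/-- A divergence-free field of class `Hⁿ`. -/
structure DivFree (n : ℕ) (u : Fin 3 → E3 → ℝ) : Prop where
  hpow : ∀ i, HPow n (u i)
  div : ∀ᵐ ξ, ∑ i, (ξ i : ℂ) * rft (u i) ξ = 0

theorem DivFree.sum_dsym {n : ℕ} {u : Fin 3 → E3 → ℝ} (hu : DivFree n u) :
    ∀ᵐ ξ, ∑ i, dsym i ξ * rft (u i) ξ = 0 := by
  filter_upwards [hu.div] with ξ hξ
  simp only [dsym, mul_assoc, ← Finset.mul_sum, hξ, mul_zero]

theorem DivFree.sum_pd {u : Fin 3 → E3 → ℝ} (hu : DivFree 1 u) : ∀ᵐ x, ∑ i, pd i (u i) x = 0 := by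
  refine sum_ae_eq_zero _ (fun i _ => (hu.hpow i).memLp_pd i) ?_
  have h : ∀ i, _ := fun i => (hu.hpow i).rft_pd i
  filter_upwards [hu.sum_dsym, h 0, h 1, h 2] with ξ h0 h1 h2 h3
  rw [Fin.sum_univ_three] at h0 ⊢
  rw [h1, h2, h3, h0]

theorem DivFree.mono {m n : ℕ} {u : Fin 3 → E3 → ℝ} (hu : DivFree n u) (h : m ≤ n) : DivFree m u :=
  ⟨fun i => (hu.hpow i).mono h, hu.div⟩

theorem DivFree.sum_pd_pd {u : Fin 3 → E3 → ℝ} (hu : DivFree 2 u) (k : Fin 3) :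
    ∀ᵐ x, ∑ i, pd i (pd k (u i)) x = 0 := by
  have a := fun i => (hu.hpow i).pd k
  refine sum_ae_eq_zero _ (fun i _ => (a i).memLp_pd i) ?_
  have h : ∀ i, _ := fun i => (a i).rft_pd i
  have h' : ∀ i, _ := fun i => ((hu.hpow i).mono one_le_two).rft_pd k
  filter_upwards [hu.sum_dsym, h 0, h 1, h 2, h' 0, h' 1, h' 2] with ξ h0 h1 h2 h3 h4 h5 h6
  rw [Fin.sum_univ_three] at h0 ⊢
  rw [h1, h2, h3, h4, h5, h6]
  linear_combination (dsym k ξ) * h0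

/-- Antisymmetry of the transport operator of a divergence-free field. -/
theorem DivFree.transport {u : Fin 3 → E3 → ℝ} (hu : DivFree 3 u) {f g : E3 → ℝ} (hf : HPow 1 f)
    (hg : HPow 1 g) :
    ∑ k, ∫ x, u k x * pd k f x * g x = -∑ k, ∫ x, u k x * f x * pd k g x := by
  have hu2 := hu.mono (show 2 ≤ 3 by norm_num)
  have ht : ∀ k, MemLp (u k) ⊤ volume := fun k => (hu2.hpow k).memLp_top
  have hpt : ∀ k, MemLp (pd k (u k)) ⊤ volume := fun k => ((hu.hpow k).pd k).memLp_top
  have key : ∀ k, ∫ x, u k x * f x * pd k g x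
      = -(∫ x, pd k (u k) x * f x * g x) - ∫ x, u k x * pd k f x * g x := by
    intro k
    have hw := (((hu.hpow k).mono (by norm_num : 1 ≤ 3)).wd k).mul (hf.wd k) (ht k) (hpt k) hf.1 (hf.memLp_pd k)
    have m1 : MemLp (fun x => pd k (u k) x * f x + u k x * pd k f x) 2 volume :=
      (memLp_top_mul (hpt k) hf.1).add (memLp_top_mul (ht k) (hf.memLp_pd k))
    rw [hw.integral_mul_eq (hg.wd k) (memLp_top_mul (ht k) hf.1) m1 hg.1 (hg.memLp_pd k)]
    simp only [add_mul]
    rw [integral_add (integrable_mul_mul (hpt k) hf.1 hg.1)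
      (integrable_mul_mul (ht k) (hf.memLp_pd k) hg.1)]
    ring
  have hz : ∑ k, ∫ x, pd k (u k) x * f x * g x = 0 := by
    rw [← integral_finsetSum _ fun k _ => integrable_mul_mul (hpt k) hf.1 hg.1]
    refine integral_eq_zero_of_ae ?_
    filter_upwards [(hu.mono (by norm_num : 1 ≤ 3)).sum_pd] with x hx
    simp only [← Finset.sum_mul, hx, zero_mul, Pi.zero_apply]
  simp only [key, Finset.sum_sub_distrib, Finset.sum_neg_distrib, hz]
  ring

theorem DivFree.transport_self {u : Fin 3 → E3 → ℝ} (hu : DivFree 3 u) {f : E3 → ℝ} (hf : HPow 1 f) :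
    ∑ k, ∫ x, u k x * pd k f x * f x = 0 := by
  have h := hu.transport hf hf
  have e : ∑ k, ∫ x, u k x * f x * pd k f x = ∑ k, ∫ x, u k x * pd k f x * f x :=
    Finset.sum_congr rfl fun k _ => integral_congr_ae (Eventually.of_forall fun x => by simp only; ring)
  rw [e] at h
  linarith

/-- The Laplacian. -/
def lap (f : E3 → ℝ) (x : E3) : ℝ := ∑ j, pd j (pd j f) x

theorem HPow.lap {n : ℕ} {f : E3 → ℝ} (h : HPow (n + 2) f) : HPow n (lap f) :=
  HPow.sum _ fun j _ => (h.pd j).pd j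

theorem sum_coord_sq (ξ : E3) : ∑ j, ξ j ^ 2 = ‖ξ‖ ^ 2 := by
  rw [EuclideanSpace.norm_sq_eq]; simp

theorem sum_dsym_sq (ξ : E3) : ∑ j, dsym j ξ * dsym j ξ = -(4 * Real.pi ^ 2 * ‖ξ‖ ^ 2 : ℝ) := by
  rw [← sum_coord_sq]
  push_cast
  rw [Finset.mul_sum, ← Finset.sum_neg_distrib]
  refine Finset.sum_congr rfl fun j _ => ?_
  rw [dsym]
  ring_nf
  rw [Complex.I_sq]; ring

theorem HPow.rft_lap {f : E3 → ℝ} (h : HPow 2 f) :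
    rft (MLANS.lap f) =ᵐ[volume] fun ξ => -(4 * Real.pi ^ 2 * ‖ξ‖ ^ 2 : ℝ) * rft f ξ := by
  have a := fun j => h.pd j
  have h' : ∀ j, _ := fun j => (a j).rft_pd j
  have h'' : ∀ j, _ := fun j => (h.mono one_le_two).rft_pd j
  filter_upwards [rft_sum Finset.univ fun j _ => (a j).memLp_pd j, h' 0, h' 1, h' 2, h'' 0, h'' 1, h'' 2]
    with ξ e h1 h2 h3 h4 h5 h6
  have e' : rft (MLANS.lap f) ξ = ∑ j, rft (MLANS.pd j (MLANS.pd j f)) ξ := e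
  rw [e', Fin.sum_univ_three, h1, h2, h3, h4, h5, h6, ← sum_dsym_sq, Fin.sum_univ_three]
  ring

theorem DivFree.integral_tensor_grad {u : Fin 3 → E3 → ℝ} (hu : DivFree 3 u) :
    ∑ l, ∑ k, ∫ x, u k x * u l x * pd k (u l) x = 0 := by
  refine Finset.sum_eq_zero fun l _ => ?_
  rw [← hu.transport_self ((hu.hpow l).mono (by norm_num : 1 ≤ 3))]
  exact Finset.sum_congr rfl fun k _ => integral_congr_ae (Eventually.of_forall fun x => by simp only; ring)

/-- Antisymmetry of transport puts the outer derivative on `u_l`; then one derivative of each `∂_j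
∂_j` is integrated by parts. Where it falls on `∂_k u_l`, the result is transport of `∂_j u_l`
against itself and vanishes. Only the terms where it falls on the transporting field survive. -/
theorem DivFree.integral_tensor_grad_lap {u : Fin 3 → E3 → ℝ} (hu : DivFree 3 u) :
    ∑ l, ∑ k, ∫ x, u k x * u l x * pd k (lap (u l)) x
      = ∑ l, ∑ k, ∑ j, ∫ x, pd j (u k) x * pd k (u l) x * pd j (u l) x := by
  have hu1 := hu.mono (show 1 ≤ 3 by norm_num)
  have ht : ∀ k, MemLp (u k) ⊤ volume := fun k => ((hu.mono (show 2 ≤ 3 by norm_num)).hpow k).memLp_top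
  have hP : ∀ j k, HPow 2 (pd j (u k)) := fun j k => (hu.hpow k).pd j
  have hP1 : ∀ j k, HPow 1 (pd j (u k)) := fun j k => (hP j k).mono one_le_two
  have hPP : ∀ i j k, HPow 1 (pd i (pd j (u k))) := fun i j k => (hP j k).pd i
  refine Finset.sum_congr rfl fun l _ => ?_
  have h0 := hu.transport (hu1.hpow l) ((hu.hpow l).lap)
  have h1 : ∑ k, ∫ x, u k x * u l x * pd k (lap (u l)) x
      = -∑ k, ∫ x, u k x * pd k (u l) x * lap (u l) x := by linarith
  have h2 : ∀ k j, ∫ x, u k x * pd k (u l) x * pd j (pd j (u l)) x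
      = -(∫ x, pd j (u k) x * pd k (u l) x * pd j (u l) x)
        - ∫ x, u k x * pd k (pd j (u l)) x * pd j (u l) x := by
    intro k j
    have hw := ((hu1.hpow k).wd j).mul ((hP1 k l).wd j) (ht k) (hP j k).memLp_top (hP k l).1 ((hP1 k l).memLp_pd j)
    have m1 : MemLp (fun x => pd j (u k) x * pd k (u l) x + u k x * pd j (pd k (u l)) x) 2 volume :=
      (memLp_top_mul (hP j k).memLp_top (hP k l).1).add (memLp_top_mul (ht k) ((hP1 k l).memLp_pd j))
    rw [hw.integral_mul_eq ((hP1 j l).wd j) (memLp_top_mul (ht k) (hP k l).1) m1 (hP j l).1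
      ((hP1 j l).memLp_pd j)]
    simp only [add_mul]
    rw [integral_add (integrable_mul_mul (hP j k).memLp_top (hP k l).1 (hP j l).1)
      (integrable_mul_mul (ht k) ((hP1 k l).memLp_pd j) (hP j l).1)]
    have e : ∫ x, u k x * pd j (pd k (u l)) x * pd j (u l) x
        = ∫ x, u k x * pd k (pd j (u l)) x * pd j (u l) x := by
      refine integral_congr_ae ?_
      filter_upwards [((hu.hpow l).mono (show 2 ≤ 3 by norm_num)).pd_pd_comm j k] with x hx
      rw [hx]
    rw [e]; ring
  have h3 : ∀ k, ∫ x, u k x * pd k (u l) x * lap (u l) x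
      = ∑ j, ∫ x, u k x * pd k (u l) x * pd j (pd j (u l)) x := by
    intro k
    rw [← integral_finsetSum _ fun j _ => integrable_mul_mul (ht k) (hP k l).1 (hPP j j l).1]
    refine integral_congr_ae (Eventually.of_forall fun x => ?_)
    simp only [lap, Finset.mul_sum]
  have h4 : ∑ k, ∑ j, ∫ x, u k x * pd k (pd j (u l)) x * pd j (u l) x = 0 := by
    rw [Finset.sum_comm]
    exact Finset.sum_eq_zero fun j _ => hu.transport_self (hP1 j l)
  rw [h1]
  simp only [h3, h2, Finset.sum_sub_distrib, Finset.sum_neg_distrib, h4]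
  ring

/-- The integral of `tr (∇u)³`. Moving `∂_i` off `u_j` gives two terms. One contains the divergence
of `∂_k u` and is zero. The other is the transport of `∂_i u_k` paired with `∂_k u_i`, which changes
sign by antisymmetry and is invariant under exchanging `i` and `k`. -/
theorem DivFree.integral_tr_cube {u : Fin 3 → E3 → ℝ} (hu : DivFree 3 u) :
    ∑ k, ∑ j, ∑ i, ∫ x, pd i (u j) x * pd j (u k) x * pd k (u i) x = 0 := by
  have hu1 := hu.mono (show 1 ≤ 3 by norm_num)
  have hu2 := hu.mono (show 2 ≤ 3 by norm_num)
  have ht : ∀ k, MemLp (u k) ⊤ volume := fun k => (hu2.hpow k).memLp_top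
  have hP : ∀ j k, HPow 2 (pd j (u k)) := fun j k => (hu.hpow k).pd j
  have hP1 : ∀ j k, HPow 1 (pd j (u k)) := fun j k => (hP j k).mono one_le_two
  have h2 : ∀ i j k, ∫ x, pd i (u j) x * pd j (u k) x * pd k (u i) x
      = -(∫ x, u j x * pd j (pd i (u k)) x * pd k (u i) x)
        - ∫ x, u j x * pd j (u k) x * pd i (pd k (u i)) x := by
    intro i j k
    have hw := ((hu1.hpow j).wd i).mul ((hP1 j k).wd i) (ht j) (hP i j).memLp_top (hP j k).1 ((hP1 j k).memLp_pd i)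
    have m1 : MemLp (fun x => pd i (u j) x * pd j (u k) x + u j x * pd i (pd j (u k)) x) 2 volume :=
      (memLp_top_mul (hP i j).memLp_top (hP j k).1).add (memLp_top_mul (ht j) ((hP1 j k).memLp_pd i))
    have h := hw.integral_mul_eq ((hP1 k i).wd i) (memLp_top_mul (ht j) (hP j k).1) m1 (hP k i).1
      ((hP1 k i).memLp_pd i)
    simp only [add_mul] at h
    rw [integral_add (integrable_mul_mul (hP i j).memLp_top (hP j k).1 (hP k i).1)
      (integrable_mul_mul (ht j) ((hP1 j k).memLp_pd i) (hP k i).1)] at h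
    have e : ∫ x, u j x * pd i (pd j (u k)) x * pd k (u i) x
        = ∫ x, u j x * pd j (pd i (u k)) x * pd k (u i) x := by
      refine integral_congr_ae ?_
      filter_upwards [(hu2.hpow k).pd_pd_comm i j] with x hx
      rw [hx]
    rw [e] at h
    linarith
  have h3 : ∀ k j, ∑ i, ∫ x, u j x * pd j (u k) x * pd i (pd k (u i)) x = 0 := by
    intro k j
    rw [← integral_finsetSum _ fun i _ => integrable_mul_mul (ht j) (hP j k).1 ((hP1 k i).memLp_pd i)]
    refine integral_eq_zero_of_ae ?_
    filter_upwards [hu2.sum_pd_pd k] with x hx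
    simp only [← Finset.mul_sum, hx, mul_zero, Pi.zero_apply]
  have h4 : ∑ k, ∑ i, ∑ j, ∫ x, u j x * pd j (pd i (u k)) x * pd k (u i) x = 0 := by
    have h5 : ∑ k, ∑ i, ∑ j, ∫ x, u j x * pd j (pd i (u k)) x * pd k (u i) x
        = -∑ k, ∑ i, ∑ j, ∫ x, u j x * pd i (u k) x * pd j (pd k (u i)) x := by
      simp only [hu.transport (hP1 _ _) (hP1 _ _), Finset.sum_neg_distrib]
    have h6 : ∑ k, ∑ i, ∑ j, ∫ x, u j x * pd i (u k) x * pd j (pd k (u i)) x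
        = ∑ k, ∑ i, ∑ j, ∫ x, u j x * pd j (pd i (u k)) x * pd k (u i) x := by
      rw [Finset.sum_comm]
      refine Finset.sum_congr rfl fun k _ => Finset.sum_congr rfl fun i _ => Finset.sum_congr rfl fun j _ =>
        integral_congr_ae (Eventually.of_forall fun x => ?_)
      simp only; ring
    rw [h6] at h5
    linarith
  have h7 : ∑ k, ∑ j, ∑ i, ∫ x, u j x * pd j (pd i (u k)) x * pd k (u i) x = 0 := by
    rw [← h4]
    exact Finset.sum_congr rfl fun k _ => Finset.sum_comm
  simp only [h2, Finset.sum_sub_distrib, Finset.sum_neg_distrib, h3, h7]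
  simp

end MLANS

end

noncomputable section

namespace MLANS

open LineDeriv

/-! ### The stress tensor at a fixed time -/

/-- The entries of `Def f · Rot g + Def g · Rot f` in terms of the gradients. -/
def drot (P Q : Fin 3 → Fin 3 → E3 → ℝ) (i j : Fin 3) (x : E3) : ℝ :=
  ∑ m, ((P i m x + P m i x) * (Q m j x - Q j m x) + (Q i m x + Q m i x) * (P m j x - P j m x))

theorem drot_comm (P Q : Fin 3 → Fin 3 → E3 → ℝ) : drot P Q = drot Q P := by
  funext i j x
  exact Finset.sum_congr rfl fun m _ => add_comm _ _

/-- Convolution with the Helmholtz kernel. -/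
def hconv (α : ℝ) (M : E3 → ℝ) (x : E3) : ℝ := ∫ y, helmholtzKernel α (x - y) * M y

/-- The bilinear stress `f ⊗ g + τ(f, g)`, in terms of the fields and their gradients. -/
def stressT (α : ℝ) (f : Fin 3 → E3 → ℝ) (P : Fin 3 → Fin 3 → E3 → ℝ) (g : Fin 3 → E3 → ℝ)
    (Q : Fin 3 → Fin 3 → E3 → ℝ) (k l : Fin 3) (x : E3) : ℝ :=
  f k x * g l x + α ^ 2 / 2 * hconv α (drot P Q k l) x

/-- The components of a vector field. -/
def comp (f : E3 → E3) (i : Fin 3) (x : E3) : ℝ := f x i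

theorem tau_eq (α : ℝ) {f g : E3 → E3} {P Q : Fin 3 → Fin 3 → E3 → ℝ}
    (hP : ∀ i j, WD i (comp f j) (P i j)) (hQ : ∀ i j, WD i (comp g j) (Q i j)) (x : E3) (k l : Fin 3) :
    tau α f g x k l = α ^ 2 / 2 * hconv α (drot P Q k l) x := by
  rw [tau, hconv]
  congr 1
  refine integral_congr_ae ?_
  filter_upwards [weakGrad_ae_eq hP, weakGrad_ae_eq hQ] with y h1 h2
  congr 1
  simp only [defTensor, rotTensor, Matrix.add_apply, Matrix.mul_apply, Matrix.sub_apply,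
    Matrix.transpose_apply, h1, h2, drot, Finset.sum_add_distrib]

/-- Symmetry of the Reynolds stress splits `2τ(u,v)` as `τ(u,v) + τ(v,u)`, so that all three groups
have the shape `f ⊗ g + τ(f,g)`. -/
theorem stress_eq (α : ℝ) {u v : E3 → E3} {P Q : Fin 3 → Fin 3 → E3 → ℝ}
    (hP : ∀ i j, WD i (comp u j) (P i j)) (hQ : ∀ i j, WD i (comp v j) (Q i j)) (x : E3) (k l : Fin 3) :
    (tensor u u x + tensor u v x + tensor v u x + (tau α u u x + (2 : ℝ) • tau α u v x)) k l
      = stressT α (comp u) P (comp u) P k l x + stressT α (comp u) P (comp v) Q k l x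
        + stressT α (comp v) Q (comp u) P k l x := by
  simp only [Matrix.add_apply, Matrix.smul_apply, tau_eq α hP hP, tau_eq α hP hQ, stressT, drot_comm Q P,
    tensor, comp, smul_eq_mul]
  ring

theorem memLp_drot {P Q : Fin 3 → Fin 3 → E3 → ℝ} (hP : ∀ i j, MemLp (P i j) 2 volume)
    (hQ : ∀ i j, MemLp (Q i j) ⊤ volume) (i j : Fin 3) : MemLp (drot P Q i j) 2 volume := by
  refine memLp_finsetSum _ fun m _ => MemLp.add ?_ ?_
  · have := memLp_top_mul ((hQ m j).sub (hQ j m)) ((hP i m).add (hP m i))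
    refine this.ae_eq (Eventually.of_forall fun x => ?_)
    simp only [Pi.add_apply, Pi.sub_apply]; ring
  · exact memLp_top_mul ((hQ i m).add (hQ m i)) ((hP m j).sub (hP j m))

theorem abs_drot_le {P Q : Fin 3 → Fin 3 → E3 → ℝ} {x : E3} {p b : ℝ} (hP : ∀ i j, |P i j x| ≤ p)
    (hQ : ∀ i j, |Q i j x| ≤ b) (i j : Fin 3) : |drot P Q i j x| ≤ 24 * (b * p) := by
  have hp : 0 ≤ p := (abs_nonneg _).trans (hP 0 0)
  have hb : 0 ≤ b := (abs_nonneg _).trans (hQ 0 0)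
  have h1 : ∀ m, |(P i m x + P m i x) * (Q m j x - Q j m x) + (Q i m x + Q m i x) * (P m j x - P j m x)|
      ≤ 8 * (b * p) := fun m => by
    refine (abs_add_le _ _).trans ?_
    rw [abs_mul, abs_mul]
    have a1 := (abs_add_le (P i m x) (P m i x)).trans (add_le_add (hP i m) (hP m i))
    have a2 := (abs_sub (Q m j x) (Q j m x)).trans (add_le_add (hQ m j) (hQ j m))
    have a3 := (abs_add_le (Q i m x) (Q m i x)).trans (add_le_add (hQ i m) (hQ m i))
    have a4 := (abs_sub (P m j x) (P j m x)).trans (add_le_add (hP m j) (hP j m))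
    have := mul_le_mul a1 a2 (abs_nonneg _) (by linarith)
    have := mul_le_mul a3 a4 (abs_nonneg _) (by linarith)
    nlinarith
  refine (Finset.abs_sum_le_sum_abs _ _).trans ((Finset.sum_le_sum fun m _ => h1 m).trans_eq ?_)
  simp; ring

theorem rft_hconv {α : ℝ} (hα : 0 < α) {M : E3 → ℝ} (hM : MemLp M 2 volume) :
    MemLp (hconv α M) 2 volume ∧ rft (hconv α M) =ᵐ[volume] fun ξ => hsym α ξ * rft M ξ :=
  rft_helmholtz_conv hα hM

theorem rft_stressT {α : ℝ} (hα : 0 < α) {f g : Fin 3 → E3 → ℝ} {P Q : Fin 3 → Fin 3 → E3 → ℝ}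
    {k l : Fin 3} (hfg : MemLp (fun x => f k x * g l x) 2 volume) (hd : MemLp (drot P Q k l) 2 volume) :
    MemLp (stressT α f P g Q k l) 2 volume ∧ rft (stressT α f P g Q k l) =ᵐ[volume] fun ξ =>
      rft (fun x => f k x * g l x) ξ + α ^ 2 / 2 * (hsym α ξ * rft (drot P Q k l) ξ) := by
  obtain ⟨h1, h2⟩ := rft_hconv hα hd
  refine ⟨hfg.add (h1.const_mul _), ?_⟩
  filter_upwards [rft_add hfg (h1.const_mul (α ^ 2 / 2)), rft_const_mul h1 (α ^ 2 / 2), h2] with ξ e1 e2 e3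
  have e1' : rft (stressT α f P g Q k l) ξ = _ := e1
  rw [e1', e2, e3]
  push_cast; ring

theorem ae_sub_left {p : E3 → Prop} (h : ∀ᵐ x, p x) (ξ : E3) : ∀ᵐ η : E3, p (ξ - η) :=
  (measurePreserving_const_sub ξ).quasiMeasurePreserving.ae h

/-- Products of functions with controlled Fourier transforms. -/
theorem rft_mul_le {f g : E3 → ℝ} (hf : MemLp f 2 volume) (hg : MemLp g 2 volume)
    (hfg : MemLp (fun x => f x * g x) 2 volume) {a b : E3 → ℝ≥0∞} (ha : ∀ᵐ ξ, ‖rft f ξ‖ₑ ≤ a ξ)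
    (hb : ∀ᵐ ξ, ‖rft g ξ‖ₑ ≤ b ξ) :
    ∀ᵐ ξ, ‖rft (fun x => f x * g x) ξ‖ₑ ≤ ∫⁻ η, b (ξ - η) * a η := by
  filter_upwards [rft_mul hf hg hfg] with ξ h
  refine h.trans (lintegral_mono_ae ?_)
  filter_upwards [ha, ae_sub_left hb ξ] with η h1 h2
  exact mul_le_mul' h2 h1

theorem rft_add_le {f g : E3 → ℝ} (hf : MemLp f 2 volume) (hg : MemLp g 2 volume) {a b : E3 → ℝ≥0∞}
    (ha : ∀ᵐ ξ, ‖rft f ξ‖ₑ ≤ a ξ) (hb : ∀ᵐ ξ, ‖rft g ξ‖ₑ ≤ b ξ) :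
    ∀ᵐ ξ, ‖rft (fun x => f x + g x) ξ‖ₑ ≤ a ξ + b ξ := by
  filter_upwards [rft_add hf hg, ha, hb] with ξ e h1 h2
  rw [e]
  exact (enorm_add_le _ _).trans (add_le_add h1 h2)

theorem rft_sub_le {f g : E3 → ℝ} (hf : MemLp f 2 volume) (hg : MemLp g 2 volume) {a b : E3 → ℝ≥0∞}
    (ha : ∀ᵐ ξ, ‖rft f ξ‖ₑ ≤ a ξ) (hb : ∀ᵐ ξ, ‖rft g ξ‖ₑ ≤ b ξ) :
    ∀ᵐ ξ, ‖rft (fun x => f x - g x) ξ‖ₑ ≤ a ξ + b ξ := by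
  filter_upwards [rft_sub hf hg, ha, hb] with ξ e h1 h2
  rw [e]
  exact (enorm_sub_le).trans (add_le_add h1 h2)

theorem rft_sum_le {ι : Type*} (s : Finset ι) {f : ι → E3 → ℝ} (hf : ∀ i ∈ s, MemLp (f i) 2 volume)
    {a : ι → E3 → ℝ≥0∞} (ha : ∀ i ∈ s, ∀ᵐ ξ, ‖rft (f i) ξ‖ₑ ≤ a i ξ) :
    ∀ᵐ ξ, ‖rft (fun x => ∑ i ∈ s, f i x) ξ‖ₑ ≤ ∑ i ∈ s, a i ξ := by
  have h := (ae_ball_iff s.countable_toSet).2 ha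
  filter_upwards [rft_sum s hf, h] with ξ e h1
  rw [e]
  exact (enorm_sum_le _ _).trans (Finset.sum_le_sum fun i hi => h1 i hi)

/-- The convolution of two nonnegative functions. -/
def cv (a b : E3 → ℝ≥0∞) (ξ : E3) : ℝ≥0∞ := ∫⁻ η, a (ξ - η) * b η

theorem cv_const_mul_left {a b : E3 → ℝ≥0∞} {c : ℝ≥0∞} (hc : c ≠ ⊤) (ξ : E3) :
    cv (fun x => c * a x) b ξ = c * cv a b ξ := by
  simp only [cv, mul_assoc]
  rw [lintegral_const_mul' _ _ hc]

theorem cv_const_mul_right {a b : E3 → ℝ≥0∞} {c : ℝ≥0∞} (hc : c ≠ ⊤) (ξ : E3) :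
    cv a (fun x => c * b x) ξ = c * cv a b ξ := by
  simp only [cv, mul_left_comm _ c]
  rw [lintegral_const_mul' _ _ hc]

theorem rft_drot_le {P Q : Fin 3 → Fin 3 → E3 → ℝ} (hP : ∀ i j, MemLp (P i j) 2 volume)
    (hQ : ∀ i j, MemLp (Q i j) 2 volume) (hQt : ∀ i j, MemLp (Q i j) ⊤ volume) {p q : E3 → ℝ≥0∞}
    (hp : ∀ i j, ∀ᵐ ξ, ‖rft (P i j) ξ‖ₑ ≤ p ξ) (hq : ∀ i j, ∀ᵐ ξ, ‖rft (Q i j) ξ‖ₑ ≤ q ξ) (i j : Fin 3) :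
    ∀ᵐ ξ, ‖rft (drot P Q i j) ξ‖ₑ ≤ 12 * (cv q p ξ + cv p q ξ) := by
  have key : ∀ m, ∀ᵐ ξ, ‖rft (fun x => (P i m x + P m i x) * (Q m j x - Q j m x)
      + (Q i m x + Q m i x) * (P m j x - P j m x)) ξ‖ₑ ≤ 4 * (cv q p ξ + cv p q ξ) := by
    intro m
    have a1 : MemLp (fun x => P i m x + P m i x) 2 volume := (hP i m).add (hP m i)
    have a2 : MemLp (fun x => Q m j x - Q j m x) 2 volume := (hQ m j).sub (hQ j m)
    have a3 : MemLp (fun x => Q i m x + Q m i x) 2 volume := (hQ i m).add (hQ m i)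
    have a4 : MemLp (fun x => P m j x - P j m x) 2 volume := (hP m j).sub (hP j m)
    have a2t : MemLp (fun x => Q m j x - Q j m x) ⊤ volume := (hQt m j).sub (hQt j m)
    have a3t : MemLp (fun x => Q i m x + Q m i x) ⊤ volume := (hQt i m).add (hQt m i)
    have p1 : MemLp (fun x => (P i m x + P m i x) * (Q m j x - Q j m x)) 2 volume :=
      (memLp_top_mul a2t a1).ae_eq (Eventually.of_forall fun x => mul_comm _ _)
    have p2 : MemLp (fun x => (Q i m x + Q m i x) * (P m j x - P j m x)) 2 volume := memLp_top_mul a3t a4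
    have b1 := rft_mul_le a1 a2 p1 (rft_add_le (hP i m) (hP m i) (hp i m) (hp m i))
      (rft_sub_le (hQ m j) (hQ j m) (hq m j) (hq j m))
    have b2 := rft_mul_le a3 a4 p2 (rft_add_le (hQ i m) (hQ m i) (hq i m) (hq m i))
      (rft_sub_le (hP m j) (hP j m) (hp m j) (hp j m))
    filter_upwards [rft_add_le p1 p2 b1 b2] with ξ h
    refine h.trans (le_of_eq ?_)
    have e1 : ∫⁻ η, (q (ξ - η) + q (ξ - η)) * (p η + p η) = 4 * cv q p ξ := by
      rw [cv, ← lintegral_const_mul' _ _ (by norm_num)]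
      congr 1; ext η; ring
    have e2 : ∫⁻ η, (p (ξ - η) + p (ξ - η)) * (q η + q η) = 4 * cv p q ξ := by
      rw [cv, ← lintegral_const_mul' _ _ (by norm_num)]
      congr 1; ext η; ring
    rw [e1, e2, mul_add]
  have hm : ∀ m, MemLp (fun x => (P i m x + P m i x) * (Q m j x - Q j m x)
      + (Q i m x + Q m i x) * (P m j x - P j m x)) 2 volume := fun m => by
    refine MemLp.add ?_ ?_
    · exact (memLp_top_mul ((hQt m j).sub (hQt j m)) ((hP i m).add (hP m i))).ae_eq
        (Eventually.of_forall fun x => mul_comm _ _)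
    · exact memLp_top_mul ((hQt i m).add (hQt m i)) ((hP m j).sub (hP j m))
  have h := rft_sum_le Finset.univ (fun m _ => hm m) (fun m _ => key m)
  filter_upwards [h] with ξ h
  refine (show ‖rft (drot P Q i j) ξ‖ₑ ≤ _ from h).trans (le_of_eq ?_)
  rw [Finset.sum_const, Finset.card_univ, Fintype.card_fin, nsmul_eq_mul, ← mul_assoc]
  norm_num

end MLANS

end

noncomputable section

namespace MLANS

open LineDeriv

/-! ### The stress paired with the Helmholtz-filtered velocity -/

theorem integrable_mul_two {f g : E3 → ℝ} (hf : MemLp f 2 volume) (hg : MemLp g 2 volume) :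
    Integrable (fun x => f x * g x) volume := hf.integrable_mul hg

/-- A field in `W^{2,∞}` with its first and second derivatives. -/
structure VDat (b : ℝ) (v : Fin 3 → E3 → ℝ) (Q : Fin 3 → Fin 3 → E3 → ℝ)
    (R : Fin 3 → Fin 3 → Fin 3 → E3 → ℝ) : Prop where
  bound : ∀ i, ∀ᵐ x, |v i x| ≤ b
  wd : ∀ j i, WD j (v i) (Q j i)
  bound_grad : ∀ j i x, |Q j i x| ≤ b
  wd_grad : ∀ k j i, WD k (Q j i) (R k j i)
  bound_hess : ∀ k j i x, |R k j i x| ≤ b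

namespace VDat

variable {b : ℝ} {v : Fin 3 → E3 → ℝ} {Q : Fin 3 → Fin 3 → E3 → ℝ}
  {R : Fin 3 → Fin 3 → Fin 3 → E3 → ℝ}

theorem nonneg (h : VDat b v Q R) : 0 ≤ b := (abs_nonneg _).trans (h.bound_grad 0 0 0)

theorem memLp (h : VDat b v Q R) (i : Fin 3) : MemLp (v i) ⊤ volume :=
  memLp_top_of_bound (h.wd 0 i).1.aestronglyMeasurable b (h.bound i)

theorem memLp_grad (h : VDat b v Q R) (j i : Fin 3) : MemLp (Q j i) ⊤ volume :=
  memLp_top_of_bound (h.wd j i).2.1.aestronglyMeasurable b (Eventually.of_forall (h.bound_grad j i))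

theorem memLp_hess (h : VDat b v Q R) (k j i : Fin 3) : MemLp (R k j i) ⊤ volume :=
  memLp_top_of_bound (h.wd_grad k j i).2.1.aestronglyMeasurable b
    (Eventually.of_forall (h.bound_hess k j i))

end VDat

/-- The gradient of a field. -/
def gr (u : Fin 3 → E3 → ℝ) (i j : Fin 3) : E3 → ℝ := pd i (u j)

/-- `(1 - α² Δ) f`. -/
def hel (α : ℝ) (f : E3 → ℝ) (x : E3) : ℝ := f x - α ^ 2 * lap f x

theorem HPow.hel {n : ℕ} {f : E3 → ℝ} (h : HPow (n + 2) f) (α : ℝ) : HPow n (hel α f) :=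
  (h.mono (by omega)).sub (h.lap.const_mul _)

theorem hsym_inv (α : ℝ) (ξ : E3) : (hsym α ξ : ℂ) * (1 + α ^ 2 * (4 * Real.pi ^ 2 * ‖ξ‖ ^ 2 : ℝ)) = 1 := by
  rw [hsym]
  have h : (1 + (2 * Real.pi * α * ‖ξ‖) ^ 2 : ℝ) ≠ 0 := by positivity
  have : ((1 / (1 + (2 * Real.pi * α * ‖ξ‖) ^ 2) * (1 + α ^ 2 * (4 * Real.pi ^ 2 * ‖ξ‖ ^ 2)) : ℝ) : ℂ)
      = ((1 : ℝ) : ℂ) := by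
    congr 1; field_simp; ring
  push_cast at this ⊢
  exact this

theorem HPow.rft_hel {f : E3 → ℝ} (h : HPow 2 f) (α : ℝ) :
    rft (MLANS.hel α f) =ᵐ[volume] fun ξ => (1 + α ^ 2 * (4 * Real.pi ^ 2 * ‖ξ‖ ^ 2 : ℝ)) * rft f ξ := by
  have hl := (HPow.lap (n := 0) h).1
  filter_upwards [rft_sub h.1 (hl.const_mul (α ^ 2)), rft_const_mul hl (α ^ 2), h.rft_lap] with ξ e1 e2 e3
  have e1' : rft (MLANS.hel α f) ξ = _ := e1
  rw [e1', e2, e3]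
  push_cast; ring

/-- The filter is self-adjoint and inverts `1 - α²Δ`, so against this test function the nonlocal
operator disappears. This dictates the choice of the first energy. -/
theorem integral_hconv_mul {α : ℝ} (hα : 0 < α) {M f : E3 → ℝ} (hM : MemLp M 2 volume) (hf : HPow 3 f)
    (k : Fin 3) : ∫ x, hconv α M x * pd k (hel α f) x = ∫ x, M x * pd k f x := by
  obtain ⟨h1, h2⟩ := rft_hconv hα hM
  have hφ : HPow 1 (hel α f) := HPow.hel (n := 1) hf α
  have hf1 : HPow 1 f := hf.mono (by norm_num)
  have a := rparseval h1 (hφ.memLp_pd k)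
  have b := rparseval hM (hf1.memLp_pd k)
  have e : ∫ ξ, rft (hconv α M) ξ * (starRingEnd ℂ) (rft (pd k (hel α f)) ξ)
      = ∫ ξ, rft M ξ * (starRingEnd ℂ) (rft (pd k f) ξ) := by
    refine integral_congr_ae ?_
    filter_upwards [h2, hφ.rft_pd k, hf1.rft_pd k, (hf.mono (by norm_num : 2 ≤ 3)).rft_hel α]
      with ξ e1 e2 e3 e4
    rw [e1, e2, e3, e4]
    simp only [map_mul, map_add, map_one, map_pow, Complex.conj_ofReal]
    linear_combination (rft M ξ * ((starRingEnd ℂ) (dsym k ξ) * (starRingEnd ℂ) (rft f ξ))) * hsym_inv α ξ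
  rw [e, ← b] at a
  exact_mod_cast a

/-- Pure algebra. Two cubic invariants of the gradient remain: the one also produced by the
Laplacian part of `u ⊗ u`, and `tr P³`, whose integral vanishes. -/
theorem drot_pairing (P : Fin 3 → Fin 3 → E3 → ℝ) (x : E3) :
    ∑ l, ∑ k, drot P P k l x * P k l x
      = 2 * (∑ l, ∑ k, ∑ j, P j k x * P k l x * P j l x - ∑ k, ∑ j, ∑ i, P i j x * P j k x * P k i x) := by
  simp only [drot, Fin.sum_univ_three]
  ring

theorem integral_sum_sum {f : Fin 3 → Fin 3 → E3 → ℝ} (hf : ∀ k l, Integrable (f k l) volume) :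
    ∑ l, ∑ k, ∫ x, f k l x = ∫ x, ∑ l, ∑ k, f k l x := by
  rw [integral_finsetSum _ fun l _ => integrable_finsetSum _ fun k _ => hf k l]
  exact Finset.sum_congr rfl fun l _ => (integral_finsetSum _ fun k _ => hf k l).symm

/-- The pure velocity part of the stress does no work. -/
theorem DivFree.pairing_self {α : ℝ} {u : Fin 3 → E3 → ℝ} (hu : DivFree 3 u) :
    (∑ l, ∑ k, ∫ x, u k x * u l x * pd k (hel α (u l)) x)
      + α ^ 2 / 2 * ∑ l, ∑ k, ∫ x, drot (gr u) (gr u) k l x * gr u k l x = 0 := by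
  have hu1 := hu.mono (show 1 ≤ 3 by norm_num)
  have hP : ∀ j k, HPow 2 (gr u j k) := fun j k => (hu.hpow k).pd j
  have ht : ∀ k, MemLp (u k) ⊤ volume := fun k => ((hu.mono (show 2 ≤ 3 by norm_num)).hpow k).memLp_top
  have hl : ∀ l, HPow 1 (lap (u l)) := fun l => (hu.hpow l).lap
  have e1 : ∀ l k, ∫ x, u k x * u l x * pd k (hel α (u l)) x
      = (∫ x, u k x * u l x * pd k (u l) x) - α ^ 2 * ∫ x, u k x * u l x * pd k (lap (u l)) x := by
    intro l k
    have h1 : pd k (hel α (u l)) =ᵐ[volume] fun x => pd k (u l) x - α ^ 2 * pd k (lap (u l)) x :=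
      (((hu1.hpow l).wd k).sub (((hl l).wd k).const_mul (α ^ 2))).ae_eq_pd (HPow.hel (n := 1) (hu.hpow l) α) |>.symm
    have m1 := integrable_mul_mul (ht k) (hu1.hpow l).1 ((hu1.hpow l).memLp_pd k)
    have m2 := (integrable_mul_mul (ht k) (hu1.hpow l).1 ((hl l).memLp_pd k)).const_mul (α ^ 2)
    rw [← integral_const_mul, ← integral_sub m1 m2]
    refine integral_congr_ae ?_
    filter_upwards [h1] with x hx
    rw [hx]; ring
  have hX : ∀ l k j, Integrable (fun x => gr u j k x * gr u k l x * gr u j l x) volume := fun l k j =>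
    integrable_mul_mul (hP j k).memLp_top (hP k l).1 (hP j l).1
  have hZ : ∀ k j i, Integrable (fun x => gr u i j x * gr u j k x * gr u k i x) volume := fun k j i =>
    integrable_mul_mul (hP i j).memLp_top (hP j k).1 (hP k i).1
  have e2 : ∑ l, ∑ k, ∫ x, drot (gr u) (gr u) k l x * gr u k l x
      = 2 * (∑ l, ∑ k, ∑ j, ∫ x, gr u j k x * gr u k l x * gr u j l x) := by
    rw [integral_sum_sum fun k l => integrable_mul_two
      (memLp_drot (fun i j => (hP i j).1) (fun i j => (hP i j).memLp_top) k l) (hP k l).1]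
    have e3 : ∑ k, ∑ j, ∑ i, ∫ x, gr u i j x * gr u j k x * gr u k i x
        = ∫ x, ∑ k, ∑ j, ∑ i, gr u i j x * gr u j k x * gr u k i x := by
      rw [← integral_sum_sum (f := fun j k x => ∑ i, gr u i j x * gr u j k x * gr u k i x)
        fun j k => integrable_finsetSum _ fun i _ => hZ k j i]
      exact Finset.sum_congr rfl fun k _ => Finset.sum_congr rfl fun j _ =>
        (integral_finsetSum _ fun i _ => hZ k j i).symm
    have e4 : ∑ l, ∑ k, ∑ j, ∫ x, gr u j k x * gr u k l x * gr u j l x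
        = ∫ x, ∑ l, ∑ k, ∑ j, gr u j k x * gr u k l x * gr u j l x := by
      rw [← integral_sum_sum (f := fun k l x => ∑ j, gr u j k x * gr u k l x * gr u j l x)
        fun k l => integrable_finsetSum _ fun j _ => hX l k j]
      exact Finset.sum_congr rfl fun l _ => Finset.sum_congr rfl fun k _ =>
        (integral_finsetSum _ fun j _ => hX l k j).symm
    have e5 := hu.integral_tr_cube
    change ∑ k, ∑ j, ∑ i, ∫ x, gr u i j x * gr u j k x * gr u k i x = 0 at e5
    simp only [drot_pairing]
    rw [integral_const_mul, integral_sub, ← e3, ← e4, e5, sub_zero]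
    · exact integrable_finsetSum _ fun l _ => integrable_finsetSum _ fun k _ =>
        integrable_finsetSum _ fun j _ => hX l k j
    · exact integrable_finsetSum _ fun l _ => integrable_finsetSum _ fun k _ =>
        integrable_finsetSum _ fun j _ => hZ l k j
  have e6 := hu.integral_tensor_grad_lap
  change _ = ∑ l, ∑ k, ∑ j, ∫ x, gr u j k x * gr u k l x * gr u j l x at e6
  -- With `X` the common cubic integral, the tensor part contributes `-α² X` through the Laplacian
  -- and the Reynolds stress `(α² / 2) · 2X`.
  simp only [e1, Finset.sum_sub_distrib, ← Finset.mul_sum]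
  rw [hu.integral_tensor_grad, e2, e6]
  ring

/-- The squared norms of a field, its gradient and its Laplacian. -/
def sq0 (u : Fin 3 → E3 → ℝ) (x : E3) : ℝ := ∑ i, u i x ^ 2

/-- The squared norm of the gradient. -/
def sq1 (u : Fin 3 → E3 → ℝ) (x : E3) : ℝ := ∑ i, ∑ j, gr u i j x ^ 2

theorem sq0_nonneg (u : Fin 3 → E3 → ℝ) (x : E3) : 0 ≤ sq0 u x := Finset.sum_nonneg fun _ _ => sq_nonneg _

theorem sq1_nonneg (u : Fin 3 → E3 → ℝ) (x : E3) : 0 ≤ sq1 u x :=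
  Finset.sum_nonneg fun _ _ => Finset.sum_nonneg fun _ _ => sq_nonneg _

theorem sq_le_sq0 (u : Fin 3 → E3 → ℝ) (i : Fin 3) (x : E3) : u i x ^ 2 ≤ sq0 u x :=
  Finset.single_le_sum (f := fun i => u i x ^ 2) (fun _ _ => sq_nonneg _) (Finset.mem_univ i)

theorem sq_le_sq1 (u : Fin 3 → E3 → ℝ) (i j : Fin 3) (x : E3) : gr u i j x ^ 2 ≤ sq1 u x :=
  (Finset.single_le_sum (f := fun j => gr u i j x ^ 2) (fun _ _ => sq_nonneg _) (Finset.mem_univ j)).trans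
    (Finset.single_le_sum (f := fun i => ∑ j, gr u i j x ^ 2)
      (fun _ _ => Finset.sum_nonneg fun _ _ => sq_nonneg _) (Finset.mem_univ i))

theorem integrable_sq0 {u : Fin 3 → E3 → ℝ} (hu : ∀ i, MemLp (u i) 2 volume) : Integrable (sq0 u) volume :=
  integrable_finsetSum _ fun i _ => (hu i).integrable_sq

theorem integrable_sq1 {u : Fin 3 → E3 → ℝ} (hu : ∀ i j, MemLp (gr u i j) 2 volume) :
    Integrable (sq1 u) volume :=
  integrable_finsetSum _ fun i _ => integrable_finsetSum _ fun j _ => (hu i j).integrable_sq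

/-- Young's inequality with a free `ε` on the product with the Laplacian `L`, so that this part can
later be absorbed by viscosity. The constant `8` is four products times the factor four of the
square of a sum, shared between `e` and `d`. -/
theorem cross_pointwise {α b ε : ℝ} (hε : 0 < ε) {v1 v2 u1 u2 q1 q2 p1 p2 w L e d l : ℝ}
    (h1 : |v1| ≤ b) (h2 : |v2| ≤ b) (h3 : |q1| ≤ b) (h4 : |q2| ≤ b) (h5 : u1 ^ 2 ≤ e) (h6 : u2 ^ 2 ≤ e)
    (h7 : p1 ^ 2 ≤ d) (h8 : p2 ^ 2 ≤ d) (h9 : w ^ 2 ≤ e) (h10 : L ^ 2 ≤ l) :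
    |((q1 * u1 + v1 * p1) + (q2 * u2 + v2 * p2)) * (w - α ^ 2 * L)|
      ≤ ((1 / 2 + α ^ 4 / (4 * ε)) * (8 * b ^ 2) + 1 / 2) * (e + d) + ε * l := by
  set A := (q1 * u1 + v1 * p1) + (q2 * u2 + v2 * p2) with hA
  have hb : 0 ≤ b := (abs_nonneg _).trans h1
  have sq : ∀ c : ℝ, |c| ≤ b → c ^ 2 ≤ b ^ 2 := fun c hc => sq_le_sq' (abs_le.1 hc).1 (abs_le.1 hc).2
  have t : ∀ c y z : ℝ, |c| ≤ b → y ^ 2 ≤ z → (c * y) ^ 2 ≤ b ^ 2 * z := fun c y z hc hy => by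
    rw [mul_pow]
    exact mul_le_mul (sq c hc) hy (sq_nonneg _) (sq_nonneg _)
  have hA2 : A ^ 2 ≤ 8 * b ^ 2 * (e + d) := by
    have := t q1 u1 e h3 h5
    have := t v1 p1 d h1 h7
    have := t q2 u2 e h4 h6
    have := t v2 p2 d h2 h8
    have : A ^ 2 ≤ 4 * ((q1 * u1) ^ 2 + (v1 * p1) ^ 2 + (q2 * u2) ^ 2 + (v2 * p2) ^ 2) := by
      rw [hA]
      nlinarith [sq_nonneg (q1 * u1 - v1 * p1), sq_nonneg (q1 * u1 - q2 * u2), sq_nonneg (q1 * u1 - v2 * p2),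
        sq_nonneg (v1 * p1 - q2 * u2), sq_nonneg (v1 * p1 - v2 * p2), sq_nonneg (q2 * u2 - v2 * p2)]
    linarith
  have he : 0 ≤ e := (sq_nonneg _).trans h5
  have hd : 0 ≤ d := (sq_nonneg _).trans h7
  have k1 : |A * w| ≤ A ^ 2 / 2 + w ^ 2 / 2 := by
    rw [abs_le]; constructor <;> nlinarith [sq_nonneg (A + w), sq_nonneg (A - w)]
  have k2 : |A * (α ^ 2 * L)| ≤ α ^ 4 / (4 * ε) * A ^ 2 + ε * L ^ 2 := by
    have e1 : ∀ s : ℝ, s ^ 2 = 1 → s * (A * (α ^ 2 * L)) ≤ α ^ 4 / (4 * ε) * A ^ 2 + ε * L ^ 2 := by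
      intro s hs
      have : 0 ≤ (α ^ 2 * A - 2 * ε * (s * L)) ^ 2 / (4 * ε) := by positivity
      have e : (α ^ 2 * A - 2 * ε * (s * L)) ^ 2 / (4 * ε)
          = α ^ 4 / (4 * ε) * A ^ 2 + ε * (s ^ 2 * L ^ 2) - s * (A * (α ^ 2 * L)) := by
        field_simp; ring
      rw [e, hs] at this
      linarith
    rw [abs_le]
    have := e1 1 (by norm_num)
    have := e1 (-1) (by norm_num)
    constructor <;> linarith
  have k3 : α ^ 4 / (4 * ε) * A ^ 2 ≤ α ^ 4 / (4 * ε) * (8 * b ^ 2 * (e + d)) := by gcongr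
  calc |A * (w - α ^ 2 * L)| ≤ |A * w| + |A * (α ^ 2 * L)| := by rw [mul_sub]; exact abs_sub _ _
    _ ≤ _ := by nlinarith [mul_le_mul_of_nonneg_left h10 hε.le]

theorem abs_sum_sum_le {f : Fin 3 → Fin 3 → ℝ} {c : ℝ} (h : ∀ k l, |f k l| ≤ c) :
    |∑ l, ∑ k, f k l| ≤ 9 * c := by
  refine (Finset.abs_sum_le_sum_abs _ _).trans ((Finset.sum_le_sum fun l _ =>
    (Finset.abs_sum_le_sum_abs _ _).trans (Finset.sum_le_sum fun k _ => h k l)).trans_eq ?_)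
  simp; ring

/-- The interaction with a field in `W^{1,∞}`. -/
theorem cross_tensor_bound {α b ε : ℝ} (hε : 0 < ε) {u v : Fin 3 → E3 → ℝ} {Q : Fin 3 → Fin 3 → E3 → ℝ}
    {R : Fin 3 → Fin 3 → Fin 3 → E3 → ℝ} (hu : DivFree 3 u) (hv : VDat b v Q R) :
    |∑ l, ∑ k, ∫ x, (u k x * v l x + v k x * u l x) * pd k (hel α (u l)) x|
      ≤ 9 * ((1 / 2 + α ^ 4 / (4 * ε)) * (8 * b ^ 2) + 1 / 2) * (∫ x, (sq0 u x + sq1 u x))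
        + 9 * ε * ∫ x, sq0 (fun i => lap (u i)) x := by
  have hu1 := hu.mono (show 1 ≤ 3 by norm_num)
  have hP : ∀ j k, HPow 2 (gr u j k) := fun j k => (hu.hpow k).pd j
  have hφ : ∀ l, HPow 1 (hel α (u l)) := fun l => HPow.hel (n := 1) (hu.hpow l) α
  have hl : ∀ l, HPow 1 (lap (u l)) := fun l => (hu.hpow l).lap
  -- The derivative is moved back from the filtered field, whose gradient contains third derivatives
  -- of `u`. `A'` is the derivative of the product; the divergence terms are kept and estimated like
  -- the others.
  set A' : Fin 3 → Fin 3 → E3 → ℝ := fun k l x => (Q k l x * u k x + v l x * gr u k k x)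
    + (Q k k x * u l x + v k x * gr u k l x) with hA'
  have m' : ∀ k l, MemLp (A' k l) 2 volume := fun k l =>
    ((memLp_top_mul (hv.memLp_grad k l) (hu1.hpow k).1).add (memLp_top_mul (hv.memLp l) (hP k k).1)).add
      ((memLp_top_mul (hv.memLp_grad k k) (hu1.hpow l).1).add (memLp_top_mul (hv.memLp k) (hP k l).1))
  have key : ∀ k l, ∫ x, (u k x * v l x + v k x * u l x) * pd k (hel α (u l)) x
      = ∫ x, -(A' k l x * hel α (u l) x) := by
    intro k l
    have hw := ((hv.wd k l).mul ((hu1.hpow k).wd k) (hv.memLp l) (hv.memLp_grad k l) (hu1.hpow k).1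
        ((hu1.hpow k).memLp_pd k)).add
      ((hv.wd k k).mul ((hu1.hpow l).wd k) (hv.memLp k) (hv.memLp_grad k k) (hu1.hpow l).1
        ((hu1.hpow l).memLp_pd k))
    have m : MemLp (fun x => v l x * u k x + v k x * u l x) 2 volume :=
      (memLp_top_mul (hv.memLp l) (hu1.hpow k).1).add (memLp_top_mul (hv.memLp k) (hu1.hpow l).1)
    have := hw.integral_mul_eq ((hφ l).wd k) m (m' k l) (hφ l).1 ((hφ l).memLp_pd k)
    rw [integral_neg]
    refine Eq.trans ?_ this
    refine integral_congr_ae (Eventually.of_forall fun x => ?_)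
    simp only; ring
  simp only [key]
  rw [integral_sum_sum fun k l => (integrable_mul_two (m' k l) (hφ l).1).fun_neg]
  have i0 := integrable_sq0 fun i => (hu1.hpow i).1
  have i1 := integrable_sq1 fun i j => (hP i j).1
  have i2 := integrable_sq0 fun i => (hl i).1
  have j0 := (i0.fun_add i1).const_mul (9 * ((1 / 2 + α ^ 4 / (4 * ε)) * (8 * b ^ 2) + 1 / 2))
  have j1 := i2.const_mul (9 * ε)
  rw [← integral_const_mul, ← integral_const_mul, ← integral_add j0 j1, ← Real.norm_eq_abs]
  refine norm_integral_le_of_norm_le (j0.fun_add j1) ?_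
  filter_upwards [hv.bound 0, hv.bound 1, hv.bound 2] with x h0 h1 h2
  have hvb : ∀ i, |v i x| ≤ b := fun i => by fin_cases i <;> assumption
  rw [Real.norm_eq_abs]
  refine (abs_sum_sum_le (c := ((1 / 2 + α ^ 4 / (4 * ε)) * (8 * b ^ 2) + 1 / 2) * (sq0 u x + sq1 u x)
    + ε * sq0 (fun i => lap (u i)) x) fun k l => ?_).trans (le_of_eq ?_)
  · rw [abs_neg]
    exact cross_pointwise hε (hvb l) (hvb k) (hv.bound_grad k l x) (hv.bound_grad k k x) (sq_le_sq0 u k x)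
      (sq_le_sq0 u l x) (sq_le_sq1 u k k x) (sq_le_sq1 u k l x) (sq_le_sq0 u l x)
      (sq_le_sq0 (fun i => lap (u i)) l x)
  · ring

theorem cross_drot_bound {b : ℝ} {u v : Fin 3 → E3 → ℝ} {Q : Fin 3 → Fin 3 → E3 → ℝ}
    {R : Fin 3 → Fin 3 → Fin 3 → E3 → ℝ} (hu : DivFree 3 u) (hv : VDat b v Q R) :
    |∑ l, ∑ k, ∫ x, drot (gr u) Q k l x * gr u k l x| ≤ 216 * b * ∫ x, (sq0 u x + sq1 u x) := by
  have hu1 := hu.mono (show 1 ≤ 3 by norm_num)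
  have hP : ∀ j k, HPow 2 (gr u j k) := fun j k => (hu.hpow k).pd j
  have i0 := integrable_sq0 fun i => (hu1.hpow i).1
  have i1 := integrable_sq1 fun i j => (hP i j).1
  rw [integral_sum_sum fun k l =>
      integrable_mul_two (memLp_drot (fun i j => (hP i j).1) hv.memLp_grad k l) (hP k l).1,
    ← integral_const_mul, ← Real.norm_eq_abs]
  refine norm_integral_le_of_norm_le ((i0.fun_add i1).const_mul (216 * b)) (Eventually.of_forall fun x => ?_)
  rw [Real.norm_eq_abs]
  have hs : ∀ i j, |gr u i j x| ≤ Real.sqrt (sq1 u x) := fun i j => by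
    rw [← Real.sqrt_sq_eq_abs]; exact Real.sqrt_le_sqrt (sq_le_sq1 u i j x)
  refine (abs_sum_sum_le (c := 24 * b * sq1 u x) fun k l => ?_).trans ?_
  · rw [abs_mul]
    refine (mul_le_mul (abs_drot_le hs (fun i j => hv.bound_grad i j x) k l) (hs k l) (abs_nonneg _)
      (by have := hv.nonneg; positivity)).trans (le_of_eq ?_)
    have := Real.mul_self_sqrt (sq1_nonneg u x)
    linear_combination 24 * b * this
  · nlinarith [mul_nonneg hv.nonneg (sq0_nonneg u x)]

/-- The full stress of the perturbed system. -/
def stress (α : ℝ) (u v : Fin 3 → E3 → ℝ) (Q : Fin 3 → Fin 3 → E3 → ℝ) (k l : Fin 3) (x : E3) : ℝ :=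
  stressT α u (gr u) u (gr u) k l x + stressT α u (gr u) v Q k l x + stressT α v Q u (gr u) k l x

/-- The self-interaction drops out by `DivFree.pairing_self`. What is left is linear in `v` and
quadratic in `u`, hence closes in the `H¹` energy up to the absorbable Laplacian. -/
theorem pairing_bound {α b ε : ℝ} (hα : 0 < α) (hε : 0 < ε) {u v : Fin 3 → E3 → ℝ}
    {Q : Fin 3 → Fin 3 → E3 → ℝ} {R : Fin 3 → Fin 3 → Fin 3 → E3 → ℝ} (hu : DivFree 3 u)
    (hv : VDat b v Q R) :
    |∑ l, ∑ k, ∫ x, stress α u v Q k l x * pd k (hel α (u l)) x|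
      ≤ (9 * ((1 / 2 + α ^ 4 / (4 * ε)) * (8 * b ^ 2) + 1 / 2) + α ^ 2 * (216 * b))
          * (∫ x, (sq0 u x + sq1 u x)) + 9 * ε * ∫ x, sq0 (fun i => lap (u i)) x := by
  have hu1 := hu.mono (show 1 ≤ 3 by norm_num)
  have hP : ∀ j k, HPow 2 (gr u j k) := fun j k => (hu.hpow k).pd j
  have ht : ∀ k, MemLp (u k) ⊤ volume := fun k => ((hu.mono (show 2 ≤ 3 by norm_num)).hpow k).memLp_top
  have hφ : ∀ l, HPow 1 (hel α (u l)) := fun l => HPow.hel (n := 1) (hu.hpow l) α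
  have d1 := memLp_drot (fun i j => (hP i j).1) (fun i j => (hP i j).memLp_top)
  have d2 := memLp_drot (fun i j => (hP i j).1) hv.memLp_grad
  have key : ∀ k l, ∫ x, stress α u v Q k l x * pd k (hel α (u l)) x
      = (∫ x, u k x * u l x * pd k (hel α (u l)) x)
        + α ^ 2 / 2 * (∫ x, drot (gr u) (gr u) k l x * gr u k l x)
        + (∫ x, (u k x * v l x + v k x * u l x) * pd k (hel α (u l)) x)
        + α ^ 2 * ∫ x, drot (gr u) Q k l x * gr u k l x := by
    intro k l
    have h1 := integral_hconv_mul hα (d1 k l) (hu.hpow l) k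
    have h2 := integral_hconv_mul hα (d2 k l) (hu.hpow l) k
    have m1 := (integrable_mul_two (rft_hconv hα (d1 k l)).1 ((hφ l).memLp_pd k)).const_mul (α ^ 2 / 2)
    have m2 := (integrable_mul_two (rft_hconv hα (d2 k l)).1 ((hφ l).memLp_pd k)).const_mul (α ^ 2)
    have m3 := integrable_mul_mul (ht k) (hu1.hpow l).1 ((hφ l).memLp_pd k)
    have m4 : MemLp (fun x => u k x * v l x + v k x * u l x) 2 volume :=
      ((memLp_top_mul (hv.memLp l) (hu1.hpow k).1).ae_eq (Eventually.of_forall fun x => mul_comm _ _)).add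
        (memLp_top_mul (hv.memLp k) (hu1.hpow l).1)
    have m5 := integrable_mul_two m4 ((hφ l).memLp_pd k)
    have m6 := m3.fun_add m1
    have m7 := m6.fun_add m5
    change _ = _ + α ^ 2 / 2 * (∫ x, drot (gr u) (gr u) k l x * pd k (u l) x) + _
      + α ^ 2 * ∫ x, drot (gr u) Q k l x * pd k (u l) x
    rw [← h1, ← h2, ← integral_const_mul, ← integral_const_mul, ← integral_add m3 m1,
      ← integral_add m6 m5, ← integral_add m7 m2]
    refine integral_congr_ae (Eventually.of_forall fun x => ?_)
    simp only [stress, stressT, drot_comm Q (gr u)]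
    ring
  have hself := hu.pairing_self (α := α)
  simp only [key, Finset.sum_add_distrib, ← Finset.mul_sum]
  rw [hself, zero_add]
  refine (abs_add_le _ _).trans ?_
  rw [abs_mul, abs_of_nonneg (sq_nonneg α)]
  have h1 := cross_tensor_bound (α := α) hε hu hv
  have h2 := mul_le_mul_of_nonneg_left (cross_drot_bound hu hv) (sq_nonneg α)
  linarith

end MLANS

end

noncomputable section

namespace MLANS

open LineDeriv

/-! ### Weighted square integrals of the Fourier transform -/

theorem ennreal_add_sq_le (a b : ℝ≥0∞) : (a + b) ^ 2 ≤ 2 * (a ^ 2 + b ^ 2) := by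
  have := ENNReal.rpow_add_le_mul_rpow_add_rpow a b (p := 2) (by norm_num)
  norm_num at this
  exact this

/-- The squared `L²` norm of a nonnegative function. -/
def nsq (g : E3 → ℝ≥0∞) : ℝ≥0∞ := ∫⁻ ξ, g ξ ^ 2

theorem nsq_mono_ae {f g : E3 → ℝ≥0∞} (h : ∀ᵐ ξ, f ξ ≤ g ξ) : nsq f ≤ nsq g :=
  lintegral_mono_ae (by filter_upwards [h] with ξ hξ; gcongr)

theorem nsq_add_le {f g : E3 → ℝ≥0∞} (hf : AEMeasurable f volume) :
    nsq (fun ξ => f ξ + g ξ) ≤ 2 * (nsq f + nsq g) := by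
  calc _ ≤ ∫⁻ ξ, 2 * (f ξ ^ 2 + g ξ ^ 2) := lintegral_mono fun ξ => ennreal_add_sq_le _ _
    _ = _ := by rw [lintegral_const_mul' _ _ (by norm_num), lintegral_add_left' (hf.pow_const 2)]; rfl

theorem nsq_const_mul {f : E3 → ℝ≥0∞} {c : ℝ≥0∞} (hc : c ≠ ⊤) : nsq (fun ξ => c * f ξ) = c ^ 2 * nsq f := by
  simp only [nsq, mul_pow]
  rw [lintegral_const_mul' _ _ (ENNReal.pow_ne_top hc)]

theorem nsq_rft {f : E3 → ℝ} (hf : MemLp f 2 volume) :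
    nsq (fun ξ => ‖rft f ξ‖ₑ) = nsq fun x => ‖f x‖ₑ := by
  rw [nsq, nsq, ← eLpNorm_two_sq, ← eLpNorm_two_sq, eLpNorm_rft hf]

/-- `∫ |ξ|^{2m} |f̂|²`. -/
def nm (m : ℕ) (f : E3 → ℝ) : ℝ≥0∞ := nsq fun ξ => ‖ξ‖ₑ ^ m * ‖rft f ξ‖ₑ

theorem aemeasurable_rft (f : E3 → ℝ) : AEMeasurable (fun ξ => ‖rft f ξ‖ₑ) volume := (memLp_rft f).1.enorm

theorem measurable_enorm_pow (m : ℕ) : Measurable fun ξ : E3 => ‖ξ‖ₑ ^ m := measurable_enorm.pow_const m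

theorem aemeasurable_nm (m : ℕ) (f : E3 → ℝ) : AEMeasurable (fun ξ => ‖ξ‖ₑ ^ m * ‖rft f ξ‖ₑ) volume :=
  (measurable_enorm_pow m).aemeasurable.mul (aemeasurable_rft f)

theorem nm_zero {f : E3 → ℝ} (hf : MemLp f 2 volume) : nm 0 f = nsq fun x => ‖f x‖ₑ := by
  rw [← nsq_rft hf, nm]; simp

theorem nm_lt_top {m : ℕ} {f : E3 → ℝ} (hf : HPow m f) : nm m f < ⊤ := by
  have := (memLp_two_iff hf.2.1).1 hf.2
  refine (lintegral_congr fun ξ => ?_).trans_lt this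
  rw [enorm_mul, enorm_pow, ← ofReal_norm ((‖ξ‖ : ℝ) : ℂ), Complex.norm_real, norm_norm, ofReal_norm]

theorem nm_congr {m : ℕ} {f : E3 → ℝ} {G : E3 → ℂ} (h : rft f =ᵐ[volume] G) :
    nm m f = nsq fun ξ => ‖ξ‖ₑ ^ m * ‖G ξ‖ₑ :=
  lintegral_congr_ae (by filter_upwards [h] with ξ hξ; rw [hξ])

theorem nm_add_le {m : ℕ} {f g : E3 → ℝ} (hf : MemLp f 2 volume) (hg : MemLp g 2 volume) :
    nm m (fun x => f x + g x) ≤ 2 * (nm m f + nm m g) := by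
  refine (nsq_mono_ae ?_).trans (nsq_add_le (aemeasurable_nm m f))
  filter_upwards [rft_add hf hg] with ξ h
  rw [h, ← mul_add]
  gcongr
  exact enorm_add_le _ _

theorem enorm_dsym_le (k : Fin 3) (ξ : E3) : ‖dsym k ξ‖ₑ ≤ ENNReal.ofReal (2 * Real.pi) * ‖ξ‖ₑ := by
  rw [← ofReal_norm, ← ofReal_norm, ← ENNReal.ofReal_mul (by positivity)]
  exact ENNReal.ofReal_le_ofReal (norm_dsym_le k ξ)

theorem two_pi_sq_le : ENNReal.ofReal (2 * Real.pi) ^ 2 ≤ 40 := by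
  rw [← ENNReal.ofReal_pow (by positivity)]
  have : (2 * Real.pi) ^ 2 ≤ 40 := by nlinarith [Real.pi_lt_d2, Real.pi_pos]
  exact (ENNReal.ofReal_le_ofReal this).trans_eq (by norm_num)

theorem nm_pd_le {m : ℕ} {f : E3 → ℝ} (hf : HPow 1 f) (j : Fin 3) : nm m (pd j f) ≤ 40 * nm (m + 1) f := by
  rw [nm_congr (hf.rft_pd j)]
  calc _ ≤ nsq (fun ξ => ENNReal.ofReal (2 * Real.pi) * (‖ξ‖ₑ ^ (m + 1) * ‖rft f ξ‖ₑ)) := by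
        refine nsq_mono_ae (Eventually.of_forall fun ξ => ?_)
        rw [enorm_mul]
        calc _ ≤ ‖ξ‖ₑ ^ m * ((ENNReal.ofReal (2 * Real.pi) * ‖ξ‖ₑ) * ‖rft f ξ‖ₑ) := by
              gcongr; exact enorm_dsym_le j ξ
          _ = _ := by ring
    _ = _ := nsq_const_mul ENNReal.ofReal_ne_top
    _ ≤ 40 * nsq (fun ξ => ‖ξ‖ₑ ^ (m + 1) * ‖rft f ξ‖ₑ) := by gcongr; exact two_pi_sq_le

theorem enorm_sq_le_sum (ξ : E3) : ‖ξ‖ₑ ^ 2 ≤ ∑ j, ‖dsym j ξ‖ₑ ^ 2 := by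
  have e : ∀ j, ‖dsym j ξ‖ₑ ^ 2 = ENNReal.ofReal (4 * Real.pi ^ 2 * ξ j ^ 2) := fun j => by
    rw [← ofReal_norm, ← ENNReal.ofReal_pow (norm_nonneg _), dsym]
    simp only [norm_mul, Complex.norm_ofNat, Complex.norm_real, Complex.norm_I, mul_one,
      Real.norm_eq_abs, abs_of_pos Real.pi_pos, mul_pow, sq_abs]
    norm_num
  simp only [e]
  rw [← ENNReal.ofReal_sum_of_nonneg fun j _ => by positivity, ← Finset.mul_sum, sum_coord_sq,
    ← ofReal_norm, ← ENNReal.ofReal_pow (norm_nonneg _)]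
  refine ENNReal.ofReal_le_ofReal ?_
  nlinarith [sq_nonneg ‖ξ‖, Real.pi_gt_three, mul_nonneg (sq_nonneg ‖ξ‖) (sq_nonneg (Real.pi - 1))]

/-- The weight `|ξ|` is controlled by the partial derivatives. -/
theorem nm_succ_le {m : ℕ} {f : E3 → ℝ} {g : Fin 3 → E3 → ℝ} (hf : MemLp f 2 volume)
    (hg : ∀ j, MemLp (g j) 2 volume) (h : ∀ j, WD j f (g j)) : nm (m + 1) f ≤ ∑ j, nm m (g j) := by
  have e : ∀ j, nm m (g j) = ∫⁻ ξ, ‖dsym j ξ‖ₑ ^ 2 * (‖ξ‖ₑ ^ m * ‖rft f ξ‖ₑ) ^ 2 := fun j => by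
    rw [nm_congr ((h j).rft_eq hf (hg j)), nsq]
    refine lintegral_congr fun ξ => ?_
    rw [enorm_mul]; ring
  simp only [e]
  have hm : ∀ j, AEMeasurable (fun ξ => ‖dsym j ξ‖ₑ ^ 2 * (‖ξ‖ₑ ^ m * ‖rft f ξ‖ₑ) ^ 2) volume := fun j =>
    ((continuous_dsym j).enorm.measurable.pow_const 2).aemeasurable.mul ((aemeasurable_nm m f).pow_const 2)
  rw [← lintegral_finsetSum' _ fun j _ => hm j]
  refine lintegral_mono fun ξ => ?_
  simp only
  rw [← Finset.sum_mul, show (‖ξ‖ₑ ^ (m + 1) * ‖rft f ξ‖ₑ) ^ 2 = ‖ξ‖ₑ ^ 2 * (‖ξ‖ₑ ^ m * ‖rft f ξ‖ₑ) ^ 2 by ring]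
  exact mul_le_mul' (enorm_sq_le_sum ξ) le_rfl

theorem nm_zero_mul_le {f g : E3 → ℝ} {b : ℝ} (hb : ∀ᵐ x, |f x| ≤ b) (hf : MemLp f ⊤ volume)
    (hg : MemLp g 2 volume) : nm 0 (fun x => f x * g x) ≤ ENNReal.ofReal b ^ 2 * nm 0 g := by
  rw [nm_zero (memLp_top_mul hf hg), nm_zero hg, ← nsq_const_mul ENNReal.ofReal_ne_top]
  refine nsq_mono_ae ?_
  filter_upwards [hb] with x hx
  rw [enorm_mul]
  gcongr
  rw [Real.enorm_eq_ofReal_abs]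
  exact ENNReal.ofReal_le_ofReal hx

/-- Multiplication by `W^{1,∞}` functions on `H¹`. -/
theorem nm_one_mul_le {f g : E3 → ℝ} {f' : Fin 3 → E3 → ℝ} {b : ℝ} (hb : ∀ᵐ x, |f x| ≤ b)
    (hb' : ∀ j, ∀ᵐ x, |f' j x| ≤ b) (hf : MemLp f ⊤ volume) (hf' : ∀ j, MemLp (f' j) ⊤ volume)
    (h : ∀ j, WD j f (f' j)) (hg : HPow 1 g) :
    nm 1 (fun x => f x * g x) ≤ 240 * ENNReal.ofReal b ^ 2 * (nm 0 g + nm 1 g) := by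
  have w := fun j => (h j).mul (hg.wd j) hf (hf' j) hg.1 (hg.memLp_pd j)
  have m1 : ∀ j, MemLp (fun x => f' j x * g x) 2 volume := fun j => memLp_top_mul (hf' j) hg.1
  have m2 : ∀ j, MemLp (fun x => f x * pd j g x) 2 volume := fun j => memLp_top_mul hf (hg.memLp_pd j)
  have m3 : ∀ j, MemLp (fun x => f' j x * g x + f x * pd j g x) 2 volume := fun j => (m1 j).add (m2 j)
  refine (nm_succ_le (m := 0) (memLp_top_mul hf hg.1) m3 w).trans ?_
  calc _ ≤ ∑ j : Fin 3, 80 * ENNReal.ofReal b ^ 2 * (nm 0 g + nm 1 g) := by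
        refine Finset.sum_le_sum fun j _ => (nm_add_le (m1 j) (m2 j)).trans ?_
        calc _ ≤ 2 * (ENNReal.ofReal b ^ 2 * nm 0 g + ENNReal.ofReal b ^ 2 * (40 * nm 1 g)) := by
              gcongr
              · exact nm_zero_mul_le (hb' j) (hf' j) hg.1
              · exact (nm_zero_mul_le hb hf (hg.memLp_pd j)).trans (by gcongr; exact nm_pd_le hg j)
          _ = ENNReal.ofReal b ^ 2 * (2 * nm 0 g + 80 * nm 1 g) := by ring
          _ ≤ ENNReal.ofReal b ^ 2 * (80 * nm 0 g + 80 * nm 1 g) := by gcongr; norm_num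
          _ = _ := by ring
    _ = _ := by
        rw [Finset.sum_const, Finset.card_univ, Fintype.card_fin, nsmul_eq_mul]
        push_cast; ring

/-- One derivative is taken by Leibniz, and the `H¹` multiplication rule is applied to each product.
Here bounded second derivatives of `v` are needed. -/
theorem nm_two_mul_le {b : ℝ} {v : Fin 3 → E3 → ℝ} {Q : Fin 3 → Fin 3 → E3 → ℝ}
    {R : Fin 3 → Fin 3 → Fin 3 → E3 → ℝ} (hv : VDat b v Q R) (l : Fin 3) {g : E3 → ℝ} (hg : HPow 2 g) :
    nm 2 (fun x => v l x * g x) ≤ 60000 * ENNReal.ofReal b ^ 2 * (nm 0 g + nm 1 g + nm 2 g) := by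
  have hg1 := hg.mono one_le_two
  have hp : ∀ j, HPow 1 (pd j g) := fun j => hg.pd j
  have w := fun j => (hv.wd j l).mul (hg1.wd j) (hv.memLp l) (hv.memLp_grad j l) hg.1 (hg1.memLp_pd j)
  have m1 : ∀ j, MemLp (fun x => Q j l x * g x) 2 volume := fun j => memLp_top_mul (hv.memLp_grad j l) hg.1
  have m2 : ∀ j, MemLp (fun x => v l x * pd j g x) 2 volume := fun j => memLp_top_mul (hv.memLp l) (hg1.memLp_pd j)
  have m3 : ∀ j, MemLp (fun x => Q j l x * g x + v l x * pd j g x) 2 volume := fun j => (m1 j).add (m2 j)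
  have bg : ∀ j i, ∀ᵐ x, |Q j i x| ≤ b := fun j i => Eventually.of_forall (hv.bound_grad j i)
  have bh : ∀ k j i, ∀ᵐ x, |R k j i x| ≤ b := fun k j i => Eventually.of_forall (hv.bound_hess k j i)
  refine (nm_succ_le (m := 1) (memLp_top_mul (hv.memLp l) hg.1) m3 w).trans ?_
  calc _ ≤ ∑ j : Fin 3, 20000 * ENNReal.ofReal b ^ 2 * (nm 0 g + nm 1 g + nm 2 g) := by
        refine Finset.sum_le_sum fun j _ => (nm_add_le (m1 j) (m2 j)).trans ?_
        calc _ ≤ 2 * (240 * ENNReal.ofReal b ^ 2 * (nm 0 g + nm 1 g)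
              + 240 * ENNReal.ofReal b ^ 2 * (40 * nm 1 g + 40 * nm 2 g)) := by
              gcongr
              · exact nm_one_mul_le (bg j l) (fun i => bh i j l) (hv.memLp_grad j l)
                  (fun i => hv.memLp_hess i j l) (fun i => hv.wd_grad i j l) hg1
              · refine (nm_one_mul_le (hv.bound l) (fun i => bg i l) (hv.memLp l)
                  (fun i => hv.memLp_grad i l) (fun i => hv.wd i l) (hp j)).trans ?_
                gcongr
                · exact nm_pd_le hg1 j
                · exact nm_pd_le hg1 j
          _ = ENNReal.ofReal b ^ 2 * (480 * nm 0 g + 19680 * nm 1 g + 19200 * nm 2 g) := by ring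
          _ ≤ ENNReal.ofReal b ^ 2 * (20000 * nm 0 g + 20000 * nm 1 g + 20000 * nm 2 g) := by
              gcongr <;> norm_num
          _ = _ := by ring
    _ = _ := by
        rw [Finset.sum_const, Finset.card_univ, Fintype.card_fin, nsmul_eq_mul]
        push_cast; ring

theorem hsym_pos (α : ℝ) (ξ : E3) : 0 < hsym α ξ := by unfold hsym; positivity

theorem hsym_le_one (α : ℝ) (ξ : E3) : hsym α ξ ≤ 1 := by
  unfold hsym
  rw [div_le_one (by positivity)]
  nlinarith [sq_nonneg (2 * Real.pi * α * ‖ξ‖)]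

theorem sq_mul_hsym_le (α : ℝ) (ξ : E3) : α ^ 2 * ‖ξ‖ ^ 2 * hsym α ξ ≤ 1 / 36 := by
  unfold hsym
  rw [mul_one_div, div_le_iff₀ (by positivity)]
  have : 0 ≤ α ^ 2 * ‖ξ‖ ^ 2 := by positivity
  have h : 36 ≤ (2 * Real.pi) ^ 2 := by nlinarith [Real.pi_gt_three]
  nlinarith [mul_le_mul_of_nonneg_left h this]

theorem enorm_hsym (α : ℝ) (ξ : E3) : ‖((hsym α ξ : ℝ) : ℂ)‖ₑ = ENNReal.ofReal (hsym α ξ) := by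
  rw [← ofReal_norm, Complex.norm_real, Real.norm_of_nonneg (hsym_pos α ξ).le]

/-- The square integral of the symmetrized products of the gradients. -/
theorem nm_drot_le {P Q : Fin 3 → Fin 3 → E3 → ℝ} {b : ℝ} (hP : ∀ i j, MemLp (P i j) 2 volume)
    (hQ : ∀ i j, MemLp (Q i j) ⊤ volume) (hQb : ∀ᵐ x, ∀ i j, |Q i j x| ≤ b) (k l : Fin 3) :
    nm 0 (drot P Q k l) ≤ 5184 * ENNReal.ofReal b ^ 2 * ∑ i, ∑ j, nm 0 (P i j) := by
  rw [nm_zero (memLp_drot hP hQ k l)]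
  simp only [nm_zero (hP _ _)]
  have hm : ∀ i j, AEMeasurable (fun x => ‖P i j x‖ₑ ^ 2) volume := fun i j => (hP i j).1.enorm.pow_const 2
  have e : ∑ i, ∑ j, nsq (fun x => ‖P i j x‖ₑ) = ∫⁻ x, ∑ i, ∑ j, ‖P i j x‖ₑ ^ 2 := by
    rw [lintegral_finsetSum' _ fun i _ => Finset.aemeasurable_fun_sum _ fun j _ => hm i j]
    exact Finset.sum_congr rfl fun i _ => (lintegral_finsetSum' _ fun j _ => hm i j).symm
  rw [e, ← lintegral_const_mul' _ _ (by finiteness), nsq]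
  refine lintegral_mono_ae ?_
  filter_upwards [hQb] with x hx
  set S := ∑ i, ∑ j, P i j x ^ 2 with hS
  have hs : ∀ i j, |P i j x| ≤ Real.sqrt S := fun i j => by
    rw [← Real.sqrt_sq_eq_abs]
    refine Real.sqrt_le_sqrt ?_
    exact (Finset.single_le_sum (f := fun j => P i j x ^ 2) (fun _ _ => sq_nonneg _) (Finset.mem_univ j)).trans
      (Finset.single_le_sum (f := fun i => ∑ j, P i j x ^ 2)
        (fun _ _ => Finset.sum_nonneg fun _ _ => sq_nonneg _) (Finset.mem_univ i))
  have hS0 : 0 ≤ S := Finset.sum_nonneg fun _ _ => Finset.sum_nonneg fun _ _ => sq_nonneg _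
  have h1 := abs_drot_le hs hx k l
  have hb : 0 ≤ b := (abs_nonneg _).trans (hx 0 0)
  have h2 : drot P Q k l x ^ 2 ≤ 5184 * b ^ 2 * S := by
    rw [← sq_abs]
    calc |drot P Q k l x| ^ 2 ≤ (24 * (b * Real.sqrt S)) ^ 2 := by gcongr
      _ = 576 * b ^ 2 * S := by rw [mul_pow, mul_pow, Real.sq_sqrt hS0]; ring
      _ ≤ _ := by gcongr; norm_num
  have e1 : ∀ y : ℝ, ‖y‖ₑ ^ 2 = ENNReal.ofReal (y ^ 2) := fun y => by
    rw [Real.enorm_eq_ofReal_abs, ← ENNReal.ofReal_pow (abs_nonneg _), sq_abs]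
  simp only [e1]
  simp only [← ENNReal.ofReal_sum_of_nonneg (fun j _ => sq_nonneg _)]
  rw [← ENNReal.ofReal_sum_of_nonneg fun i _ => Finset.sum_nonneg fun _ _ => sq_nonneg _,
    ← ENNReal.ofReal_pow hb, ← hS, show (5184 : ℝ≥0∞) = ENNReal.ofReal 5184 by norm_num,
    ← ENNReal.ofReal_mul (by norm_num), ← ENNReal.ofReal_mul (by positivity)]
  exact ENNReal.ofReal_le_ofReal h2

/-- The total weighted square integral of the components. -/
def en (m : ℕ) (u : Fin 3 → E3 → ℝ) : ℝ≥0∞ := ∑ i, nm m (u i)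

theorem nm_le_en (m : ℕ) (u : Fin 3 → E3 → ℝ) (i : Fin 3) : nm m (u i) ≤ en m u :=
  Finset.single_le_sum (f := fun i => nm m (u i)) (fun _ _ => zero_le) (Finset.mem_univ i)

theorem sum_nm_gr_le {m : ℕ} {u : Fin 3 → E3 → ℝ} (hu : ∀ i, HPow 1 (u i)) :
    ∑ i, ∑ j, nm m (gr u i j) ≤ 120 * en (m + 1) u := by
  calc _ ≤ ∑ i : Fin 3, ∑ j, 40 * nm (m + 1) (u j) :=
        Finset.sum_le_sum fun i _ => Finset.sum_le_sum fun j _ => nm_pd_le (hu j) i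
    _ = _ := by
        rw [Finset.sum_const, Finset.card_univ, Fintype.card_fin, nsmul_eq_mul, ← Finset.mul_sum, ← mul_assoc]
        norm_num [en]

end MLANS

end

noncomputable section

namespace MLANS

open LineDeriv

/-! ### Fourier bounds for the stress -/

theorem cv_comm (a b : E3 → ℝ≥0∞) (ξ : E3) : cv a b ξ = cv b a ξ := by
  rw [cv, cv, ← lintegral_sub_left_eq_self (fun η => b (ξ - η) * a η) ξ]
  refine lintegral_congr fun η => ?_
  rw [sub_sub_cancel, mul_comm]

theorem aemeasurable_sub_left {a : E3 → ℝ≥0∞} (ha : AEMeasurable a volume) (ξ : E3) :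
    AEMeasurable (fun η => a (ξ - η)) volume :=
  ha.comp_quasiMeasurePreserving (measurePreserving_const_sub ξ).quasiMeasurePreserving

theorem cv_sq_le {a b : E3 → ℝ≥0∞} (ha : AEMeasurable a volume) (hb : AEMeasurable b volume) (ξ : E3) :
    cv a b ξ ^ 2 ≤ nsq a * nsq b := by
  refine (lintegral_mul_sq_le (aemeasurable_sub_left ha ξ) hb).trans (le_of_eq ?_)
  rw [lintegral_sub_left_eq_self (fun η => a η ^ 2) ξ]; rfl

theorem nsq_cv_le {a b : E3 → ℝ≥0∞} (ha : AEMeasurable a volume) (hb : AEMeasurable b volume) :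
    nsq (cv a b) ≤ (∫⁻ ξ, a ξ) ^ 2 * nsq b := lintegral_conv_sq_le ha hb

theorem aemeasurable_cv {a b : E3 → ℝ≥0∞} (ha : AEMeasurable a volume) (hb : AEMeasurable b volume) :
    AEMeasurable (cv a b) volume := (aemeasurable_sub_mul ha hb).lintegral_prod_right'

/-- Splitting a weight over a convolution. -/
theorem mul_cv_le {a b : E3 → ℝ≥0∞} (ha : AEMeasurable a volume) (hb : AEMeasurable b volume)
    {w : E3 → ℝ≥0∞} (hw : Measurable w) {c : ℝ≥0∞} (hc : c ≠ ⊤)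
    (h : ∀ ξ η, w ξ ≤ c * (w (ξ - η) + w η)) {ξ : E3} (hξ : w ξ ≠ ⊤) :
    w ξ * cv a b ξ ≤ c * (cv (fun η => w η * a η) b ξ + cv a (fun η => w η * b η) ξ) := by
  have hA : AEMeasurable (fun η => w (ξ - η) * a (ξ - η) * b η) volume :=
    (aemeasurable_sub_left (a := fun η => w η * a η) (hw.aemeasurable.mul ha) ξ).mul hb
  rw [cv, ← lintegral_const_mul' _ _ hξ, cv, cv, ← lintegral_add_left' hA, ← lintegral_const_mul' _ _ hc]
  refine lintegral_mono fun η => ?_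
  calc w ξ * (a (ξ - η) * b η) ≤ (c * (w (ξ - η) + w η)) * (a (ξ - η) * b η) := by gcongr; exact h ξ η
    _ = _ := by ring

theorem enorm_le_sub_add (ξ η : E3) : ‖ξ‖ₑ ≤ ‖ξ - η‖ₑ + ‖η‖ₑ := by
  have := enorm_add_le (ξ - η) η
  rwa [sub_add_cancel] at this

/-- The sum of the absolute values of the transforms of the components. -/
def ua (u : Fin 3 → E3 → ℝ) (ξ : E3) : ℝ≥0∞ := ∑ i, ‖rft (u i) ξ‖ₑ

theorem aemeasurable_ua (u : Fin 3 → E3 → ℝ) : AEMeasurable (ua u) volume :=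
  Finset.aemeasurable_fun_sum _ fun i _ => aemeasurable_rft (u i)

theorem aemeasurable_pow_ua (m : ℕ) (u : Fin 3 → E3 → ℝ) : AEMeasurable (fun ξ => ‖ξ‖ₑ ^ m * ua u ξ) volume :=
  (measurable_enorm_pow m).aemeasurable.mul (aemeasurable_ua u)

theorem le_ua (u : Fin 3 → E3 → ℝ) (i : Fin 3) (ξ : E3) : ‖rft (u i) ξ‖ₑ ≤ ua u ξ :=
  Finset.single_le_sum (f := fun i => ‖rft (u i) ξ‖ₑ) (fun _ _ => zero_le) (Finset.mem_univ i)

theorem ennreal_sum_sq_le (a : Fin 3 → ℝ≥0∞) : (∑ i, a i) ^ 2 ≤ 4 * ∑ i, a i ^ 2 := by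
  rw [Fin.sum_univ_three, Fin.sum_univ_three]
  calc _ ≤ 2 * ((a 0 + a 1) ^ 2 + a 2 ^ 2) := ennreal_add_sq_le _ _
    _ ≤ 2 * (2 * (a 0 ^ 2 + a 1 ^ 2) + 2 * a 2 ^ 2) := by
        gcongr
        · exact ennreal_add_sq_le _ _
        · exact le_mul_of_one_le_left (zero_le) (by norm_num)
    _ = _ := by ring

theorem nsq_mul_ua_le {w : E3 → ℝ≥0∞} (hw : Measurable w) (u : Fin 3 → E3 → ℝ) :
    nsq (fun ξ => w ξ * ua u ξ) ≤ 4 * ∑ i, nsq fun ξ => w ξ * ‖rft (u i) ξ‖ₑ := by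
  have hm : ∀ i, AEMeasurable (fun ξ => (w ξ * ‖rft (u i) ξ‖ₑ) ^ 2) volume := fun i =>
    (hw.aemeasurable.mul (aemeasurable_rft (u i))).pow_const 2
  simp only [nsq]
  rw [← lintegral_finsetSum' _ fun i _ => hm i, ← lintegral_const_mul' _ _ (by norm_num)]
  refine lintegral_mono fun ξ => ?_
  rw [ua, Finset.mul_sum]
  exact ennreal_sum_sq_le _

theorem nsq_pow_ua_le (m : ℕ) (u : Fin 3 → E3 → ℝ) : nsq (fun ξ => ‖ξ‖ₑ ^ m * ua u ξ) ≤ 4 * en m u :=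
  nsq_mul_ua_le (measurable_enorm_pow m) u

/-- `∫ |û|`. -/
def l1 (u : Fin 3 → E3 → ℝ) : ℝ≥0∞ := ∫⁻ ξ, ua u ξ

/-- The symbol bounding the filtered products of gradients. -/
def wsym (α : ℝ) (ξ : E3) : ℝ≥0∞ := ENNReal.ofReal (α ^ 2 * hsym α ξ)

theorem rft_gr_le {u : Fin 3 → E3 → ℝ} (hu : ∀ i, HPow 1 (u i)) (i j : Fin 3) :
    ∀ᵐ ξ, ‖rft (gr u i j) ξ‖ₑ ≤ ENNReal.ofReal (2 * Real.pi) * (‖ξ‖ₑ ^ 1 * ua u ξ) := by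
  filter_upwards [(hu j).rft_pd i] with ξ h
  rw [gr, h, enorm_mul, pow_one, ← mul_assoc]
  exact mul_le_mul' (enorm_dsym_le i ξ) (le_ua u j ξ)

theorem memLp_tensor {f g : Fin 3 → E3 → ℝ} (hf : ∀ i, HPow 3 (f i)) (hg : ∀ i, HPow 3 (g i)) (k l : Fin 3) :
    MemLp (fun x => f k x * g l x) 2 volume :=
  memLp_top_mul ((hf k).mono (by norm_num : 2 ≤ 3)).memLp_top (hg l).1

theorem memLp_drot_gr {f g : Fin 3 → E3 → ℝ} (hf : ∀ i, HPow 3 (f i)) (hg : ∀ i, HPow 3 (g i))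
    (k l : Fin 3) : MemLp (drot (gr f) (gr g) k l) 2 volume :=
  memLp_drot (fun i j => ((hf j).pd i).1) (fun i j => ((hg j).pd i).memLp_top) k l

/-- A majorant without cancellations: products become convolutions of absolute values and the filter
becomes its positive symbol. The constant is `480 = 12 · 40` with `(2π)² ≤ 40`. -/
theorem rft_stressT_le {α : ℝ} (hα : 0 < α) {f g : Fin 3 → E3 → ℝ} (hf : ∀ i, HPow 3 (f i))
    (hg : ∀ i, HPow 3 (g i)) (k l : Fin 3) :
    ∀ᵐ ξ, ‖rft (stressT α f (gr f) g (gr g) k l) ξ‖ₑ ≤ cv (ua g) (ua f) ξ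
      + 480 * (wsym α ξ * cv (fun ξ => ‖ξ‖ₑ ^ 1 * ua g ξ) (fun ξ => ‖ξ‖ₑ ^ 1 * ua f ξ) ξ) := by
  have hf1 := fun i => (hf i).mono (show 1 ≤ 3 by norm_num)
  have hg1 := fun i => (hg i).mono (show 1 ≤ 3 by norm_num)
  have m1 := memLp_tensor hf hg k l
  have b1 := rft_mul_le (hf k).1 (hg l).1 m1 (Eventually.of_forall (le_ua f k)) (Eventually.of_forall (le_ua g l))
  have b2 := rft_drot_le (fun i j => ((hf j).pd i).1) (fun i j => ((hg j).pd i).1)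
    (fun i j => ((hg j).pd i).memLp_top) (rft_gr_le hf1) (rft_gr_le hg1) k l
  have hc : ENNReal.ofReal (2 * Real.pi) ≠ ⊤ := ENNReal.ofReal_ne_top
  filter_upwards [(rft_stressT hα m1 (memLp_drot_gr hf hg k l)).2, b1, b2] with ξ e h1 h2
  rw [e]
  refine (enorm_add_le _ _).trans (add_le_add h1 ?_)
  rw [cv_const_mul_left hc, cv_const_mul_right hc, cv_const_mul_left hc, cv_const_mul_right hc,
    cv_comm (fun ξ => ‖ξ‖ₑ ^ 1 * ua f ξ)] at h2
  set X := cv (fun ξ => ‖ξ‖ₑ ^ 1 * ua g ξ) (fun ξ => ‖ξ‖ₑ ^ 1 * ua f ξ) ξ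
  have e1 : ‖(α : ℂ) ^ 2 / 2‖ₑ = ENNReal.ofReal (α ^ 2 / 2) := by
    rw [← ofReal_norm]; simp
  rw [enorm_mul, enorm_mul, enorm_hsym, e1]
  calc _ ≤ ENNReal.ofReal (α ^ 2 / 2) * (ENNReal.ofReal (hsym α ξ) * (12 * (ENNReal.ofReal (2 * Real.pi) *
        (ENNReal.ofReal (2 * Real.pi) * X) + ENNReal.ofReal (2 * Real.pi) * (ENNReal.ofReal (2 * Real.pi) * X)))) := by
        gcongr
        exact h2
    _ = 12 * ENNReal.ofReal (2 * Real.pi) ^ 2 * ((2 * ENNReal.ofReal (α ^ 2 / 2)) * ENNReal.ofReal (hsym α ξ) * X) := by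
        ring
    _ ≤ 12 * 40 * (wsym α ξ * X) := by
        have e2 : 2 * ENNReal.ofReal (α ^ 2 / 2) = ENNReal.ofReal (α ^ 2) := by
          rw [show (2 : ℝ≥0∞) = ENNReal.ofReal 2 by norm_num, ← ENNReal.ofReal_mul (by norm_num)]
          congr 1; ring
        rw [e2, wsym, ENNReal.ofReal_mul (sq_nonneg α)]
        gcongr
        exact two_pi_sq_le
    _ = _ := by norm_num

theorem ofReal_pow_norm (m : ℕ) (ξ : E3) : ENNReal.ofReal (‖ξ‖ ^ m) = ‖ξ‖ₑ ^ m := by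
  rw [ENNReal.ofReal_pow (norm_nonneg _), ofReal_norm]

theorem sq_mul_wsym_le (α : ℝ) (ξ : E3) : ‖ξ‖ₑ ^ 2 * wsym α ξ ≤ ENNReal.ofReal (1 / 36) := by
  rw [wsym, ← ofReal_pow_norm, ← ENNReal.ofReal_mul (by positivity)]
  refine ENNReal.ofReal_le_ofReal ?_
  have := sq_mul_hsym_le α ξ
  linarith

theorem wsym_mul_one_add_le (α : ℝ) (ξ : E3) : α ^ 2 * hsym α ξ * (‖ξ‖ * (1 + ‖ξ‖)) ≤ α ^ 2 + 1 := by
  have h1 := sq_mul_hsym_le α ξ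
  have h2 := hsym_le_one α ξ
  have h3 := (hsym_pos α ξ).le
  have h4 : ‖ξ‖ * (1 + ‖ξ‖) ≤ 1 + 2 * ‖ξ‖ ^ 2 := by nlinarith [sq_nonneg (‖ξ‖ - 1)]
  calc _ ≤ α ^ 2 * hsym α ξ * (1 + 2 * ‖ξ‖ ^ 2) := by gcongr
    _ = α ^ 2 * hsym α ξ + 2 * (α ^ 2 * ‖ξ‖ ^ 2 * hsym α ξ) := by ring
    _ ≤ _ := by nlinarith [mul_le_mul_of_nonneg_left h2 (sq_nonneg α)]

/-- The quadratic stress in `Ḣ²`. -/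
theorem nsq_stressT_two {α : ℝ} (hα : 0 < α) {u : Fin 3 → E3 → ℝ} (hu : ∀ i, HPow 3 (u i)) (k l : Fin 3) :
    nm 2 (stressT α u (gr u) u (gr u) k l) ≤ 1296 * l1 u ^ 2 * en 2 u := by
  have hm := aemeasurable_ua u
  have hm1 := aemeasurable_pow_ua 1 u
  have hm2 := aemeasurable_pow_ua 2 u
  have key : ∀ᵐ ξ, ‖ξ‖ₑ ^ 2 * ‖rft (stressT α u (gr u) u (gr u) k l) ξ‖ₑ
      ≤ 18 * cv (ua u) (fun ξ => ‖ξ‖ₑ ^ 2 * ua u ξ) ξ := by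
    filter_upwards [rft_stressT_le hα hu hu k l] with ξ h
    set X := cv (ua u) (fun ξ => ‖ξ‖ₑ ^ 2 * ua u ξ) ξ with hX
    have h1 : ‖ξ‖ₑ ^ 2 * cv (ua u) (ua u) ξ ≤ 2 * (X + X) := by
      have := mul_cv_le hm hm (measurable_enorm_pow 2) (c := 2) (by norm_num) (fun ξ η => ?_) (ξ := ξ) (by finiteness)
      · rwa [cv_comm (fun η => ‖η‖ₑ ^ 2 * ua u η), ← hX] at this
      · exact (pow_le_pow_left' (enorm_le_sub_add ξ η) 2).trans (ennreal_add_sq_le _ _)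
    -- By `2|ξ-η||η| ≤ |ξ-η|² + |η|²` a product of two gradients is traded for one factor with two
    -- derivatives and one with none. The filter compensates the outer weight `|ξ|²`, so the
    -- estimate stays linear in the `Ḣ²` energy.
    have h2 : cv (fun ξ => ‖ξ‖ₑ ^ 1 * ua u ξ) (fun ξ => ‖ξ‖ₑ ^ 1 * ua u ξ) ξ ≤ X := by
      have h3 : 2 * cv (fun ξ => ‖ξ‖ₑ ^ 1 * ua u ξ) (fun ξ => ‖ξ‖ₑ ^ 1 * ua u ξ) ξ
          ≤ cv (fun ξ => ‖ξ‖ₑ ^ 2 * ua u ξ) (ua u) ξ + X := by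
        have hA : AEMeasurable (fun η => ‖ξ - η‖ₑ ^ 2 * ua u (ξ - η) * ua u η) volume :=
          (aemeasurable_sub_left (a := fun η => ‖η‖ₑ ^ 2 * ua u η) hm2 ξ).mul hm
        rw [hX, cv, cv, cv, ← lintegral_add_left' hA,
          ← lintegral_const_mul' _ _ (by norm_num)]
        refine lintegral_mono fun η => ?_
        simp only [pow_one]
        calc _ = (2 * (‖ξ - η‖ₑ * ‖η‖ₑ)) * (ua u (ξ - η) * ua u η) := by ring
          _ ≤ (‖ξ - η‖ₑ ^ 2 + ‖η‖ₑ ^ 2) * (ua u (ξ - η) * ua u η) := by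
              gcongr
              rw [← ofReal_norm, ← ofReal_norm, ← ENNReal.ofReal_pow (norm_nonneg _),
                ← ENNReal.ofReal_pow (norm_nonneg _), ← ENNReal.ofReal_mul (norm_nonneg _),
                ← ENNReal.ofReal_add (by positivity) (by positivity), two_mul,
                ← ENNReal.ofReal_add (by positivity) (by positivity)]
              refine ENNReal.ofReal_le_ofReal ?_
              nlinarith [sq_nonneg (‖ξ - η‖ - ‖η‖)]
          _ = _ := by ring
      rw [cv_comm (fun η => ‖η‖ₑ ^ 2 * ua u η), ← hX, ← two_mul] at h3
      exact (ENNReal.mul_le_mul_iff_right (by norm_num) (by norm_num)).1 h3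
    calc _ ≤ ‖ξ‖ₑ ^ 2 * (cv (ua u) (ua u) ξ + 480 * (wsym α ξ *
          cv (fun ξ => ‖ξ‖ₑ ^ 1 * ua u ξ) (fun ξ => ‖ξ‖ₑ ^ 1 * ua u ξ) ξ)) := by gcongr
      _ = ‖ξ‖ₑ ^ 2 * cv (ua u) (ua u) ξ + 480 * ((‖ξ‖ₑ ^ 2 * wsym α ξ) *
          cv (fun ξ => ‖ξ‖ₑ ^ 1 * ua u ξ) (fun ξ => ‖ξ‖ₑ ^ 1 * ua u ξ) ξ) := by ring
      _ ≤ 2 * (X + X) + 480 * (ENNReal.ofReal (1 / 36) * X) := by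
          gcongr
          exact sq_mul_wsym_le α ξ
      _ = (4 + 480 * ENNReal.ofReal (1 / 36)) * X := by ring
      -- The sum is `4 + 480 / 36`, slightly above `17`.
      _ ≤ 18 * X := by
          gcongr
          rw [show (480 : ℝ≥0∞) = ENNReal.ofReal 480 by norm_num, ← ENNReal.ofReal_mul (by norm_num),
            show (4 : ℝ≥0∞) = ENNReal.ofReal 4 by norm_num, ← ENNReal.ofReal_add (by norm_num) (by norm_num),
            show (18 : ℝ≥0∞) = ENNReal.ofReal 18 by norm_num]
          exact ENNReal.ofReal_le_ofReal (by norm_num)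
  calc _ ≤ nsq (fun ξ => 18 * cv (ua u) (fun ξ => ‖ξ‖ₑ ^ 2 * ua u ξ) ξ) := nsq_mono_ae key
    _ = 18 ^ 2 * nsq (cv (ua u) (fun ξ => ‖ξ‖ₑ ^ 2 * ua u ξ)) := nsq_const_mul (by norm_num)
    _ ≤ 18 ^ 2 * (l1 u ^ 2 * (4 * en 2 u)) := by
        gcongr
        exact (nsq_cv_le hm hm2).trans (by gcongr; exacts [le_rfl, nsq_pow_ua_le 2 u])
    _ = _ := by ring

/-- The weighted norm `∫ (1 + |ξ|)^{2s} |û|²`. -/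
def hs (s : ℝ) (u : Fin 3 → E3 → ℝ) : ℝ≥0∞ :=
  ∑ i, nsq fun ξ => ENNReal.ofReal ((1 + ‖ξ‖) ^ s) * ‖rft (u i) ξ‖ₑ

theorem one_add_rpow_le {σ : ℝ} (h0 : 0 ≤ σ) (h1 : σ ≤ 1) (ξ η : E3) :
    (1 + ‖ξ‖) ^ σ ≤ 2 * ((1 + ‖ξ - η‖) ^ σ + (1 + ‖η‖) ^ σ) := by
  have e1 : ‖ξ‖ ≤ ‖ξ - η‖ + ‖η‖ := by simpa using norm_add_le (ξ - η) η
  have key : ∀ a b : ℝ, 0 ≤ a → a ≤ b → (1 + (a + b)) ^ σ ≤ 2 * (1 + b) ^ σ := fun a b ha hab => by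
    calc _ ≤ (2 * (1 + b)) ^ σ := Real.rpow_le_rpow (by linarith) (by linarith) h0
      _ = 2 ^ σ * (1 + b) ^ σ := Real.mul_rpow (by norm_num) (by linarith)
      _ ≤ 2 ^ (1 : ℝ) * (1 + b) ^ σ :=
          mul_le_mul_of_nonneg_right (Real.rpow_le_rpow_of_exponent_le (by norm_num) h1)
            (Real.rpow_nonneg (by linarith) _)
      _ = _ := by rw [Real.rpow_one]
  have p1 : 0 ≤ (1 + ‖ξ - η‖) ^ σ := by positivity
  have p2 : 0 ≤ (1 + ‖η‖) ^ σ := by positivity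
  refine (Real.rpow_le_rpow (by positivity) (by linarith : 1 + ‖ξ‖ ≤ 1 + (‖ξ - η‖ + ‖η‖)) h0).trans ?_
  rcases le_total ‖ξ - η‖ ‖η‖ with h | h
  · linarith [key _ _ (norm_nonneg _) h]
  · rw [add_comm ‖ξ - η‖]
    linarith [key _ _ (norm_nonneg _) h]

/-- The quadratic stress in `Ḣ¹`. -/
theorem nsq_stressT_one {α s : ℝ} (hα : 0 < α) (hs1 : 3 / 2 < s) (hs2 : s ≤ 2) : ∃ K : ℝ≥0,
    ∀ u : Fin 3 → E3 → ℝ, (∀ i, HPow 3 (u i)) → ∀ k l,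
      nm 1 (stressT α u (gr u) u (gr u) k l) ≤ K * (l1 u ^ 2 * en 1 u + en 1 u * hs s u) := by
  have hi : Integrable (fun ξ : E3 => (1 + ‖ξ‖) ^ (-(2 * s))) volume :=
    integrable_one_add_norm (by simp; linarith)
  set J : ℝ≥0∞ := ∫⁻ ξ : E3, ENNReal.ofReal ((1 + ‖ξ‖) ^ (-(2 * s))) with hJ
  have hJt : J ≠ ⊤ := by
    rw [hJ, ← ofReal_integral_eq_lintegral_ofReal hi (Eventually.of_forall fun ξ => by positivity)]
    exact ENNReal.ofReal_ne_top
  set c : ℝ≥0∞ := ENNReal.ofReal (α ^ 2 + 1) with hc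
  have hct : c ≠ ⊤ := ENNReal.ofReal_ne_top
  refine ⟨(32 + 2 * 480 ^ 2 * (16 * 16 * c ^ 2 * J)).toNNReal, fun u hu k l => ?_⟩
  rw [ENNReal.coe_toNNReal (by finiteness)]
  have hm := aemeasurable_ua u
  have hm1 := aemeasurable_pow_ua 1 u
  -- The `Ḣ²` energy must not appear here. Instead the weight `(1 + |ξ|)^{s-1}` is split over the
  -- convolution of the two gradients, where each factor is in `L²`; this bounds the convolution
  -- pointwise by the inverse of `w`. As `|ξ|` times the filter decays like `(1 + |ξ|)^{-1}`, the
  -- total decay is `(1 + |ξ|)^{-s}`, square integrable because `s > 3/2`. The condition `s ≤ 2`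
  -- keeps the exponent of `w` at most one.
  set w : E3 → ℝ≥0∞ := fun ξ => ENNReal.ofReal ((1 + ‖ξ‖) ^ (s - 1)) with hw
  have hwm : Measurable w := by rw [hw]; fun_prop
  have hwt : ∀ ξ, w ξ ≠ ⊤ := fun ξ => ENNReal.ofReal_ne_top
  set g : E3 → ℝ≥0∞ := fun ξ => ‖ξ‖ₑ ^ 1 * ua u ξ with hg
  have hwg : AEMeasurable (fun ξ => w ξ * g ξ) volume := hwm.aemeasurable.mul hm1
  have hws : ∀ ξ η, w ξ ≤ 2 * (w (ξ - η) + w η) := fun ξ η => by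
    simp only [hw]
    have e : ∀ X : ℝ, (2 : ℝ≥0∞) * ENNReal.ofReal X = ENNReal.ofReal (2 * X) := fun X => by
      rw [ENNReal.ofReal_mul (by norm_num)]; norm_num
    rw [← ENNReal.ofReal_add (by positivity) (by positivity), e]
    exact ENNReal.ofReal_le_ofReal (one_add_rpow_le (by linarith) (by linarith) ξ η)
  have h2 : nsq (fun ξ => w ξ * g ξ) ≤ 4 * hs s u := by
    refine (nsq_mono_ae (Eventually.of_forall fun ξ => ?_)).trans
      (nsq_mul_ua_le (w := fun ξ => ENNReal.ofReal ((1 + ‖ξ‖) ^ s)) (by fun_prop) u)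
    simp only [hw, hg, pow_one]
    rw [← mul_assoc, ← ofReal_norm, ← ENNReal.ofReal_mul (by positivity)]
    gcongr
    rw [Real.rpow_sub_one (by positivity), div_mul_eq_mul_div, div_le_iff₀ (by positivity)]
    gcongr
    linarith
  set Z := nsq g * nsq (fun ξ => w ξ * g ξ) with hZ
  have h3 : ∀ ξ, (‖ξ‖ₑ ^ 1 * (wsym α ξ * cv g g ξ)) ^ 2
      ≤ c ^ 2 * ENNReal.ofReal ((1 + ‖ξ‖) ^ (-(2 * s))) * (16 * Z) := by
    intro ξ
    have e1 : w ξ * cv g g ξ ≤ 4 * cv g (fun η => w η * g η) ξ := by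
      refine (mul_cv_le hm1 hm1 hwm (c := 2) (by norm_num) hws (hwt ξ)).trans (le_of_eq ?_)
      rw [cv_comm (fun η => w η * g η)]; ring
    have e2 : (w ξ * cv g g ξ) ^ 2 ≤ 16 * Z := by
      calc _ ≤ (4 * cv g (fun η => w η * g η) ξ) ^ 2 := by gcongr
        _ = 16 * cv g (fun η => w η * g η) ξ ^ 2 := by ring
        _ ≤ _ := by gcongr; exact cv_sq_le hm1 hwg ξ
    have e3 : ‖ξ‖ₑ ^ 1 * wsym α ξ ≤ c * ENNReal.ofReal ((1 + ‖ξ‖) ^ (-s)) * w ξ := by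
      simp only [hw, hc, wsym]
      rw [← ofReal_pow_norm, ← ENNReal.ofReal_mul (by positivity), ← ENNReal.ofReal_mul (by positivity),
        ← ENNReal.ofReal_mul (by positivity)]
      refine ENNReal.ofReal_le_ofReal ?_
      rw [mul_assoc (α ^ 2 + 1), ← Real.rpow_add (by positivity), show -s + (s - 1) = -1 by ring,
        Real.rpow_neg_one, ← div_eq_mul_inv, le_div_iff₀ (by positivity), pow_one]
      have := wsym_mul_one_add_le α ξ
      linarith
    have e4 : ENNReal.ofReal ((1 + ‖ξ‖) ^ (-s)) ^ 2 = ENNReal.ofReal ((1 + ‖ξ‖) ^ (-(2 * s))) := by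
      rw [← ENNReal.ofReal_pow (by positivity), ← Real.rpow_natCast, ← Real.rpow_mul (by positivity)]
      congr 2; push_cast; ring
    calc _ = ((‖ξ‖ₑ ^ 1 * wsym α ξ) * cv g g ξ) ^ 2 := by ring
      _ ≤ ((c * ENNReal.ofReal ((1 + ‖ξ‖) ^ (-s)) * w ξ) * cv g g ξ) ^ 2 := by gcongr
      _ = c ^ 2 * ENNReal.ofReal ((1 + ‖ξ‖) ^ (-s)) ^ 2 * (w ξ * cv g g ξ) ^ 2 := by ring
      _ ≤ _ := by rw [e4]; gcongr
  have h4 : nsq (fun ξ => ‖ξ‖ₑ ^ 1 * (wsym α ξ * cv g g ξ)) ≤ 16 * c ^ 2 * J * Z := by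
    refine (lintegral_mono h3).trans (le_of_eq ?_)
    have : ∀ ξ : E3, c ^ 2 * ENNReal.ofReal ((1 + ‖ξ‖) ^ (-(2 * s))) * (16 * Z)
        = ENNReal.ofReal ((1 + ‖ξ‖) ^ (-(2 * s))) * (16 * c ^ 2 * Z) := fun ξ => by ring
    simp only [this]
    rw [lintegral_mul_const _ (by fun_prop)]
    ring
  have h5 : Z ≤ 16 * (en 1 u * hs s u) := by
    calc Z ≤ (4 * en 1 u) * (4 * hs s u) := mul_le_mul' (nsq_pow_ua_le 1 u) h2
      _ = _ := by ring
  have key : ∀ᵐ ξ, ‖ξ‖ₑ ^ 1 * ‖rft (stressT α u (gr u) u (gr u) k l) ξ‖ₑ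
      ≤ 2 * cv (ua u) g ξ + 480 * (‖ξ‖ₑ ^ 1 * (wsym α ξ * cv g g ξ)) := by
    filter_upwards [rft_stressT_le hα hu hu k l] with ξ h
    have h1 : ‖ξ‖ₑ ^ 1 * cv (ua u) (ua u) ξ ≤ 2 * cv (ua u) g ξ := by
      have := mul_cv_le hm hm (measurable_enorm_pow 1) (c := 1) (by norm_num)
        (fun ξ η => by simpa using enorm_le_sub_add ξ η) (ξ := ξ) (by finiteness)
      rwa [cv_comm (fun η => ‖η‖ₑ ^ 1 * ua u η), one_mul, ← two_mul] at this
    calc _ ≤ ‖ξ‖ₑ ^ 1 * (cv (ua u) (ua u) ξ + 480 * (wsym α ξ * cv g g ξ)) := by gcongr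
      _ = ‖ξ‖ₑ ^ 1 * cv (ua u) (ua u) ξ + 480 * (‖ξ‖ₑ ^ 1 * (wsym α ξ * cv g g ξ)) := by ring
      _ ≤ _ := by gcongr
  calc _ ≤ nsq (fun ξ => 2 * cv (ua u) g ξ + 480 * (‖ξ‖ₑ ^ 1 * (wsym α ξ * cv g g ξ))) := nsq_mono_ae key
    _ ≤ 2 * (nsq (fun ξ => 2 * cv (ua u) g ξ) + nsq (fun ξ => 480 * (‖ξ‖ₑ ^ 1 * (wsym α ξ * cv g g ξ)))) :=
        nsq_add_le ((aemeasurable_cv hm hm1).const_mul _)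
    _ = 2 * (2 ^ 2 * nsq (cv (ua u) g) + 480 ^ 2 * nsq (fun ξ => ‖ξ‖ₑ ^ 1 * (wsym α ξ * cv g g ξ))) := by
        rw [nsq_const_mul (by norm_num), nsq_const_mul (by norm_num)]
    _ ≤ 2 * (2 ^ 2 * (l1 u ^ 2 * (4 * en 1 u)) + 480 ^ 2 * (16 * c ^ 2 * J * (16 * (en 1 u * hs s u)))) := by
        gcongr
        · exact (nsq_cv_le hm hm1).trans (by gcongr; exacts [le_rfl, nsq_pow_ua_le 1 u])
        · exact h4.trans (by gcongr)
    _ = 32 * (l1 u ^ 2 * en 1 u) + 2 * 480 ^ 2 * (16 * 16 * c ^ 2 * J) * (en 1 u * hs s u) := by ring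
    _ ≤ (32 + 2 * 480 ^ 2 * (16 * 16 * c ^ 2 * J)) * (l1 u ^ 2 * en 1 u)
        + (32 + 2 * 480 ^ 2 * (16 * 16 * c ^ 2 * J)) * (en 1 u * hs s u) := by
        gcongr
        · exact le_self_add
        · exact le_add_self
    _ = _ := by ring

end MLANS

end

noncomputable section

namespace MLANS

open LineDeriv

/-! ### Fourier bounds for the total stress -/

theorem pow_mul_wsym_le (α : ℝ) {m : ℕ} (hm : m = 1 ∨ m = 2) (ξ : E3) :
    ‖ξ‖ₑ ^ m * (ENNReal.ofReal (α ^ 2 / 2) * ENNReal.ofReal (hsym α ξ)) ≤ ENNReal.ofReal (α ^ 2 + 1) := by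
  rw [← ofReal_pow_norm, ← ENNReal.ofReal_mul (by positivity), ← ENNReal.ofReal_mul (by positivity)]
  refine ENNReal.ofReal_le_ofReal ?_
  have h0 := (hsym_pos α ξ).le
  have h1 := hsym_le_one α ξ
  have h2 := sq_mul_hsym_le α ξ
  have h3 : α ^ 2 * hsym α ξ ≤ α ^ 2 := mul_le_of_le_one_right (sq_nonneg α) h1
  have h4 : 0 ≤ α ^ 2 * hsym α ξ := by positivity
  rcases hm with rfl | rfl
  · nlinarith [mul_nonneg h4 (sq_nonneg (‖ξ‖ - 1))]
  · nlinarith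

/-- The filter gains two derivatives, so up to `m = 2` the filtered product of gradients needs only
an `L²` bound. This suffices for the terms containing `v`. -/
theorem nm_stressT_le {α : ℝ} (hα : 0 < α) {m : ℕ} (hm : m = 1 ∨ m = 2) {f g : Fin 3 → E3 → ℝ}
    {P Q : Fin 3 → Fin 3 → E3 → ℝ} {k l : Fin 3} (hfg : MemLp (fun x => f k x * g l x) 2 volume)
    (hd : MemLp (drot P Q k l) 2 volume) :
    nm m (stressT α f P g Q k l)
      ≤ 2 * (nm m (fun x => f k x * g l x) + ENNReal.ofReal (α ^ 2 + 1) ^ 2 * nm 0 (drot P Q k l)) := by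
  have e1 : ‖(α : ℂ) ^ 2 / 2‖ₑ = ENNReal.ofReal (α ^ 2 / 2) := by
    rw [← ofReal_norm]; simp
  calc _ ≤ nsq (fun ξ => ‖ξ‖ₑ ^ m * ‖rft (fun x => f k x * g l x) ξ‖ₑ
        + ENNReal.ofReal (α ^ 2 + 1) * (‖ξ‖ₑ ^ 0 * ‖rft (drot P Q k l) ξ‖ₑ)) := by
        refine nsq_mono_ae ?_
        filter_upwards [(rft_stressT hα hfg hd).2] with ξ e
        rw [e]
        calc _ ≤ ‖ξ‖ₑ ^ m * (‖rft (fun x => f k x * g l x) ξ‖ₑ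
              + ‖(α : ℂ) ^ 2 / 2 * (hsym α ξ * rft (drot P Q k l) ξ)‖ₑ) := by gcongr; exact enorm_add_le _ _
          _ = ‖ξ‖ₑ ^ m * ‖rft (fun x => f k x * g l x) ξ‖ₑ + ‖ξ‖ₑ ^ m * (ENNReal.ofReal (α ^ 2 / 2)
              * ENNReal.ofReal (hsym α ξ)) * ‖rft (drot P Q k l) ξ‖ₑ := by
              rw [enorm_mul, enorm_mul, enorm_hsym, e1]; ring
          _ ≤ _ := by
              rw [pow_zero, one_mul]
              gcongr
              exact pow_mul_wsym_le α hm ξ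
    _ ≤ 2 * (nsq (fun ξ => ‖ξ‖ₑ ^ m * ‖rft (fun x => f k x * g l x) ξ‖ₑ)
        + nsq (fun ξ => ENNReal.ofReal (α ^ 2 + 1) * (‖ξ‖ₑ ^ 0 * ‖rft (drot P Q k l) ξ‖ₑ))) :=
        nsq_add_le (aemeasurable_nm m _)
    _ = _ := by rw [nsq_const_mul ENNReal.ofReal_ne_top]; rfl

section

variable {α b : ℝ} {u v : Fin 3 → E3 → ℝ} {Q : Fin 3 → Fin 3 → E3 → ℝ} {R : Fin 3 → Fin 3 → Fin 3 → E3 → ℝ}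

theorem memLp_drot_left (hu : ∀ i, HPow 3 (u i)) (hv : VDat b v Q R) (k l : Fin 3) :
    MemLp (drot (gr u) Q k l) 2 volume :=
  memLp_drot (fun i j => ((hu j).pd i).1) hv.memLp_grad k l

theorem nm_drot_left_le (hu : ∀ i, HPow 3 (u i)) (hv : VDat b v Q R) (k l : Fin 3) :
    nm 0 (drot (gr u) Q k l) ≤ 622080 * ENNReal.ofReal b ^ 2 * en 1 u := by
  refine (nm_drot_le (fun i j => ((hu j).pd i).1) hv.memLp_grad
    (Eventually.of_forall fun x i j => hv.bound_grad i j x) k l).trans ?_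
  calc _ ≤ 5184 * ENNReal.ofReal b ^ 2 * (120 * en 1 u) := by
        gcongr
        exact sum_nm_gr_le fun i => (hu i).mono (by norm_num)
    _ = 5184 * 120 * ENNReal.ofReal b ^ 2 * en 1 u := by ring
    _ = _ := by norm_num

theorem memLp_stress_parts (hα : 0 < α) (hu : ∀ i, HPow 3 (u i)) (hv : VDat b v Q R) (k l : Fin 3) :
    MemLp (stressT α u (gr u) u (gr u) k l) 2 volume ∧ MemLp (stressT α u (gr u) v Q k l) 2 volume ∧
      MemLp (stressT α v Q u (gr u) k l) 2 volume := by
  have m1 : MemLp (fun x => u k x * v l x) 2 volume :=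
    (memLp_top_mul (hv.memLp l) (hu k).1).ae_eq (Eventually.of_forall fun x => mul_comm _ _)
  have d := memLp_drot_left hu hv k l
  exact ⟨(rft_stressT hα (memLp_tensor hu hu k l) (memLp_drot_gr hu hu k l)).1, (rft_stressT hα m1 d).1,
    (rft_stressT hα (memLp_top_mul (hv.memLp k) (hu l).1) (by rwa [drot_comm])).1⟩

theorem memLp_stress (hα : 0 < α) (hu : ∀ i, HPow 3 (u i)) (hv : VDat b v Q R) (k l : Fin 3) :
    MemLp (stress α u v Q k l) 2 volume := by
  obtain ⟨h1, h2, h3⟩ := memLp_stress_parts hα hu hv k l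
  exact (h1.add h2).add h3

theorem nm_stress_le (hα : 0 < α) (hu : ∀ i, HPow 3 (u i)) (hv : VDat b v Q R) {m : ℕ} (hm : m = 1 ∨ m = 2)
    {X : ℝ≥0∞} (hX : ∀ i j, nm m (fun x => v i x * u j x) ≤ X) (k l : Fin 3) :
    nm m (stress α u v Q k l) ≤ 4 * nm m (stressT α u (gr u) u (gr u) k l)
      + 12 * (X + ENNReal.ofReal (α ^ 2 + 1) ^ 2 * (622080 * ENNReal.ofReal b ^ 2 * en 1 u)) := by
  obtain ⟨h1, h2, h3⟩ := memLp_stress_parts hα hu hv k l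
  have d := memLp_drot_left hu hv k l
  have hd := nm_drot_left_le hu hv k l
  have hc : (fun x => u k x * v l x) = fun x => v l x * u k x := funext fun x => mul_comm _ _
  have m1 : MemLp (fun x => u k x * v l x) 2 volume := by
    rw [hc]; exact memLp_top_mul (hv.memLp l) (hu k).1
  have e2 : nm m (stressT α u (gr u) v Q k l)
      ≤ 2 * (X + ENNReal.ofReal (α ^ 2 + 1) ^ 2 * (622080 * ENNReal.ofReal b ^ 2 * en 1 u)) := by
    refine (nm_stressT_le hα hm m1 d).trans ?_
    rw [hc]
    gcongr
    exact hX l k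
  have e3 : nm m (stressT α v Q u (gr u) k l)
      ≤ 2 * (X + ENNReal.ofReal (α ^ 2 + 1) ^ 2 * (622080 * ENNReal.ofReal b ^ 2 * en 1 u)) := by
    refine (nm_stressT_le hα hm (memLp_top_mul (hv.memLp k) (hu l).1) (by rwa [drot_comm])).trans ?_
    rw [drot_comm]
    gcongr
    exact hX k l
  set W := X + ENNReal.ofReal (α ^ 2 + 1) ^ 2 * (622080 * ENNReal.ofReal b ^ 2 * en 1 u)
  calc _ ≤ 2 * (nm m (fun x => stressT α u (gr u) u (gr u) k l x + stressT α u (gr u) v Q k l x)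
        + nm m (stressT α v Q u (gr u) k l)) := nm_add_le (h1.add h2) h3
    _ ≤ 2 * (2 * (nm m (stressT α u (gr u) u (gr u) k l) + 2 * W) + 2 * W) := by
        gcongr
        exact (nm_add_le h1 h2).trans (by gcongr)
    _ = _ := by ring

end

/-- The total stress in `Ḣ²`. -/
theorem exists_nm_two_stress_le {α : ℝ} (hα : 0 < α) : ∃ K : ℝ≥0, ∀ (b : ℝ) (u v : Fin 3 → E3 → ℝ)
    (Q : Fin 3 → Fin 3 → E3 → ℝ) (R : Fin 3 → Fin 3 → Fin 3 → E3 → ℝ), (∀ i, HPow 3 (u i)) → VDat b v Q R →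
    ∀ k l, nm 2 (stress α u v Q k l)
      ≤ K * (l1 u ^ 2 * en 2 u + ENNReal.ofReal b ^ 2 * (en 0 u + en 1 u + en 2 u)) := by
  set c : ℝ≥0∞ := ENNReal.ofReal (α ^ 2 + 1) with hc
  have hct : c ≠ ⊤ := ENNReal.ofReal_ne_top
  refine ⟨(5184 + 12 * (60000 + c ^ 2 * 622080)).toNNReal, fun b u v Q R hu hv k l => ?_⟩
  rw [ENNReal.coe_toNNReal (by finiteness)]
  refine (nm_stress_le hα hu hv (Or.inr rfl) (X := 60000 * ENNReal.ofReal b ^ 2 * (en 0 u + en 1 u + en 2 u))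
    (fun i j => (nm_two_mul_le hv i ((hu j).mono (by norm_num))).trans ?_) k l).trans ?_
  · gcongr <;> exact nm_le_en _ u j
  set E := en 0 u + en 1 u + en 2 u with hE
  have h1 : en 1 u ≤ E := by rw [hE, add_right_comm]; exact le_add_self
  set B := ENNReal.ofReal b ^ 2
  set L := l1 u ^ 2 * en 2 u with hL
  calc _ ≤ 4 * (1296 * L) + 12 * (60000 * B * E + c ^ 2 * (622080 * B * E)) := by
        gcongr
        exact (nsq_stressT_two hα hu k l).trans (le_of_eq (mul_assoc _ _ _))
    _ = (5184 : ℝ≥0∞) * L + 12 * (60000 + c ^ 2 * 622080) * (B * E) := by ring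
    _ ≤ (5184 + 12 * (60000 + c ^ 2 * 622080)) * L + (5184 + 12 * (60000 + c ^ 2 * 622080)) * (B * E) := by
        gcongr
        · exact le_self_add
        · exact le_add_self
    _ = _ := by ring

/-- The total stress in `Ḣ¹`. -/
theorem exists_nm_one_stress_le {α s : ℝ} (hα : 0 < α) (hs1 : 3 / 2 < s) (hs2 : s ≤ 2) : ∃ K : ℝ≥0,
    ∀ (b : ℝ) (u v : Fin 3 → E3 → ℝ) (Q : Fin 3 → Fin 3 → E3 → ℝ) (R : Fin 3 → Fin 3 → Fin 3 → E3 → ℝ),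
    (∀ i, HPow 3 (u i)) → VDat b v Q R → ∀ k l, nm 1 (stress α u v Q k l)
      ≤ K * (l1 u ^ 2 * en 1 u + en 1 u * hs s u + ENNReal.ofReal b ^ 2 * (en 0 u + en 1 u)) := by
  set c : ℝ≥0∞ := ENNReal.ofReal (α ^ 2 + 1) with hc
  have hct : c ≠ ⊤ := ENNReal.ofReal_ne_top
  obtain ⟨K, hK⟩ := nsq_stressT_one hα hs1 hs2
  refine ⟨(4 * K + 12 * (240 + c ^ 2 * 622080)).toNNReal, fun b u v Q R hu hv k l => ?_⟩
  rw [ENNReal.coe_toNNReal (by finiteness)]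
  refine (nm_stress_le hα hu hv (Or.inl rfl) (X := 240 * ENNReal.ofReal b ^ 2 * (en 0 u + en 1 u))
    (fun i j => (nm_one_mul_le (hv.bound i) (fun j => Eventually.of_forall (hv.bound_grad j i)) (hv.memLp i)
      (fun j => hv.memLp_grad j i) (fun j => hv.wd j i) ((hu j).mono (by norm_num))).trans ?_) k l).trans ?_
  · gcongr <;> exact nm_le_en _ u j
  set E := en 0 u + en 1 u with hE
  have h1 : en 1 u ≤ E := le_add_self
  set B := ENNReal.ofReal b ^ 2
  set L := l1 u ^ 2 * en 1 u + en 1 u * hs s u with hL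
  calc _ ≤ 4 * (K * L) + 12 * (240 * B * E + c ^ 2 * (622080 * B * E)) := by
        gcongr
        exact hK u hu k l
    _ = 4 * K * L + 12 * (240 + c ^ 2 * 622080) * (B * E) := by ring
    _ ≤ (4 * K + 12 * (240 + c ^ 2 * 622080)) * L + (4 * K + 12 * (240 + c ^ 2 * 622080)) * (B * E) := by
        gcongr
        · exact le_self_add
        · exact le_add_self
    _ = _ := by ring

end MLANS

end

noncomputable section

namespace MLANS

open LineDeriv

/-! ### Weakly differentiable curves in a Hilbert space -/

section Hilbert

variable {H : Type*} [NormedAddCommGroup H] [InnerProductSpace ℂ H] {D : Set H} {X Z : ℝ → H} {b c M : ℝ}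

/-- The mean value inequality bounds each scalar function for `d ∈ D` with constant `M ‖d‖`. The
bound extends to all `d` by density, and the increment itself is then taken for `d`. -/
theorem lipschitz_of_weak_deriv (hD : Dense D) (hM : ∀ t ∈ Icc b c, ‖Z t‖ ≤ M)
    (h : ∀ d ∈ D, ∀ t ∈ Icc b c,
      HasDerivWithinAt (fun r => inner ℂ d (X r)) (inner ℂ d (Z t)) (Icc b c) t)
    {r t : ℝ} (hr : r ∈ Icc b c) (ht : t ∈ Icc b c) : ‖X r - X t‖ ≤ M * |r - t| := by
  have key : ∀ d : H, ‖(inner ℂ d (X r - X t) : ℂ)‖ ≤ M * ‖d‖ * |r - t| := by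
    have hcl : IsClosed {d : H | ‖(inner ℂ d (X r - X t) : ℂ)‖ ≤ M * ‖d‖ * |r - t|} :=
      isClosed_le (by fun_prop) (by fun_prop)
    have hsub : D ⊆ {d : H | ‖(inner ℂ d (X r - X t) : ℂ)‖ ≤ M * ‖d‖ * |r - t|} := by
      intro d hd
      have := (convex_Icc b c).norm_image_sub_le_of_norm_hasDerivWithin_le (h d hd) (C := M * ‖d‖)
        (fun y hy => (norm_inner_le_norm _ _).trans (by
          rw [mul_comm]; exact mul_le_mul_of_nonneg_right (hM y hy) (norm_nonneg _))) ht hr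
      simpa only [mem_ofPred_eq, inner_sub_right, Real.norm_eq_abs] using this
    intro d
    exact hcl.closure_subset_iff.2 hsub (hD.closure_eq ▸ mem_univ d)
  have h1 := key (X r - X t)
  rw [inner_self_eq_norm_sq_to_K, norm_pow, RCLike.norm_ofReal, abs_norm] at h1
  rcases (norm_nonneg (X r - X t)).eq_or_lt with h0 | h0
  · rw [← h0]
    exact mul_nonneg ((norm_nonneg _).trans (hM t ht)) (abs_nonneg _)
  · nlinarith

/-- The Lipschitz bound makes the remainders uniformly `O(|r - t|)` in norm, so replacing `x` by a
nearby `d` costs an arbitrarily small multiple of `|r - t|`. -/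
theorem weak_deriv_extend (hD : Dense D) (hM : ∀ t ∈ Icc b c, ‖Z t‖ ≤ M)
    (h : ∀ d ∈ D, ∀ t ∈ Icc b c,
      HasDerivWithinAt (fun r => inner ℂ d (X r)) (inner ℂ d (Z t)) (Icc b c) t)
    (x : H) {t : ℝ} (ht : t ∈ Icc b c) :
    HasDerivWithinAt (fun r => (inner ℂ x (X r) : ℂ)) (inner ℂ x (Z t)) (Icc b c) t := by
  have hM0 : 0 ≤ M := (norm_nonneg _).trans (hM t ht)
  rw [hasDerivWithinAt_iff_isLittleO, Asymptotics.isLittleO_iff]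
  intro ε hε
  obtain ⟨d, hd, hxd⟩ := Metric.mem_closure_iff.1 (hD.closure_eq ▸ mem_univ x : x ∈ closure D)
    (ε / (2 * (2 * M + 1))) (by positivity)
  have h1 := (hasDerivWithinAt_iff_isLittleO.1 (h d hd t ht))
  rw [Asymptotics.isLittleO_iff] at h1
  filter_upwards [h1 (half_pos hε), self_mem_nhdsWithin] with r hr hrI
  have e : (inner ℂ x (X r) - inner ℂ x (X t) - (r - t) • inner ℂ x (Z t) : ℂ)
      = inner ℂ (x - d) (X r - X t - (r - t) • Z t)
        + (inner ℂ d (X r) - inner ℂ d (X t) - (r - t) • inner ℂ d (Z t)) := by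
    have : (r - t) • Z t = ((r - t : ℝ) : ℂ) • Z t := (Complex.coe_smul _ _).symm
    rw [this, inner_sub_left, inner_sub_right, inner_sub_right, inner_sub_right, inner_sub_right,
      inner_smul_right, inner_smul_right]
    simp only [Complex.real_smul]
    ring
  rw [e]
  refine (norm_add_le _ _).trans ?_
  have h2 : ‖X r - X t - (r - t) • Z t‖ ≤ (2 * M + 1) * ‖r - t‖ := by
    have a1 := lipschitz_of_weak_deriv hD hM h hrI ht
    have a2 : ‖(r - t) • Z t‖ ≤ ‖r - t‖ * M := by
      rw [norm_smul]; exact mul_le_mul_of_nonneg_left (hM t ht) (norm_nonneg _)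
    rw [← Real.norm_eq_abs] at a1
    have := norm_sub_le (X r - X t) ((r - t) • Z t)
    nlinarith [norm_nonneg (r - t)]
  have h3 : ‖(inner ℂ (x - d) (X r - X t - (r - t) • Z t) : ℂ)‖ ≤ ε / 2 * ‖r - t‖ := by
    refine (norm_inner_le_norm _ _).trans ?_
    rw [dist_eq_norm] at hxd
    calc _ ≤ ε / (2 * (2 * M + 1)) * ((2 * M + 1) * ‖r - t‖) := by gcongr
      _ = _ := by field_simp
  linarith

/-- From `‖X r‖² = 2 Re ⟨X t, X r⟩ - ‖X t‖² + ‖X r - X t‖²`: the first term is differentiable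
weakly, and the last is `O(|r - t|²)` by the Lipschitz bound. No strong derivative of the curve is
needed. -/
theorem hasDerivWithinAt_norm_sq (hD : Dense D) (hM : ∀ t ∈ Icc b c, ‖Z t‖ ≤ M)
    (h : ∀ d ∈ D, ∀ t ∈ Icc b c,
      HasDerivWithinAt (fun r => inner ℂ d (X r)) (inner ℂ d (Z t)) (Icc b c) t)
    {t : ℝ} (ht : t ∈ Icc b c) :
    HasDerivWithinAt (fun r => ‖X r‖ ^ 2) (2 * (inner ℂ (X t) (Z t) : ℂ).re) (Icc b c) t := by
  have h1 := weak_deriv_extend hD hM h (X t) ht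
  have h2 : HasDerivWithinAt (fun r => 2 * (inner ℂ (X t) (X r) : ℂ).re) (2 * (inner ℂ (X t) (Z t) : ℂ).re)
      (Icc b c) t := (Complex.reCLM.hasFDerivAt.comp_hasDerivWithinAt t h1).const_mul 2
  have h3 : HasDerivWithinAt (fun r => ‖X r - X t‖ ^ 2) 0 (Icc b c) t := by
    rw [hasDerivWithinAt_iff_isLittleO]
    have hO : (fun r => ‖X r - X t‖ ^ 2 - ‖X t - X t‖ ^ 2 - (r - t) • (0 : ℝ)) =O[𝓝[Icc b c] t]
        fun r => (r - t) ^ 2 := by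
      refine Asymptotics.IsBigO.of_bound (M ^ 2) ?_
      filter_upwards [self_mem_nhdsWithin] with r hr
      have := lipschitz_of_weak_deriv hD hM h hr ht
      simp only [sub_self, norm_zero, smul_zero, sub_zero, norm_pow, norm_norm, ne_eq, OfNat.ofNat_ne_zero,
        not_false_eq_true, zero_pow]
      rw [← mul_pow, Real.norm_eq_abs]
      gcongr
    refine hO.trans_isLittleO ?_
    have : Tendsto (fun r : ℝ => r - t) (𝓝[Icc b c] t) (𝓝 0) := by
      have h4 : Tendsto (fun r : ℝ => r - t) (𝓝 t) (𝓝 (t - t)) := by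
        exact (continuous_id.sub continuous_const).tendsto t
      rw [sub_self] at h4
      exact h4.mono_left nhdsWithin_le_nhds
    refine (Asymptotics.isLittleO_iff).2 fun ε hε => ?_
    filter_upwards [this (Metric.ball_mem_nhds 0 hε)] with r hr
    rw [mem_preimage, mem_ball_zero_iff] at hr
    rw [pow_two, norm_mul]
    gcongr
  have h4 := (h2.add h3).sub_const (‖X t‖ ^ 2)
  rw [add_zero] at h4
  refine h4.congr_of_mem (fun r _ => ?_) ht
  have e := @norm_sub_sq ℂ _ _ _ _ (X r) (X t)
  have e2 : RCLike.re (inner ℂ (X r) (X t)) = (inner ℂ (X t) (X r) : ℂ).re := by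
    rw [← inner_conj_symm]; exact Complex.conj_re _
  simp only [Pi.add_apply]
  rw [e, e2]
  ring

end Hilbert

/-! ### The weak equation tested with Fourier transforms -/

/-- The Schwartz vector field with given components. -/
def fieldOf (φ : Fin 3 → 𝓢(E3, ℝ)) : 𝓢(E3, E3) :=
  ∑ i, SchwartzMap.postcompCLM (ContinuousLinearMap.toSpanSingleton ℝ (basisVec i)) (φ i)

theorem fieldOf_apply (φ : Fin 3 → 𝓢(E3, ℝ)) (x : E3) (i : Fin 3) : fieldOf φ x i = φ i x := by
  simp only [fieldOf, sum_apply, SchwartzMap.postcompCLM_apply,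
    ContinuousLinearMap.toSpanSingleton_apply, basisVec]
  simp [Pi.single_apply]

theorem proj_comp_fieldOf (φ : Fin 3 → 𝓢(E3, ℝ)) (i : Fin 3) :
    (fun x => EuclideanSpace.proj (𝕜 := ℝ) i (fieldOf φ x)) = φ i :=
  funext fun x => fieldOf_apply φ x i

theorem fderiv_fieldOf (φ : Fin 3 → 𝓢(E3, ℝ)) (x w : E3) (i : Fin 3) :
    (fderiv ℝ (fieldOf φ) x w) i = (∂_{w} (φ i)) x := by
  rw [SchwartzMap.lineDerivOp_apply_eq_fderiv, ← proj_comp_fieldOf φ i]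
  have h := ((EuclideanSpace.proj (𝕜 := ℝ) i).hasFDerivAt.comp x ((fieldOf φ).hasFDerivAt x)).fderiv
  have e : (fun x => EuclideanSpace.proj (𝕜 := ℝ) i (fieldOf φ x)) = (EuclideanSpace.proj (𝕜 := ℝ) i) ∘ fieldOf φ := rfl
  rw [e, h]
  rfl

theorem laplacian_fieldOf (φ : Fin 3 → 𝓢(E3, ℝ)) (x : E3) (i : Fin 3) :
    (Δ (fieldOf φ : E3 → E3) x) i = ∑ k, (∂_{basisVec k} (∂_{basisVec k} (φ i))) x := by
  have h1 : Δ (φ i : E3 → ℝ) x = (Δ (fieldOf φ : E3 → E3) x) i := by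
    have h := ContDiffAt.laplacian_CLM_comp_left (l := EuclideanSpace.proj (𝕜 := ℝ) i)
      (((fieldOf φ).smooth 2).contDiffAt (x := x))
    rw [← proj_comp_fieldOf φ i]
    exact h
  rw [← h1, ← SchwartzMap.laplacian_apply, SchwartzMap.laplacian_eq_sum (EuclideanSpace.basisFun (Fin 3) ℝ)]
  simp [basisVec]

theorem weakFlow_real {ν : ℝ} {I : Set ℝ} {u : ℝ → E3 → E3} {S : ℝ → E3 → Mat3} (h : WeakFlow ν I u S)
    {t : ℝ} (ht : t ∈ I) (hu : ∀ᶠ r in 𝓝 t, ∀ i, TI (comp (u r) i)) (hS : ∀ k i, TI fun x => S t x k i)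
    {φ : Fin 3 → 𝓢(E3, ℝ)} (hφ : ∀ x, ∑ i, (∂_{basisVec i} (φ i)) x = 0) :
    HasDerivAt (fun r => ∑ i, ∫ x, comp (u r) i x * φ i x)
      (ν * (∑ i, ∑ k, ∫ x, comp (u t) i x * (∂_{basisVec k} (∂_{basisVec k} (φ i))) x)
        + ∑ k, ∑ i, ∫ x, S t x k i * (∂_{basisVec k} (φ i)) x) t := by
  have h1 := h (fieldOf φ) (fun x => by simp only [fderiv_fieldOf, hφ]) t ht
  have ht' := hu.self_of_nhds
  have e0 : ∀ r x i, u r x i = comp (u r) i x := fun _ _ _ => rfl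
  simp only [fieldOf_apply, laplacian_fieldOf, fderiv_fieldOf, e0] at h1
  have e1 : ∫ x, ∑ i, comp (u t) i x * ∑ k, (∂_{basisVec k} (∂_{basisVec k} (φ i))) x
      = ∑ i, ∑ k, ∫ x, comp (u t) i x * (∂_{basisVec k} (∂_{basisVec k} (φ i))) x := by
    simp only [Finset.mul_sum]
    rw [integral_finsetSum _ fun i _ => integrable_finsetSum _ fun k _ => (ht' i).integrable_mul_schwartz _]
    exact Finset.sum_congr rfl fun i _ => integral_finsetSum _ fun k _ => (ht' i).integrable_mul_schwartz _
  have e2 : ∫ x, ∑ k, ∑ i, S t x k i * (∂_{basisVec k} (φ i)) x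
      = ∑ k, ∑ i, ∫ x, S t x k i * (∂_{basisVec k} (φ i)) x := by
    rw [integral_finsetSum _ fun k _ => integrable_finsetSum _ fun i _ => (hS k i).integrable_mul_schwartz _]
    exact Finset.sum_congr rfl fun k _ => integral_finsetSum _ fun i _ => (hS k i).integrable_mul_schwartz _
  rw [e1, e2] at h1
  refine h1.congr_of_eventuallyEq ?_
  filter_upwards [hu] with r hr
  exact (integral_finsetSum _ fun i _ => (hr i).integrable_mul_schwartz _).symm

/-- The real and imaginary parts of a solenoidal field are solenoidal. Complex fields are needed
because the test fields will be Fourier transforms. -/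
theorem weakFlow_complex {ν : ℝ} {I : Set ℝ} {u : ℝ → E3 → E3} {S : ℝ → E3 → Mat3} (h : WeakFlow ν I u S)
    {t : ℝ} (ht : t ∈ I) (hu : ∀ᶠ r in 𝓝 t, ∀ i, TI (comp (u r) i)) (hS : ∀ k i, TI fun x => S t x k i)
    {φ : Fin 3 → 𝓢(E3, ℂ)} (hφ : ∀ x, ∑ i, (∂_{basisVec i} (φ i)) x = 0) :
    HasDerivAt (fun r => ∑ i, ∫ x, (comp (u r) i x : ℂ) * φ i x)
      (ν * (∑ i, ∑ k, ∫ x, (comp (u t) i x : ℂ) * (∂_{basisVec k} (∂_{basisVec k} (φ i))) x)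
        + ∑ k, ∑ i, ∫ x, (S t x k i : ℂ) * (∂_{basisVec k} (φ i)) x) t := by
  have dR : ∀ (k : Fin 3) (ψ : 𝓢(E3, ℂ)), ∂_{basisVec k} (schwartzRe ψ) = schwartzRe (∂_{basisVec k} ψ) :=
    fun k ψ => by ext x; rw [lineDeriv_schwartzRe, schwartzRe_apply]
  have dI : ∀ (k : Fin 3) (ψ : 𝓢(E3, ℂ)), ∂_{basisVec k} (schwartzIm ψ) = schwartzIm (∂_{basisVec k} ψ) :=
    fun k ψ => by ext x; rw [lineDeriv_schwartzIm, schwartzIm_apply]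
  have h1 := (weakFlow_real h ht hu hS (φ := fun i => schwartzRe (φ i)) fun x => by
    simp only [lineDeriv_schwartzRe]
    rw [← Complex.re_sum, hφ, Complex.zero_re]).ofReal_comp
  have h2 := (weakFlow_real h ht hu hS (φ := fun i => schwartzIm (φ i)) fun x => by
    simp only [lineDeriv_schwartzIm]
    rw [← Complex.im_sum, hφ, Complex.zero_im]).ofReal_comp
  have h3 := h1.add (h2.mul_const Complex.I)
  simp only [dR, dI] at h3
  have ht' := hu.self_of_nhds
  refine (h3.congr_of_eventuallyEq ?_).congr_deriv ?_
  · filter_upwards [hu] with r hr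
    simp only [Pi.add_apply]
    push_cast
    rw [Finset.sum_mul, ← Finset.sum_add_distrib]
    exact Finset.sum_congr rfl fun i _ => integral_mul_schwartzC (hr i) _
  · simp only [integral_mul_schwartzC (ht' _), integral_mul_schwartzC (hS _ _)]
    push_cast
    simp only [Finset.sum_add_distrib, Finset.sum_mul, Finset.mul_sum, mul_add, add_mul]
    simp only [mul_assoc]
    ring

end MLANS

end

/-! ### The equation on the Fourier side, with the pressure eliminated. -/

noncomputable section

namespace MLANS

open LineDeriv

theorem integral_mul_fourier {f : E3 → ℝ} (hf : MemLp f 2 volume) (g : 𝓢(E3, ℂ)) :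
    ∫ x, (f x : ℂ) * (𝓕 g : 𝓢(E3, ℂ)) x = ∫ ξ, rft f ξ * g ξ :=
  (integral_ft_mul (f := fun x => (f x : ℂ)) hf.ofReal g).symm

theorem integral_mul_lineDeriv_fourier {f : E3 → ℝ} (hf : MemLp f 2 volume) (k : Fin 3) (g : 𝓢(E3, ℂ)) :
    ∫ x, (f x : ℂ) * (∂_{basisVec k} (𝓕 g : 𝓢(E3, ℂ))) x = -∫ ξ, rft f ξ * (dsym k ξ * g ξ) := by
  have e : ∀ x, (f x : ℂ) * (∂_{basisVec k} (𝓕 g : 𝓢(E3, ℂ))) x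
      = -(2 * Real.pi * Complex.I) * ((f x : ℂ) * (𝓕 (coordMul k g) : 𝓢(E3, ℂ)) x) := fun x => by
    rw [lineDeriv_fourier]
    simp only [smul_apply, smul_eq_mul]
    ring
  simp only [e]
  rw [integral_const_mul, integral_mul_fourier hf, ← integral_const_mul, ← integral_neg]
  refine integral_congr_ae (Eventually.of_forall fun ξ => ?_)
  simp only [coordMul_apply, dsym]
  ring

theorem integral_mul_lineDeriv_two_fourier {f : E3 → ℝ} (hf : MemLp f 2 volume) (k : Fin 3) (g : 𝓢(E3, ℂ)) :
    ∫ x, (f x : ℂ) * (∂_{basisVec k} (∂_{basisVec k} (𝓕 g : 𝓢(E3, ℂ)))) x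
      = ∫ ξ, rft f ξ * (dsym k ξ ^ 2 * g ξ) := by
  have e : ∀ x, (f x : ℂ) * (∂_{basisVec k} (∂_{basisVec k} (𝓕 g : 𝓢(E3, ℂ)))) x
      = -(2 * Real.pi * Complex.I) * ((f x : ℂ) * (∂_{basisVec k} (𝓕 (coordMul k g) : 𝓢(E3, ℂ))) x) :=
    fun x => by
      rw [lineDeriv_fourier, LineDeriv.lineDerivOp_smul]
      simp only [smul_apply, smul_eq_mul]
      ring
  simp only [e]
  rw [integral_const_mul, integral_mul_lineDeriv_fourier hf, ← integral_neg, ← integral_const_mul]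
  refine integral_congr_ae (Eventually.of_forall fun ξ => ?_)
  simp only [coordMul_apply, dsym]
  ring

/-- The weak equation on the Fourier side. -/
theorem weakFlow_fourier {ν : ℝ} {I : Set ℝ} {u : ℝ → E3 → E3} {S : ℝ → E3 → Mat3} (h : WeakFlow ν I u S)
    {t : ℝ} (ht : t ∈ I) (hu : ∀ᶠ r in 𝓝 t, ∀ i, MemLp (comp (u r) i) 2 volume)
    (hS : ∀ k i, MemLp (fun x => S t x k i) 2 volume)
    {g : Fin 3 → 𝓢(E3, ℂ)} (hg : ∀ ξ, ∑ i, (ξ i : ℂ) * g i ξ = 0) :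
    HasDerivAt (fun r => ∑ i, ∫ ξ, rft (comp (u r) i) ξ * g i ξ)
      (ν * (∑ i, ∑ k, ∫ ξ, rft (comp (u t) i) ξ * (dsym k ξ ^ 2 * g i ξ))
        - ∑ k, ∑ i, ∫ ξ, rft (fun x => S t x k i) ξ * (dsym k ξ * g i ξ)) t := by
  have hdiv : ∀ x, ∑ i, (∂_{basisVec i} (𝓕 (g i) : 𝓢(E3, ℂ))) x = 0 := fun x => by
    have e : ∑ i, coordMul i (g i) = 0 := by
      ext ξ
      simp only [sum_apply, coordMul_apply, hg]
      rfl
    have e2 : ∑ i, ∂_{basisVec i} (𝓕 (g i) : 𝓢(E3, ℂ)) = 0 := by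
      simp only [lineDeriv_fourier]
      rw [← Finset.smul_sum, ← FourierTransform.fourier_sum, e, FourierTransform.fourier_zero, smul_zero]
    have := DFunLike.congr_fun e2 x
    simpa only [sum_apply, zero_apply] using this
  have h1 := weakFlow_complex h ht (hu.mono fun r hr i => (hr i).ti (by norm_num))
    (fun k i => (hS k i).ti (by norm_num)) hdiv
  refine (h1.congr_of_eventuallyEq ?_).congr_deriv ?_
  · filter_upwards [hu] with r hr
    exact Finset.sum_congr rfl fun i _ => (integral_mul_fourier (hr i) (g i)).symm
  · have ht' := hu.self_of_nhds
    simp only [integral_mul_lineDeriv_two_fourier (ht' _), integral_mul_lineDeriv_fourier (hS _ _)]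
    simp only [Finset.sum_neg_distrib]
    ring

/-- The components of the divergence-free test fields. -/
def solTest (l : Fin 3) (θ : 𝓢(E3, ℂ)) (i : Fin 3) : 𝓢(E3, ℂ) :=
  (if i = l then ∑ m, coordMul m (coordMul m θ) else 0) - coordMul i (coordMul l θ)

theorem sum_coord_sq_complex (ξ : E3) : ∑ i, (ξ i : ℂ) ^ 2 = (‖ξ‖ : ℂ) ^ 2 := by
  rw [← Complex.ofReal_pow, ← sum_coord_sq]
  push_cast
  rfl

theorem solTest_apply (l : Fin 3) (θ : 𝓢(E3, ℂ)) (i : Fin 3) (ξ : E3) :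
    solTest l θ i ξ = ((if i = l then (‖ξ‖ : ℂ) ^ 2 else 0) - ξ i * ξ l) * θ ξ := by
  rw [solTest, sub_apply, coordMul_apply, coordMul_apply]
  split_ifs
  · simp only [sum_apply, coordMul_apply, ← mul_assoc, ← pow_two]
    rw [← Finset.sum_mul, sum_coord_sq_complex]
    ring
  · rw [zero_apply]; ring

theorem sum_mul_solTest (U : Fin 3 → ℂ) (l : Fin 3) (θ : 𝓢(E3, ℂ)) (ξ : E3) :
    ∑ i, U i * solTest l θ i ξ = (U l * (‖ξ‖ : ℂ) ^ 2 - ξ l * ∑ i, ξ i * U i) * θ ξ := by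
  simp only [solTest_apply]
  rw [sub_mul, Finset.mul_sum, Finset.sum_mul]
  have e : ∀ i, U i * (((if i = l then (‖ξ‖ : ℂ) ^ 2 else 0) - ξ i * ξ l) * θ ξ)
      = (if i = l then U i * (‖ξ‖ : ℂ) ^ 2 * θ ξ else 0) - ξ l * (ξ i * U i) * θ ξ := fun i => by
    split_ifs <;> ring
  simp only [e]
  rw [Finset.sum_sub_distrib, Finset.sum_ite_eq' Finset.univ l, if_pos (Finset.mem_univ l)]

/-- The right-hand side of the equation for the `l`-th component, on the Fourier side and with the pressure
eliminated. -/
def rhsSym (ν : ℝ) (u : Fin 3 → E3 → ℝ) (S : Fin 3 → Fin 3 → E3 → ℝ) (l : Fin 3) (ξ : E3) : ℂ :=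
  -(4 * Real.pi ^ 2 * ν) * (‖ξ‖ : ℂ) ^ 2 * rft (u l) ξ - (∑ k, dsym k ξ * rft (S k l) ξ)
    + ξ l / (‖ξ‖ : ℂ) ^ 2 * ∑ k, dsym k ξ * ∑ i, ξ i * rft (S k i) ξ

theorem integrable_mul_schwartz {F : E3 → ℂ} (hF : MemLp F 2 volume) (θ : 𝓢(E3, ℂ)) :
    Integrable (fun ξ => F ξ * θ ξ) volume := hF.integrable_mul (memLp_schwartz θ 2)

/-- The test field is `|ξ|²` times the Leray projection of `θ` in direction `l`; the factor `|ξ|²`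
keeps it Schwartz. As the transform of the velocity is orthogonal to `ξ`, pairing with it isolates
component `l`. On the stress the projection remains and gives the last term of `rhsSym`. -/
theorem hasDerivWithinAt_rft {ν : ℝ} {I J : Set ℝ} {u : ℝ → E3 → E3} {S : ℝ → E3 → Mat3}
    (h : WeakFlow ν I u S) {t : ℝ} (ht : t ∈ I) (htJ : t ∈ J)
    (hu : ∀ᶠ r in 𝓝 t, ∀ i, MemLp (comp (u r) i) 2 volume)
    (hS : ∀ k i, MemLp (fun x => S t x k i) 2 volume)
    (hdiv : ∀ r ∈ J, ∀ᵐ ξ, ∑ i, (ξ i : ℂ) * rft (comp (u r) i) ξ = 0) (l : Fin 3) (θ : 𝓢(E3, ℂ)) :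
    HasDerivWithinAt (fun r => ∫ ξ, rft (comp (u r) l) ξ * ((‖ξ‖ : ℂ) ^ 2 * θ ξ))
      (∫ ξ, rhsSym ν (comp (u t)) (fun k i x => S t x k i) l ξ * ((‖ξ‖ : ℂ) ^ 2 * θ ξ)) J t := by
  have hg : ∀ ξ : E3, ∑ i, (ξ i : ℂ) * solTest l θ i ξ = 0 := fun ξ => by
    rw [sum_mul_solTest (fun i => (ξ i : ℂ))]
    simp only [← pow_two, sum_coord_sq_complex]
    ring
  have h1 := (weakFlow_fourier h ht hu hS hg).hasDerivWithinAt (s := J)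
  have ht' := hu.self_of_nhds
  have int1 : ∀ r i, Integrable (fun ξ => rft (comp (u r) i) ξ * solTest l θ i ξ) volume := fun r i =>
    integrable_mul_schwartz (memLp_rft _) _
  have e1 : ∀ r ∈ J, ∫ ξ, rft (comp (u r) l) ξ * ((‖ξ‖ : ℂ) ^ 2 * θ ξ)
      = ∑ i, ∫ ξ, rft (comp (u r) i) ξ * solTest l θ i ξ := fun r hr => by
    rw [← integral_finsetSum _ fun i _ => int1 r i]
    refine integral_congr_ae ?_
    filter_upwards [hdiv r hr] with ξ hξ
    rw [sum_mul_solTest (fun i => rft (comp (u r) i) ξ), hξ]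
    ring
  refine (h1.congr e1 (e1 t htJ)).congr_deriv ?_
  have d1 : ∀ (k : Fin 3) (ψ : 𝓢(E3, ℂ)) (ξ : E3), dsym k ξ * ψ ξ
      = ((2 * Real.pi * Complex.I : ℂ) • coordMul k ψ) ξ := fun k ψ ξ => by
    rw [smul_apply, coordMul_apply, smul_eq_mul, dsym]; ring
  have int2 : ∀ i k, Integrable (fun ξ => rft (comp (u t) i) ξ * (dsym k ξ ^ 2 * solTest l θ i ξ)) volume :=
    fun i k => by
      simp only [pow_two, mul_assoc, d1]
      exact integrable_mul_schwartz (memLp_rft _) _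
  have int3 : ∀ k i, Integrable (fun ξ => rft (fun x => S t x k i) ξ * (dsym k ξ * solTest l θ i ξ)) volume :=
    fun k i => by
      simp only [d1]
      exact integrable_mul_schwartz (memLp_rft _) _
  simp only [← integral_finsetSum _ fun k _ => int2 _ k, ← integral_finsetSum _ fun i _ => int3 _ i]
  rw [← integral_finsetSum _ fun i _ => integrable_finsetSum _ fun k _ => int2 i k,
    ← integral_finsetSum _ fun k _ => integrable_finsetSum _ fun i _ => int3 k i, ← integral_const_mul,
    ← integral_sub ((integrable_finsetSum _ fun i _ => integrable_finsetSum _ fun k _ => int2 i k).const_mul _)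
      (integrable_finsetSum _ fun k _ => integrable_finsetSum _ fun i _ => int3 k i)]
  refine integral_congr_ae ?_
  -- The origin is discarded because `rhsSym` divides by `|ξ|²`.
  filter_upwards [hdiv t htJ, Measure.ae_ne volume (0 : E3)] with ξ hξ h0
  have hn : (‖ξ‖ : ℂ) ≠ 0 := by simpa using h0
  have s1 : ∑ i, ∑ k, rft (comp (u t) i) ξ * (dsym k ξ ^ 2 * solTest l θ i ξ)
      = -(4 * Real.pi ^ 2) * (‖ξ‖ : ℂ) ^ 2 * (rft (comp (u t) l) ξ * (‖ξ‖ : ℂ) ^ 2 * θ ξ) := by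
    have : ∀ i, ∑ k, rft (comp (u t) i) ξ * (dsym k ξ ^ 2 * solTest l θ i ξ)
        = (∑ k, dsym k ξ ^ 2) * (rft (comp (u t) i) ξ * solTest l θ i ξ) := fun i => by
      rw [Finset.sum_mul]
      exact Finset.sum_congr rfl fun k _ => by ring
    simp only [this]
    rw [← Finset.mul_sum, sum_mul_solTest (fun i => rft (comp (u t) i) ξ), hξ]
    have : ∑ k, dsym k ξ ^ 2 = -(4 * Real.pi ^ 2) * (‖ξ‖ : ℂ) ^ 2 := by
      rw [← sum_coord_sq_complex, Finset.mul_sum]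
      refine Finset.sum_congr rfl fun k _ => ?_
      rw [dsym, mul_pow, mul_pow, mul_pow, Complex.I_sq]; ring
    rw [this]; ring
  have s2 : ∑ k, ∑ i, rft (fun x => S t x k i) ξ * (dsym k ξ * solTest l θ i ξ)
      = ((∑ k, dsym k ξ * rft (fun x => S t x k l) ξ) * (‖ξ‖ : ℂ) ^ 2
        - ξ l * ∑ k, dsym k ξ * ∑ i, ξ i * rft (fun x => S t x k i) ξ) * θ ξ := by
    have : ∀ k, ∑ i, rft (fun x => S t x k i) ξ * (dsym k ξ * solTest l θ i ξ)
        = dsym k ξ * ((rft (fun x => S t x k l) ξ * (‖ξ‖ : ℂ) ^ 2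
          - ξ l * ∑ i, ξ i * rft (fun x => S t x k i) ξ) * θ ξ) := fun k => by
      rw [← sum_mul_solTest (fun i => rft (fun x => S t x k i) ξ), Finset.mul_sum]
      exact Finset.sum_congr rfl fun i _ => by ring
    simp only [this]
    rw [Finset.sum_mul, Finset.mul_sum, ← Finset.sum_sub_distrib, Finset.sum_mul]
    exact Finset.sum_congr rfl fun k _ => by ring
  rw [s1, s2, rhsSym]
  field_simp
  ring

end MLANS

end

noncomputable section

namespace MLANS

open LineDeriv

/-! ### The energy identity -/

/-- A smooth cutoff weight, supported away from the origin and from infinity. -/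
def CutWeight (G : E3 → ℝ) : Prop :=
  ∃ H : E3 → ℝ, ContDiff ℝ ∞ H ∧ HasCompactSupport H ∧ ∀ ξ, G ξ = ‖ξ‖ ^ 2 * H ξ

theorem CutWeight.continuous {G : E3 → ℝ} (h : CutWeight G) : Continuous G := by
  obtain ⟨H, h1, -, h3⟩ := h
  rw [show G = fun ξ => ‖ξ‖ ^ 2 * H ξ from funext h3]
  have := h1.continuous
  fun_prop

theorem CutWeight.bound {G : E3 → ℝ} (h : CutWeight G) :
    ∃ C : ℝ, 0 ≤ C ∧ ∀ ξ, |G ξ| ≤ C ∧ |G ξ| * ‖ξ‖ ^ 2 ≤ C := by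
  have hc := h.continuous
  obtain ⟨H, h1, h2, h3⟩ := h
  have hcs : HasCompactSupport G := by
    rw [show G = fun ξ => ‖ξ‖ ^ 2 * H ξ from funext h3]
    exact h2.mul_left
  obtain ⟨C1, hC1⟩ := hcs.exists_bound_of_continuous hc
  obtain ⟨C2, hC2⟩ := (hcs.mul_right (f' := fun ξ : E3 => ‖ξ‖ ^ 2)).exists_bound_of_continuous
    (hc.mul (by fun_prop))
  refine ⟨max C1 C2, ((norm_nonneg _).trans (hC1 0)).trans (le_max_left _ _), fun ξ =>
    ⟨(hC1 ξ).trans (le_max_left _ _), le_trans ?_ ((hC2 ξ).trans (le_max_right _ _))⟩⟩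
  simp

theorem CutWeight.memLp_mul {G : E3 → ℝ} (h : CutWeight G) {F : E3 → ℂ} (hF : MemLp F 2 volume) :
    MemLp (fun ξ => (G ξ : ℂ) * F ξ) 2 volume := by
  obtain ⟨C, h0, hC⟩ := h.bound
  refine (hF.norm.const_mul C).mono' ((Complex.continuous_ofReal.comp h.continuous).aestronglyMeasurable.mul hF.1)
    (Eventually.of_forall fun ξ => ?_)
  rw [norm_mul, Complex.norm_real, Real.norm_eq_abs]
  exact mul_le_mul_of_nonneg_right (hC ξ).1 (norm_nonneg _)

theorem norm_coord_div_le (ξ : E3) (l i : Fin 3) : ‖(ξ l : ℂ) / (‖ξ‖ : ℂ) ^ 2 * ξ i‖ ≤ 1 := by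
  rw [norm_mul, norm_div, norm_pow, Complex.norm_real, Complex.norm_real, Complex.norm_real, norm_norm,
    Real.norm_eq_abs, Real.norm_eq_abs, div_mul_eq_mul_div]
  rcases (norm_nonneg ξ).eq_or_lt with h | h
  · rw [← h]; simp
  · rw [div_le_one (by positivity), pow_two]
    exact mul_le_mul (abs_coord_le ξ l) (abs_coord_le ξ i) (abs_nonneg _) h.le

/-- The pointwise bound of the right-hand side. -/
theorem norm_rhsSym_le (ν : ℝ) (u : Fin 3 → E3 → ℝ) (S : Fin 3 → Fin 3 → E3 → ℝ) (l : Fin 3) (ξ : E3) :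
    ‖rhsSym ν u S l ξ‖ ≤ 4 * Real.pi ^ 2 * |ν| * (‖ξ‖ ^ 2 * ‖rft (u l) ξ‖)
      + 4 * Real.pi * ∑ k, ∑ i, ‖ξ‖ * ‖rft (S k i) ξ‖ := by
  have h1 : ‖∑ k, dsym k ξ * rft (S k l) ξ‖ ≤ 2 * Real.pi * ∑ k, ∑ i, ‖ξ‖ * ‖rft (S k i) ξ‖ := by
    rw [Finset.mul_sum]
    refine (norm_sum_le _ _).trans (Finset.sum_le_sum fun k _ => ?_)
    rw [norm_mul]
    calc _ ≤ 2 * Real.pi * ‖ξ‖ * ‖rft (S k l) ξ‖ := by gcongr; exact norm_dsym_le k ξ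
      _ = 2 * Real.pi * (‖ξ‖ * ‖rft (S k l) ξ‖) := by ring
      _ ≤ _ := by
          gcongr
          exact Finset.single_le_sum (f := fun i => ‖ξ‖ * ‖rft (S k i) ξ‖) (fun _ _ => by positivity)
            (Finset.mem_univ l)
  have h2 : ‖(ξ l : ℂ) / (‖ξ‖ : ℂ) ^ 2 * ∑ k, dsym k ξ * ∑ i, ξ i * rft (S k i) ξ‖
      ≤ 2 * Real.pi * ∑ k, ∑ i, ‖ξ‖ * ‖rft (S k i) ξ‖ := by
    rw [Finset.mul_sum, Finset.mul_sum]
    refine (norm_sum_le _ _).trans (Finset.sum_le_sum fun k _ => ?_)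
    rw [mul_left_comm, norm_mul, Finset.mul_sum, ← Finset.mul_sum _ _ ‖ξ‖, ← mul_assoc]
    gcongr
    · exact norm_dsym_le k ξ
    · refine (norm_sum_le _ _).trans (Finset.sum_le_sum fun i _ => ?_)
      rw [← mul_assoc, norm_mul]
      exact mul_le_of_le_one_left (norm_nonneg _) (norm_coord_div_le ξ l i)
  have h3 : ‖(-(4 * Real.pi ^ 2 * ν) * (‖ξ‖ : ℂ) ^ 2 * rft (u l) ξ : ℂ)‖
      = 4 * Real.pi ^ 2 * |ν| * (‖ξ‖ ^ 2 * ‖rft (u l) ξ‖) := by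
    simp only [norm_mul, norm_neg, norm_pow, Complex.norm_real, Complex.norm_ofNat, Real.norm_eq_abs,
      abs_of_pos Real.pi_pos, abs_norm]
    ring
  rw [rhsSym]
  calc _ ≤ (_ + _) + _ := (norm_add_le _ _).trans (add_le_add_left (norm_sub_le _ _) _)
    _ ≤ (4 * Real.pi ^ 2 * |ν| * (‖ξ‖ ^ 2 * ‖rft (u l) ξ‖) + 2 * Real.pi * ∑ k, ∑ i, ‖ξ‖ * ‖rft (S k i) ξ‖)
        + 2 * Real.pi * ∑ k, ∑ i, ‖ξ‖ * ‖rft (S k i) ξ‖ := add_le_add (add_le_add h3.le h1) h2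
    _ = _ := by ring

theorem aestronglyMeasurable_rhsSym (ν : ℝ) (u : Fin 3 → E3 → ℝ) (S : Fin 3 → Fin 3 → E3 → ℝ) (l : Fin 3) :
    AEStronglyMeasurable (rhsSym ν u S l) volume := by
  have hd : ∀ k, AEStronglyMeasurable (dsym k) volume := fun k => (continuous_dsym k).aestronglyMeasurable
  have hn : Continuous fun ξ : E3 => (‖ξ‖ : ℂ) ^ 2 := by fun_prop
  have hc : ∀ k, AEStronglyMeasurable (fun ξ : E3 => (ξ k : ℂ)) volume := fun k =>
    (continuous_coordC k).aestronglyMeasurable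
  have hq : AEStronglyMeasurable (fun ξ : E3 => (ξ l : ℂ) / (‖ξ‖ : ℂ) ^ 2) volume :=
    ((continuous_coordC l).measurable.div hn.measurable).aestronglyMeasurable
  refine (((hn.const_mul (-(4 * Real.pi ^ 2 * ν) : ℂ)).aestronglyMeasurable.mul (memLp_rft _).1).sub
    (Finset.aestronglyMeasurable_fun_sum _ fun k _ => (hd k).mul (memLp_rft _).1)).add
    (hq.mul (Finset.aestronglyMeasurable_fun_sum _ fun k _ => (hd k).mul
      (Finset.aestronglyMeasurable_fun_sum _ fun i _ => (hc i).mul (memLp_rft _).1)))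

/-- The weighted right-hand side is square integrable, with a bound. -/
theorem CutWeight.exists_rhsSym_bound {G : E3 → ℝ} (h : CutWeight G) (ν : ℝ) : ∃ K : ℝ≥0, ∀ (M : ℝ≥0)
    (u : Fin 3 → E3 → ℝ) (S : Fin 3 → Fin 3 → E3 → ℝ), (∀ i, eLpNorm (rft (u i)) 2 volume ≤ M) →
    (∀ k i, eLpNorm (fun ξ => (‖ξ‖ : ℂ) * rft (S k i) ξ) 2 volume ≤ M) → ∀ l,
      eLpNorm (fun ξ => (G ξ : ℂ) * rhsSym ν u S l ξ) 2 volume ≤ K * M := by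
  obtain ⟨C, h0, hC⟩ := h.bound
  set K1 : ℝ := C * (4 * Real.pi ^ 2 * |ν| + 4 * Real.pi)
  have hK1 : 0 ≤ K1 := by positivity
  refine ⟨K1.toNNReal * 10, fun M u S hu hS l => ?_⟩
  have mS : ∀ k i, AEStronglyMeasurable (fun ξ => ‖(‖ξ‖ : ℂ) * rft (S k i) ξ‖) volume := fun k i =>
    ((Complex.continuous_ofReal.comp continuous_norm).aestronglyMeasurable.mul (memLp_rft (S k i)).1).norm
  calc _ ≤ eLpNorm (fun ξ => K1 * (‖rft (u l) ξ‖ + ∑ k, ∑ i, ‖(‖ξ‖ : ℂ) * rft (S k i) ξ‖)) 2 volume := by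
        refine eLpNorm_mono fun ξ => ?_
        rw [norm_mul, Complex.norm_real, Real.norm_eq_abs]
        refine (mul_le_mul_of_nonneg_left (norm_rhsSym_le ν u S l ξ) (abs_nonneg _)).trans (le_trans ?_ (le_abs_self _))
        obtain ⟨c1, c2⟩ := hC ξ
        simp only [norm_mul, Complex.norm_real, norm_norm]
        set T := ∑ k, ∑ i, ‖ξ‖ * ‖rft (S k i) ξ‖
        have hT : 0 ≤ T := Finset.sum_nonneg fun _ _ => Finset.sum_nonneg fun _ _ => by positivity
        calc _ = 4 * Real.pi ^ 2 * |ν| * (|G ξ| * ‖ξ‖ ^ 2) * ‖rft (u l) ξ‖ + 4 * Real.pi * |G ξ| * T := by ring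
          _ ≤ 4 * Real.pi ^ 2 * |ν| * C * ‖rft (u l) ξ‖ + 4 * Real.pi * C * T := by gcongr
          _ ≤ K1 * ‖rft (u l) ξ‖ + K1 * T := by
              gcongr
              · have : 0 ≤ C * (4 * Real.pi) := by positivity
                simp only [K1]; nlinarith
              · have : 0 ≤ C * (4 * Real.pi ^ 2 * |ν|) := by positivity
                simp only [K1]; nlinarith
          _ = _ := by ring
    _ = ENNReal.ofReal K1 * eLpNorm (fun ξ => ‖rft (u l) ξ‖ + ∑ k, ∑ i, ‖(‖ξ‖ : ℂ) * rft (S k i) ξ‖) 2 volume := by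
        rw [← Real.enorm_of_nonneg hK1]
        exact eLpNorm_const_smul K1 _ 2 volume
    _ ≤ ENNReal.ofReal K1 * (M + ∑ _k : Fin 3, ∑ _i : Fin 3, (M : ℝ≥0∞)) := by
        gcongr
        refine (eLpNorm_add_le (memLp_rft _).1.norm (Finset.aestronglyMeasurable_fun_sum _ fun k _ =>
          Finset.aestronglyMeasurable_fun_sum _ fun i _ => mS k i) (by norm_num)).trans (add_le_add ?_ ?_)
        · rw [eLpNorm_norm]; exact hu l
        · have e : (fun ξ => ∑ k, ∑ i, ‖(‖ξ‖ : ℂ) * rft (S k i) ξ‖)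
              = ∑ k, ∑ i, fun ξ => ‖(‖ξ‖ : ℂ) * rft (S k i) ξ‖ := by
            ext ξ; simp only [Finset.sum_apply]
          rw [e]
          refine (eLpNorm_sum_le (fun k _ => Finset.aestronglyMeasurable_sum _ fun i _ => mS k i) (by norm_num)).trans
            (Finset.sum_le_sum fun k _ => (eLpNorm_sum_le (fun i _ => mS k i) (by norm_num)).trans
              (Finset.sum_le_sum fun i _ => ?_))
          rw [eLpNorm_norm]; exact hS k i
    _ = _ := by
        simp only [Finset.sum_const, Finset.card_univ, Fintype.card_fin, nsmul_eq_mul]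
        push_cast
        rw [ENNReal.ofReal]; ring

/-- The weighted energy on the Fourier side. -/
def engy (G : E3 → ℝ) (u : Fin 3 → E3 → ℝ) : ℝ := ∑ l, ∫ ξ, ‖(G ξ : ℂ) * rft (u l) ξ‖ ^ 2

/-- The weighted pairing of the field with the divergence of the stress. -/
def pairG (G : E3 → ℝ) (u : Fin 3 → E3 → ℝ) (S : Fin 3 → Fin 3 → E3 → ℝ) : ℝ :=
  ∑ l, ∑ k, (∫ ξ, (starRingEnd ℂ) ((G ξ : ℂ) * rft (u l) ξ) * ((G ξ : ℂ) * (dsym k ξ * rft (S k l) ξ))).re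

theorem dense_schwartz : Dense (range fun ψ : 𝓢(E3, ℂ) => ψ.toLp 2 (volume : Measure E3)) :=
  SchwartzMap.denseRange_toLpCLM (F := ℂ) (p := 2) (by norm_num)

/-- A Schwartz function conjugated and multiplied by a smooth compactly supported function. -/
theorem exists_schwartz_conj_mul {H : E3 → ℝ} (h1 : ContDiff ℝ ∞ H) (h2 : HasCompactSupport H) (ψ : 𝓢(E3, ℂ)) :
    ∃ θ : 𝓢(E3, ℂ), ∀ ξ, θ ξ = H ξ * (starRingEnd ℂ) (ψ ξ) := by
  have h3 : HasCompactSupport fun ξ => (H ξ : ℂ) * (starRingEnd ℂ) (ψ ξ) :=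
    (h2.comp_left (g := Complex.ofReal) rfl).mul_right
  have h4 : ContDiff ℝ ∞ fun ξ => (H ξ : ℂ) * (starRingEnd ℂ) (ψ ξ) :=
    (Complex.ofRealCLM.contDiff.comp h1).mul (Complex.conjCLE.contDiff.comp (ψ.smooth ⊤))
  exact ⟨h3.toSchwartzMap h4, fun _ => rfl⟩

theorem inner_toLp {F G : E3 → ℂ} (hF : MemLp F 2 volume) (hG : MemLp G 2 volume) :
    (inner ℂ (hF.toLp F) (hG.toLp G) : ℂ) = ∫ ξ, (starRingEnd ℂ) (F ξ) * G ξ := by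
  rw [L2.inner_def]
  refine integral_congr_ae ?_
  filter_upwards [hF.coeFn_toLp, hG.coeFn_toLp] with ξ e1 e2
  rw [e1, e2, RCLike.inner_apply, mul_comm]

theorem norm_toLp_sq {F : E3 → ℂ} (hF : MemLp F 2 volume) : ‖hF.toLp F‖ ^ 2 = ∫ ξ, ‖F ξ‖ ^ 2 := by
  have h := inner_toLp hF hF
  rw [inner_self_eq_norm_sq_to_K] at h
  have e : ∀ ξ, (starRingEnd ℂ) (F ξ) * F ξ = ((‖F ξ‖ ^ 2 : ℝ) : ℂ) := fun ξ => by
    rw [mul_comm, Complex.mul_conj, Complex.normSq_eq_norm_sq]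
  simp only [e] at h
  rw [integral_complex_ofReal] at h
  exact Complex.ofReal_injective (by rw [Complex.ofReal_pow]; exact h)

end MLANS

end

/-! ### Time derivatives of the weighted energies. -/

noncomputable section

namespace MLANS

open LineDeriv

theorem CutWeight.mul {G m : E3 → ℝ} (h : CutWeight G) (hm : ContDiff ℝ ∞ m) :
    CutWeight fun ξ => m ξ * G ξ := by
  obtain ⟨H, h1, h2, h3⟩ := h
  exact ⟨fun ξ => m ξ * H ξ, hm.mul h1, h2.mul_left, fun ξ => by simp only [h3]; ring⟩

theorem CutWeight.normSq_mul {G : E3 → ℝ} (h : CutWeight G) : CutWeight fun ξ => ‖ξ‖ ^ 2 * G ξ :=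
  h.mul (contDiff_norm_sq ℝ)

theorem CutWeight.memLp_dsym_mul {G : E3 → ℝ} (h : CutWeight G) {F : E3 → ℂ} (hF : MemLp F 2 volume) (k : Fin 3) :
    MemLp (fun ξ => (G ξ : ℂ) * (dsym k ξ * F ξ)) 2 volume := by
  have hc : CutWeight fun ξ => ξ k * G ξ := h.mul (m := fun ξ => ξ k) (by fun_prop)
  refine ((hc.memLp_mul hF).const_mul (2 * Real.pi * Complex.I)).ae_eq (Eventually.of_forall fun ξ => ?_)
  simp only [dsym]
  push_cast
  ring

/-- The Hilbert space lemma in `L²` for the weighted transform, with Schwartz functions as dense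
set. Because `G = |ξ|² H`, testing with `ψ` is the same as using `θ = H` times the conjugate of `ψ`
in `hasDerivWithinAt_rft`. The compact support of `G` makes the right-hand side uniformly bounded in
`L²`. -/
theorem hasDerivWithinAt_engy_comp {ν T' b c : ℝ} {u : ℝ → E3 → E3} {S : ℝ → E3 → Mat3}
    (h : WeakFlow ν (Ioo 0 T') u S) (hb : 0 < b) (hc : c < T')
    (hu : ∀ r ∈ Ioo 0 T', ∀ i, MemLp (comp (u r) i) 2 volume)
    (hS : ∀ r ∈ Icc b c, ∀ k i, MemLp (fun x => S r x k i) 2 volume)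
    (hdiv : ∀ r ∈ Icc b c, ∀ᵐ ξ, ∑ i, (ξ i : ℂ) * rft (comp (u r) i) ξ = 0) {M : ℝ≥0}
    (hM : ∀ r ∈ Icc b c, ∀ i, eLpNorm (rft (comp (u r) i)) 2 volume ≤ M)
    (hMS : ∀ r ∈ Icc b c, ∀ k i, eLpNorm (fun ξ => (‖ξ‖ : ℂ) * rft (fun x => S r x k i) ξ) 2 volume ≤ M)
    {G : E3 → ℝ} (hG : CutWeight G) (l : Fin 3) {t : ℝ} (ht : t ∈ Icc b c) :
    MemLp (fun ξ => (G ξ : ℂ) * rhsSym ν (comp (u t)) (fun k i x => S t x k i) l ξ) 2 volume ∧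
    HasDerivWithinAt (fun r => ∫ ξ, ‖(G ξ : ℂ) * rft (comp (u r) l) ξ‖ ^ 2)
      (2 * (∫ ξ, (starRingEnd ℂ) ((G ξ : ℂ) * rft (comp (u t) l) ξ)
        * ((G ξ : ℂ) * rhsSym ν (comp (u t)) (fun k i x => S t x k i) l ξ)).re) (Icc b c) t := by
  obtain ⟨K, hK⟩ := hG.exists_rhsSym_bound ν
  have mX : ∀ r, MemLp (fun ξ => (G ξ : ℂ) * rft (comp (u r) l) ξ) 2 volume := fun r =>
    hG.memLp_mul (memLp_rft _)
  have bZ : ∀ r ∈ Icc b c, eLpNorm (fun ξ => (G ξ : ℂ) * rhsSym ν (comp (u r)) (fun k i x => S r x k i) l ξ) 2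
      volume ≤ K * M := fun r hr => hK M _ _ (hM r hr) (hMS r hr) l
  have mZ : ∀ r ∈ Icc b c, MemLp (fun ξ => (G ξ : ℂ) * rhsSym ν (comp (u r)) (fun k i x => S r x k i) l ξ) 2 volume :=
    fun r hr => ⟨(Complex.continuous_ofReal.comp hG.continuous).aestronglyMeasurable.mul
      (aestronglyMeasurable_rhsSym _ _ _ _), (bZ r hr).trans_lt (by finiteness)⟩
  refine ⟨mZ t ht, ?_⟩
  classical
  -- Square integrability is known only on the interval; the value zero outside is never used.
  let Z : ℝ → Lp ℂ 2 (volume : Measure E3) := fun r => if hr : r ∈ Icc b c then (mZ r hr).toLp _ else 0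
  have hZ : ∀ r (hr : r ∈ Icc b c), Z r = (mZ r hr).toLp _ := fun r hr => dif_pos hr
  have hZM : ∀ r ∈ Icc b c, ‖Z r‖ ≤ (K * M : ℝ≥0) := fun r hr => by
    rw [hZ r hr, Lp.norm_toLp]
    exact ENNReal.toReal_le_coe_of_le_coe (by rw [ENNReal.coe_mul]; exact bZ r hr)
  have hw : ∀ d ∈ range fun ψ : 𝓢(E3, ℂ) => ψ.toLp 2 (volume : Measure E3), ∀ r ∈ Icc b c,
      HasDerivWithinAt (fun r => (inner ℂ d ((mX r).toLp _) : ℂ)) (inner ℂ d (Z r)) (Icc b c) r := by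
    rintro d ⟨ψ, rfl⟩ r hr
    obtain ⟨H, h1, h2, h3⟩ := hG
    obtain ⟨θ, hθ⟩ := exists_schwartz_conj_mul h1 h2 ψ
    have hrI : r ∈ Ioo 0 T' := ⟨hb.trans_le hr.1, hr.2.trans_lt hc⟩
    have h4 := hasDerivWithinAt_rft h hrI hr (by
      filter_upwards [isOpen_Ioo.mem_nhds hrI] with r' hr' using hu r' hr') (hS r hr) hdiv l θ
    have e : ψ.toLp 2 (volume : Measure E3) = (memLp_schwartz ψ 2).toLp ψ := rfl
    have e2 : ∀ F : E3 → ℂ, ∫ ξ, (starRingEnd ℂ) (ψ ξ) * ((G ξ : ℂ) * F ξ)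
        = ∫ ξ, F ξ * ((‖ξ‖ : ℂ) ^ 2 * θ ξ) := fun F => by
      refine integral_congr_ae (Eventually.of_forall fun ξ => ?_)
      simp only [hθ, h3]
      push_cast
      ring
    simp only [e, hZ r hr, inner_toLp, e2]
    exact h4
  have key := hasDerivWithinAt_norm_sq dense_schwartz hZM hw ht
  simp only [hZ t ht, inner_toLp, norm_toLp_sq] at key
  exact key

/-- The energy identity: the pressure does not contribute. -/
theorem hasDerivWithinAt_engy {ν T' b c : ℝ} {u : ℝ → E3 → E3} {S : ℝ → E3 → Mat3}
    (h : WeakFlow ν (Ioo 0 T') u S) (hb : 0 < b) (hc : c < T')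
    (hu : ∀ r ∈ Ioo 0 T', ∀ i, MemLp (comp (u r) i) 2 volume)
    (hS : ∀ r ∈ Icc b c, ∀ k i, MemLp (fun x => S r x k i) 2 volume)
    (hdiv : ∀ r ∈ Icc b c, ∀ᵐ ξ, ∑ i, (ξ i : ℂ) * rft (comp (u r) i) ξ = 0) {M : ℝ≥0}
    (hM : ∀ r ∈ Icc b c, ∀ i, eLpNorm (rft (comp (u r) i)) 2 volume ≤ M)
    (hMS : ∀ r ∈ Icc b c, ∀ k i, eLpNorm (fun ξ => (‖ξ‖ : ℂ) * rft (fun x => S r x k i) ξ) 2 volume ≤ M)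
    {G : E3 → ℝ} (hG : CutWeight G) {t : ℝ} (ht : t ∈ Icc b c) :
    HasDerivWithinAt (fun r => engy G (comp (u r)))
      (-(8 * Real.pi ^ 2 * ν) * engy (fun ξ => ‖ξ‖ * G ξ) (comp (u t))
        - 2 * pairG G (comp (u t)) fun k i x => S t x k i) (Icc b c) t := by
  have h1 := fun l => hasDerivWithinAt_engy_comp h hb hc hu hS hdiv hM hMS hG l ht
  have h2 : HasDerivWithinAt (fun r => engy G (comp (u r))) _ (Icc b c) t :=
    HasDerivWithinAt.fun_sum fun l (_ : l ∈ Finset.univ) => (h1 l).2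
  refine h2.congr_deriv ?_
  have imul : ∀ {F F' : E3 → ℂ}, MemLp F 2 volume → MemLp F' 2 volume →
      Integrable (fun ξ => F ξ * F' ξ) volume := fun hF hF' => hF.integrable_mul hF'
  set W : E3 → ℂ := fun ξ => ∑ k, dsym k ξ * ∑ i, ξ i * rft (fun x => S t x k i) ξ with hW
  have mX : ∀ l, MemLp (fun ξ => (starRingEnd ℂ) ((G ξ : ℂ) * rft (comp (u t) l) ξ)) 2 volume := fun l =>
    (hG.memLp_mul (memLp_rft _)).star
  have mA : ∀ l, MemLp (fun ξ => ((‖ξ‖ ^ 2 * G ξ : ℝ) : ℂ) * rft (comp (u t) l) ξ) 2 volume := fun l =>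
    hG.normSq_mul.memLp_mul (memLp_rft _)
  have mB : ∀ l k, MemLp (fun ξ => (G ξ : ℂ) * (dsym k ξ * rft (fun x => S t x k l) ξ)) 2 volume := fun l k =>
    hG.memLp_dsym_mul (memLp_rft _) k
  have mR := fun l => (h1 l).1
  have eR : ∀ l ξ, (G ξ : ℂ) * rhsSym ν (comp (u t)) (fun k i x => S t x k i) l ξ
      = -(4 * Real.pi ^ 2 * ν) * (((‖ξ‖ ^ 2 * G ξ : ℝ) : ℂ) * rft (comp (u t) l) ξ)
        - (∑ k, (G ξ : ℂ) * (dsym k ξ * rft (fun x => S t x k l) ξ))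
        + (G ξ : ℂ) * (ξ l / (‖ξ‖ : ℂ) ^ 2 * W ξ) := fun l ξ => by
    rw [rhsSym, ← Finset.mul_sum]
    push_cast
    ring
  -- Square integrability of the pressure part is obtained by subtracting the viscous and stress
  -- parts from the whole right-hand side.
  have mC : ∀ l, MemLp (fun ξ => (G ξ : ℂ) * (ξ l / (‖ξ‖ : ℂ) ^ 2 * W ξ)) 2 volume := fun l => by
    have := ((mR l).sub ((mA l).const_mul (-(4 * Real.pi ^ 2 * ν)))).add (memLp_finsetSum Finset.univ fun k _ => mB l k)
    refine this.ae_eq (Eventually.of_forall fun ξ => ?_)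
    simp only [Pi.add_apply, Pi.sub_apply, eR]
    ring
  have split : ∀ l, ∫ ξ, (starRingEnd ℂ) ((G ξ : ℂ) * rft (comp (u t) l) ξ)
        * ((G ξ : ℂ) * rhsSym ν (comp (u t)) (fun k i x => S t x k i) l ξ)
      = -(4 * Real.pi ^ 2 * ν) * ((∫ ξ, ‖((‖ξ‖ * G ξ : ℝ) : ℂ) * rft (comp (u t) l) ξ‖ ^ 2 : ℝ) : ℂ)
        - (∑ k, ∫ ξ, (starRingEnd ℂ) ((G ξ : ℂ) * rft (comp (u t) l) ξ) * ((G ξ : ℂ) * (dsym k ξ * rft (fun x => S t x k l) ξ)))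
        + ∫ ξ, (starRingEnd ℂ) ((G ξ : ℂ) * rft (comp (u t) l) ξ) * ((G ξ : ℂ) * (ξ l / (‖ξ‖ : ℂ) ^ 2 * W ξ)) := fun l => by
    have i1 := imul (mX l) (mA l)
    have i2 := fun k => imul (mX l) (mB l k)
    have i3 := imul (mX l) (mC l)
    have e1 : ((∫ ξ, ‖((‖ξ‖ * G ξ : ℝ) : ℂ) * rft (comp (u t) l) ξ‖ ^ 2 : ℝ) : ℂ)
        = ∫ ξ, (starRingEnd ℂ) ((G ξ : ℂ) * rft (comp (u t) l) ξ) * (((‖ξ‖ ^ 2 * G ξ : ℝ) : ℂ) * rft (comp (u t) l) ξ) := by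
      rw [← integral_complex_ofReal]
      refine integral_congr_ae (Eventually.of_forall fun ξ => ?_)
      simp only
      rw [← Complex.normSq_eq_norm_sq, ← Complex.mul_conj, map_mul, map_mul, Complex.conj_ofReal, Complex.conj_ofReal]
      push_cast
      ring
    have i12 : Integrable (fun ξ => -(4 * Real.pi ^ 2 * ν : ℂ)
        * ((starRingEnd ℂ) ((G ξ : ℂ) * rft (comp (u t) l) ξ) * (((‖ξ‖ ^ 2 * G ξ : ℝ) : ℂ) * rft (comp (u t) l) ξ))
        - ∑ k, (starRingEnd ℂ) ((G ξ : ℂ) * rft (comp (u t) l) ξ)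
          * ((G ξ : ℂ) * (dsym k ξ * rft (fun x => S t x k l) ξ))) volume :=
      (i1.const_mul _).sub (integrable_finsetSum _ fun k _ => i2 k)
    rw [e1, ← integral_const_mul, ← integral_finsetSum _ fun k _ => i2 k,
      ← integral_sub (i1.const_mul _) (integrable_finsetSum _ fun k _ => i2 k),
      ← integral_add i12 i3]
    refine integral_congr_ae (Eventually.of_forall fun ξ => ?_)
    simp only [eR, ← Finset.mul_sum]
    ring
  -- The pressure part is a multiple of `ξ`, to which the transform of the velocity is orthogonal at
  -- almost every frequency. A scalar weight does not affect this.
  have zero : ∑ l, ∫ ξ, (starRingEnd ℂ) ((G ξ : ℂ) * rft (comp (u t) l) ξ) * ((G ξ : ℂ) * (ξ l / (‖ξ‖ : ℂ) ^ 2 * W ξ)) = 0 := by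
    rw [← integral_finsetSum _ fun l _ => imul (mX l) (mC l)]
    refine integral_eq_zero_of_ae ?_
    filter_upwards [hdiv t ht] with ξ hξ
    have e1 : ∑ l, (starRingEnd ℂ) ((G ξ : ℂ) * rft (comp (u t) l) ξ) * ((G ξ : ℂ) * (ξ l / (‖ξ‖ : ℂ) ^ 2 * W ξ))
        = (starRingEnd ℂ) (∑ l, (ξ l : ℂ) * rft (comp (u t) l) ξ) * ((G ξ : ℂ) ^ 2 / (‖ξ‖ : ℂ) ^ 2 * W ξ) := by
      rw [map_sum, Finset.sum_mul]
      refine Finset.sum_congr rfl fun l _ => ?_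
      rw [map_mul, map_mul, Complex.conj_ofReal, Complex.conj_ofReal]
      ring
    simp only [Pi.zero_apply]
    rw [e1, hξ]
    simp
  have zero' := congrArg Complex.re zero
  rw [Complex.re_sum, Complex.zero_re] at zero'
  simp only [split]
  rw [engy, pairG, ← Finset.mul_sum]
  have e : ∀ l, ((-(4 * Real.pi ^ 2 * ν) * ((∫ ξ, ‖((‖ξ‖ * G ξ : ℝ) : ℂ) * rft (comp (u t) l) ξ‖ ^ 2 : ℝ) : ℂ) : ℂ)).re
      = -(4 * Real.pi ^ 2 * ν) * ∫ ξ, ‖((‖ξ‖ * G ξ : ℝ) : ℂ) * rft (comp (u t) l) ξ‖ ^ 2 := fun l => by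
    rw [← Complex.ofReal_re (-(4 * Real.pi ^ 2 * ν) * ∫ ξ, ‖((‖ξ‖ * G ξ : ℝ) : ℂ) * rft (comp (u t) l) ξ‖ ^ 2)]
    congr 1
    push_cast
    ring
  simp only [Complex.add_re, Complex.sub_re, Complex.re_sum, e]
  rw [Finset.sum_add_distrib, Finset.sum_sub_distrib, zero', ← Finset.mul_sum]
  ring

end MLANS

end

noncomputable section

namespace MLANS

open LineDeriv

/-! ### The Sobolev norms in terms of the components -/

theorem norm_complexify (f : E3 → E3) (x : E3) : ‖complexify f x‖ = ‖f x‖ := by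
  rw [EuclideanSpace.norm_eq, EuclideanSpace.norm_eq]
  simp [complexify]

theorem memLp_complexify {f : E3 → E3} (hf : MemLp f 2 volume) : MemLp (complexify f) 2 volume := by
  have hc : Continuous fun y : E3 => (WithLp.toLp 2 fun i => ((y i : ℝ) : ℂ) : EuclideanSpace ℂ (Fin 3)) := by
    fun_prop
  exact (memLp_congr_norm (hc.comp_aestronglyMeasurable hf.1) hf.1
    (Eventually.of_forall fun x => norm_complexify f x)).2 hf

/-- Coordinate projections commute with the integrals that define the transform of a tempered
distribution, so the vector-valued transform can be handled component by component. -/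
theorem fourier_complexify_coord {f : E3 → E3} (h : MemLp (complexify f) 2 volume) (i : Fin 3) :
    (fun ξ => (𝓕 (h.toLp (complexify f)) : Lp (EuclideanSpace ℂ (Fin 3)) 2 (volume : Measure E3)) ξ i)
      =ᵐ[volume] rft (comp f i) := by
  set F := (𝓕 (h.toLp (complexify f)) : Lp (EuclideanSpace ℂ (Fin 3)) 2 (volume : Measure E3)) with hF
  let P : EuclideanSpace ℂ (Fin 3) →L[ℂ] ℂ := EuclideanSpace.proj i
  have mF : MemLp (fun ξ => F ξ i) 2 volume := P.comp_memLp' (Lp.memLp F)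
  have mf : MemLp (fun x => (comp f i x : ℂ)) 2 volume := P.comp_memLp' h
  refine ae_eq_ft_of_forall mf mF.locInt2 fun φ => ?_
  have h1 := DFunLike.congr_fun (Lp.fourier_toTemperedDistribution_eq (h.toLp (complexify f))) φ
  rw [TemperedDistribution.fourier_apply, Lp.toTemperedDistribution_apply,
    Lp.toTemperedDistribution_apply] at h1
  have h2 := congrArg P h1
  have int : ∀ (ψ : 𝓢(E3, ℂ)) (K : Lp (EuclideanSpace ℂ (Fin 3)) 2 (volume : Measure E3)),
      Integrable (fun x => ψ x • K x) volume := fun ψ K =>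
    memLp_one_iff_integrable.1 ((Lp.memLp K).smul (memLp_schwartz ψ 2))
  rw [← P.integral_comp_comm (int _ _), ← P.integral_comp_comm (int _ _)] at h2
  simp only [map_smul, smul_eq_mul] at h2
  calc _ = _ := integral_congr_ae (Eventually.of_forall fun x => mul_comm _ _)
    _ = _ := h2.symm
    _ = _ := integral_congr_ae ?_
  filter_upwards [h.coeFn_toLp] with x hx
  rw [hx, mul_comm]
  rfl

theorem enorm_sq_eq_sum (z : EuclideanSpace ℂ (Fin 3)) : ‖z‖ₑ ^ 2 = ∑ i, ‖z i‖ₑ ^ 2 := by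
  simp only [← ofReal_norm]
  simp only [← ENNReal.ofReal_pow (norm_nonneg _)]
  rw [← ENNReal.ofReal_sum_of_nonneg fun i _ => by positivity, EuclideanSpace.norm_sq_eq]

theorem homSobolevNorm_eq {f : E3 → E3} (h : MemLp (complexify f) 2 volume) (n : ℕ) :
    homSobolevNorm n f = (ENNReal.ofReal ((2 * Real.pi) ^ (2 * n)) * en n (comp f)) ^ (1 / 2 : ℝ) := by
  rw [homSobolevNorm, dif_pos h]
  congr 1
  have hm : ∀ i, AEMeasurable (fun ξ => (‖ξ‖ₑ ^ n * ‖rft (comp f i) ξ‖ₑ) ^ 2) volume := fun i =>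
    (aemeasurable_nm n _).pow_const 2
  rw [en]
  simp only [nm, nsq]
  rw [← lintegral_finsetSum' _ fun i _ => hm i, ← lintegral_const_mul' _ _ ENNReal.ofReal_ne_top]
  refine lintegral_congr_ae ?_
  filter_upwards [fourier_complexify_coord h 0, fourier_complexify_coord h 1, fourier_complexify_coord h 2]
    with ξ h0 h1 h2
  rw [enorm_sq_eq_sum, Fin.sum_univ_three, Fin.sum_univ_three, h0, h1, h2]
  have e : ENNReal.ofReal ((2 * Real.pi * ‖ξ‖) ^ (2 * (n : ℝ)))
      = ENNReal.ofReal ((2 * Real.pi) ^ (2 * n)) * (‖ξ‖ₑ ^ n) ^ 2 := by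
    rw [← ofReal_pow_norm, ← ENNReal.ofReal_pow (by positivity), ← ENNReal.ofReal_mul (by positivity)]
    congr 1
    rw [show (2 * (n : ℝ)) = ((2 * n : ℕ) : ℝ) by push_cast; ring, Real.rpow_natCast, mul_pow]
    ring
  rw [e]
  ring

theorem hpow_of_homSobolevNorm {f : E3 → E3} {n : ℕ} (h : homSobolevNorm n f < ⊤) (i : Fin 3) :
    HPow n (comp f i) := by
  by_cases hm : MemLp (complexify f) 2 volume
  · rw [homSobolevNorm_eq hm, ENNReal.rpow_lt_top_iff_of_pos (by norm_num)] at h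
    have hc : ENNReal.ofReal ((2 * Real.pi) ^ (2 * n)) ≠ 0 := by
      have : 0 < (2 * Real.pi) ^ (2 * n) := by positivity
      simpa using this
    have h1 : en n (comp f) < ⊤ := ENNReal.lt_top_of_mul_ne_top_right h.ne hc
    have h2 := (nm_le_en n (comp f) i).trans_lt h1
    have mf : MemLp (fun x => (comp f i x : ℂ)) 2 volume :=
      (EuclideanSpace.proj (𝕜 := ℂ) i : EuclideanSpace ℂ (Fin 3) →L[ℂ] ℂ).comp_memLp' hm
    refine ⟨by simpa using mf.re, (memLp_two_iff ((continuous_norm_pow n).aestronglyMeasurable.mul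
      (memLp_rft _).1)).2 ?_⟩
    refine lt_of_le_of_lt (lintegral_mono fun ξ => ?_) h2
    simp only [Pi.mul_apply]
    rw [enorm_mul, enorm_pow, ← ofReal_norm ((‖ξ‖ : ℝ) : ℂ), Complex.norm_real, norm_norm, ofReal_norm]
  -- The norm is infinite off `L²`, so its finiteness already contains square integrability.
  · rw [homSobolevNorm, dif_neg hm] at h
    exact absurd h (lt_irrefl _)

theorem WeakDivFree.ae_sum_eq_zero {f : E3 → E3} (h : WeakDivFree f) (hf : ∀ i, HPow 1 (comp f i)) :
    ∀ᵐ ξ, ∑ i, (ξ i : ℂ) * rft (comp f i) ξ = 0 := by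
  have mp : ∀ i, MemLp (pd i (comp f i)) 2 volume := fun i => (hf i).memLp_pd i
  have ms : MemLp (fun x => ∑ i, pd i (comp f i) x) 2 volume := memLp_finsetSum _ fun i _ => mp i
  have h0 : (fun x => ∑ i, pd i (comp f i) x) =ᵐ[volume] 0 := by
    refine ae_eq_zero_of_integral_contDiff_smul_eq_zero (ms.ti (by norm_num)).locallyIntegrable fun g hg1 hg2 => ?_
    obtain ⟨φ, hφ⟩ := exists_schwartz_of_contDiff hg1 hg2
    have hφ' : (φ : E3 → ℝ) = g := funext hφ
    have e := h g hg1 hg2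
    have i1 : ∀ i, Integrable (fun x => comp f i x * (∂_{basisVec i} φ) x) volume := fun i =>
      ((hf i).1.ti (by norm_num)).integrable_mul_schwartz _
    have i2 : ∀ i, Integrable (fun x => pd i (comp f i) x * φ x) volume := fun i =>
      ((mp i).ti (by norm_num)).integrable_mul_schwartz _
    have e1 : ∫ x, ∑ i, f x i * fderiv ℝ g x (basisVec i) = ∑ i, ∫ x, comp f i x * (∂_{basisVec i} φ) x := by
      rw [← integral_finsetSum _ fun i _ => i1 i]
      simp only [SchwartzMap.lineDerivOp_apply_eq_fderiv, hφ', comp]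
    have e2 : ∫ x, g x • ∑ i, pd i (comp f i) x = ∑ i, ∫ x, pd i (comp f i) x * φ x := by
      rw [← integral_finsetSum _ fun i _ => i2 i]
      refine integral_congr_ae (Eventually.of_forall fun x => ?_)
      simp only [smul_eq_mul, Finset.mul_sum, hφ]
      exact Finset.sum_congr rfl fun i _ => mul_comm _ _
    have e3 : ∀ i, ∫ x, pd i (comp f i) x * φ x = -∫ x, comp f i x * (∂_{basisVec i} φ) x := fun i => by
      rw [((hf i).wd i).2.2, neg_neg]
    rw [e2]
    simp only [e3]
    rw [Finset.sum_neg_distrib, ← e1, e, neg_zero]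
  have z : MemLp (fun _ : E3 => (0 : ℝ)) 2 volume := MemLp.zero
  have h1 : rft (fun x => ∑ i, pd i (comp f i) x) = rft (fun _ => 0) := rft_congr h0
  have h2 : rft (fun _ => (0 : ℝ)) =ᵐ[volume] 0 := by
    have := rft_const_mul z 0
    simp only [mul_zero, Complex.ofReal_zero, zero_mul] at this
    exact this
  have h3 : ∀ᵐ ξ, ∀ i, rft (pd i (comp f i)) ξ = dsym i ξ * rft (comp f i) ξ :=
    ae_all_iff.2 fun i => (hf i).rft_pd i
  filter_upwards [rft_sum Finset.univ fun i _ => mp i, h2, h3] with ξ e1 e2 e3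
  rw [h1, e2] at e1
  simp only [e3, dsym, mul_assoc] at e1
  simp only [← Finset.mul_sum, Pi.zero_apply] at e1
  have hp : (Real.pi : ℂ) ≠ 0 := by exact_mod_cast Real.pi_ne_zero
  have := e1.symm
  simpa [hp, Complex.I_ne_zero] using this

/-! ### Comparison of the weighted norms -/

theorem en_zero_le_hs {s : ℝ} (hs0 : 0 ≤ s) (u : Fin 3 → E3 → ℝ) : en 0 u ≤ hs s u := by
  refine Finset.sum_le_sum fun i _ => nsq_mono_ae (Eventually.of_forall fun ξ => ?_)
  gcongr
  rw [pow_zero, ← ENNReal.ofReal_one]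
  exact ENNReal.ofReal_le_ofReal (Real.one_le_rpow (by linarith [norm_nonneg ξ]) hs0)

theorem en_one_le_hs {s : ℝ} (hs1 : 1 ≤ s) (u : Fin 3 → E3 → ℝ) : en 1 u ≤ hs s u := by
  refine Finset.sum_le_sum fun i _ => nsq_mono_ae (Eventually.of_forall fun ξ => ?_)
  gcongr
  rw [← ofReal_pow_norm, pow_one]
  refine ENNReal.ofReal_le_ofReal ?_
  have := Real.rpow_le_rpow_of_exponent_le (by linarith [norm_nonneg ξ] : 1 ≤ 1 + ‖ξ‖) hs1
  rw [Real.rpow_one] at this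
  linarith

theorem hs_two_le (u : Fin 3 → E3 → ℝ) : hs 2 u ≤ 8 * (en 0 u + en 2 u) := by
  rw [en, en, ← Finset.sum_add_distrib, Finset.mul_sum]
  refine Finset.sum_le_sum fun i _ => ?_
  calc _ ≤ nsq (fun ξ => 2 * (‖ξ‖ₑ ^ 0 * ‖rft (u i) ξ‖ₑ) + 2 * (‖ξ‖ₑ ^ 2 * ‖rft (u i) ξ‖ₑ)) := by
        refine nsq_mono_ae (Eventually.of_forall fun ξ => ?_)
        rw [← mul_add, ← add_mul, ← mul_assoc]
        gcongr
        rw [← ofReal_pow_norm, ← ofReal_pow_norm, ← ENNReal.ofReal_add (by positivity) (by positivity),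
          two_mul, ← ENNReal.ofReal_add (by positivity) (by positivity)]
        refine ENNReal.ofReal_le_ofReal ?_
        rw [Real.rpow_two, pow_zero]
        nlinarith [sq_nonneg (‖ξ‖ - 1)]
    _ ≤ 2 * (nsq (fun ξ => 2 * (‖ξ‖ₑ ^ 0 * ‖rft (u i) ξ‖ₑ)) + nsq (fun ξ => 2 * (‖ξ‖ₑ ^ 2 * ‖rft (u i) ξ‖ₑ))) :=
        nsq_add_le ((aemeasurable_nm 0 _).const_mul _)
    _ = 2 * (2 ^ 2 * nm 0 (u i) + 2 ^ 2 * nm 2 (u i)) := by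
        rw [nsq_const_mul (by norm_num), nsq_const_mul (by norm_num)]; rfl
    _ = _ := by ring

/-- Cauchy–Schwarz against `(1 + |ξ|)^{-s}`. It is used with the exponent of the solution class for
local bounds, and with exponent two in the final Gronwall argument. -/
theorem exists_l1_sq_le {s : ℝ} (hs1 : 3 / 2 < s) : ∃ C : ℝ≥0, ∀ u : Fin 3 → E3 → ℝ, l1 u ^ 2 ≤ C * hs s u := by
  have hi : Integrable (fun ξ : E3 => (1 + ‖ξ‖) ^ (-(2 * s))) volume :=
    integrable_one_add_norm (by simp; linarith)
  set J : ℝ≥0∞ := ∫⁻ ξ : E3, ENNReal.ofReal ((1 + ‖ξ‖) ^ (-(2 * s))) with hJ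
  have hJt : J ≠ ⊤ := by
    rw [hJ, ← ofReal_integral_eq_lintegral_ofReal hi (Eventually.of_forall fun ξ => by positivity)]
    exact ENNReal.ofReal_ne_top
  refine ⟨(4 * J).toNNReal, fun u => ?_⟩
  rw [ENNReal.coe_toNNReal (by finiteness)]
  have e : l1 u = ∫⁻ ξ, ENNReal.ofReal ((1 + ‖ξ‖) ^ (-s)) * (ENNReal.ofReal ((1 + ‖ξ‖) ^ s) * ua u ξ) := by
    refine lintegral_congr fun ξ => ?_
    rw [← mul_assoc, ← ENNReal.ofReal_mul (by positivity), ← Real.rpow_add (by positivity)]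
    simp
  have hm : Measurable fun ξ : E3 => ENNReal.ofReal ((1 + ‖ξ‖) ^ s) := by fun_prop
  have hm' : Measurable fun ξ : E3 => ENNReal.ofReal ((1 + ‖ξ‖) ^ (-s)) := by fun_prop
  rw [e]
  refine (lintegral_mul_sq_le hm'.aemeasurable (hm.aemeasurable.mul (aemeasurable_ua u))).trans ?_
  have e2 : ∫⁻ ξ : E3, ENNReal.ofReal ((1 + ‖ξ‖) ^ (-s)) ^ 2 = J := by
    refine lintegral_congr fun ξ => ?_
    rw [← ENNReal.ofReal_pow (by positivity), ← Real.rpow_natCast, ← Real.rpow_mul (by positivity)]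
    congr 2; push_cast; ring
  rw [e2]
  calc _ ≤ J * (4 * hs s u) := by
        gcongr
        exact nsq_mul_ua_le hm u
    _ = _ := by ring

end MLANS

end

noncomputable section

namespace MLANS

open LineDeriv

/-! ### The solution on the Fourier side -/

/-- For `t ≥ a` the weight is at least `a^e`, so the weighted bound becomes a bound of the norm
itself. This is the role of `a > 0`. -/
theorem DotCBesov.exists_bound {χ : E3 → ℝ} {T e σ : ℝ} {p q : ℝ≥0∞} {w : ℝ → E3 → E3}
    (h : DotCBesov χ T e σ p q w) (he : 0 ≤ e) {a : ℝ} (ha : 0 < a) :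
    ∃ B : ℝ, ∀ t ∈ Ioo 0 T, a ≤ t → (besovNorm χ σ p q (w t)).toReal ≤ B := by
  obtain ⟨M, hM⟩ := h.2.1
  have hae : 0 < a ^ e := Real.rpow_pos_of_pos ha e
  refine ⟨M / a ^ e, fun t ht hat => ?_⟩
  have h1 := hM t ht
  have hfin := (h.1.1 t ht).2
  rw [le_div_iff₀ hae]
  have h2 := ENNReal.toReal_mono ENNReal.coe_ne_top h1
  rw [ENNReal.toReal_mul, ENNReal.toReal_ofReal (Real.rpow_nonneg ht.1.le _), ENNReal.coe_toReal] at h2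
  have h3 : a ^ e ≤ t ^ e := Real.rpow_le_rpow ha.le hat he
  nlinarith [ENNReal.toReal_nonneg (a := besovNorm χ σ p q (w t))]

theorem exists_VDat {χ : E3 → ℝ} (hχ : IsLPProfile χ) {p : ℝ≥0∞} (hp : 1 ≤ p) {q : ℝ≥0∞} (hq : 1 ≤ q) (B : ℝ) :
    ∃ b : ℝ, ∀ w : E3 → E3, MemBesov χ 6 p q w → (besovNorm χ 6 p q w).toReal ≤ B →
      ∃ Q R, VDat b (comp w) Q R := by
  obtain ⟨C, hC0, hC⟩ := exists_W2Bound hχ hp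
  refine ⟨C * B, fun w hw hB => ?_⟩
  have hle : C * (besovNorm χ 6 p q w).toReal ≤ C * B := mul_le_mul_of_nonneg_left hB hC0
  choose g h h1 h2 h3 h4 h5 using fun i => hC _ _ (hw.blockData hχ hp hq i)
  exact ⟨fun j i => g i j, fun k j i => h i j k, fun i => (h1 i).mono fun x hx => hx.trans hle, fun j i => h2 i j,
    fun j i x => (h3 i j x).trans hle, fun k j i => h4 i j k, fun k j i x => (h5 i j k x).trans hle⟩

theorem exists_hs_le {χ : E3 → ℝ} (hχ : IsLPProfile χ) {q : ℝ≥0∞} (hq : 1 ≤ q) {s' s : ℝ} (hs0 : 0 ≤ s')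
    (hss : s' < s) (B : ℝ) : ∃ M : ℝ≥0, ∀ w : E3 → E3, MemBesov χ s 2 q w →
      (besovNorm χ s 2 q w).toReal ≤ B → hs s' (comp w) ≤ M := by
  obtain ⟨C, hC0, hC⟩ := exists_sobolev_bound hχ hs0 hss
  refine ⟨3 * (C * B ^ 2).toNNReal, fun w hw hB => ?_⟩
  have key : ∀ i, nsq (fun ξ => ENNReal.ofReal ((1 + ‖ξ‖) ^ s') * ‖rft (comp w i) ξ‖ₑ)
      ≤ ENNReal.ofReal (C * B ^ 2) := fun i => by
    refine le_trans (le_of_eq ?_) ((hC _ _ (hw.blockData2 hχ hq i)).trans (ENNReal.ofReal_le_ofReal ?_))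
    · refine lintegral_congr fun ξ => ?_
      rw [mul_pow, ← ENNReal.ofReal_pow (by positivity), ← Real.rpow_natCast, ← Real.rpow_mul (by positivity),
        mul_comm s']
      rfl
    · have := ENNReal.toReal_nonneg (a := besovNorm χ s 2 q w)
      gcongr
  calc _ ≤ ∑ _i : Fin 3, ENNReal.ofReal (C * B ^ 2) := Finset.sum_le_sum fun i _ => key i
    _ = _ := by
        rw [Finset.sum_const, Finset.card_univ, Fintype.card_fin, nsmul_eq_mul]
        push_cast
        rfl

/-- What the energy estimates use about the solution of the perturbed equation on `[a, T')`. -/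
structure FlowData (α ν b s a T' : ℝ) (u : ℝ → E3 → E3) (S : ℝ → E3 → Mat3) : Prop where
  pos : 0 < a
  flow : WeakFlow ν (Ioo 0 T') u S
  memLp : ∀ r ∈ Ioo 0 T', ∀ i, MemLp (comp (u r) i) 2 volume
  divFree : ∀ t ∈ Ico a T', DivFree 3 (comp (u t))
  vdat : ∀ t ∈ Ico a T', ∃ v Q R, VDat b v Q R ∧ ∀ k l, (fun x => S t x k l) = stress α (comp (u t)) v Q k l
  hs_le : ∀ c < T', ∃ M : ℝ≥0, ∀ t ∈ Icc a c, hs s (comp (u t)) ≤ M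

/-- The bound on `v` is uniform up to `T'` because `v` exists beyond that time, while the bounds on
`u` hold only on compact subintervals. This asymmetry is what the energy estimates have to overcome.
-/
theorem exists_flowData {χ : E3 → ℝ} (hχ : IsLPProfile χ) {α ν p : ℝ} (hp : 3 < p) {q : ℝ≥0∞} (hq : 1 ≤ q)
    {s : ℝ} (hs : 3 / 2 < s) (hs' : s < 5 / 2) {v : ℝ → E3 → E3} (hv : IsGlobalLANSSolution χ α ν p q v)
    {a T' : ℝ} (ha : 0 < a) {u : ℝ → E3 → E3} (hu : IsMLANSSolution χ α ν s q T' v u)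
    (hu3 : ∀ t ∈ Ico a T', homSobolevNorm 3 (u t) < ⊤) :
    ∃ b s', 3 / 2 < s' ∧ s' ≤ 2 ∧ FlowData α ν b s' a T' u fun t x =>
      tensor (u t) (u t) x + tensor (u t) (v t) x + tensor (v t) (u t) x +
        (tau α (u t) (u t) x + (2 : ℝ) • tau α (u t) (v t) x) := by
  have hp1 : 1 ≤ ENNReal.ofReal p := by
    rw [← ENNReal.ofReal_one]; exact ENNReal.ofReal_le_ofReal (by linarith)
  have h3p : 3 / p < 6 := by rw [div_lt_iff₀ (by linarith)]; linarith
  have hpow : ∀ t ∈ Ico a T', ∀ i, HPow 3 (comp (u t) i) := fun t ht =>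
    hpow_of_homSobolevNorm (n := 3) (by exact_mod_cast hu3 t ht)
  -- Without the assumption `a < T'` the time interval may be empty; the excluded case is vacuous.
  by_cases hT : 0 < T' + 1
  swap
  · refine ⟨0, 2, by norm_num, le_rfl, ⟨ha, hu.equation, fun r hr => ?_, fun t ht => ?_, fun t ht => ?_, fun c hc => ?_⟩⟩
    · exact absurd (hr.1.trans hr.2) (by linarith)
    · exact absurd (ht.1.trans_lt ht.2) (by linarith)
    · exact absurd (ht.1.trans_lt ht.2) (by linarith)
    · exact ⟨0, fun t ht => absurd (ht.1.trans ht.2) (by linarith)⟩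
  -- Any time beyond `T'` serves. The regularity six is the one required by `BlockData`, and exceeds
  -- `3 / p` since `p > 3`.
  have hvC := hv.dotC (T' + 1) hT 6 h3p
  obtain ⟨B, hB⟩ := hvC.exists_bound (by linarith) ha
  obtain ⟨b, hb⟩ := exists_VDat hχ hp1 hq B
  -- The midpoint of `3/2` and `s` leaves room for the embedding of the Besov space. It is below two
  -- because `s < 5/2`, as the `Ḣ¹` bound of the stress requires.
  refine ⟨b, (s + 3 / 2) / 2, by linarith, by linarith, ⟨ha, hu.equation, fun r hr i => ?_, fun t ht => ?_,
    fun t ht => ?_, fun c hc => ?_⟩⟩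
  · obtain ⟨T, hT1, hT2⟩ := exists_between hr.2
    exact memLp_coord ((hu.bc T ⟨hr.1.trans hT1, hT2⟩).1.1 r ⟨hr.1.le, hT1⟩).1 i
  · exact ⟨hpow t ht, (hu.divFree t ⟨ha.le.trans ht.1, ht.2⟩).ae_sum_eq_zero fun i =>
      (hpow t ht i).mono (by norm_num)⟩
  · have htT : t ∈ Ioo 0 (T' + 1) := ⟨ha.trans_le ht.1, by linarith [ht.2]⟩
    obtain ⟨Q, R, hQ⟩ := hb (v t) (hvC.1.1 t htT) (hB t htT ht.1)
    refine ⟨comp (v t), Q, R, hQ, fun k l => funext fun x => ?_⟩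
    exact stress_eq α (P := gr (comp (u t))) (fun i j => ((hpow t ht j).mono (by norm_num : 1 ≤ 3)).wd i)
      (fun i j => hQ.wd i j) x k l
  · by_cases hac : a ≤ c
    · obtain ⟨T, hT1, hT2⟩ := exists_between hc
      have hTI : T ∈ Ioo 0 T' := ⟨ha.trans_le (hac.trans hT1.le), hT2⟩
      have hC := hu.dotC T hTI
      obtain ⟨B', hB'⟩ := hC.exists_bound (by linarith) ha
      obtain ⟨M, hM⟩ := exists_hs_le hχ hq (s' := (s + 3 / 2) / 2) (s := s) (by linarith) (by linarith) B'
      refine ⟨M, fun t ht => ?_⟩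
      have htI : t ∈ Ioo 0 T := ⟨ha.trans_le ht.1, ht.2.trans_lt hT1⟩
      exact hM (u t) (hC.1.1 t htI) (hB' t htI ht.1)
    · exact ⟨0, fun t ht => absurd (ht.1.trans ht.2) hac⟩

end MLANS

end

noncomputable section

namespace MLANS

open LineDeriv

/-! ### Cutoffs -/

/-- A bump function that equals one on a large ball. -/
def outerBump (n : ℕ) : ContDiffBump (0 : E3) := ⟨n + 1, n + 2, by positivity, by linarith⟩

/-- A bump function supported in a small ball. -/
def innerBump (n : ℕ) : ContDiffBump (0 : E3) :=
  ⟨1 / (n + 2), 1 / (n + 1), by positivity, one_div_lt_one_div_of_lt (by positivity) (by linarith)⟩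

/-- A smooth cutoff to an annulus. -/
def cutoff (n : ℕ) (ξ : E3) : ℝ := outerBump n ξ * (1 - innerBump n ξ)

theorem cutoff_nonneg (n : ℕ) (ξ : E3) : 0 ≤ cutoff n ξ :=
  mul_nonneg (outerBump n).nonneg (sub_nonneg.2 (innerBump n).le_one)

theorem cutoff_le_one (n : ℕ) (ξ : E3) : cutoff n ξ ≤ 1 :=
  mul_le_one₀ (outerBump n).le_one (sub_nonneg.2 (innerBump n).le_one)
    (sub_le_self _ (innerBump n).nonneg)

theorem contDiff_cutoff (n : ℕ) : ContDiff ℝ ∞ (cutoff n) :=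
  (outerBump n).contDiff.mul (contDiff_const.sub (innerBump n).contDiff)

theorem tendsto_cutoff {ξ : E3} (hξ : ξ ≠ 0) : Tendsto (fun n => cutoff n ξ) atTop (𝓝 1) := by
  refine tendsto_const_nhds.congr' ?_
  have h0 : 0 < ‖ξ‖ := norm_pos_iff.2 hξ
  obtain ⟨N, hN⟩ := exists_nat_gt (max ‖ξ‖ (1 / ‖ξ‖))
  filter_upwards [eventually_ge_atTop N] with n hn
  have hn' : (N : ℝ) ≤ n := by exact_mod_cast hn
  have h1 : ‖ξ‖ ≤ n + 1 := by linarith [(le_max_left _ _).trans hN.le]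
  have h2 : 1 / (n + 1 : ℝ) ≤ ‖ξ‖ := by
    rw [one_div_le (by positivity) h0]
    linarith [(le_max_right _ _).trans hN.le]
  rw [cutoff, (outerBump n).one_of_mem_closedBall (by simpa [outerBump] using h1),
    (innerBump n).zero_of_le_dist (by simpa [innerBump] using h2)]
  ring

/-- The cutoff of the weight `|ξ|^m`. -/
def cutW (m n : ℕ) (ξ : E3) : ℝ := ‖ξ‖ ^ m * cutoff n ξ

/-- The cutoff vanishes near the origin, so division by `|ξ|²` is smooth and even the weights with
`m = 0` and `m = 1` are admissible. -/
theorem cutWeight_cutW (m n : ℕ) : CutWeight (cutW m n) := by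
  have hz : cutoff n =ᶠ[𝓝 0] 0 := by
    filter_upwards [(innerBump n).eventuallyEq_one] with ξ hξ
    rw [cutoff, hξ]; simp
  refine ⟨fun ξ => cutW m n ξ / ‖ξ‖ ^ 2, contDiff_iff_contDiffAt.2 fun ξ => ?_, ?_, fun ξ => ?_⟩
  · by_cases hξ : ξ = 0
    · subst hξ
      refine (contDiffAt_const (c := (0 : ℝ))).congr_of_eventuallyEq ?_
      filter_upwards [hz] with η hη
      rw [cutW, hη]; simp
    · exact (((contDiffAt_norm ℝ hξ).pow m).mul (contDiff_cutoff n).contDiffAt).div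
        ((contDiffAt_norm ℝ hξ).pow 2) (by simpa using hξ)
  · have h1 : HasCompactSupport (cutoff n) := (outerBump n).hasCompactSupport.mul_right
    have h2 : HasCompactSupport (cutW m n) := h1.mul_left
    simp only [div_eq_mul_inv]
    exact h2.mul_right
  · by_cases hξ : ξ = 0
    · subst hξ
      have := hz.self_of_nhds
      rw [cutW, this]; simp
    · have : ‖ξ‖ ≠ 0 := by simpa using hξ
      field_simp

theorem abs_cutW_le (m n : ℕ) (ξ : E3) : |cutW m n ξ| ≤ ‖ξ‖ ^ m := by
  rw [cutW, abs_of_nonneg (mul_nonneg (by positivity) (cutoff_nonneg n ξ))]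
  exact mul_le_of_le_one_right (by positivity) (cutoff_le_one n ξ)

theorem tendsto_cutW (m : ℕ) {ξ : E3} (hξ : ξ ≠ 0) : Tendsto (fun n => cutW m n ξ) atTop (𝓝 (‖ξ‖ ^ m)) := by
  have := (tendsto_cutoff hξ).const_mul (‖ξ‖ ^ m)
  rwa [mul_one] at this

/-- The weighted energy with weight `|ξ|^m`. -/
def enr (m : ℕ) (u : Fin 3 → E3 → ℝ) : ℝ := engy (fun ξ => ‖ξ‖ ^ m) u

theorem HPow.memLp_pow {m : ℕ} {f : E3 → ℝ} (h : HPow m f) :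
    MemLp (fun ξ => ((‖ξ‖ ^ m : ℝ) : ℂ) * rft f ξ) 2 volume := by
  simpa only [Complex.ofReal_pow] using h.2

theorem engy_nonneg (G : E3 → ℝ) (u : Fin 3 → E3 → ℝ) : 0 ≤ engy G u :=
  Finset.sum_nonneg fun _ _ => integral_nonneg fun _ => sq_nonneg _

theorem integrable_norm_sq {F : E3 → ℂ} (hF : MemLp F 2 volume) : Integrable (fun ξ => ‖F ξ‖ ^ 2) volume :=
  (memLp_two_iff_integrable_sq_norm hF.1).1 hF

theorem ofReal_enr {m : ℕ} {u : Fin 3 → E3 → ℝ} (hu : ∀ l, HPow m (u l)) : ENNReal.ofReal (enr m u) = en m u := by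
  rw [enr, engy, en, ENNReal.ofReal_sum_of_nonneg fun l _ => integral_nonneg fun _ => sq_nonneg _]
  refine Finset.sum_congr rfl fun l _ => ?_
  rw [ofReal_integral_eq_lintegral_ofReal (integrable_norm_sq (hu l).memLp_pow)
    (Eventually.of_forall fun ξ => sq_nonneg _)]
  refine lintegral_congr fun ξ => ?_
  rw [ENNReal.ofReal_pow (norm_nonneg _), ofReal_norm, enorm_mul, ← ofReal_norm ((‖ξ‖ ^ m : ℝ) : ℂ),
    Complex.norm_real, Real.norm_of_nonneg (by positivity), ofReal_pow_norm]

theorem engy_cutW_le {m : ℕ} {u : Fin 3 → E3 → ℝ} (hu : ∀ l, HPow m (u l)) (n : ℕ) :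
    engy (cutW m n) u ≤ enr m u := by
  refine Finset.sum_le_sum fun l _ => integral_mono
    (integrable_norm_sq ((cutWeight_cutW m n).memLp_mul (memLp_rft _))) (integrable_norm_sq (hu l).memLp_pow) fun ξ => ?_
  simp only [norm_mul, Complex.norm_real, Real.norm_eq_abs]
  rw [abs_of_nonneg (by positivity : 0 ≤ ‖ξ‖ ^ m)]
  gcongr
  exact abs_cutW_le m n ξ

theorem tendsto_engy_cutW {m : ℕ} {u : Fin 3 → E3 → ℝ} (hu : ∀ l, HPow m (u l)) :
    Tendsto (fun n => engy (cutW m n) u) atTop (𝓝 (enr m u)) := by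
  simp only [enr, engy]
  refine tendsto_finsetSum _ fun l _ => ?_
  refine tendsto_integral_of_dominated_convergence (fun ξ => ‖((‖ξ‖ ^ m : ℝ) : ℂ) * rft (u l) ξ‖ ^ 2)
    (fun n => (integrable_norm_sq ((cutWeight_cutW m n).memLp_mul (memLp_rft _))).1)
    (integrable_norm_sq (hu l).memLp_pow) (fun n => Eventually.of_forall fun ξ => ?_) ?_
  · rw [Real.norm_of_nonneg (sq_nonneg _), norm_mul, norm_mul, Complex.norm_real, Complex.norm_real,
      Real.norm_eq_abs, Real.norm_of_nonneg (by positivity : 0 ≤ ‖ξ‖ ^ m)]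
    gcongr
    exact abs_cutW_le m n ξ
  · filter_upwards [Measure.ae_ne volume (0 : E3)] with ξ h0
    exact (((Complex.continuous_ofReal.tendsto _).comp (tendsto_cutW m h0)).mul_const _).norm.pow 2

/-- The integrand of the pairing is controlled by the product of two weighted norms. -/
theorem norm_pair_le {m m' m'' n : ℕ} (hm : m' + m'' = 2 * m + 1) (k : Fin 3) (ξ : E3) (z w : ℂ) :
    ‖(starRingEnd ℂ) ((cutW m n ξ : ℂ) * z) * ((cutW m n ξ : ℂ) * (dsym k ξ * w))‖
      ≤ 2 * Real.pi * (‖(cutW m' n ξ : ℂ) * z‖ * ‖((‖ξ‖ ^ m'' : ℝ) : ℂ) * w‖) := by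
  have c0 := cutoff_nonneg n ξ
  have c1 := cutoff_le_one n ξ
  simp only [norm_mul, RCLike.norm_conj, Complex.norm_real, Real.norm_eq_abs, cutW, abs_pow, abs_norm,
    abs_of_nonneg c0]
  calc _ ≤ ‖ξ‖ ^ m * cutoff n ξ * ‖z‖ * (‖ξ‖ ^ m * 1 * (2 * Real.pi * ‖ξ‖ * ‖w‖)) := by
        gcongr
        exact norm_dsym_le k ξ
    _ = 2 * Real.pi * (‖ξ‖ ^ (2 * m + 1) * (cutoff n ξ * ‖z‖ * ‖w‖)) := by ring
    _ = _ := by rw [← hm]; ring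

/-- The `2m + 1` powers of `|ξ|` are distributed between velocity and stress, then Young's
inequality is applied. Only the velocity keeps the cutoff, so with `m' = m + 1` its term is absorbed
by the truncated dissipation. The factor three counts the index `k`. -/
theorem abs_pairG_cutW_le {m m' m'' : ℕ} (hm : m' + m'' = 2 * m + 1) (n : ℕ) {ε : ℝ} (hε : 0 < ε)
    {u : Fin 3 → E3 → ℝ} {S : Fin 3 → Fin 3 → E3 → ℝ} (hS : ∀ k l, HPow m'' (S k l)) :
    |pairG (cutW m n) u S| ≤ 3 * ε * engy (cutW m' n) u + Real.pi ^ 2 / ε * ∑ k, enr m'' (S k) := by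
  have key : ∀ l k, |(∫ ξ, (starRingEnd ℂ) ((cutW m n ξ : ℂ) * rft (u l) ξ)
      * ((cutW m n ξ : ℂ) * (dsym k ξ * rft (S k l) ξ))).re|
      ≤ ε * (∫ ξ, ‖(cutW m' n ξ : ℂ) * rft (u l) ξ‖ ^ 2)
        + Real.pi ^ 2 / ε * ∫ ξ, ‖((‖ξ‖ ^ m'' : ℝ) : ℂ) * rft (S k l) ξ‖ ^ 2 := fun l k => by
    have i1 := integrable_norm_sq ((cutWeight_cutW m' n).memLp_mul (memLp_rft (u l)))
    have i2 := integrable_norm_sq (hS k l).memLp_pow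
    rw [← integral_const_mul, ← integral_const_mul, ← integral_add (i1.const_mul _) (i2.const_mul _)]
    refine (Complex.abs_re_le_norm _).trans (norm_integral_le_of_norm_le ((i1.const_mul _).add (i2.const_mul _))
      (Eventually.of_forall fun ξ => (norm_pair_le hm k ξ _ _).trans ?_))
    set x := ‖(cutW m' n ξ : ℂ) * rft (u l) ξ‖
    set y := ‖((‖ξ‖ ^ m'' : ℝ) : ℂ) * rft (S k l) ξ‖
    have h : 0 ≤ (ε * x - Real.pi * y) ^ 2 / ε := by positivity
    have e : (ε * x - Real.pi * y) ^ 2 / ε = ε * x ^ 2 + Real.pi ^ 2 / ε * y ^ 2 - 2 * Real.pi * (x * y) := by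
      field_simp; ring
    linarith
  rw [pairG]
  refine (Finset.abs_sum_le_sum_abs _ _).trans ((Finset.sum_le_sum fun l _ => (Finset.abs_sum_le_sum_abs _ _).trans
    (Finset.sum_le_sum fun k _ => key l k)).trans (le_of_eq ?_))
  simp only [Finset.sum_add_distrib, Finset.sum_const, Finset.card_univ, Fintype.card_fin, nsmul_eq_mul,
    ← Finset.mul_sum, enr, engy]
  rw [Finset.sum_comm]
  push_cast
  ring

theorem tendsto_pairG_cutW {m m' m'' : ℕ} (hm : m' + m'' = 2 * m + 1) {u : Fin 3 → E3 → ℝ}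
    {S : Fin 3 → Fin 3 → E3 → ℝ} (hu : ∀ l, HPow m' (u l)) (hS : ∀ k l, HPow m'' (S k l)) :
    Tendsto (fun n => pairG (cutW m n) u S) atTop (𝓝 (pairG (fun ξ => ‖ξ‖ ^ m) u S)) := by
  simp only [pairG]
  refine tendsto_finsetSum _ fun l _ => tendsto_finsetSum _ fun k _ => ?_
  refine (Complex.continuous_re.tendsto _).comp ?_
  have hi : Integrable (fun ξ => 2 * Real.pi * (‖((‖ξ‖ ^ m' : ℝ) : ℂ) * rft (u l) ξ‖
      * ‖((‖ξ‖ ^ m'' : ℝ) : ℂ) * rft (S k l) ξ‖)) volume :=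
    ((hu l).memLp_pow.norm.integrable_mul (hS k l).memLp_pow.norm).const_mul _
  refine tendsto_integral_of_dominated_convergence _ (fun n => ?_) hi
    (fun n => Eventually.of_forall fun ξ => (norm_pair_le hm k ξ _ _).trans ?_) ?_
  · exact ((cutWeight_cutW m n).memLp_mul (memLp_rft _)).1.star.mul
      ((cutWeight_cutW m n).memLp_dsym_mul (memLp_rft _) k).1
  · rw [norm_mul, norm_mul ((‖ξ‖ ^ m' : ℝ) : ℂ), Complex.norm_real, Complex.norm_real, Real.norm_eq_abs,
      Real.norm_of_nonneg (by positivity : 0 ≤ ‖ξ‖ ^ m')]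
    gcongr
    exact abs_cutW_le m' n ξ
  · filter_upwards [Measure.ae_ne volume (0 : E3)] with ξ h0
    have h1 := (Complex.continuous_ofReal.tendsto _).comp (tendsto_cutW m h0)
    exact ((Complex.continuous_conj.tendsto _).comp (h1.mul_const _)).mul (h1.mul_const _)

end MLANS

end

noncomputable section

namespace MLANS

open LineDeriv

/-! ### Fixed-time identities -/

theorem hpow_of_nm_lt_top {m : ℕ} {f : E3 → ℝ} (hf : MemLp f 2 volume) (h : nm m f < ⊤) : HPow m f := by
  refine ⟨hf, (memLp_two_iff ((continuous_norm_pow m).aestronglyMeasurable.mul (memLp_rft _).1)).2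
    (lt_of_le_of_lt (lintegral_mono fun ξ => ?_) h)⟩
  simp only [Pi.mul_apply]
  rw [enorm_mul, enorm_pow, ← ofReal_norm ((‖ξ‖ : ℝ) : ℂ), Complex.norm_real, norm_norm, ofReal_norm]

theorem integral_sq_eq {f : E3 → ℝ} (hf : MemLp f 2 volume) : ∫ x, f x ^ 2 = ∫ ξ, ‖rft f ξ‖ ^ 2 := by
  apply Complex.ofReal_injective
  have := rparseval hf hf
  simp only [← sq] at this
  rw [this, ← integral_complex_ofReal]
  refine integral_congr_ae (Eventually.of_forall fun ξ => ?_)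
  simp only [Complex.mul_conj, Complex.normSq_eq_norm_sq]

theorem integral_sq0 {u : Fin 3 → E3 → ℝ} (hu : ∀ i, MemLp (u i) 2 volume) : ∫ x, sq0 u x = enr 0 u := by
  simp only [sq0, enr, engy]
  rw [integral_finsetSum _ fun i _ => (hu i).integrable_sq]
  exact Finset.sum_congr rfl fun i _ => by simp [integral_sq_eq (hu i)]

theorem sum_norm_dsym_sq (ξ : E3) : ∑ j, ‖dsym j ξ‖ ^ 2 = 4 * Real.pi ^ 2 * ‖ξ‖ ^ 2 := by
  rw [← sum_coord_sq, Finset.mul_sum]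
  refine Finset.sum_congr rfl fun j _ => ?_
  rw [dsym]
  simp only [norm_mul, Complex.norm_ofNat, Complex.norm_real, Complex.norm_I, mul_one, Real.norm_eq_abs, mul_pow,
    sq_abs]
  ring

theorem integral_sq1 {u : Fin 3 → E3 → ℝ} (hu : ∀ i, HPow 1 (u i)) :
    ∫ x, sq1 u x = 4 * Real.pi ^ 2 * enr 1 u := by
  simp only [sq1, enr, engy, gr]
  have hi : ∀ i j, Integrable (fun ξ => ‖dsym i ξ * rft (u j) ξ‖ ^ 2) volume := fun i j =>
    integrable_norm_sq (by simpa using memLp_dsym_mul (n := 0) (hu j) i)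
  have e : ∀ i j, ∫ x, pd i (u j) x ^ 2 = ∫ ξ, ‖dsym i ξ * rft (u j) ξ‖ ^ 2 := fun i j => by
    rw [integral_sq_eq ((hu j).memLp_pd i)]
    exact integral_congr_ae (by filter_upwards [(hu j).rft_pd i] with ξ h; rw [h])
  rw [integral_finsetSum _ fun i _ => integrable_finsetSum _ fun j _ => ((hu j).memLp_pd i).integrable_sq]
  simp only [integral_finsetSum _ fun j _ => ((hu j).memLp_pd _).integrable_sq, e]
  rw [Finset.sum_comm, Finset.mul_sum]
  refine Finset.sum_congr rfl fun j _ => ?_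
  rw [← integral_finsetSum _ fun i _ => hi i j, ← integral_const_mul]
  refine integral_congr_ae (Eventually.of_forall fun ξ => ?_)
  simp only [norm_mul, mul_pow]
  rw [← Finset.sum_mul, sum_norm_dsym_sq]
  simp only [Complex.norm_real, norm_pow, norm_norm]
  ring

theorem integral_sq0_lap {u : Fin 3 → E3 → ℝ} (hu : ∀ i, HPow 2 (u i)) :
    ∫ x, sq0 (fun i => lap (u i)) x = 16 * Real.pi ^ 4 * enr 2 u := by
  rw [integral_sq0 fun i => (HPow.lap (n := 0) (hu i)).1]
  simp only [enr, engy]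
  rw [Finset.mul_sum]
  refine Finset.sum_congr rfl fun j _ => ?_
  rw [← integral_const_mul]
  refine integral_congr_ae ?_
  filter_upwards [(hu j).rft_lap] with ξ h
  rw [h]
  simp only [norm_mul, mul_pow, norm_neg, Complex.norm_real, norm_pow, norm_norm, Real.norm_ofNat,
    Real.norm_of_nonneg Real.pi_pos.le]
  ring

theorem conj_dsym (k : Fin 3) (ξ : E3) : (starRingEnd ℂ) (dsym k ξ) = -dsym k ξ := by
  simp only [dsym, map_mul, Complex.conj_ofReal, Complex.conj_I, Complex.conj_ofNat]
  ring

/-- The weights `1` and `4π²α²|ξ|²` add up to the symbol of `1 - α²Δ`. This returns from the Fourier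
side to the physical pairing in which the cancellation was proved. -/
theorem pairG_zero_add_one {α : ℝ} {u : Fin 3 → E3 → ℝ} {S : Fin 3 → Fin 3 → E3 → ℝ} (hu : ∀ l, HPow 3 (u l))
    (hS : ∀ k l, HPow 1 (S k l)) :
    pairG (fun ξ => ‖ξ‖ ^ 0) u S + 4 * Real.pi ^ 2 * α ^ 2 * pairG (fun ξ => ‖ξ‖ ^ 1) u S
      = -∑ l, ∑ k, ∫ x, S k l x * pd k (hel α (u l)) x := by
  simp only [pairG]
  rw [Finset.mul_sum, ← Finset.sum_add_distrib, ← Finset.sum_neg_distrib]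
  refine Finset.sum_congr rfl fun l _ => ?_
  rw [Finset.mul_sum, ← Finset.sum_add_distrib, ← Finset.sum_neg_distrib]
  refine Finset.sum_congr rfl fun k _ => ?_
  have hd : MemLp (fun ξ => dsym k ξ * rft (S k l) ξ) 2 volume := by simpa using memLp_dsym_mul (n := 0) (hS k l) k
  have i0 : Integrable (fun ξ => (starRingEnd ℂ) (((‖ξ‖ ^ 0 : ℝ) : ℂ) * rft (u l) ξ)
      * (((‖ξ‖ ^ 0 : ℝ) : ℂ) * (dsym k ξ * rft (S k l) ξ))) volume := by
    refine ((memLp_rft (u l)).star.integrable_mul hd).congr (Eventually.of_forall fun ξ => ?_)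
    simp
  have i1 : Integrable (fun ξ => (starRingEnd ℂ) (((‖ξ‖ ^ 1 : ℝ) : ℂ) * rft (u l) ξ)
      * (((‖ξ‖ ^ 1 : ℝ) : ℂ) * (dsym k ξ * rft (S k l) ξ))) volume := by
    refine (((hu l).mono (show 2 ≤ 3 by norm_num)).memLp_pow.star.integrable_mul hd).congr
      (Eventually.of_forall fun ξ => ?_)
    simp only [Pi.star_apply, Pi.mul_apply, RCLike.star_def, map_mul, Complex.conj_ofReal]
    push_cast
    ring
  have hφ : HPow 1 (hel α (u l)) := HPow.hel (n := 1) (hu l) α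
  have e : ((∫ x, S k l x * pd k (hel α (u l)) x : ℝ) : ℂ)
      = -((∫ ξ, (starRingEnd ℂ) (((‖ξ‖ ^ 0 : ℝ) : ℂ) * rft (u l) ξ)
          * (((‖ξ‖ ^ 0 : ℝ) : ℂ) * (dsym k ξ * rft (S k l) ξ)))
        + ((4 * Real.pi ^ 2 * α ^ 2 : ℝ) : ℂ) * ∫ ξ, (starRingEnd ℂ) (((‖ξ‖ ^ 1 : ℝ) : ℂ) * rft (u l) ξ)
          * (((‖ξ‖ ^ 1 : ℝ) : ℂ) * (dsym k ξ * rft (S k l) ξ))) := by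
    rw [rparseval (hS k l).1 (hφ.memLp_pd k), ← integral_const_mul, ← integral_add i0 (i1.const_mul _), ← integral_neg]
    refine integral_congr_ae ?_
    filter_upwards [hφ.rft_pd k, ((hu l).mono (show 2 ≤ 3 by norm_num)).rft_hel α] with ξ h1 h2
    rw [h1, h2]
    simp only [map_mul, conj_dsym, map_add, map_one, Complex.conj_ofReal, map_pow]
    push_cast
    ring
  have := congrArg Complex.re e
  rw [Complex.ofReal_re] at this
  rw [this, Complex.neg_re, Complex.add_re, Complex.re_ofReal_mul]
  ring

theorem exists_pairing_le {α : ℝ} (hα : 0 < α) (b : ℝ) {δ : ℝ} (hδ : 0 < δ) : ∃ C : ℝ, 0 ≤ C ∧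
    ∀ (u v : Fin 3 → E3 → ℝ) (Q : Fin 3 → Fin 3 → E3 → ℝ) (R : Fin 3 → Fin 3 → Fin 3 → E3 → ℝ),
      DivFree 3 u → VDat b v Q R → (∀ k l, HPow 1 (stress α u v Q k l)) →
      |pairG (fun ξ => ‖ξ‖ ^ 0) u (stress α u v Q) + 4 * Real.pi ^ 2 * α ^ 2 * pairG (fun ξ => ‖ξ‖ ^ 1) u (stress α u v Q)|
        ≤ C * (enr 0 u + 4 * Real.pi ^ 2 * α ^ 2 * enr 1 u) + δ * enr 2 u := by
  -- Chosen so that `9ε` times the factor `16π⁴` of `integral_sq0_lap` is `δ`.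
  set ε := δ / (144 * Real.pi ^ 4) with hε
  have hε0 : 0 < ε := by positivity
  set K := 9 * ((1 / 2 + α ^ 4 / (4 * ε)) * (8 * b ^ 2) + 1 / 2) + α ^ 2 * (216 * |b|) with hK
  have hK0 : 0 ≤ K := by positivity
  -- The factor `1 + 1/α²` compares `‖u‖² + ‖∇u‖²` with the energy in which the gradient carries
  -- `α²`.
  refine ⟨K * (1 + 1 / α ^ 2), by positivity, fun u v Q R hu hv hS => ?_⟩
  have h1 := fun i => (hu.hpow i).mono (show 1 ≤ 3 by norm_num)
  have h2 := fun i => (hu.hpow i).mono (show 2 ≤ 3 by norm_num)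
  have j0 : Integrable (fun x => sq0 u x) volume := integrable_finsetSum _ fun i _ => (hu.hpow i).1.integrable_sq
  have j1 : Integrable (fun x => sq1 u x) volume :=
    integrable_finsetSum _ fun i _ => integrable_finsetSum _ fun j _ => ((h1 j).memLp_pd i).integrable_sq
  rw [pairG_zero_add_one hu.hpow hS, abs_neg]
  refine (pairing_bound hα hε0 hu hv).trans ?_
  rw [integral_add j0 j1, integral_sq0 fun i => (hu.hpow i).1, integral_sq1 h1, integral_sq0_lap h2]
  have hb : |b| = b := abs_of_nonneg hv.nonneg
  rw [hb] at hK
  have e0 := engy_nonneg (fun ξ => ‖ξ‖ ^ 0) u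
  have e1 := engy_nonneg (fun ξ => ‖ξ‖ ^ 1) u
  rw [← hK]
  have : 9 * ε * (16 * Real.pi ^ 4 * enr 2 u) = δ * enr 2 u := by
    rw [hε]; field_simp; ring
  rw [this]
  refine add_le_add_left ?_ _
  rw [mul_assoc K]
  refine mul_le_mul_of_nonneg_left ?_ hK0
  have : (1 + 1 / α ^ 2) * (enr 0 u + 4 * Real.pi ^ 2 * α ^ 2 * enr 1 u)
      = enr 0 u + 4 * Real.pi ^ 2 * enr 1 u + (1 / α ^ 2 * enr 0 u + 4 * Real.pi ^ 2 * α ^ 2 * enr 1 u) := by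
    field_simp; ring
  rw [this]
  have : 0 ≤ enr 0 u := e0
  have : 0 ≤ enr 1 u := e1
  have : 0 ≤ 1 / α ^ 2 * enr 0 u + 4 * Real.pi ^ 2 * α ^ 2 * enr 1 u := by positivity
  linarith

end MLANS

end

noncomputable section

namespace MLANS

open LineDeriv

/-! ### Differential inequalities along the flow -/

/-- An integral Gronwall inequality with an integrable coefficient. -/
theorem exists_bound_of_le_add_lintegral {f k : ℝ → ℝ≥0∞} {a T' : ℝ} (haT : a < T')
    (hloc : ∀ c < T', ∃ M : ℝ≥0, ∀ t ∈ Icc a c, f t ≤ M) (hk : ∫⁻ x in Ico a T', k x ≠ ⊤)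
    (h : ∀ r t, a ≤ r → r ≤ t → t < T' → f t ≤ f r + ∫⁻ x in Ioc r t, k x * f x) :
    ∃ M : ℝ≥0, ∀ t ∈ Ico a T', f t ≤ M := by
  -- By absolute continuity the coefficient has integral at most one half on some final interval.
  -- There the supremum of `f` up to time `t` is at most `M` plus half of itself. It is finite by
  -- local boundedness, hence at most `2 * M`, independently of `t`.
  obtain ⟨δ, hδ, hδk⟩ := exists_pos_setLIntegral_lt_of_measure_lt hk (ε := 2⁻¹) (by simp)
  obtain ⟨d, hd0, hd⟩ := ENNReal.lt_iff_exists_nnreal_btwn.1 hδ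
  have hd0' : (0 : ℝ) < d := by exact_mod_cast hd0
  set b := max a (T' - d) with hb
  have hab : a ≤ b := le_max_left _ _
  have hbT : b < T' := max_lt haT (by linarith)
  obtain ⟨M, hM⟩ := hloc b hbT
  refine ⟨2 * M, fun t ht => ?_⟩
  rcases le_total t b with htb | htb
  · exact (hM t ⟨ht.1, htb⟩).trans (by push_cast; exact le_mul_of_one_le_left' (by norm_num))
  obtain ⟨N, hN⟩ := hloc t ht.2
  set Ms := ⨆ x ∈ Icc b t, f x with hMs
  have hMsN : Ms ≤ N := iSup₂_le fun x hx => hN x ⟨hab.trans hx.1, hx.2⟩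
  have hMst : Ms ≠ ⊤ := ne_top_of_le_ne_top ENNReal.coe_ne_top hMsN
  have key : ∀ x ∈ Icc b t, f x ≤ M + 2⁻¹ * Ms := fun x hx => by
    have hsub : Ioc b x ⊆ Ico a T' := fun y hy => ⟨hab.trans hy.1.le, (hy.2.trans hx.2).trans_lt ht.2⟩
    have hk2 : ∫⁻ y in Ioc b x, k y ≤ 2⁻¹ := by
      have := hδk (Ioc b x) (lt_of_le_of_lt (Measure.restrict_apply_le _ _) (by
        rw [Real.volume_Ioc]
        refine lt_of_le_of_lt ?_ hd
        rw [← ENNReal.ofReal_coe_nnreal]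
        exact ENNReal.ofReal_le_ofReal (by linarith [hx.2, ht.2, le_max_right a (T' - d)])))
      rw [Measure.restrict_restrict measurableSet_Ioc, inter_eq_left.2 hsub] at this
      exact this.le
    refine (h b x hab hx.1 (hx.2.trans_lt ht.2)).trans (add_le_add (hM b ⟨hab, le_rfl⟩) ?_)
    calc _ ≤ ∫⁻ y in Ioc b x, k y * Ms := setLIntegral_mono' measurableSet_Ioc fun y hy =>
            mul_le_mul' le_rfl (le_iSup₂ (f := fun x (_ : x ∈ Icc b t) => f x) y ⟨hy.1.le, hy.2.trans hx.2⟩)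
      _ = (∫⁻ y in Ioc b x, k y) * Ms := lintegral_mul_const' _ _ hMst
      _ ≤ _ := mul_le_mul' hk2 le_rfl
  have h2 : Ms ≤ M + 2⁻¹ * Ms := iSup₂_le key
  have h3 : Ms ≤ 2 * M := by
    lift Ms to ℝ≥0 using hMst with m
    have e : (2⁻¹ : ℝ≥0∞) = ((2⁻¹ : ℝ≥0) : ℝ≥0∞) := by simp
    rw [e] at h2
    norm_cast at h2 ⊢
    rw [← NNReal.coe_le_coe] at h2 ⊢
    push_cast at h2 ⊢
    linarith
  push_cast
  exact (le_iSup₂ (f := fun x (_ : x ∈ Icc b t) => f x) t ⟨htb, le_rfl⟩).trans h3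

theorem sum_enr_le {m : ℕ} {S : Fin 3 → Fin 3 → E3 → ℝ} (hS : ∀ k l, HPow m (S k l)) {B : ℝ} (hB0 : 0 ≤ B)
    (h : ∀ k l, nm m (S k l) ≤ ENNReal.ofReal B) : ∑ k, enr m (S k) ≤ 9 * B := by
  have key : ∀ k, enr m (S k) ≤ 3 * B := fun k => by
    rw [← ENNReal.ofReal_le_ofReal_iff (by positivity), ofReal_enr (hS k)]
    refine (Finset.sum_le_sum fun l _ => h k l).trans (le_of_eq ?_)
    rw [Finset.sum_const, Finset.card_univ, Fintype.card_fin, nsmul_eq_mul, ENNReal.ofReal_mul (by norm_num)]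
    norm_num
  refine (Finset.sum_le_sum fun k _ => key k).trans (le_of_eq ?_)
  rw [Finset.sum_const, Finset.card_univ, Fintype.card_fin, nsmul_eq_mul]
  push_cast; ring

theorem hpow_one_of_two {S : Fin 3 → Fin 3 → E3 → ℝ} (hS : ∀ k l, HPow 2 (S k l)) (k l : Fin 3) : HPow 1 (S k l) :=
  (hS k l).mono one_le_two

variable {α ν b s a T' : ℝ} {u : ℝ → E3 → E3} {S : ℝ → E3 → Mat3}

theorem FlowData.hpow (h : FlowData α ν b s a T' u S) {m : ℕ} (hm : m ≤ 3) {t : ℝ} (ht : t ∈ Ico a T') (i : Fin 3) :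
    HPow m (comp (u t) i) :=
  ((h.divFree t ht).hpow i).mono hm

/-- The square of the Wiener norm is finite. -/
theorem FlowData.l1_sq_lt_top (h : FlowData α ν b s a T' u S) (hs1 : 3 / 2 < s) {t : ℝ} (ht : t ∈ Ico a T') :
    l1 (comp (u t)) ^ 2 < ⊤ := by
  obtain ⟨C, hC⟩ := exists_l1_sq_le hs1
  obtain ⟨M, hM⟩ := h.hs_le t ht.2
  exact (hC _).trans_lt (ENNReal.mul_lt_top ENNReal.coe_lt_top ((hM t ⟨ht.1, le_rfl⟩).trans_lt ENNReal.coe_lt_top))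

theorem FlowData.en_lt_top (h : FlowData α ν b s a T' u S) {m : ℕ} (hm : m ≤ 3) {t : ℝ} (ht : t ∈ Ico a T') :
    en m (comp (u t)) < ⊤ :=
  ENNReal.sum_lt_top.2 fun i _ => nm_lt_top (h.hpow hm ht i)

theorem FlowData.hpow_stress (h : FlowData α ν b s a T' u S) (hα : 0 < α) (hs1 : 3 / 2 < s) {t : ℝ} (ht : t ∈ Ico a T')
    (k l : Fin 3) : HPow 2 fun x => S t x k l := by
  obtain ⟨v, Q, R, hv, e⟩ := h.vdat t ht
  obtain ⟨K, hK⟩ := exists_nm_two_stress_le hα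
  rw [e]
  refine hpow_of_nm_lt_top (memLp_stress hα (h.divFree t ht).hpow hv k l)
    ((hK b _ v Q R (h.divFree t ht).hpow hv k l).trans_lt ?_)
  have h0 := h.en_lt_top (m := 0) (by norm_num) ht
  have h1 := h.en_lt_top (m := 1) (by norm_num) ht
  have h2 := h.en_lt_top (m := 2) (by norm_num) ht
  have h3 := h.l1_sq_lt_top hs1 ht
  exact ENNReal.mul_lt_top ENNReal.coe_lt_top (ENNReal.add_lt_top.2 ⟨ENNReal.mul_lt_top h3 h2,
    ENNReal.mul_lt_top (by finiteness) (ENNReal.add_lt_top.2 ⟨ENNReal.add_lt_top.2 ⟨h0, h1⟩, h2⟩)⟩)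

/-- Every norm in the `Ḣ¹` bound of the stress is dominated by the `H^s` norm, which the solution
class bounds on compact intervals. No boundedness in time of the `Ḣ²` norm is available yet. -/
theorem FlowData.exists_sum_enr_one_le (h : FlowData α ν b s a T' u S) (hα : 0 < α) (hs1 : 3 / 2 < s) (hs2 : s ≤ 2)
    {c : ℝ} (hc : c < T') : ∃ M : ℝ, 0 ≤ M ∧ ∀ t ∈ Icc a c, ∑ k, enr 1 (fun l x => S t x k l) ≤ M := by
  obtain ⟨M, hM⟩ := h.hs_le c hc
  obtain ⟨C, hC⟩ := exists_l1_sq_le hs1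
  obtain ⟨K, hK⟩ := exists_nm_one_stress_le hα hs1 hs2
  set B : ℝ≥0∞ := K * (C * M * M + M * M + ENNReal.ofReal b ^ 2 * (M + M)) with hB
  have hBt : B ≠ ⊤ := by finiteness
  refine ⟨9 * B.toReal, by positivity, fun t ht => sum_enr_le
    (hpow_one_of_two fun k l => h.hpow_stress hα hs1 ⟨ht.1, ht.2.trans_lt hc⟩ k l) ENNReal.toReal_nonneg fun k l => ?_⟩
  have ht' : t ∈ Ico a T' := ⟨ht.1, ht.2.trans_lt hc⟩
  obtain ⟨v, Q, R, hv, e⟩ := h.vdat t ht'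
  have h0 := (en_zero_le_hs (by linarith : 0 ≤ s) _).trans (hM t ht)
  have h1 := (en_one_le_hs (by linarith : 1 ≤ s) _).trans (hM t ht)
  rw [e, ENNReal.ofReal_toReal hBt]
  refine (hK b _ v Q R (h.divFree t ht').hpow hv k l).trans ?_
  have h2 := (hC (comp (u t))).trans (mul_le_mul' le_rfl (hM t ht))
  have h3 := hM t ht
  rw [hB]
  gcongr

theorem FlowData.exists_en_le (h : FlowData α ν b s a T' u S) (hs1 : 3 / 2 < s) {c : ℝ} (hc : c < T') :
    ∃ M : ℝ, 0 ≤ M ∧ ∀ t ∈ Icc a c, enr 0 (comp (u t)) ≤ M ∧ enr 1 (comp (u t)) ≤ M := by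
  obtain ⟨M, hM⟩ := h.hs_le c hc
  refine ⟨M, M.2, fun t ht => ?_⟩
  have ht' : t ∈ Ico a T' := ⟨ht.1, ht.2.trans_lt hc⟩
  have h0 := (en_zero_le_hs (by linarith : 0 ≤ s) _).trans (hM t ht)
  have h1 := (en_one_le_hs (by linarith : 1 ≤ s) _).trans (hM t ht)
  rw [← ofReal_enr (h.hpow (by norm_num) ht'), ← ENNReal.ofReal_coe_nnreal] at h0 h1
  exact ⟨(ENNReal.ofReal_le_ofReal_iff M.2).1 h0, (ENNReal.ofReal_le_ofReal_iff M.2).1 h1⟩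

theorem cutW_succ (m n : ℕ) : (fun ξ => ‖ξ‖ * cutW m n ξ) = cutW (m + 1) n := by
  funext ξ; rw [cutW, cutW]; ring

theorem eLpNorm_rft_sq_le {f : Fin 3 → E3 → ℝ} (i : Fin 3) : eLpNorm (rft (f i)) 2 volume ^ 2 ≤ en 0 f := by
  refine le_trans (le_of_eq ?_) (nm_le_en 0 f i)
  rw [eLpNorm_two_sq, nm, nsq]
  simp

/-- The cut off energies satisfy their energy identities. -/
theorem FlowData.hasDerivWithinAt (h : FlowData α ν b s a T' u S) (hα : 0 < α) (hs1 : 3 / 2 < s) (hs2 : s ≤ 2)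
    {c : ℝ} (hc : c < T') (m n : ℕ) {t : ℝ} (ht : t ∈ Icc a c) :
    HasDerivWithinAt (fun r => engy (cutW m n) (comp (u r)))
      (-(8 * Real.pi ^ 2 * ν) * engy (cutW (m + 1) n) (comp (u t))
        - 2 * pairG (cutW m n) (comp (u t)) fun k l x => S t x k l) (Icc a c) t := by
  have hI : ∀ r ∈ Icc a c, r ∈ Ico a T' := fun r hr => ⟨hr.1, hr.2.trans_lt hc⟩
  obtain ⟨M0, hM0⟩ := h.hs_le c hc
  obtain ⟨M1, hM1, hM1'⟩ := h.exists_sum_enr_one_le hα hs1 hs2 hc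
  -- A cheap substitute for the square root; only finiteness of the uniform bound matters.
  have hle : ∀ {x : ℝ≥0∞} {y : ℝ≥0}, x ^ 2 ≤ y → x ≤ ((1 + y : ℝ≥0) : ℝ≥0∞) := fun {x y} hxy => by
    by_contra hcon
    push Not at hcon
    have h1 : ((1 + y : ℝ≥0) : ℝ≥0∞) ^ 2 ≤ x ^ 2 := by gcongr
    have h2 := h1.trans hxy
    norm_cast at h2
    rw [← NNReal.coe_le_coe] at h2
    push_cast at h2
    nlinarith [y.2]
  have hMM : ∀ {x y : ℝ≥0}, x ≤ y → ((1 + x : ℝ≥0) : ℝ≥0∞) ≤ ((1 + y : ℝ≥0) : ℝ≥0∞) := fun hxy => by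
    exact_mod_cast add_le_add_right hxy 1
  have hS2 := fun r hr k l => h.hpow_stress hα hs1 (hI r hr) k l
  rw [← cutW_succ]
  refine hasDerivWithinAt_engy h.flow h.pos hc h.memLp (fun r hr k l => (hS2 r hr k l).1)
    (fun r hr => (h.divFree r (hI r hr)).div) (M := 1 + (M0 + M1.toNNReal)) (fun r hr i => ?_) (fun r hr k i => ?_)
    (cutWeight_cutW m n) ht
  · exact (hle ((eLpNorm_rft_sq_le i).trans ((en_zero_le_hs (by linarith : 0 ≤ s) _).trans (hM0 r hr)))).trans
      (hMM le_self_add)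
  · refine (hle (y := M1.toNNReal) ?_).trans (hMM le_add_self)
    have h1 := hM1' r hr
    have h2 : nm 1 (fun x => S r x k i) ≤ ENNReal.ofReal (∑ k, enr 1 fun l x => S r x k l) := by
      refine (nm_le_en 1 (fun l x => S r x k l) i).trans ?_
      rw [← ofReal_enr fun l => (hS2 r hr k l).mono one_le_two]
      exact ENNReal.ofReal_le_ofReal (Finset.single_le_sum
        (f := fun k => enr 1 fun l x => S r x k l) (fun k _ => engy_nonneg _ _) (Finset.mem_univ k))
    refine le_trans (le_of_eq ?_) (h2.trans (ENNReal.ofReal_le_ofReal h1))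
    rw [eLpNorm_two_sq, nm, nsq]
    refine lintegral_congr fun ξ => ?_
    rw [enorm_mul, ← ofReal_norm ((‖ξ‖ : ℝ) : ℂ), Complex.norm_real, norm_norm, ofReal_norm, pow_one]

theorem FlowData.continuousOn (h : FlowData α ν b s a T' u S) (hα : 0 < α) (hs1 : 3 / 2 < s) (hs2 : s ≤ 2)
    {c : ℝ} (hc : c < T') (m n : ℕ) : ContinuousOn (fun r => engy (cutW m n) (comp (u r))) (Icc a c) :=
  fun _ ht => (h.hasDerivWithinAt hα hs1 hs2 hc m n ht).continuousWithinAt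

/-- The full energies are pointwise limits of the truncated ones, which are continuous in time. -/
theorem FlowData.aestronglyMeasurable (h : FlowData α ν b s a T' u S) (hα : 0 < α) (hs1 : 3 / 2 < s) (hs2 : s ≤ 2)
    {c : ℝ} (hc : c < T') {m : ℕ} (hm : m ≤ 3) :
    AEStronglyMeasurable (fun r => enr m (comp (u r))) (volume.restrict (Icc a c)) := by
  refine aestronglyMeasurable_of_tendsto_ae atTop
    (fun n => (h.continuousOn hα hs1 hs2 hc m n).aestronglyMeasurable measurableSet_Icc) ?_
  filter_upwards [ae_restrict_mem measurableSet_Icc] with t ht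
  exact tendsto_engy_cutW (h.hpow hm ⟨ht.1, ht.2.trans_lt hc⟩)

end MLANS

end

noncomputable section

namespace MLANS

open LineDeriv

/-! ### A priori bounds -/

variable {α ν b s a T' : ℝ} {u : ℝ → E3 → E3} {S : ℝ → E3 → Mat3}

theorem enr_nonneg (m : ℕ) (u : Fin 3 → E3 → ℝ) : 0 ≤ enr m u := engy_nonneg _ u

theorem FlowData.hasDerivAt (h : FlowData α ν b s a T' u S) (hα : 0 < α) (hs1 : 3 / 2 < s) (hs2 : s ≤ 2)
    (m n : ℕ) {t : ℝ} (ht : t ∈ Ioo a T') :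
    HasDerivAt (fun r => engy (cutW m n) (comp (u r)))
      (-(8 * Real.pi ^ 2 * ν) * engy (cutW (m + 1) n) (comp (u t))
        - 2 * pairG (cutW m n) (comp (u t)) fun k l x => S t x k l) t := by
  obtain ⟨c, hc1, hc2⟩ := exists_between ht.2
  exact (h.hasDerivWithinAt hα hs1 hs2 hc2 m n ⟨ht.1.le, hc1.le⟩).hasDerivAt (Icc_mem_nhds ht.1 hc1)

/-- Half of the dissipation absorbs the pairing and the other half stays on the left. No
cancellation is used, and the stress enters only through an integrable majorant. It is applied with
`m = 1` for preliminary integrability and with `m = 2` at the final level. -/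
theorem FlowData.engy_add_le (h : FlowData α ν b s a T' u S) (hα : 0 < α) (hν : 0 < ν) (hs1 : 3 / 2 < s) (hs2 : s ≤ 2)
    {m : ℕ} (hm : m ≤ 2) (n : ℕ) {r t : ℝ} (har : a ≤ r) (hrt : r ≤ t) (ht : t < T') {φ : ℝ → ℝ}
    (hφ : IntegrableOn φ (Icc r t) volume) (hS : ∀ τ ∈ Icc r t, ∑ k, enr m (fun l x => S τ x k l) ≤ φ τ) :
    engy (cutW m n) (comp (u t)) + 4 * Real.pi ^ 2 * ν * (∫ τ in r..t, engy (cutW (m + 1) n) (comp (u τ)))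
      ≤ engy (cutW m n) (comp (u r)) + 3 / ν * ∫ τ in r..t, φ τ := by
  have hsub : Icc r t ⊆ Icc a t := Icc_subset_Icc_left har
  have hY : IntegrableOn (fun τ => engy (cutW (m + 1) n) (comp (u τ))) (Icc r t) volume :=
    ((h.continuousOn hα hs1 hs2 ht (m + 1) n).mono hsub).integrableOn_Icc
  have key := intervalIntegral.sub_le_integral_of_hasDeriv_right_of_le (g := fun r => engy (cutW m n) (comp (u r)))
    (φ := fun τ => -(4 * Real.pi ^ 2 * ν) * engy (cutW (m + 1) n) (comp (u τ)) + 3 / ν * φ τ) hrt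
    ((h.continuousOn hα hs1 hs2 ht m n).mono hsub)
    (fun τ hτ => (h.hasDerivAt hα hs1 hs2 m n ⟨har.trans_lt hτ.1, hτ.2.trans ht⟩).hasDerivWithinAt)
    ((hY.const_mul (-(4 * Real.pi ^ 2 * ν))).fun_add (hφ.const_mul (3 / ν))) fun τ hτ => ?_
  · have i1 : IntervalIntegrable (fun τ => engy (cutW (m + 1) n) (comp (u τ))) volume r t :=
      (intervalIntegrable_iff_integrableOn_Icc_of_le hrt).2 hY
    have i2 : IntervalIntegrable φ volume r t := (intervalIntegrable_iff_integrableOn_Icc_of_le hrt).2 hφ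
    rw [intervalIntegral.integral_add (i1.const_mul _) (i2.const_mul _), intervalIntegral.integral_const_mul,
      intervalIntegral.integral_const_mul] at key
    linarith
  · have hτ' : τ ∈ Ico a T' := ⟨har.trans hτ.1.le, hτ.2.trans ht⟩
    -- With this `ε` the doubled pairing costs `4π²ν` times the higher energy, half of the available
    -- `8π²ν`, and leaves `3/ν` in front of the stress.
    have h1 := abs_pairG_cutW_le (m := m) (m' := m + 1) (m'' := m) (by ring) n
      (ε := 2 * Real.pi ^ 2 * ν / 3) (by positivity) (u := comp (u τ)) (S := fun k l x => S τ x k l)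
      fun k l => (h.hpow_stress hα hs1 hτ' k l).mono hm
    have h2 := (abs_le.1 h1).1
    have h3 := hS τ ⟨hτ.1.le, hτ.2.le⟩
    have e : Real.pi ^ 2 / (2 * Real.pi ^ 2 * ν / 3) = 3 / ν / 2 := by
      have := Real.pi_pos.ne'
      field_simp
    rw [e] at h2
    have h4 := mul_le_mul_of_nonneg_left h3 (by positivity : 0 ≤ 3 / ν)
    have h5 : 3 * (2 * Real.pi ^ 2 * ν / 3) = 2 * Real.pi ^ 2 * ν := by ring
    rw [h5] at h2
    linarith

/-- At the `Ḣ¹` level the stress is bounded on compact intervals, so the truncated dissipation is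
bounded uniformly in the cutoff; Fatou removes the cutoff. The bound may blow up as `c` tends to
`T'`. It only justifies the limit in the energy inequality below. -/
theorem FlowData.integrableOn_enr_two (h : FlowData α ν b s a T' u S) (hα : 0 < α) (hν : 0 < ν) (hs1 : 3 / 2 < s)
    (hs2 : s ≤ 2) {c : ℝ} (hc : c < T') : IntegrableOn (fun t => enr 2 (comp (u t))) (Icc a c) volume := by
  rcases lt_or_ge c a with hca | hac
  · simp [Icc_eq_empty (not_le.2 hca)]
  obtain ⟨M, hM0, hM⟩ := h.exists_sum_enr_one_le hα hs1 hs2 hc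
  have hI : ∀ t ∈ Icc a c, t ∈ Ico a T' := fun t ht => ⟨ht.1, ht.2.trans_lt hc⟩
  have hcont := fun n => h.continuousOn hα hs1 hs2 hc 2 n
  have key : ∀ n, ∫⁻ t in Icc a c, ENNReal.ofReal (engy (cutW 2 n) (comp (u t)))
      ≤ ENNReal.ofReal ((enr 1 (comp (u a)) + 3 / ν * ((c - a) * M)) / (4 * Real.pi ^ 2 * ν)) := fun n => by
    rw [← ofReal_integral_eq_lintegral_ofReal (hcont n).integrableOn_Icc (Eventually.of_forall fun t => engy_nonneg _ _),
      integral_Icc_eq_integral_Ioc, ← intervalIntegral.integral_of_le hac]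
    refine ENNReal.ofReal_le_ofReal ?_
    rw [le_div_iff₀ (by positivity)]
    have h1 := h.engy_add_le hα hν hs1 hs2 one_le_two n le_rfl hac hc (φ := fun _ => M) (by simp) hM
    rw [intervalIntegral.integral_const, smul_eq_mul] at h1
    have h2 := engy_cutW_le (h.hpow (m := 1) (by norm_num) (hI a ⟨le_rfl, hac⟩)) n
    have h3 := engy_nonneg (cutW 1 n) (comp (u c))
    linarith
  refine ⟨h.aestronglyMeasurable hα hs1 hs2 hc (by norm_num), ?_⟩
  rw [hasFiniteIntegral_iff_ofReal (Eventually.of_forall fun t => enr_nonneg 2 _)]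
  calc _ = ∫⁻ t in Icc a c, liminf (fun n => ENNReal.ofReal (engy (cutW 2 n) (comp (u t)))) atTop :=
        setLIntegral_congr_fun measurableSet_Icc fun t ht =>
          (((ENNReal.continuous_ofReal.tendsto _).comp
            (tendsto_engy_cutW (h.hpow (by norm_num) (hI t ht)))).liminf_eq).symm
    _ ≤ liminf (fun n => ∫⁻ t in Icc a c, ENNReal.ofReal (engy (cutW 2 n) (comp (u t)))) atTop :=
        lintegral_liminf_le' fun n => ((hcont n).aestronglyMeasurable measurableSet_Icc).aemeasurable.ennreal_ofReal
    _ ≤ _ := liminf_le_of_frequently_le' (Frequently.of_forall key)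
    _ < ⊤ := ENNReal.ofReal_lt_top

theorem FlowData.integrableOn_enr (h : FlowData α ν b s a T' u S) (hα : 0 < α) (hs1 : 3 / 2 < s)
    (hs2 : s ≤ 2) {c : ℝ} (hc : c < T') {m : ℕ} (hm : m ≤ 1) :
    IntegrableOn (fun t => enr m (comp (u t))) (Icc a c) volume := by
  obtain ⟨M, hM0, hM⟩ := h.exists_en_le hs1 hc
  refine Integrable.of_bound (h.aestronglyMeasurable hα hs1 hs2 hc (m := m) (by omega)) M ?_
  filter_upwards [ae_restrict_mem measurableSet_Icc] with t ht
  rw [Real.norm_of_nonneg (enr_nonneg _ _)]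
  interval_cases m
  · exact (hM t ht).1
  · exact (hM t ht).2

/-- The energy inequality for the `H¹` energy adapted to the filtered equation. -/
theorem FlowData.exists_energy_le (h : FlowData α ν b s a T' u S) (hα : 0 < α) (hν : 0 < ν) (hs1 : 3 / 2 < s)
    (hs2 : s ≤ 2) : ∃ C : ℝ, 0 ≤ C ∧ ∀ r t, a ≤ r → r ≤ t → t < T' →
      (enr 0 (comp (u t)) + 4 * Real.pi ^ 2 * α ^ 2 * enr 1 (comp (u t)))
        + 16 * Real.pi ^ 4 * ν * α ^ 2 * (∫ τ in r..t, enr 2 (comp (u τ)))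
      ≤ (enr 0 (comp (u r)) + 4 * Real.pi ^ 2 * α ^ 2 * enr 1 (comp (u r)))
        + C * ∫ τ in r..t, (enr 0 (comp (u τ)) + 4 * Real.pi ^ 2 * α ^ 2 * enr 1 (comp (u τ))) := by
  set κ := 4 * Real.pi ^ 2 * α ^ 2 with hκ
  have hκ0 : 0 < κ := by positivity
  -- The pairing enters doubled, so this `δ` uses half of the dissipation `8π²νκ` of the Laplacian.
  obtain ⟨C, hC0, hC⟩ := exists_pairing_le hα b (δ := 2 * Real.pi ^ 2 * ν * κ) (by positivity)
  refine ⟨2 * C, by positivity, fun r t har hrt htT => ?_⟩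
  have hsub : Icc r t ⊆ Icc a t := Icc_subset_Icc_left har
  have hI : ∀ τ ∈ Icc r t, τ ∈ Ico a T' := fun τ hτ => ⟨har.trans hτ.1, hτ.2.trans_lt htT⟩
  obtain ⟨M, hM0, hM⟩ := h.exists_sum_enr_one_le hα hs1 hs2 htT
  have J : ∀ {m}, m ≤ 1 → IntervalIntegrable (fun τ => enr m (comp (u τ))) volume r t := fun hm =>
    (intervalIntegrable_iff_integrableOn_Icc_of_le hrt).2 ((h.integrableOn_enr hα hs1 hs2 htT hm).mono_set hsub)
  have J2 : IntervalIntegrable (fun τ => enr 2 (comp (u τ))) volume r t :=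
    (intervalIntegrable_iff_integrableOn_Icc_of_le hrt).2 ((h.integrableOn_enr_two hα hν hs1 hs2 htT).mono_set hsub)
  set E : ℕ → ℝ → ℝ := fun n τ => engy (cutW 0 n) (comp (u τ)) + κ * engy (cutW 1 n) (comp (u τ)) with hE
  set D : ℕ → ℝ → ℝ := fun n τ => (-(8 * Real.pi ^ 2 * ν) * engy (cutW 1 n) (comp (u τ))
      - 2 * pairG (cutW 0 n) (comp (u τ)) fun k l x => S τ x k l)
    + κ * (-(8 * Real.pi ^ 2 * ν) * engy (cutW 2 n) (comp (u τ))
      - 2 * pairG (cutW 1 n) (comp (u τ)) fun k l x => S τ x k l) with hD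
  -- The cancellation holds only without cutoff. The integrated identity is therefore passed to the
  -- limit `n → ∞` first, and its right-hand side `L` is estimated afterwards.
  set L : ℝ → ℝ := fun τ => (-(8 * Real.pi ^ 2 * ν) * enr 1 (comp (u τ))
      - 2 * pairG (fun ξ => ‖ξ‖ ^ 0) (comp (u τ)) fun k l x => S τ x k l)
    + κ * (-(8 * Real.pi ^ 2 * ν) * enr 2 (comp (u τ))
      - 2 * pairG (fun ξ => ‖ξ‖ ^ 1) (comp (u τ)) fun k l x => S τ x k l) with hL
  -- A majorant independent of `n`, from Young's inequality with `ε = 1`. Its integrability uses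
  -- `FlowData.integrableOn_enr_two`.
  set B : ℝ → ℝ := fun τ => 6 * enr 0 (comp (u τ)) + 8 * Real.pi ^ 2 * ν * enr 1 (comp (u τ))
    + κ * (6 + 8 * Real.pi ^ 2 * ν) * enr 2 (comp (u τ)) + (1 + κ) * (2 * Real.pi ^ 2 * M) with hB
  have hBi : IntervalIntegrable B volume r t :=
    ((((J zero_le_one).const_mul 6).add ((J le_rfl).const_mul (8 * Real.pi ^ 2 * ν))).add
      (J2.const_mul (κ * (6 + 8 * Real.pi ^ 2 * ν)))).add intervalIntegrable_const
  have hder : ∀ n, ∀ τ ∈ Ioo r t, HasDerivAt (E n) (D n τ) τ := fun n τ hτ => by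
    have hτ' : τ ∈ Ioo a T' := ⟨har.trans_lt hτ.1, hτ.2.trans htT⟩
    exact (h.hasDerivAt hα hs1 hs2 0 n hτ').add ((h.hasDerivAt hα hs1 hs2 1 n hτ').const_mul κ)
  have hDB : ∀ n, ∀ τ ∈ Icc r t, |D n τ| ≤ B τ := fun n τ hτ => by
    have hS1 := hpow_one_of_two fun k l => h.hpow_stress hα hs1 (hI τ hτ) k l
    have p0 := abs_pairG_cutW_le (m := 0) (m' := 0) (m'' := 1) rfl n one_pos (u := comp (u τ)) hS1
    have p1 := abs_pairG_cutW_le (m := 1) (m' := 2) (m'' := 1) rfl n one_pos (u := comp (u τ)) hS1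
    have e0 := engy_cutW_le (h.hpow (m := 0) (by norm_num) (hI τ hτ)) n
    have e1 := engy_cutW_le (h.hpow (m := 1) (by norm_num) (hI τ hτ)) n
    have e2 := engy_cutW_le (h.hpow (m := 2) (by norm_num) (hI τ hτ)) n
    have hM' := mul_le_mul_of_nonneg_left (hM τ (hsub hτ)) (sq_nonneg Real.pi)
    rw [div_one] at p0 p1
    have q0 : |-(8 * Real.pi ^ 2 * ν) * engy (cutW 1 n) (comp (u τ))
        - 2 * pairG (cutW 0 n) (comp (u τ)) fun k l x => S τ x k l|
        ≤ 6 * enr 0 (comp (u τ)) + 8 * Real.pi ^ 2 * ν * enr 1 (comp (u τ)) + 2 * Real.pi ^ 2 * M := by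
      refine (abs_sub _ _).trans ?_
      rw [abs_mul, abs_mul, abs_neg, abs_of_nonneg (engy_nonneg _ _), abs_two,
        abs_of_pos (by positivity : 0 < 8 * Real.pi ^ 2 * ν)]
      have := mul_le_mul_of_nonneg_left e1 (by positivity : 0 ≤ 8 * Real.pi ^ 2 * ν)
      linarith
    have q1 : |-(8 * Real.pi ^ 2 * ν) * engy (cutW 2 n) (comp (u τ))
        - 2 * pairG (cutW 1 n) (comp (u τ)) fun k l x => S τ x k l|
        ≤ (6 + 8 * Real.pi ^ 2 * ν) * enr 2 (comp (u τ)) + 2 * Real.pi ^ 2 * M := by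
      refine (abs_sub _ _).trans ?_
      rw [abs_mul, abs_mul, abs_neg, abs_of_nonneg (engy_nonneg _ _), abs_two,
        abs_of_pos (by positivity : 0 < 8 * Real.pi ^ 2 * ν)]
      have := mul_le_mul_of_nonneg_left e2 (by positivity : 0 ≤ 8 * Real.pi ^ 2 * ν)
      linarith
    refine (abs_add_le _ _).trans ?_
    rw [abs_mul, abs_of_pos hκ0]
    have := mul_le_mul_of_nonneg_left q1 hκ0.le
    rw [hB]
    linarith
  -- Nothing is known directly about measurability of the stress in time; `D n` is measurable
  -- because it is a derivative.
  have hDm : ∀ n, AEStronglyMeasurable (D n) (volume.restrict (uIoc r t)) := fun n => by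
    rw [uIoc_of_le hrt, ← Measure.restrict_congr_set Ioo_ae_eq_Ioc]
    refine (measurable_deriv (E n)).aestronglyMeasurable.congr ?_
    filter_upwards [ae_restrict_mem measurableSet_Ioo] with τ hτ
    exact (hder n τ hτ).deriv
  have hIcc : ∀ τ ∈ uIoc r t, τ ∈ Icc r t := fun τ hτ => by
    rw [uIoc_of_le hrt] at hτ; exact ⟨hτ.1.le, hτ.2⟩
  have hDi : ∀ n, IntervalIntegrable (D n) volume r t := fun n => hBi.mono_fun' (hDm n) (by
    filter_upwards [ae_restrict_mem measurableSet_uIoc] with τ hτ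
    exact hDB n τ (hIcc τ hτ))
  have ftc : ∀ n, ∫ τ in r..t, D n τ = E n t - E n r := fun n =>
    intervalIntegral.integral_eq_sub_of_hasDerivAt_of_le hrt (((h.continuousOn hα hs1 hs2 htT 0 n).add
      ((h.continuousOn hα hs1 hs2 htT 1 n).const_mul κ)).mono hsub) (hder n) (hDi n)
  have hlimD : ∀ τ ∈ Icc r t, Tendsto (fun n => D n τ) atTop (𝓝 (L τ)) := fun τ hτ => by
    have hS1 := hpow_one_of_two fun k l => h.hpow_stress hα hs1 (hI τ hτ) k l
    have H := fun {m} (hm : m ≤ 3) => h.hpow hm (hI τ hτ)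
    exact (((tendsto_engy_cutW (H (m := 1) (by norm_num))).const_mul _).sub
      ((tendsto_pairG_cutW (m := 0) (m' := 0) (m'' := 1) rfl (H (by norm_num)) hS1).const_mul 2)).add
      ((((tendsto_engy_cutW (H (m := 2) (by norm_num))).const_mul _).sub
      ((tendsto_pairG_cutW (m := 1) (m' := 2) (m'' := 1) rfl (H (by norm_num)) hS1).const_mul 2)).const_mul κ)
  have hlimE : ∀ τ ∈ Icc r t, Tendsto (fun n => E n τ) atTop
      (𝓝 (enr 0 (comp (u τ)) + κ * enr 1 (comp (u τ)))) := fun τ hτ =>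
    (tendsto_engy_cutW (h.hpow (by norm_num) (hI τ hτ))).add
      ((tendsto_engy_cutW (h.hpow (by norm_num) (hI τ hτ))).const_mul κ)
  have hlim := intervalIntegral.tendsto_integral_filter_of_dominated_convergence (l := atTop) (F := D) (f := L)
    (a := r) (b := t) B (Eventually.of_forall hDm)
    (Eventually.of_forall fun n => Eventually.of_forall fun τ hτ => hDB n τ (hIcc τ hτ)) hBi
    (Eventually.of_forall fun τ hτ => hlimD τ (hIcc τ hτ))
  simp only [ftc] at hlim
  have hEq := tendsto_nhds_unique hlim ((hlimE t ⟨hrt, le_rfl⟩).sub (hlimE r ⟨le_rfl, hrt⟩))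
  have hLm : AEStronglyMeasurable L (volume.restrict (uIoc r t)) := by
    refine aestronglyMeasurable_of_tendsto_ae atTop hDm ?_
    filter_upwards [ae_restrict_mem measurableSet_uIoc] with τ hτ
    exact hlimD τ (hIcc τ hτ)
  have hLi : IntervalIntegrable L volume r t := hBi.mono_fun' hLm (by
    filter_upwards [ae_restrict_mem measurableSet_uIoc] with τ hτ
    exact le_of_tendsto (hlimD τ (hIcc τ hτ)).norm (Eventually.of_forall fun n => hDB n τ (hIcc τ hτ)))
  have hFi : IntervalIntegrable (fun τ => enr 0 (comp (u τ)) + κ * enr 1 (comp (u τ))) volume r t :=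
    (J zero_le_one).add ((J le_rfl).const_mul κ)
  have hLle := intervalIntegral.integral_mono_on hrt hLi
    ((hFi.const_mul (2 * C)).sub (J2.const_mul (4 * Real.pi ^ 2 * ν * κ))) fun τ hτ => by
      obtain ⟨v, Q, R, hv, e⟩ := h.vdat τ (hI τ hτ)
      have e' : (fun k l x => S τ x k l) = stress α (comp (u τ)) v Q := by
        funext k l; exact e k l
      have hS1 := hpow_one_of_two fun k l => h.hpow_stress hα hs1 (hI τ hτ) k l
      have hP := hC _ v Q R (h.divFree τ (hI τ hτ)) hv fun k l => by rw [← e]; exact hS1 k l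
      have hP' := (abs_le.1 hP).1
      have e1 : 0 ≤ 8 * Real.pi ^ 2 * ν * enr 1 (comp (u τ)) := mul_nonneg (by positivity) (engy_nonneg _ _)
      simp only [hL, e']
      linarith
  rw [intervalIntegral.integral_sub (hFi.const_mul _) (J2.const_mul _), intervalIntegral.integral_const_mul,
    intervalIntegral.integral_const_mul, hEq] at hLle
  have : 4 * Real.pi ^ 2 * ν * κ = 16 * Real.pi ^ 4 * ν * α ^ 2 := by rw [hκ]; ring
  rw [this] at hLle
  linarith

end MLANS

end

noncomputable section

namespace MLANS

open LineDeriv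

/-! ### Global bounds -/

theorem ofReal_intervalIntegral {g : ℝ → ℝ} {r t : ℝ} (hrt : r ≤ t) (hg : IntegrableOn g (Icc r t) volume)
    (h0 : ∀ x, 0 ≤ g x) : ENNReal.ofReal (∫ x in r..t, g x) = ∫⁻ x in Ioc r t, ENNReal.ofReal (g x) := by
  rw [intervalIntegral.integral_of_le hrt, ofReal_integral_eq_lintegral_ofReal (hg.mono_set Ioc_subset_Icc_self)
    (Eventually.of_forall h0)]

theorem setLIntegral_Ico_le {f : ℝ → ℝ≥0∞} {a T' : ℝ} {B : ℝ≥0∞} (h : ∀ c < T', ∫⁻ x in Ioc a c, f x ≤ B) :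
    ∫⁻ x in Ico a T', f x ≤ B := by
  have hsub : Ioo a T' ⊆ ⋃ n : ℕ, Ioc a (T' - 1 / (n + 1)) := fun x hx => by
    obtain ⟨n, hn⟩ := exists_nat_one_div_lt (sub_pos.2 hx.2)
    exact mem_iUnion.2 ⟨n, hx.1, by linarith⟩
  rw [setLIntegral_congr Ioo_ae_eq_Ico.symm]
  refine (lintegral_mono_set hsub).trans ?_
  rw [setLIntegral_iUnion_of_directed]
  · exact iSup_le fun n => h _ (by have : (0 : ℝ) < 1 / (n + 1) := by positivity
                                   linarith)
  · refine directed_of_isDirected_le fun m n hmn => Ioc_subset_Ioc_right ?_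
    have : (m : ℝ) ≤ n := by exact_mod_cast hmn
    gcongr

variable {α ν b s a T' : ℝ} {u : ℝ → E3 → E3} {S : ℝ → E3 → Mat3}

/-- Gronwall with a constant coefficient on a finite interval, dropping the dissipation. The bound
is then put back into the energy inequality, which controls the dissipation uniformly up to `T'`. -/
theorem FlowData.exists_enr_bound (h : FlowData α ν b s a T' u S) (haT : a < T') (hα : 0 < α) (hν : 0 < ν)
    (hs1 : 3 / 2 < s) (hs2 : s ≤ 2) :
    (∃ M : ℝ, 0 ≤ M ∧ ∀ t ∈ Ico a T', enr 0 (comp (u t)) ≤ M ∧ enr 1 (comp (u t)) ≤ M) ∧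
      ∫⁻ t in Ico a T', ENNReal.ofReal (enr 2 (comp (u t))) < ⊤ := by
  obtain ⟨C, hC0, hC⟩ := h.exists_energy_le hα hν hs1 hs2
  set κ := 4 * Real.pi ^ 2 * α ^ 2 with hκ
  have hκ0 : 0 < κ := by positivity
  set F : ℝ → ℝ := fun t => enr 0 (comp (u t)) + κ * enr 1 (comp (u t)) with hF
  have hF0 : ∀ t, 0 ≤ F t := fun t => add_nonneg (enr_nonneg _ _) (mul_nonneg hκ0.le (enr_nonneg _ _))
  have hFi : ∀ c < T', IntegrableOn F (Icc a c) volume := fun c hc =>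
    (h.integrableOn_enr hα hs1 hs2 hc zero_le_one).fun_add ((h.integrableOn_enr hα hs1 hs2 hc le_rfl).const_mul κ)
  have hY0 : ∀ r t, r ≤ t → 0 ≤ 16 * Real.pi ^ 4 * ν * α ^ 2 * ∫ τ in r..t, enr 2 (comp (u τ)) := fun r t hrt =>
    mul_nonneg (by positivity) (intervalIntegral.integral_nonneg hrt fun τ _ => enr_nonneg _ _)
  obtain ⟨N, hN⟩ := exists_bound_of_le_add_lintegral (f := fun t => ENNReal.ofReal (F t))
    (k := fun _ => ENNReal.ofReal C) haT (fun c hc => by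
      obtain ⟨M, hM0, hM⟩ := h.exists_en_le hs1 hc
      refine ⟨(M + κ * M).toNNReal, fun t ht => ENNReal.ofReal_le_ofReal ?_⟩
      have := mul_le_mul_of_nonneg_left (hM t ht).2 hκ0.le
      exact add_le_add (hM t ht).1 this)
    (by rw [setLIntegral_const]; exact ENNReal.mul_ne_top (by simp) (by simp))
    fun r t har hrt ht => by
      have h1 := hC r t har hrt ht
      have h2 := hY0 r t hrt
      have hi := (hFi t ht).mono_set (Icc_subset_Icc_left har)
      rw [← lintegral_congr fun τ => ENNReal.ofReal_mul (q := F τ) hC0,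
        ← ofReal_intervalIntegral hrt (hi.const_mul C) fun τ => mul_nonneg hC0 (hF0 τ),
        intervalIntegral.integral_const_mul, ← ENNReal.ofReal_add (hF0 r)
          (mul_nonneg hC0 (intervalIntegral.integral_nonneg hrt fun τ _ => hF0 τ))]
      exact ENNReal.ofReal_le_ofReal (by linarith)
  have hN' : ∀ t ∈ Ico a T', F t ≤ N := fun t ht => by
    have := hN t ht
    rwa [ENNReal.ofReal_le_iff_le_toReal (by simp), ENNReal.coe_toReal] at this
  constructor
  · refine ⟨N + N / κ, by positivity, fun t ht => ?_⟩
    have h1 := hN' t ht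
    have e0 := enr_nonneg 0 (comp (u t))
    have e1 := mul_nonneg hκ0.le (enr_nonneg 1 (comp (u t)))
    have h2 : enr 1 (comp (u t)) ≤ N / κ := by
      rw [le_div_iff₀ hκ0]; linarith
    have h3 : (0 : ℝ) ≤ N / κ := by positivity
    exact ⟨by linarith, by linarith [N.2]⟩
  · refine lt_of_le_of_lt (setLIntegral_Ico_le (B := ENNReal.ofReal
      ((F a + C * (N * (T' - a))) / (16 * Real.pi ^ 4 * ν * α ^ 2))) fun c hc => ?_) ENNReal.ofReal_lt_top
    rcases lt_or_ge c a with hca | hac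
    · simp [Ioc_eq_empty (not_lt.2 hca.le)]
    rw [← ofReal_intervalIntegral hac (h.integrableOn_enr_two hα hν hs1 hs2 hc) fun τ => enr_nonneg _ _]
    refine ENNReal.ofReal_le_ofReal ?_
    rw [le_div_iff₀ (by positivity)]
    have h1 := hC a c le_rfl hac hc
    have h2 : ∫ τ in a..c, F τ ≤ ∫ _τ in a..c, (N : ℝ) := intervalIntegral.integral_mono_on hac
      ((intervalIntegrable_iff_integrableOn_Icc_of_le hac).2 (hFi c hc)) intervalIntegrable_const
      fun τ hτ => hN' τ ⟨hτ.1, hτ.2.trans_lt hc⟩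
    rw [intervalIntegral.integral_const, smul_eq_mul] at h2
    have h3 : (c - a) * (N : ℝ) ≤ N * (T' - a) := by nlinarith [N.2]
    have h4 := mul_le_mul_of_nonneg_left (h2.trans h3) hC0
    have h5 := hF0 c
    linarith

theorem FlowData.exists_sum_enr_two_le (h : FlowData α ν b s a T' u S) (hα : 0 < α) (hs1 : 3 / 2 < s) :
    ∃ K : ℝ, 0 ≤ K ∧ ∀ t ∈ Ico a T', ∀ Λ M : ℝ, 0 ≤ Λ → 0 ≤ M → l1 (comp (u t)) ^ 2 ≤ ENNReal.ofReal Λ →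
      enr 0 (comp (u t)) ≤ M → enr 1 (comp (u t)) ≤ M →
      ∑ k, enr 2 (fun l x => S t x k l)
        ≤ K * (Λ * enr 2 (comp (u t)) + b ^ 2 * (M + M + enr 2 (comp (u t)))) := by
  obtain ⟨K, hK⟩ := exists_nm_two_stress_le hα
  refine ⟨9 * K, by positivity, fun t ht Λ M hΛ hM hl h0 h1 => ?_⟩
  obtain ⟨v, Q, R, hv, e⟩ := h.vdat t ht
  have hY := enr_nonneg 2 (comp (u t))
  rw [mul_assoc]
  refine sum_enr_le (fun k l => h.hpow_stress hα hs1 ht k l) (by positivity) fun k l => ?_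
  rw [e]
  refine (hK b _ v Q R (h.divFree t ht).hpow hv k l).trans ?_
  rw [ENNReal.ofReal_mul K.coe_nonneg, ENNReal.ofReal_add (by positivity) (by positivity), ENNReal.ofReal_mul hΛ,
    ENNReal.ofReal_mul (sq_nonneg b), ENNReal.ofReal_add (by positivity) hY, ENNReal.ofReal_add hM hM,
    ofReal_enr (h.hpow (by norm_num) ht), ← ofReal_enr (h.hpow (m := 0) (by norm_num) ht),
    ← ofReal_enr (h.hpow (m := 1) (by norm_num) ht)]
  have hb : ENNReal.ofReal b ^ 2 ≤ ENNReal.ofReal (b ^ 2) := by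
    rw [← sq_abs, ENNReal.ofReal_pow (abs_nonneg b)]
    gcongr
    exact le_abs_self b
  have e' : ENNReal.ofReal (K : ℝ) = K := ENNReal.ofReal_coe_nnreal
  rw [← e']
  gcongr

theorem FlowData.enr_two_le (h : FlowData α ν b s a T' u S) (hα : 0 < α) (hν : 0 < ν) (hs1 : 3 / 2 < s) (hs2 : s ≤ 2)
    {r t : ℝ} (har : a ≤ r) (hrt : r ≤ t) (ht : t < T') {φ : ℝ → ℝ} (hφ : IntegrableOn φ (Icc r t) volume)
    (hS : ∀ τ ∈ Icc r t, ∑ k, enr 2 (fun l x => S τ x k l) ≤ φ τ) :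
    enr 2 (comp (u t)) ≤ enr 2 (comp (u r)) + 3 / ν * ∫ τ in r..t, φ τ := by
  refine le_of_tendsto_of_tendsto (tendsto_engy_cutW (h.hpow (by norm_num) ⟨har.trans hrt, ht⟩))
    ((tendsto_engy_cutW (h.hpow (by norm_num) ⟨har, hrt.trans_lt ht⟩)).add_const _) (Eventually.of_forall fun n => ?_)
  have h1 := h.engy_add_le hα hν hs1 hs2 le_rfl n har hrt ht hφ hS
  have h2 : 0 ≤ 4 * Real.pi ^ 2 * ν * ∫ τ in r..t, engy (cutW (2 + 1) n) (comp (u τ)) :=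
    mul_nonneg (by positivity) (intervalIntegral.integral_nonneg hrt fun τ _ => engy_nonneg _ _)
  simp only
  linarith

/-- The local boundedness that the Gronwall lemma presupposes. On a compact interval the `L¹` norm
of the transform is bounded by the solution class, so the right-hand side is linear in the `Ḣ²`
energy and integrable. -/
theorem FlowData.exists_enr_two_le_Icc (h : FlowData α ν b s a T' u S) (hα : 0 < α) (hν : 0 < ν)
    (hs1 : 3 / 2 < s) (hs2 : s ≤ 2) {c : ℝ} (hc : c < T') :
    ∃ M : ℝ, 0 ≤ M ∧ ∀ t ∈ Icc a c, enr 2 (comp (u t)) ≤ M := by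
  obtain ⟨N, hN⟩ := h.hs_le c hc
  obtain ⟨M, hM0, hM⟩ := h.exists_en_le hs1 hc
  obtain ⟨C, hC⟩ := exists_l1_sq_le hs1
  obtain ⟨K, hK0, hK⟩ := h.exists_sum_enr_two_le hα hs1
  set φ : ℝ → ℝ := fun τ => K * (C * N * enr 2 (comp (u τ)) + b ^ 2 * (M + M + enr 2 (comp (u τ)))) with hφ
  have hφ0 : ∀ τ, 0 ≤ φ τ := fun τ => by
    have := enr_nonneg 2 (comp (u τ))
    positivity
  have hY := h.integrableOn_enr_two hα hν hs1 hs2 hc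
  have hφi : IntegrableOn φ (Icc a c) volume :=
    ((hY.const_mul (C * N : ℝ)).fun_add (((integrable_const (M + M)).fun_add hY).const_mul (b ^ 2))).const_mul K
  refine ⟨enr 2 (comp (u a)) + 3 / ν * ∫ τ in Icc a c, φ τ, add_nonneg (enr_nonneg _ _)
    (mul_nonneg (by positivity) (integral_nonneg hφ0)), fun t ht => ?_⟩
  have hsub : Icc a t ⊆ Icc a c := Icc_subset_Icc_right ht.2
  refine (h.enr_two_le hα hν hs1 hs2 le_rfl ht.1 (ht.2.trans_lt hc) (hφi.mono_set hsub) fun τ hτ => ?_).trans ?_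
  · have hτ' := hsub hτ
    refine hK τ ⟨hτ'.1, hτ'.2.trans_lt hc⟩ (C * N) M (by positivity) hM0 ?_ (hM τ hτ').1 (hM τ hτ').2
    refine (hC _).trans ((mul_le_mul' le_rfl (hN τ hτ')).trans (le_of_eq ?_))
    rw [ENNReal.ofReal_mul C.coe_nonneg, ENNReal.ofReal_coe_nnreal, ENNReal.ofReal_coe_nnreal]
  · gcongr
    rw [intervalIntegral.integral_of_le ht.1]
    exact setIntegral_mono_set hφi (Eventually.of_forall hφ0) (Ioc_subset_Icc_self.trans hsub).eventuallyLE

/-- The inequality is quadratic in `1 + y`, but one factor is read as a coefficient. The first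
energy level makes it integrable up to `T'`, and Gronwall for a linear inequality applies. -/
theorem FlowData.exists_enr_two_le (h : FlowData α ν b s a T' u S) (haT : a < T') (hα : 0 < α) (hν : 0 < ν)
    (hs1 : 3 / 2 < s) (hs2 : s ≤ 2) : ∃ M : ℝ≥0, ∀ t ∈ Ico a T', en 2 (comp (u t)) ≤ M := by
  obtain ⟨⟨M, hM0, hM⟩, hYi⟩ := h.exists_enr_bound haT hα hν hs1 hs2
  obtain ⟨C, hC⟩ := exists_l1_sq_le (s := 2) (by norm_num)
  obtain ⟨K, hK0, hK⟩ := h.exists_sum_enr_two_le hα hs1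
  set y : ℝ → ℝ := fun t => enr 2 (comp (u t)) with hy
  have hy0 : ∀ t, 0 ≤ y t := fun t => enr_nonneg _ _
  -- The factor `8` comes from `hs_two_le`. The two summands bound the self-interaction and the
  -- interaction with `v` by multiples of `(1 + y)²`.
  set A : ℝ := K * (8 * C * (M + 1) + b ^ 2 * (M + M + 1)) with hA
  have hA0 : 0 ≤ A := by positivity
  set k : ℝ → ℝ := fun t => 3 / ν * A * (1 + y t) with hk
  have hk0 : ∀ t, 0 ≤ k t := fun t => mul_nonneg (by positivity) (by linarith [hy0 t])
  have hS : ∀ τ ∈ Ico a T', ∑ k, enr 2 (fun l x => S τ x k l) ≤ A * ((1 + y τ) * (1 + y τ)) := fun τ hτ => by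
    have y0 := hy0 τ
    refine (hK τ hτ (C * (8 * (M + y τ))) M (by positivity) hM0 ?_ (hM τ hτ).1 (hM τ hτ).2).trans ?_
    · refine (hC _).trans ?_
      rw [ENNReal.ofReal_mul C.coe_nonneg, ENNReal.ofReal_coe_nnreal, ENNReal.ofReal_mul (by norm_num),
        ENNReal.ofReal_add hM0 y0, ofReal_enr (h.hpow (by norm_num) hτ)]
      refine mul_le_mul' le_rfl ((hs_two_le _).trans ?_)
      rw [← ofReal_enr (h.hpow (m := 0) (by norm_num) hτ), ENNReal.ofReal_ofNat]
      gcongr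
      exact (hM τ hτ).1
    · rw [hA, mul_assoc K]
      refine mul_le_mul_of_nonneg_left ?_ hK0
      have e1 : (M + y τ) * y τ ≤ (M + 1) * ((1 + y τ) * (1 + y τ)) := by nlinarith [mul_nonneg hM0 y0]
      have e2 : M + M + y τ ≤ (M + M + 1) * ((1 + y τ) * (1 + y τ)) := by
        nlinarith [mul_nonneg hM0 y0, mul_nonneg hM0 (mul_nonneg y0 y0)]
      have e3 := mul_le_mul_of_nonneg_left e1 (by positivity : (0 : ℝ) ≤ 8 * C)
      have e4 := mul_le_mul_of_nonneg_left e2 (sq_nonneg b)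
      linarith
  have hloc := fun c hc => h.exists_enr_two_le_Icc hα hν hs1 hs2 (c := c) hc
  obtain ⟨N, hN⟩ := exists_bound_of_le_add_lintegral (f := fun t => ENNReal.ofReal (1 + y t))
    (k := fun t => ENNReal.ofReal (k t)) haT (fun c hc => by
      obtain ⟨B, hB0, hB⟩ := hloc c hc
      exact ⟨(1 + B).toNNReal, fun t ht => ENNReal.ofReal_le_ofReal (by linarith [hB t ht])⟩)
    (by
      simp only [hk]
      simp_rw [ENNReal.ofReal_mul (by positivity : 0 ≤ 3 / ν * A), ENNReal.ofReal_add zero_le_one (hy0 _)]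
      rw [lintegral_const_mul' _ _ ENNReal.ofReal_ne_top, lintegral_add_left measurable_const, setLIntegral_const]
      exact ENNReal.mul_ne_top ENNReal.ofReal_ne_top
        (ENNReal.add_ne_top.2 ⟨ENNReal.mul_ne_top ENNReal.ofReal_ne_top (by simp), hYi.ne⟩))
    fun r t har hrt ht => by
      obtain ⟨B, hB0, hB⟩ := hloc t ht
      -- Integrability of the square uses the local bound; the first energy level only gives
      -- integrability of `y` itself.
      have hi : IntegrableOn (fun τ => (1 + y τ) * (1 + y τ)) (Icc r t) volume := by
        have hm : AEStronglyMeasurable y (volume.restrict (Icc r t)) :=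
          (h.aestronglyMeasurable hα hs1 hs2 ht (m := 2) (by norm_num)).mono_measure
            (Measure.restrict_mono_set _ (Icc_subset_Icc_left har))
        have hm1 : AEStronglyMeasurable (fun τ => 1 + y τ) (volume.restrict (Icc r t)) :=
          aestronglyMeasurable_const.add hm
        refine Integrable.of_bound (hm1.mul hm1) ((1 + B) * (1 + B)) ?_
        filter_upwards [ae_restrict_mem measurableSet_Icc] with τ hτ
        have h1 := hB τ ⟨har.trans hτ.1, hτ.2⟩
        have h2 : y τ ≤ B := h1
        have h3 := hy0 τ
        rw [Real.norm_of_nonneg (mul_nonneg (by linarith) (by linarith))]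
        gcongr
      have h1 := h.enr_two_le hα hν hs1 hs2 har hrt ht (hi.const_mul A) fun τ hτ =>
        hS τ ⟨har.trans hτ.1, hτ.2.trans_lt ht⟩
      have e : ∀ τ, k τ * (1 + y τ) = 3 / ν * (A * ((1 + y τ) * (1 + y τ))) := fun τ => by
        simp only [hk]; ring
      have i1 : IntegrableOn (fun τ => k τ * (1 + y τ)) (Icc r t) volume := by
        simp only [e]
        exact (hi.const_mul A).const_mul (3 / ν)
      have hk1 : ∀ τ, 0 ≤ k τ * (1 + y τ) := fun τ => mul_nonneg (hk0 τ) (by linarith [hy0 τ])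
      rw [← lintegral_congr fun τ => ENNReal.ofReal_mul (q := 1 + y τ) (hk0 τ),
        ← ofReal_intervalIntegral hrt i1 hk1, ← ENNReal.ofReal_add (by linarith [hy0 r])
          (intervalIntegral.integral_nonneg hrt fun τ _ => hk1 τ)]
      refine ENNReal.ofReal_le_ofReal ?_
      simp only [e]
      rw [intervalIntegral.integral_const_mul]
      simp only [hy]
      linarith
  refine ⟨N, fun t ht => ?_⟩
  rw [← ofReal_enr (h.hpow (by norm_num) ht)]
  exact (ENNReal.ofReal_le_ofReal (by linarith)).trans (hN t ht)

theorem iSup_homSobolevNorm_two_lt_top {t₀ t₁ : ℝ} (hu : ∀ t ∈ Ico t₀ t₁, MemLp (complexify (u t)) 2 volume) {M : ℝ≥0}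
    (hM : ∀ t ∈ Ico t₀ t₁, en 2 (comp (u t)) ≤ M) : (⨆ t ∈ Ico t₀ t₁, homSobolevNorm 2 (u t)) < ⊤ := by
  refine lt_of_le_of_lt (b := (ENNReal.ofReal ((2 * Real.pi) ^ (2 * 2)) * M) ^ (1 / 2 : ℝ))
    (iSup₂_le fun t ht => ?_) (ENNReal.rpow_lt_top_of_nonneg (by norm_num) (by finiteness))
  have := homSobolevNorm_eq (hu t ht) 2
  rw [Nat.cast_ofNat] at this
  rw [this]
  gcongr
  exact hM t ht

end MLANS

end

theorem mainTheorem6 (χ : MLANS.E3 → ℝ) (hχ : MLANS.IsLPProfile χ)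
    (α ν : ℝ) (hα : 0 < α) (hν : 0 < ν)
    (p : ℝ) (hp : 3 < p) (q : ℝ≥0∞) (hq : 1 ≤ q)
    (s : ℝ) (hs : 3 / 2 < s) (hs' : s < 5 / 2)
    (v : ℝ → MLANS.E3 → MLANS.E3) (hv : MLANS.IsGlobalLANSSolution χ α ν p q v)
    (a T' : ℝ) (ha : 0 < a) (haT : a < T')
    (u : ℝ → MLANS.E3 → MLANS.E3) (hu : MLANS.IsMLANSSolution χ α ν s q T' v u)
    (hu3 : ∀ t ∈ Set.Ico a T', MLANS.homSobolevNorm 3 (u t) < ⊤) :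
    (⨆ t ∈ Set.Ico a T', MLANS.homSobolevNorm 2 (u t)) < ⊤ := by
  obtain ⟨b, s', hs1, hs2, h⟩ := MLANS.exists_flowData hχ hp hq hs hs' hv ha hu hu3
  obtain ⟨M, hM⟩ := h.exists_enr_two_le haT hα hν hs1 hs2
  refine MLANS.iSup_homSobolevNorm_two_lt_top (fun t ht => ?_) hM
  obtain ⟨T, hT1, hT2⟩ := exists_between ht.2
  have ht0 : 0 < t := ha.trans_le ht.1
  exact MLANS.memLp_complexify ((hu.bc T ⟨ht0.trans hT1, hT2⟩).1.1 t ⟨ht0.le, hT1⟩).1
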